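/- Let $k$ be a field and $n\ge 0$. A *chain of projective lines* over an algebraically closed field $K$ is a reduced projective curve $C=C_1\cup\dots\cup C_m$ ($m\geq 1$) over $K$ whose irreducible components $C_j$ are projective lines with two distinct poles $p_j^-,p_j^+$, such that $C_i\cap C_j=\emptyset$ for $|i-j|>1$ and $C_j,C_{j+1}$ intersect transversally in the single point $p_j^+=p_{j+1}^-$; put $s_-=p_1^-$, $s_+=p_m^+$. An *$A_n$-curve* over $K$ is a chain of projective lines together with closed points $s_1,\dots,s_{n+1}\in C$ (not necessarily distinct), different from $s_\pm$ and from the intersection points of components, such that each component contains at least one $s_i$. An $A_n$-curve over $k$ is a proper flat $k$-scheme $C$ with rational points $s_-,s_+,s_1,\dots,s_{n+1}$ such that for every algebraically closed extension field $K$ of $k$ the base change to $K$ is an $A_n$-curve over $K$. *$A_n$-data* over $k$ is a collection of ratios $(t_{\beta_{ij}}:t_{-\beta_{ij}})\in\mathbb P^1(k)$ for $i\ne j$ in $\{1,\dots,n+1\}$, where $\beta_{ji}=-\beta_{ij}$, such that $t_{\beta_{ij}}t_{\beta_{jl}}t_{-\beta_{il}}=t_{-\beta_{ij}}t_{-\beta_{jl}}t_{\beta_{il}}$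 for all pairwise distinct $i,j,l$. (1) Let $(C,s_-,s_+,s_1,\dots,s_{n+1})$ be an $A_n$-curve over $k$. For each $i$ there is a basis $z_{\alpha_i},z_{-\alpha_i}$ of $H^0(C,\mathcal O_C(s_i))$ that is normalised, i.e. $z_{\alpha_i}(s_-)=0$, $z_{-\alpha_i}(s_+)=0$ and $z_{\alpha_i}(s_i)=z_{-\alpha_i}(s_i)\neq 0$. For any choice of normalised bases: (a) for all $i\neq j$ the ratios $(t_{\beta_{ij}}:t_{-\beta_{ij}})=(z_{-\alpha_j}(s_i):z_{\alpha_j}(s_i))$ are well defined (the two values are not both zero, and the definitions for $(i,j)$ and for $(j,i)$ are compatible), and they form $A_n$-data; (b) for each $i$ the sections $(z_{-\alpha_i}:z_{\alpha_i})$ of $\mathcal O_C(s_i)$ define a morphism from $C$ to a projective line $\mathbb P^1_{\{\pm\alpha_i\}}$ over $k$ with homogeneous coordinates $z_{-\alpha_i},z_{\alpha_i}$, and the resulting morphism $C\to\prod_{i=1}^{n+1}\mathbb P^1_{\{\pm\alpha_i\}}$ is an isomorphism onto the closed subscheme $C'$ determined by the homogeneous equations $$t_{\beta_{ij}}z_{\alpha_j}z_{-\alpha_i}=t_{-\beta_{ij}}z_{-\alpha_j}z_{\alpha_i},\qquad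 i,j\in\{1,\dots,n+1\},\ i\neq j;$$ (c) the closed subschemes of $C'$ given by the additional equation $z_{\alpha_i}=z_{-\alpha_i}$, by the additional equations $z_{\alpha_1}=\dots=z_{\alpha_{n+1}}=0$, and by the additional equations $z_{-\alpha_1}=\dots=z_{-\alpha_{n+1}}=0$ are rational points $s_i'$, $s_-'$ and $s_+'$ respectively; $(C',s_-',s_+',s_1',\dots,s_{n+1}')$ is an $A_n$-curve, and the isomorphism $C\to C'$ is an isomorphism of $A_n$-curves, i.e. it maps $s_\pm$ to $s'_\pm$ and $s_i$ to $s_i'$. (2) Conversely, all $A_n$-data over $k$ arise in this way: for any $A_n$-data over $k$ there are an $A_n$-curve over $k$ and normalised bases of the spaces $H^0(C,\mathcal O_C(s_i))$ such that the ratios of (a) are the given ones. -/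

import Mathlib

open CategoryTheory CategoryTheory.Limits AlgebraicGeometry

universe u

namespace LosevManin

noncomputable section

/-! ## The projective line and products of projective lines -/

attribute [local instance] MvPolynomial.gradedAlgebra

/-- The projective line `Proj k[X₀, X₁]`. -/
def P1 (k : Type u) [Field k] : Scheme.{u} :=
  Proj (MvPolynomial.homogeneousSubmodule (Fin 2) k)

/-- The structure morphism of the projective line. -/
def P1.toSpec (k : Type u) [Field k] : P1 k ⟶ Spec (CommRingCat.of k) :=
  Proj.toSpecZero (MvPolynomial.homogeneousSubmodule (Fin 2) k) ≫
    Spec.map (CommRingCat.ofHom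
      (algebraMap k (MvPolynomial.homogeneousSubmodule (Fin 2) k 0)))

/-- The standard chart `D₊(X_b)`, where the homogeneous coordinate `X_b` is invertible. -/
def P1.chart (k : Type u) [Field k] (b : Fin 2) : (P1 k).Opens :=
  Proj.basicOpen (MvPolynomial.homogeneousSubmodule (Fin 2) k) (MvPolynomial.X b)

/-- The regular function `X_a / X_b` on the chart `D₊(X_b)`. -/
def P1.ratio (k : Type u) [Field k] (a b : Fin 2) : Γ(P1 k, P1.chart k b) :=
  (Proj.awayToSection (MvPolynomial.homogeneousSubmodule (Fin 2) k) (MvPolynomial.X b)).hom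
    (HomogeneousLocalization.Away.mk (MvPolynomial.homogeneousSubmodule (Fin 2) k)
      ((MvPolynomial.mem_homogeneousSubmodule 1 _).2 (MvPolynomial.isHomogeneous_X k b)) 1
      (MvPolynomial.X a)
      ((MvPolynomial.mem_homogeneousSubmodule _ _).2
        (by simpa using MvPolynomial.isHomogeneous_X k a)))

/-- The pull-back of `X_a / X_b` along `φ : T ⟶ ℙ¹`, on an open set mapped into `D₊(X_b)`. -/
def coordRatio {k : Type u} [Field k] {T : Scheme.{u}} (φ : T ⟶ P1 k) (a b : Fin 2)
    (W : T.Opens) (h : W ≤ φ ⁻¹ᵁ P1.chart k b) : Γ(T, W) :=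
  (φ.appLE (P1.chart k b) W h).hom (P1.ratio k a b)

/-- The product `(ℙ¹)^(n+1)` over `k`. -/
def P1Pow (k : Type u) [Field k] (n : ℕ) : Scheme.{u} :=
  widePullback (Spec (CommRingCat.of k)) (fun _ : Fin (n + 1) => P1 k) (fun _ => P1.toSpec k)

/-- The structure morphism of `(ℙ¹)^(n+1)`. -/
def P1Pow.toSpec (k : Type u) [Field k] (n : ℕ) : P1Pow k n ⟶ Spec (CommRingCat.of k) :=
  WidePullback.base (fun _ : Fin (n + 1) => P1.toSpec k)

/-- The projections of `(ℙ¹)^(n+1)`. -/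
def P1Pow.proj (k : Type u) [Field k] (n : ℕ) (i : Fin (n + 1)) : P1Pow k n ⟶ P1 k :=
  WidePullback.π (fun _ : Fin (n + 1) => P1.toSpec k) i

/-- Scalars as functions on an open subset of a `k`-scheme. -/
def scalar {k : Type u} [Field k] {X : Scheme.{u}} (f : X ⟶ Spec (CommRingCat.of k))
    (U : X.Opens) : k →+* Γ(X, U) :=
  (f.appLE ⊤ U le_top).hom.comp (Scheme.ΓSpecIso (CommRingCat.of k)).inv.hom

/-- The pull-backs of `X_b / X_{ε i}` along morphisms `φ i : T ⟶ ℙ¹`, for all `i` and `b`. -/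
def coordRatios {k : Type u} [Field k] {n : ℕ} {T : Scheme.{u}} (φ : Fin (n + 1) → (T ⟶ P1 k))
    (ε : Fin (n + 1) → Fin 2) (W : T.Opens) (h : ∀ i, W ≤ φ i ⁻¹ᵁ P1.chart k (ε i))
    (ib : Fin (n + 1) × Fin 2) : Γ(T, W) :=
  coordRatio (φ ib.1) ib.2 (ε ib.1) W (h ib.1)

/-- For a `k`-scheme `T` with morphisms `φ i : T ⟶ ℙ¹`, and an open set `W` mapped by `φ i` into the
chart where `X_{ε i}` is invertible, for all `i`: the dehomogenisation of a polynomial, in which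
`X_{i, b}` is replaced by the pull-back of `X_b / X_{ε i}` along `φ i`. -/
def dehomogenise {k : Type u} [Field k] {n : ℕ} {T : Scheme.{u}} (f : T ⟶ Spec (CommRingCat.of k))
    (φ : Fin (n + 1) → (T ⟶ P1 k)) (ε : Fin (n + 1) → Fin 2) (W : T.Opens)
    (h : ∀ i, W ≤ φ i ⁻¹ᵁ P1.chart k (ε i))
    (p : MvPolynomial (Fin (n + 1) × Fin 2) k) : Γ(T, W) :=
  MvPolynomial.eval₂ (scalar f W) (coordRatios φ ε W h) p

/-- The ideal sheaf on `(ℙ¹)^(n+1)` generated by a set of multihomogeneous equations, i.e. the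
smallest (quasi-coherent) ideal sheaf that contains their dehomogenisations on the standard charts.
The corresponding closed subscheme is the one determined by these equations. -/
def equationIdeal {k : Type u} [Field k] {n : ℕ}
    (S : Set (MvPolynomial (Fin (n + 1) × Fin 2) k)) : (P1Pow k n).IdealSheafData :=
  sInf {J | ∀ p ∈ S, ∀ (ε : Fin (n + 1) → Fin 2) (W : (P1Pow k n).affineOpens)
    (h : ∀ i, W.1 ≤ P1Pow.proj k n i ⁻¹ᵁ P1.chart k (ε i)),
      dehomogenise (P1Pow.toSpec k n) (P1Pow.proj k n) ε W.1 h p ∈ J.ideal W}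

/-! ## Chains of projective lines and `A_n`-curves -/

/-- The point in the image of a rational point `s : Spec k ⟶ X`. -/
def point {k : Type u} [Field k] {X : Scheme.{u}} (s : Spec (CommRingCat.of k) ⟶ X) : X :=
  s (IsLocalRing.closedPoint k)

/-- A chain of projective lines over `K` (algebraically closed in all uses), with end points
`s₋`, `s₊` and marked points `s_i`. The components are `line j : ℙ¹ ⟶ C`, `j = 0, …, m`, with poles
`poleMinus j ≠ polePlus j`; the curve is reduced and proper (equivalently, projective, in dimension
one). Two consecutive components meet in a single point, transversally: their scheme-theoretic
intersection is reduced. The chain is stable: each component contains a marked point. -/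
structure IsStablePointedChain {K : Type u} [Field K] {C : Scheme.{u}}
    (π : C ⟶ Spec (CommRingCat.of K)) (sMinus sPlus : Spec (CommRingCat.of K) ⟶ C) {n : ℕ}
    (s : Fin (n + 1) → (Spec (CommRingCat.of K) ⟶ C)) (m : ℕ)
    (line : Fin (m + 1) → (P1 K ⟶ C)) (poleMinus polePlus : Fin (m + 1) → P1 K) : Prop where
  isProper : IsProper π
  isReduced : IsReduced C
  line_over : ∀ j, line j ≫ π = P1.toSpec K
  line_closed : ∀ j, IsClosedImmersion (line j)
  cover : ∀ x : C, ∃ j, x ∈ Set.range (line j)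
  poleMinus_closed : ∀ j, IsClosed {poleMinus j}
  polePlus_closed : ∀ j, IsClosed {polePlus j}
  poles_ne : ∀ j, poleMinus j ≠ polePlus j
  disjoint : ∀ i j : Fin (m + 1), i.1 + 1 < j.1 →
    Disjoint (Set.range (line i)) (Set.range (line j))
  pole_eq : ∀ j : Fin m, line j.castSucc (polePlus j.castSucc) = line j.succ (poleMinus j.succ)
  inter : ∀ j : Fin m, Set.range (line j.castSucc) ∩ Set.range (line j.succ) =
    {line j.castSucc (polePlus j.castSucc)}
  transversal : ∀ j : Fin m, IsReduced (pullback (line j.castSucc) (line j.succ))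
  sMinus_over : sMinus ≫ π = 𝟙 _
  sPlus_over : sPlus ≫ π = 𝟙 _
  s_over : ∀ i, s i ≫ π = 𝟙 _
  sMinus_eq : point sMinus = line 0 (poleMinus 0)
  sPlus_eq : point sPlus = line (Fin.last m) (polePlus (Fin.last m))
  s_ne : ∀ i j, point (s i) ≠ line j (poleMinus j) ∧ point (s i) ≠ line j (polePlus j)
  stable : ∀ j, ∃ i, point (s i) ∈ Set.range (line j)

/-- `A_n`-curves over an algebraically closed field: stable `(n+1)`-pointed chains of projective
lines, of some length. -/
def IsGeometricAnCurve {K : Type u} [Field K] {C : Scheme.{u}}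
    (π : C ⟶ Spec (CommRingCat.of K)) (sMinus sPlus : Spec (CommRingCat.of K) ⟶ C) {n : ℕ}
    (s : Fin (n + 1) → (Spec (CommRingCat.of K) ⟶ C)) : Prop :=
  ∃ (m : ℕ) (line : Fin (m + 1) → (P1 K ⟶ C)) (poleMinus polePlus : Fin (m + 1) → P1 K),
    IsStablePointedChain π sMinus sPlus s m line poleMinus polePlus

/-- The base change of a section along a field extension. -/
def baseChangeSection {k : Type u} [Field k] {C : Scheme.{u}} {π : C ⟶ Spec (CommRingCat.of k)}
    (K : Type u) [Field K] [Algebra k K] (s : Spec (CommRingCat.of k) ⟶ C) (hs : s ≫ π = 𝟙 _) :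
    Spec (CommRingCat.of K) ⟶ pullback π (Spec.map (CommRingCat.ofHom (algebraMap k K))) :=
  pullback.lift (Spec.map (CommRingCat.ofHom (algebraMap k K)) ≫ s) (𝟙 _)
    (by rw [Category.assoc, hs, Category.comp_id, Category.id_comp])

/-- An `A_n`-curve over a field `k`: a proper flat morphism to `Spec k` with sections
`s₋, s₊, s_0, …, s_n` all of whose geometric fibres are `A_n`-curves. -/
structure IsAnCurve {k : Type u} [Field k] {C : Scheme.{u}}
    (π : C ⟶ Spec (CommRingCat.of k)) (sMinus sPlus : Spec (CommRingCat.of k) ⟶ C) {n : ℕ}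
    (s : Fin (n + 1) → (Spec (CommRingCat.of k) ⟶ C)) : Prop where
  isProper : IsProper π
  flat : Flat π
  sMinus_over : sMinus ≫ π = 𝟙 _
  sPlus_over : sPlus ≫ π = 𝟙 _
  s_over : ∀ i, s i ≫ π = 𝟙 _
  geometric : ∀ (K : Type u) [Field K] [IsAlgClosed K] [Algebra k K],
    IsGeometricAnCurve (pullback.snd π (Spec.map (CommRingCat.ofHom (algebraMap k K))))
      (baseChangeSection K sMinus sMinus_over) (baseChangeSection K sPlus sPlus_over)
      (fun i => baseChangeSection K (s i) (s_over i))

/-! ## Global sections of `𝒪(D)` -/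

/-- Global sections of `𝒪_X(D) = ℋom(I, 𝒪_X)`, where `I` is the ideal sheaf of the divisor `D`:
families of linear maps `I(W) → 𝒪_X(W)`, `W` affine open, that are compatible with restriction.
The structure morphism `f` is recorded for the sake of the `k`-vector space structure. -/
@[ext]
structure H0 {k : Type u} [Field k] {X : Scheme.{u}} (f : X ⟶ Spec (CommRingCat.of k))
    (I : X.IdealSheafData) where
  app : ∀ W : X.affineOpens, I.ideal W →ₗ[Γ(X, W)] Γ(X, W)
  compat : ∀ (V W : X.affineOpens) (h : V ≤ W) (g : I.ideal W),
    (X.presheaf.map (homOfLE h : V.1 ⟶ W.1).op).hom (app W g) =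
      app V ⟨(X.presheaf.map (homOfLE h : V.1 ⟶ W.1).op).hom g.1, I.ideal_le_comap_ideal h g.2⟩

namespace H0

variable {k : Type u} [Field k] {X : Scheme.{u}} {f : X ⟶ Spec (CommRingCat.of k)}
  {I : X.IdealSheafData}

theorem scalar_restrict (f : X ⟶ Spec (CommRingCat.of k)) {V W : X.Opens} (h : V ≤ W) (c : k) :
    (X.presheaf.map (homOfLE h).op).hom (scalar f W c) = scalar f V c := by
  simp only [scalar, RingHom.comp_apply]
  rw [← Scheme.Hom.appLE_map f (V := W) (U := ⊤) le_top (homOfLE h).op]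
  rfl

instance : Zero (H0 f I) := ⟨⟨fun _ => 0, by intros; simp⟩⟩

instance : Add (H0 f I) :=
  ⟨fun σ τ => ⟨fun W => σ.app W + τ.app W, by
    intro V W h g; simp [σ.compat V W h g, τ.compat V W h g]⟩⟩

instance : Neg (H0 f I) :=
  ⟨fun σ => ⟨fun W => -σ.app W, by intro V W h g; simp [σ.compat V W h g]⟩⟩

instance : SMul k (H0 f I) :=
  ⟨fun c σ => ⟨fun W => scalar f W.1 c • σ.app W, by
    intro V W h g
    simp only [LinearMap.smul_apply, smul_eq_mul, map_mul, σ.compat V W h g]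
    rw [scalar_restrict]⟩⟩

@[simp] theorem zero_app (W : X.affineOpens) : (0 : H0 f I).app W = 0 := rfl
@[simp] theorem add_app (σ τ : H0 f I) (W : X.affineOpens) :
    (σ + τ).app W = σ.app W + τ.app W := rfl
@[simp] theorem neg_app (σ : H0 f I) (W : X.affineOpens) : (-σ).app W = -σ.app W := rfl
@[simp] theorem smul_app (c : k) (σ : H0 f I) (W : X.affineOpens) :
    (c • σ).app W = scalar f W.1 c • σ.app W := rfl

instance : AddCommGroup (H0 f I) where
  add_assoc _ _ _ := by ext1; funext W; simp [add_assoc]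
  zero_add _ := by ext1; funext W; simp
  add_zero _ := by ext1; funext W; simp
  add_comm _ _ := by ext1; funext W; simp [add_comm]
  neg_add_cancel _ := by ext1; funext W; simp
  nsmul := nsmulRec
  zsmul := zsmulRec

instance : Module k (H0 f I) where
  one_smul _ := by ext1; funext W; simp
  mul_smul _ _ _ := by ext1; funext W; simp [mul_smul]
  smul_zero _ := by ext1; funext W; simp
  smul_add _ _ _ := by ext1; funext W; simp
  add_smul _ _ _ := by ext1; funext W; simp [add_smul]
  zero_smul _ := by ext1; funext W; simp

/-- The open set where a section of `𝒪_X(D)` generates it: for `I` invertible with local generator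
`g`, the section `σ` is `σ(g)` times the local generator of `𝒪_X(D) = I⁻¹` dual to `g`. -/
def nonvanishing (σ : H0 f I) : X.Opens :=
  ⨆ (W : X.affineOpens) (g : I.ideal W), X.basicOpen (σ.app W g)

/-- `σ(x) = 0` in the fibre of `𝒪_X(D)` at `x`. -/
def VanishesAt (σ : H0 f I) (x : X) : Prop := x ∉ σ.nonvanishing

/-- `(σ(x) : τ(x)) = (a : b)` in `ℙ¹(k)`, for a rational point `x` (in particular `σ(x)`, `τ(x)` are
not both zero). -/
def HasRatioAt (σ τ : H0 f I) (x : X) (a b : k) : Prop :=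
  ¬ (σ.VanishesAt x ∧ τ.VanishesAt x) ∧ ¬ (a = 0 ∧ b = 0) ∧ (a • τ - b • σ).VanishesAt x

/-- The morphism `φ : X ⟶ ℙ¹` is the one given by the line bundle `𝒪_X(D)` with the generating
sections `z 0`, `z 1`: it is a `k`-morphism, the preimage of `D₊(X_b)` is the locus where `z b` does
not vanish, and there `z a = φ^*(X_a / X_b) · z b`. -/
structure IsMorphismOf (φ : X ⟶ P1 k) (z : Fin 2 → H0 f I) : Prop where
  comp_toSpec : φ ≫ P1.toSpec k = f
  preimage : ∀ b, φ ⁻¹ᵁ P1.chart k b = (z b).nonvanishing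
  ratio : ∀ (a b : Fin 2) (W : X.affineOpens) (h : W.1 ≤ φ ⁻¹ᵁ P1.chart k b) (g : I.ideal W),
    (z a).app W g = coordRatio φ a b W.1 h * (z b).app W g

end H0

/-! ## Normalised bases, `A_n`-data and the equations -/

/-- The basis `z 0 = z_{-α}`, `z 1 = z_α` of `H⁰(C, 𝒪_C(s))` is normalised: `z_α(s₋) = 0`,
`z_{-α}(s₊) = 0` and `z_α(s) = z_{-α}(s) ≠ 0`. -/
structure IsNormalised {k : Type u} [Field k] {C : Scheme.{u}} {π : C ⟶ Spec (CommRingCat.of k)}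
    (sMinus sPlus s : Spec (CommRingCat.of k) ⟶ C)
    (z : Module.Basis (Fin 2) k (H0 π (Scheme.Hom.ker s))) : Prop where
  minus : (z 1).VanishesAt (point sMinus)
  plus : (z 0).VanishesAt (point sPlus)
  eq : (z 1 - z 0).VanishesAt (point s)
  ne : ¬ (z 1).VanishesAt (point s)

/-- `A_n`-data over a field, in homogeneous coordinates: `t i j` is `t_{β_ij}`, and
`t j i` is `t_{-β_ij}`, where `β_ij` are the roots of `A_n`. Diagonal entries are irrelevant. -/
structure IsAnData {k : Type u} [Field k] {n : ℕ} (t : Fin (n + 1) → Fin (n + 1) → k) : Prop where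
  ne_zero : ∀ i j, i ≠ j → ¬ (t i j = 0 ∧ t j i = 0)
  rel : ∀ i j l, i ≠ j → j ≠ l → i ≠ l → t i j * t j l * t l i = t j i * t l j * t i l

/-- The ratios `(t_{β_ij} : t_{-β_ij}) = (z_{-α_j}(s_i) : z_{α_j}(s_i))` for all `i ≠ j`. -/
def IsExtracted {k : Type u} [Field k] {C : Scheme.{u}} {π : C ⟶ Spec (CommRingCat.of k)} {n : ℕ}
    {s : Fin (n + 1) → (Spec (CommRingCat.of k) ⟶ C)}
    (z : ∀ i, Module.Basis (Fin 2) k (H0 π (Scheme.Hom.ker (s i))))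
    (t : Fin (n + 1) → Fin (n + 1) → k) : Prop :=
  ∀ i j, i ≠ j → H0.HasRatioAt (z j 0) (z j 1) (point (s i)) (t i j) (t j i)

/-- The equations `t_{β_ij} z_{α_j} z_{-α_i} = t_{-β_ij} z_{-α_j} z_{α_i}` for `i ≠ j`, where
`z_{-α_i}`, `z_{α_i}` are the coordinates `X_{i,0}`, `X_{i,1}` on the `i`-th projective line. -/
def curveEquations {k : Type u} [Field k] {n : ℕ} (t : Fin (n + 1) → Fin (n + 1) → k) :
    Set (MvPolynomial (Fin (n + 1) × Fin 2) k) :=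
  {p | ∃ i j, i ≠ j ∧ p =
    MvPolynomial.C (t i j) * MvPolynomial.X (j, 1) * MvPolynomial.X (i, 0) -
      MvPolynomial.C (t j i) * MvPolynomial.X (j, 0) * MvPolynomial.X (i, 1)}

/-- The closed subscheme `C'` of `(ℙ¹)^(n+1)` determined by the equations. -/
def embeddedCurve {k : Type u} [Field k] {n : ℕ} (t : Fin (n + 1) → Fin (n + 1) → k) :
    Scheme.{u} :=
  (equationIdeal (curveEquations t)).subscheme

/-- The inclusion of `C'` into `(ℙ¹)^(n+1)`. -/
def embeddedCurve.ι {k : Type u} [Field k] {n : ℕ} (t : Fin (n + 1) → Fin (n + 1) → k) :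
    embeddedCurve t ⟶ P1Pow k n :=
  (equationIdeal (curveEquations t)).subschemeι

/-- The rational point `x` of `C'` is the closed subscheme of `C'` defined by the additional
equations `E`. -/
def IsPointDefinedBy {k : Type u} [Field k] {n : ℕ} {t : Fin (n + 1) → Fin (n + 1) → k}
    (x : Spec (CommRingCat.of k) ⟶ embeddedCurve t)
    (E : Set (MvPolynomial (Fin (n + 1) × Fin 2) k)) : Prop :=
  Scheme.Hom.ker (x ≫ embeddedCurve.ι t) = equationIdeal (curveEquations t ∪ E)

end

end LosevManin

open LosevManin

namespace LosevManin

noncomputable section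

attribute [local instance] MvPolynomial.gradedAlgebra

section ProjectiveLine
variable {k : Type u} [Field k]

theorem X_mem (k : Type u) [Field k] (a : Fin 2) : (MvPolynomial.X a : MvPolynomial (Fin 2) k) ∈
    MvPolynomial.homogeneousSubmodule (Fin 2) k 1 :=
  (MvPolynomial.mem_homogeneousSubmodule 1 _).2 (MvPolynomial.isHomogeneous_X k a)

theorem P1.isAffineOpen_chart (b : Fin 2) : IsAffineOpen (P1.chart k b) :=
  Proj.isAffineOpen_basicOpen _ _ (X_mem k b) one_pos

/-- The homogeneous prime ideal of a point of the projective line. -/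
def P1.prime (p : P1 k) : Ideal (MvPolynomial (Fin 2) k) :=
  (show ProjectiveSpectrum (MvPolynomial.homogeneousSubmodule (Fin 2) k) from
    p).asHomogeneousIdeal.toIdeal

instance (p : P1 k) : (P1.prime p).IsPrime :=
  (show ProjectiveSpectrum (MvPolynomial.homogeneousSubmodule (Fin 2) k) from p).isPrime

theorem P1.mem_chart (p : P1 k) (b : Fin 2) :
    p ∈ P1.chart k b ↔ MvPolynomial.X b ∉ P1.prime p := Iff.rfl

/-- The value of a section of the structure sheaf of the projective line at a point, in the
localisation of the polynomial ring. -/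
def P1.value {U : (P1 k).Opens} (f : Γ(P1 k, U)) (p : U) : Localization.AtPrime (P1.prime p.1) :=
  (show HomogeneousLocalization.AtPrime (MvPolynomial.homogeneousSubmodule (Fin 2) k)
    (P1.prime p.1) from f.1 p).val

theorem P1.section_ext {U : (P1 k).Opens} {f g : Γ(P1 k, U)} (h : ∀ p, P1.value f p = P1.value g p) :
    f = g := by
  apply Subtype.ext
  funext p
  exact HomogeneousLocalization.val_injective _ (h p)

theorem P1.value_map {U V : (P1 k).Opens} (i : U ≤ V) (f : Γ(P1 k, V)) (p : U) :
    P1.value ((P1 k).presheaf.map (homOfLE i).op f) p = P1.value f ⟨p.1, i p.2⟩ := rfl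

theorem P1.value_mul {U : (P1 k).Opens} (f g : Γ(P1 k, U)) (p : U) :
    P1.value (f * g) p = P1.value f p * P1.value g p :=
  HomogeneousLocalization.val_mul (𝒜 := MvPolynomial.homogeneousSubmodule (Fin 2) k)
    (x := (P1.prime p.1).primeCompl) _ _

theorem P1.value_one {U : (P1 k).Opens} (p : U) :
    P1.value (1 : Γ(P1 k, U)) p = 1 :=
  HomogeneousLocalization.val_one (𝒜 := MvPolynomial.homogeneousSubmodule (Fin 2) k)
    (x := (P1.prime p.1).primeCompl)

/-- A homogeneous coordinate in the local ring of the polynomial ring at the prime of a point. -/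
def P1.coord (p : P1 k) (f : MvPolynomial (Fin 2) k) : Localization.AtPrime (P1.prime p) :=
  algebraMap _ _ f

theorem P1.value_awayMk {b : Fin 2} {n : ℕ} {f : MvPolynomial (Fin 2) k}
    (hf : f ∈ MvPolynomial.homogeneousSubmodule (Fin 2) k (n • 1)) (p : P1.chart k b) :
    P1.value (U := P1.chart k b)
      ((Proj.awayToSection (MvPolynomial.homogeneousSubmodule (Fin 2) k) (MvPolynomial.X b)).hom
        (HomogeneousLocalization.Away.mk (MvPolynomial.homogeneousSubmodule (Fin 2) k)
          (X_mem k b) n f hf)) p * P1.coord p.1 (MvPolynomial.X b) ^ n = P1.coord p.1 f := by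
  have hX : MvPolynomial.X b ^ n ∈ (P1.prime p.1).primeCompl :=
    (P1.prime p.1).primeCompl.pow_mem p.2 n
  have h : P1.value (U := P1.chart k b)
      ((Proj.awayToSection (MvPolynomial.homogeneousSubmodule (Fin 2) k) (MvPolynomial.X b)).hom
        (HomogeneousLocalization.Away.mk (MvPolynomial.homogeneousSubmodule (Fin 2) k)
          (X_mem k b) n f hf)) p =
      IsLocalization.mk' (Localization.AtPrime (P1.prime p.1)) f ⟨_, hX⟩ := by
    refine (ProjectiveSpectrum.Proj.awayToSection_apply
      (MvPolynomial.homogeneousSubmodule (Fin 2) k) (MvPolynomial.X b) _ p).trans ?_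
    rw [HomogeneousLocalization.Away.val_mk, Localization.mk_eq_mk', IsLocalization.map_mk']
    rfl
  rw [h, P1.coord, P1.coord, ← map_pow]
  exact IsLocalization.mk'_spec (Localization.AtPrime (P1.prime p.1)) f
    (⟨_, hX⟩ : (P1.prime p.1).primeCompl)

theorem P1.value_ratio (a b : Fin 2) (p : P1.chart k b) :
    P1.value (P1.ratio k a b) p * P1.coord p.1 (MvPolynomial.X b) =
      P1.coord p.1 (MvPolynomial.X a) := by
  have := P1.value_awayMk (b := b) (n := 1) (f := MvPolynomial.X a)
    (by simpa using X_mem k a) p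
  rwa [pow_one] at this

theorem P1.isUnit_coord (b : Fin 2) (p : P1.chart k b) :
    IsUnit (P1.coord p.1 (MvPolynomial.X b)) :=
  IsLocalization.map_units (M := (P1.prime p.1).primeCompl) _ ⟨_, p.2⟩

theorem P1.ratio_self (b : Fin 2) : P1.ratio k b b = 1 := by
  apply P1.section_ext
  intro p
  rw [P1.value_one]
  exact (P1.isUnit_coord b p).mul_right_cancel (by rw [P1.value_ratio, one_mul])

theorem P1.ratio_mul_ratio (a b c : Fin 2) (W : (P1 k).Opens) (ha : W ≤ P1.chart k a)
    (hb : W ≤ P1.chart k b) :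
    (P1 k).presheaf.map (homOfLE ha).op (P1.ratio k c a) *
      (P1 k).presheaf.map (homOfLE hb).op (P1.ratio k a b) =
    (P1 k).presheaf.map (homOfLE hb).op (P1.ratio k c b) := by
  apply P1.section_ext
  intro p
  rw [P1.value_mul, P1.value_map, P1.value_map, P1.value_map]
  apply (P1.isUnit_coord b ⟨p, hb p.2⟩).mul_right_cancel
  rw [mul_assoc, P1.value_ratio a b ⟨p, hb p.2⟩, P1.value_ratio c b ⟨p, hb p.2⟩]
  have := P1.value_ratio c a ⟨p.1, ha p.2⟩
  exact this

theorem scalar_eq {X : Scheme.{u}} (f : X ⟶ Spec (CommRingCat.of k)) (W : X.Opens)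
    (h : W ≤ f ⁻¹ᵁ ⊤) : scalar f W =
      ((Scheme.ΓSpecIso (CommRingCat.of k)).inv ≫ f.appLE ⊤ W h).hom := rfl

theorem toSpecΓ_injective {X : Scheme.{u}} {W : X.Opens} {R : CommRingCat.{u}}
    {φ ψ : R ⟶ Γ(X, W)} (h : W.toSpecΓ ≫ Spec.map φ = W.toSpecΓ ≫ Spec.map ψ) : φ = ψ := by
  have h2 := congrArg (fun g => g.appTop) h
  simp only [Scheme.Hom.comp_appTop, Scheme.Opens.toSpecΓ_appTop] at h2
  rw [Scheme.ΓSpecIso_naturality_assoc, Scheme.ΓSpecIso_naturality_assoc,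
    cancel_epi, cancel_mono] at h2
  exact h2

theorem isIso_toSpecΓ_of_isAffineOpen {X : Scheme.{u}} {W : X.Opens} (h : IsAffineOpen W) :
    IsIso W.toSpecΓ := by
  have : IsAffine W := h
  delta Scheme.Opens.toSpecΓ
  infer_instance

theorem toSpecΓ_comp_SpecMap_ΓSpecIso_inv (R : CommRingCat.{u}) :
    (Spec R).toSpecΓ ≫ Spec.map (Scheme.ΓSpecIso R).inv = 𝟙 _ := by
  simp

theorem ι_comp_eq_toSpecΓ {X : Scheme.{u}} (f : X ⟶ Spec (CommRingCat.of k)) (W : X.Opens) :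
    W.ι ≫ f = W.toSpecΓ ≫ Spec.map (CommRingCat.ofHom (scalar f W)) := by
  have h1 := Scheme.Opens.toSpecΓ_SpecMap_appLE f ⊤ W (by simp)
  rw [scalar_eq f W (by simp), CommRingCat.ofHom_hom, Spec.map_comp, reassoc_of% h1,
    Scheme.Opens.toSpecΓ_top, Category.assoc, toSpecΓ_comp_SpecMap_ΓSpecIso_inv, Category.comp_id]
  exact (Scheme.Hom.resLE_comp_ι f (U := ⊤) (V := W) (by simp)).symm

theorem scalar_unique {X : Scheme.{u}} {f : X ⟶ Spec (CommRingCat.of k)} {W : X.Opens}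
    {φ : CommRingCat.of k ⟶ Γ(X, W)} (h : W.ι ≫ f = W.toSpecΓ ≫ Spec.map φ) :
    scalar f W = φ.hom := by
  rw [ι_comp_eq_toSpecΓ] at h
  rw [← toSpecΓ_injective h]; rfl

theorem appLE_scalar {X Y : Scheme.{u}} (f : X ⟶ Spec (CommRingCat.of k)) (g : Y ⟶ X)
    (W : X.Opens) (V : Y.Opens) (h : V ≤ g ⁻¹ᵁ W) (c : k) :
    (g.appLE W V h).hom (scalar f W c) = scalar (g ≫ f) V c := by
  rw [scalar_eq f W (by simp), scalar_eq (g ≫ f) V (by simp),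
    ← Scheme.Hom.appLE_comp_appLE g f ⊤ W V (by simp) h]
  rfl

theorem P1.scalar_chart (b : Fin 2) (c : k) : scalar (P1.toSpec k) (P1.chart k b) c =
    (Proj.awayToSection (MvPolynomial.homogeneousSubmodule (Fin 2) k) (MvPolynomial.X b)).hom
    (HomogeneousLocalization.fromZeroRingHom (MvPolynomial.homogeneousSubmodule (Fin 2) k) _
      (algebraMap k (MvPolynomial.homogeneousSubmodule (Fin 2) k 0) c)) := by
  have : scalar (P1.toSpec k) (P1.chart k b) = (CommRingCat.ofHom
      (algebraMap k (MvPolynomial.homogeneousSubmodule (Fin 2) k 0)) ≫ CommRingCat.ofHom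
      (HomogeneousLocalization.fromZeroRingHom (MvPolynomial.homogeneousSubmodule (Fin 2) k) _) ≫
      (Proj.awayToSection (MvPolynomial.homogeneousSubmodule (Fin 2) k) (MvPolynomial.X b))).hom := by
    apply scalar_unique
    have h := Proj.awayι_toSpecZero (MvPolynomial.homogeneousSubmodule (Fin 2) k)
      (MvPolynomial.X b) (X_mem k b) one_pos
    rw [Proj.awayι, Category.assoc, Iso.inv_comp_eq, Proj.basicOpenIsoSpec_hom,
      Proj.basicOpenToSpec] at h
    have h2 := (reassoc_of% h) (Spec.map (CommRingCat.ofHom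
      (algebraMap k (MvPolynomial.homogeneousSubmodule (Fin 2) k 0))))
    refine Eq.trans h2 ?_
    rw [← Spec.map_comp, ← Spec.map_comp]
    rfl
  rw [this]; rfl

theorem P1.value_scalar (b : Fin 2) (c : k) (p : P1.chart k b) :
    P1.value (scalar (P1.toSpec k) (P1.chart k b) c) p = P1.coord p.1 (MvPolynomial.C c) := by
  rw [P1.scalar_chart]
  have h : MvPolynomial.C c ∈ MvPolynomial.homogeneousSubmodule (Fin 2) k (0 • 1) := by
    simp
  have := P1.value_awayMk (b := b) h p
  rw [pow_zero, mul_one] at this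
  rw [← this]
  congr 3

/-- The value of sections at a point, as a ring homomorphism. -/
def P1.valueHom {U : (P1 k).Opens} (p : U) : Γ(P1 k, U) →+* Localization.AtPrime (P1.prime p.1) where
  toFun f := P1.value f p
  map_one' := P1.value_one p
  map_mul' _ _ := P1.value_mul _ _ p
  map_zero' := HomogeneousLocalization.val_zero
    (𝒜 := MvPolynomial.homogeneousSubmodule (Fin 2) k) (x := (P1.prime p.1).primeCompl)
  map_add' _ _ := HomogeneousLocalization.val_add
    (𝒜 := MvPolynomial.homogeneousSubmodule (Fin 2) k) (x := (P1.prime p.1).primeCompl) _ _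

theorem P1.dehom_surjective (b : Fin 2) :
    Function.Surjective (MvPolynomial.eval₂Hom (scalar (P1.toSpec k) (P1.chart k b))
      (fun a => P1.ratio k a b)) := by
  intro s
  obtain ⟨x, rfl⟩ := (Proj.basicOpenIsoAway (MvPolynomial.homogeneousSubmodule (Fin 2) k)
    (MvPolynomial.X b) (X_mem k b) one_pos).commRingCatIsoToRingEquiv.surjective s
  obtain ⟨n, f, hf, rfl⟩ := HomogeneousLocalization.Away.mk_surjective _ (X_mem k b) x
  refine ⟨f, P1.section_ext fun p => ?_⟩
  apply ((P1.isUnit_coord b p).pow n).mul_right_cancel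
  refine Eq.trans ?_ (P1.value_awayMk hf p).symm
  rw [MvPolynomial.coe_eval₂Hom, MvPolynomial.eval₂_eq']
  change P1.valueHom p _ * _ = _
  rw [map_sum, Finset.sum_mul]
  conv_rhs => rw [f.as_sum, P1.coord, map_sum]
  refine Finset.sum_congr rfl fun d hd => ?_
  have hn : d 0 + d 1 = n := by
    have := (MvPolynomial.mem_homogeneousSubmodule _ _).1 hf (MvPolynomial.mem_support_iff.1 hd)
    simpa [Finsupp.weight_apply, Finsupp.sum_fintype] using this
  rw [MvPolynomial.monomial_eq, map_mul, map_mul, Finsupp.prod_fintype _ _ (by simp)]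
  simp only [Fin.prod_univ_two, map_mul, map_pow]
  have h0 := P1.value_ratio 0 b p
  have h1 := P1.value_ratio 1 b p
  have hc := P1.value_scalar b (MvPolynomial.coeff d f) p
  have e : ∀ g, P1.valueHom p g = P1.value g p := fun _ => rfl
  have e' : ∀ g, algebraMap (MvPolynomial (Fin 2) k) (Localization.AtPrime (P1.prime p.1)) g =
    P1.coord p.1 g := fun _ => rfl
  rw [e, e, e, e', e', e', ← h0, ← h1, hc, ← hn]
  ring

theorem P1.chart_sup : P1.chart k 0 ⊔ P1.chart k 1 = ⊤ := by
  rw [eq_top_iff]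
  intro p _
  by_contra h
  have h' : ∀ b : Fin 2, MvPolynomial.X b ∈ P1.prime p := by
    intro b
    by_contra hb
    fin_cases b
    · exact h (Or.inl hb)
    · exact h (Or.inr hb)
  apply (show ProjectiveSpectrum (MvPolynomial.homogeneousSubmodule (Fin 2) k) from
    p).not_irrelevant_le
  intro f hf
  change f ∈ P1.prime p
  rw [HomogeneousIdeal.mem_irrelevant_iff, GradedRing.proj_apply] at hf
  have hc : MvPolynomial.coeff 0 f = 0 := by
    have := congrArg (MvPolynomial.coeff 0) hf
    erw [MvPolynomial.decomposition.decompose'_apply] at this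
    simpa [MvPolynomial.coeff_homogeneousComponent] using this
  rw [f.as_sum]
  refine Ideal.sum_mem _ fun d hd => ?_
  have hd0 : d ≠ 0 := by
    rintro rfl
    exact MvPolynomial.mem_support_iff.1 hd hc
  obtain ⟨i, hi⟩ := Finsupp.ne_iff.1 hd0
  rw [MvPolynomial.monomial_eq]
  refine Ideal.mul_mem_left _ _ ?_
  rw [Finsupp.prod_fintype _ _ (by simp), ← Finset.mul_prod_erase _ _ (Finset.mem_univ i)]
  exact Ideal.mul_mem_right _ _ (Ideal.pow_mem_of_mem _ (h' i) _ (Nat.pos_of_ne_zero hi))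

theorem P1.map_irrelevant_eq_top {R : Type u} [CommRing R] (F : MvPolynomial (Fin 2) k →+* R)
    (hu : Ideal.span (Set.range fun b => F (MvPolynomial.X b)) = ⊤) :
    (HomogeneousIdeal.irrelevant
      (MvPolynomial.homogeneousSubmodule (Fin 2) k)).toIdeal.map F = ⊤ := by
  rw [eq_top_iff, ← hu, Ideal.span_le]
  rintro _ ⟨b, rfl⟩
  apply Ideal.mem_map_of_mem
  change _ ∈ HomogeneousIdeal.irrelevant _
  rw [HomogeneousIdeal.mem_irrelevant_iff, GradedRing.proj_apply]
  exact DirectSum.decompose_of_mem_ne _ (X_mem k b) one_ne_zero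

theorem basicOpen_toSpecΓ_comp_SpecMap {T : Scheme.{u}} (x : Γ(T, ⊤))
    (ψ : Localization.Away x →+* Γ(T, T.basicOpen x))
    (hψ : ψ.comp (algebraMap _ _) = (T.presheaf.map (homOfLE le_top : T.basicOpen x ⟶ ⊤).op).hom) :
    (T.basicOpen x).toSpecΓ ≫ Spec.map (CommRingCat.ofHom ψ) =
      (T.isoOfEq (T.toSpecΓ_preimage_basicOpen x)).inv ≫ T.toSpecΓ ∣_ _ ≫
        (basicOpenIsoSpecAway x).hom := by
  rw [← cancel_mono (Spec.map (CommRingCat.ofHom (algebraMap Γ(T, ⊤) (Localization.Away x)))),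
    Category.assoc, ← Spec.map_comp, ← CommRingCat.ofHom_comp, hψ]
  simp only [Category.assoc]
  rw [basicOpenIsoSpecAway_hom_SpecMap, CommRingCat.ofHom_hom,
    Scheme.Opens.toSpecΓ_SpecMap_presheaf_map_top, Iso.eq_inv_comp]
  have h2 : (T.isoOfEq (T.toSpecΓ_preimage_basicOpen x)).hom ≫ (T.basicOpen x).ι =
    (T.toSpecΓ ⁻¹ᵁ PrimeSpectrum.basicOpen x).ι := Scheme.isoOfEq_hom_ι _ _
  refine (Category.assoc _ _ _).symm.trans ((congrArg (· ≫ T.toSpecΓ) h2).trans ?_)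
  exact (morphismRestrict_ι T.toSpecΓ (PrimeSpectrum.basicOpen x)).symm

theorem toBasicOpenOfGlobalSections_toSpec {T : Scheme.{u}}
    (F : MvPolynomial (Fin 2) k →+* Γ(T, ⊤)) {n : ℕ} {t : MvPolynomial (Fin 2) k}
    (ht : t ∈ MvPolynomial.homogeneousSubmodule (Fin 2) k n) (hn : 0 < n) :
    Proj.toBasicOpenOfGlobalSections (MvPolynomial.homogeneousSubmodule (Fin 2) k) F rfl hn ht ≫
      Proj.basicOpenToSpec (MvPolynomial.homogeneousSubmodule (Fin 2) k) t =
    ((T.isoOfEq (T.toSpecΓ_preimage_basicOpen (F t))).inv ≫ T.toSpecΓ ∣_ _ ≫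
        (basicOpenIsoSpecAway (F t)).hom) ≫ Spec.map (CommRingCat.ofHom
          ((IsLocalization.map (M := .powers t) (T := .powers (F t)) (Localization.Away (F t)) F
            (by rw [← Submonoid.map_le_iff_le_comap, Submonoid.map_powers])).comp
            (algebraMap _ (Localization.Away t)))) := by
  rw [Proj.toBasicOpenOfGlobalSections, Category.assoc,
    ← Proj.basicOpenIsoSpec_hom _ _ ht hn, Iso.inv_hom_id, Category.comp_id]
  simp only [Category.assoc]

/-- The morphism to the projective line defined by two functions without common zeros. -/
def P1.ofPair {T : Scheme.{u}} (f : T ⟶ Spec (CommRingCat.of k)) (u : Fin 2 → Γ(T, ⊤))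
    (hu : Ideal.span (Set.range u) = ⊤) : T ⟶ P1 k :=
  Proj.fromOfGlobalSections (MvPolynomial.homogeneousSubmodule (Fin 2) k)
    (MvPolynomial.eval₂Hom (scalar f ⊤) u) (P1.map_irrelevant_eq_top _ (by simpa using hu))

section ofPair
variable {T : Scheme.{u}} (f : T ⟶ Spec (CommRingCat.of k)) (u : Fin 2 → Γ(T, ⊤))
    (hu : Ideal.span (Set.range u) = ⊤)

theorem P1.ofPair_toSpec : P1.ofPair f u hu ≫ P1.toSpec k = f := by
  have h := Proj.fromOfGlobalSections_toSpecZero (MvPolynomial.homogeneousSubmodule (Fin 2) k)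
    (MvPolynomial.eval₂Hom (scalar f ⊤) u) (P1.map_irrelevant_eq_top _ (by simpa using hu))
  refine (reassoc_of% h) _ |>.trans ?_
  have h2 := ι_comp_eq_toSpecΓ f ⊤
  have : IsIso (⊤ : T.Opens).ι := by rw [← Scheme.topIso_hom]; infer_instance
  rw [Scheme.Opens.toSpecΓ_top, Category.assoc, cancel_epi] at h2
  conv_rhs => rw [h2]
  rw [← Spec.map_comp, ← CommRingCat.ofHom_comp]
  congr 3
  ext c
  exact MvPolynomial.eval₂_C _ _ _

theorem P1.ofPair_preimage (b : Fin 2) :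
    P1.ofPair f u hu ⁻¹ᵁ P1.chart k b = T.basicOpen (u b) := by
  have := Proj.fromOfGlobalSections_preimage_basicOpen (MvPolynomial.homogeneousSubmodule (Fin 2) k)
    (MvPolynomial.eval₂Hom (scalar f ⊤) u) (P1.map_irrelevant_eq_top _ (by simpa using hu))
    one_pos (X_mem k b)
  refine Eq.trans this ?_
  simp

theorem P1.ofPair_ratio_basicOpen (a b : Fin 2) :
    coordRatio (P1.ofPair f u hu) a b
      (T.basicOpen (MvPolynomial.eval₂Hom (scalar f ⊤) u (MvPolynomial.X b)))
        (by rw [P1.ofPair_preimage, MvPolynomial.eval₂Hom_X']) *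
      T.presheaf.map (homOfLE le_top).op (MvPolynomial.eval₂Hom (scalar f ⊤) u (MvPolynomial.X b)) =
      T.presheaf.map (homOfLE le_top).op
        (MvPolynomial.eval₂Hom (scalar f ⊤) u (MvPolynomial.X a)) := by
  set F : MvPolynomial (Fin 2) k →+* Γ(T, ⊤) := MvPolynomial.eval₂Hom (scalar f ⊤) u with hF
  have hFX : ∀ a, F (MvPolynomial.X a) = u a := fun a => MvPolynomial.eval₂Hom_X' _ _ a
  have hirr := P1.map_irrelevant_eq_top F (by simpa [hFX] using hu)
  set W := T.basicOpen (F (MvPolynomial.X b)) with hW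
  have hu' : IsUnit ((T.presheaf.map (homOfLE le_top : W ⟶ ⊤).op).hom
      (F (MvPolynomial.X b))) := by
    exact RingedSpace.isUnit_res_basicOpen _ _
  let ψ : Localization.Away (F (MvPolynomial.X b)) →+* Γ(T, W) :=
    IsLocalization.Away.lift (F (MvPolynomial.X b)) hu'
  have hψ : ψ.comp (algebraMap _ _) = (T.presheaf.map (homOfLE le_top : W ⟶ ⊤).op).hom :=
    IsLocalization.Away.lift_comp _ hu'
  let μ : Localization.Away (MvPolynomial.X b : MvPolynomial (Fin 2) k) →+*
      Localization.Away (F (MvPolynomial.X b)) :=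
    IsLocalization.map (M := .powers (MvPolynomial.X b : MvPolynomial (Fin 2) k))
      (T := .powers (F (MvPolynomial.X b))) _ F
      (by rw [← Submonoid.map_le_iff_le_comap, Submonoid.map_powers])
  have hμ : ∀ p, μ (algebraMap _ _ p) = algebraMap _ _ (F p) := fun p => IsLocalization.map_eq _ p
  have hres := Proj.fromOfGlobalSections_resLE (MvPolynomial.homogeneousSubmodule (Fin 2) k) F hirr
    one_pos (X_mem k b)
  let φ := Proj.fromOfGlobalSections (MvPolynomial.homogeneousSubmodule (Fin 2) k) F hirr
  have hle : W ≤ φ ⁻¹ᵁ Proj.basicOpen (MvPolynomial.homogeneousSubmodule (Fin 2) k)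
    (MvPolynomial.X b) := (Proj.fromOfGlobalSections_preimage_basicOpen _ F hirr
      one_pos (X_mem k b)).ge
  have key : Proj.awayToSection (MvPolynomial.homogeneousSubmodule (Fin 2) k) (MvPolynomial.X b) ≫
      φ.appLE _ W hle = CommRingCat.ofHom ((ψ.comp μ).comp (algebraMap _ _)) := by
    apply toSpecΓ_injective
    rw [Spec.map_comp, Scheme.Opens.toSpecΓ_SpecMap_appLE_assoc, hres]
    rw [RingHom.comp_assoc, CommRingCat.ofHom_comp, Spec.map_comp,
      reassoc_of% (basicOpen_toSpecΓ_comp_SpecMap _ ψ hψ)]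
    exact toBasicOpenOfGlobalSections_toSpec F (X_mem k b) one_pos
  have key2 := congrArg (fun g => g.hom (HomogeneousLocalization.Away.mk
      (MvPolynomial.homogeneousSubmodule (Fin 2) k) (X_mem k b) 1 (MvPolynomial.X a)
      (by simpa using X_mem k a))) key
  have key3 : coordRatio (P1.ofPair f u hu) a b (T.basicOpen (F (MvPolynomial.X b))) hle =
    ψ (μ (algebraMap _ _ (HomogeneousLocalization.Away.mk
      (MvPolynomial.homogeneousSubmodule (Fin 2) k) (X_mem k b) 1 (MvPolynomial.X a)
      (by simpa using X_mem k a)))) := key2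
  have key4 : coordRatio (P1.ofPair f u hu) a b (T.basicOpen (F (MvPolynomial.X b))) hle *
      T.presheaf.map (homOfLE le_top).op (F (MvPolynomial.X b)) =
        T.presheaf.map (homOfLE le_top).op (F (MvPolynomial.X a)) := by
    have e : ∀ p, (T.presheaf.map (homOfLE le_top : W ⟶ ⊤).op).hom (F p) =
        ψ (μ (algebraMap _ _ p)) := fun p => by
      rw [← hψ, hμ]; rfl
    rw [key3]
    refine (congrArg _ (e _)).trans (Eq.trans ?_ (e _).symm)
    rw [← map_mul, ← map_mul]
    congr 2
    rw [HomogeneousLocalization.algebraMap_apply, HomogeneousLocalization.Away.val_mk,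
      Localization.mk_eq_mk']
    have h5 := IsLocalization.mk'_spec (Localization.Away (MvPolynomial.X b : MvPolynomial (Fin 2) k))
      (MvPolynomial.X a) (⟨MvPolynomial.X b ^ 1, 1, rfl⟩ :
        Submonoid.powers (MvPolynomial.X b : MvPolynomial (Fin 2) k))
    simpa only [pow_one] using h5
  exact key4

theorem P1.ofPair_ratio (a b : Fin 2) (W : T.Opens) (h : W ≤ P1.ofPair f u hu ⁻¹ᵁ P1.chart k b) :
    coordRatio (P1.ofPair f u hu) a b W h *
      T.presheaf.map (homOfLE le_top).op (u b) = T.presheaf.map (homOfLE le_top).op (u a) := by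
  have hle : W ≤ T.basicOpen (MvPolynomial.eval₂Hom (scalar f ⊤) u (MvPolynomial.X b)) := by
    rw [MvPolynomial.eval₂Hom_X']
    exact h.trans (P1.ofPair_preimage f u hu b).le
  have := congrArg (T.presheaf.map (homOfLE hle).op).hom (P1.ofPair_ratio_basicOpen f u hu a b)
  rw [map_mul] at this
  rw [← CommRingCat.comp_apply, ← CommRingCat.comp_apply, ← T.presheaf.map_comp] at this
  have hX : ∀ a : Fin 2, u a = MvPolynomial.eval₂Hom (scalar f ⊤) u (MvPolynomial.X a) :=
    fun _ => (MvPolynomial.eval₂Hom_X' (scalar f ⊤) u _).symm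
  rw [hX a, hX b]
  refine Eq.trans (congrArg (· * _) ?_) this
  rw [coordRatio, coordRatio, ← CommRingCat.comp_apply, Scheme.Hom.appLE_map]

end ofPair

theorem coordRatio_map {T : Scheme.{u}} (φ : T ⟶ P1 k) (a b : Fin 2) {V W : T.Opens} (i : V ≤ W)
    (h : W ≤ φ ⁻¹ᵁ P1.chart k b) : T.presheaf.map (homOfLE i).op (coordRatio φ a b W h) =
      coordRatio φ a b V (i.trans h) := by
  rw [coordRatio, coordRatio, ← CommRingCat.comp_apply, Scheme.Hom.appLE_map]

theorem coordRatio_self {T : Scheme.{u}} (φ : T ⟶ P1 k) (b : Fin 2) (W : T.Opens)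
    (h : W ≤ φ ⁻¹ᵁ P1.chart k b) : coordRatio φ b b W h = 1 := by
  rw [coordRatio, P1.ratio_self, map_one]

theorem coordRatio_mul {T : Scheme.{u}} (φ : T ⟶ P1 k) (a b c : Fin 2) (W : T.Opens)
    (ha : W ≤ φ ⁻¹ᵁ P1.chart k a) (hb : W ≤ φ ⁻¹ᵁ P1.chart k b) :
    coordRatio φ c a W ha * coordRatio φ a b W hb = coordRatio φ c b W hb := by
  have hW : W ≤ φ ⁻¹ᵁ (P1.chart k a ⊓ P1.chart k b) := fun x hx => ⟨ha hx, hb hx⟩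
  have h := congrArg (φ.appLE (P1.chart k a ⊓ P1.chart k b) W hW).hom
    (P1.ratio_mul_ratio a b c (P1.chart k a ⊓ P1.chart k b) inf_le_left inf_le_right)
  rw [map_mul, ← CommRingCat.comp_apply, ← CommRingCat.comp_apply, ← CommRingCat.comp_apply,
    Scheme.Hom.map_appLE, Scheme.Hom.map_appLE] at h
  exact h

theorem appLE_coordRatio {S T : Scheme.{u}} (g : S ⟶ T) (φ : T ⟶ P1 k) (a b : Fin 2) (W : T.Opens)
    (h : W ≤ φ ⁻¹ᵁ P1.chart k b) (V : S.Opens) (hV : V ≤ g ⁻¹ᵁ W) :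
    (g.appLE W V hV).hom (coordRatio φ a b W h) =
      coordRatio (g ≫ φ) a b V (hV.trans (Scheme.Hom.preimage_mono g h)) := by
  rw [coordRatio, coordRatio, ← CommRingCat.comp_apply, Scheme.Hom.appLE_comp_appLE]

/-- Morphisms to the projective line agree if they have locally the same homogeneous coordinates. -/
theorem P1.hom_ext {T : Scheme.{u}} {φ ψ : T ⟶ P1 k} (hs : φ ≫ P1.toSpec k = ψ ≫ P1.toSpec k)
    (h : ∀ x : T, ∃ (b : Fin 2) (W : T.Opens) (_ : x ∈ W) (h1 : W ≤ φ ⁻¹ᵁ P1.chart k b)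
      (h2 : W ≤ ψ ⁻¹ᵁ P1.chart k b), ∀ a, coordRatio φ a b W h1 = coordRatio ψ a b W h2) :
    φ = ψ := by
  choose b W hx h1 h2 he using h
  have hc : ⨆ x, W x = ⊤ := by
    rw [eq_top_iff]; intro x _; exact TopologicalSpace.Opens.mem_iSup.2 ⟨x, hx x⟩
  refine (T.openCoverOfIsOpenCover W hc).hom_ext _ _ fun x => ?_
  change (W x).ι ≫ φ = (W x).ι ≫ ψ
  have e : φ.appLE _ _ (h1 x) = ψ.appLE _ _ (h2 x) := by
    ext y
    obtain ⟨p, rfl⟩ := P1.dehom_surjective (b x) y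
    have : (φ.appLE _ _ (h1 x)).hom.comp (MvPolynomial.eval₂Hom
        (scalar (P1.toSpec k) (P1.chart k (b x))) (fun a => P1.ratio k a (b x))) =
      (ψ.appLE _ _ (h2 x)).hom.comp (MvPolynomial.eval₂Hom
        (scalar (P1.toSpec k) (P1.chart k (b x))) (fun a => P1.ratio k a (b x))) := by
      apply MvPolynomial.ringHom_ext
      · intro c
        simp only [RingHom.comp_apply, MvPolynomial.coe_eval₂Hom, MvPolynomial.eval₂_C]
        rw [appLE_scalar, appLE_scalar, hs]
      · intro a
        simp only [RingHom.comp_apply, MvPolynomial.coe_eval₂Hom, MvPolynomial.eval₂_X]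
        exact he x a
    exact congrArg (fun g => g p) this
  have e2 := Scheme.Opens.toSpecΓ_SpecMap_appLE φ _ _ (h1 x)
  rw [e, Scheme.Opens.toSpecΓ_SpecMap_appLE] at e2
  have := isIso_toSpecΓ_of_isAffineOpen (P1.isAffineOpen_chart (k := k) (b x))
  rw [cancel_mono] at e2
  rw [← Scheme.Hom.resLE_comp_ι φ (h1 x), ← Scheme.Hom.resLE_comp_ι ψ (h2 x), e2]

end ProjectiveLine

section Sections

/-- Restriction of sections of the structure sheaf. -/
def res {X : Scheme.{u}} {V W : X.Opens} (h : V ≤ W) : Γ(X, W) →+* Γ(X, V) :=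
  (X.presheaf.map (homOfLE h).op).hom

variable {X Y : Scheme.{u}}

theorem res_res {U V W : X.Opens} (h : U ≤ V) (h' : V ≤ W) (f : Γ(X, W)) :
    res h (res h' f) = res (h.trans h') f := by
  simp only [res]
  rw [← CommRingCat.comp_apply, ← X.presheaf.map_comp]
  rfl

theorem res_self {W : X.Opens} (h : W ≤ W) (f : Γ(X, W)) : res h f = f := by
  have : (homOfLE h).op = 𝟙 _ := rfl
  rw [res, this, X.presheaf.map_id]; rfl

theorem appLE_res (q : Y ⟶ X) {U V : X.Opens} {W : Y.Opens} (h : U ≤ V) (hW : W ≤ q ⁻¹ᵁ U)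
    (f : Γ(X, V)) : (q.appLE U W hW).hom (res h f) =
      (q.appLE V W (hW.trans (Scheme.Hom.preimage_mono q h))).hom f := by
  rw [res, ← CommRingCat.comp_apply, Scheme.Hom.map_appLE]

theorem res_appLE (q : Y ⟶ X) {U : X.Opens} {V W : Y.Opens} (h : W ≤ V) (hW : V ≤ q ⁻¹ᵁ U)
    (f : Γ(X, U)) : res h ((q.appLE U V hW).hom f) = (q.appLE U W (h.trans hW)).hom f := by
  rw [res, ← CommRingCat.comp_apply, Scheme.Hom.appLE_map]

theorem appLE_appLE {Z : Scheme.{u}} (p : Z ⟶ Y) (q : Y ⟶ X) {U : X.Opens} {V : Y.Opens}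
    {W : Z.Opens} (h : W ≤ p ⁻¹ᵁ V) (hW : V ≤ q ⁻¹ᵁ U) (f : Γ(X, U)) :
    (p.appLE V W h).hom ((q.appLE U V hW).hom f) =
      ((p ≫ q).appLE U W (h.trans (Scheme.Hom.preimage_mono p hW))).hom f := by
  rw [← CommRingCat.comp_apply, Scheme.Hom.appLE_comp_appLE]

theorem isUnit_res_of_le_basicOpen {V W : X.Opens} (h : V ≤ W) (f : Γ(X, W))
    (hf : V ≤ X.basicOpen f) : IsUnit (res h f) := by
  have := (RingedSpace.isUnit_res_basicOpen X.toSheafedSpace f).map (res hf)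
  have e := res_res hf (X.basicOpen_le f) f
  rw [← e]
  exact this

theorem basicOpen_res_eq {V W : X.Opens} (h : V ≤ W) (f : Γ(X, W)) :
    X.basicOpen (res h f) = V ⊓ X.basicOpen f :=
  X.basicOpen_res f (homOfLE h).op

theorem preimage_basicOpen_appLE (q : Y ⟶ X) {U : X.Opens} {V : Y.Opens} (h : V ≤ q ⁻¹ᵁ U)
    (f : Γ(X, U)) : Y.basicOpen ((q.appLE U V h).hom f) = V ⊓ q ⁻¹ᵁ X.basicOpen f := by
  rw [Scheme.Hom.appLE, CommRingCat.comp_apply]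
  refine (Scheme.basicOpen_res _ _ _).trans ?_
  rw [Scheme.preimage_basicOpen]

variable {k : Type u} [Field k]

theorem res_scalar (f : X ⟶ Spec (CommRingCat.of k)) {V W : X.Opens} (h : V ≤ W) (c : k) :
    res h (scalar f W c) = scalar f V c :=
  H0.scalar_restrict f h c

theorem res_coordRatio (φ : X ⟶ P1 k) (a b : Fin 2) {V W : X.Opens} (i : V ≤ W)
    (h : W ≤ φ ⁻¹ᵁ P1.chart k b) :
    res i (coordRatio φ a b W h) = coordRatio φ a b V (i.trans h) :=
  coordRatio_map φ a b i h

end Sections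

section Glue
variable {k : Type u} [Field k] {T : Scheme.{u}}

theorem P1.ofPair_congr (f : T ⟶ Spec (CommRingCat.of k)) {v w : Fin 2 → Γ(T, ⊤)}
    (hv : Ideal.span (Set.range v) = ⊤) (hw : Ideal.span (Set.range w) = ⊤)
    (h : v 0 * w 1 = v 1 * w 0) : P1.ofPair f v hv = P1.ofPair f w hw := by
  have hvw : ∀ a b, v a * w b = v b * w a := by
    intro a b
    fin_cases a <;> fin_cases b <;> first | rfl | exact h | exact h.symm
  have h1 : (1 : Γ(T, ⊤)) ∈ Ideal.span (Set.range w) := by rw [hw]; trivial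
  rw [Ideal.mem_span_range_iff_exists_fun] at h1
  obtain ⟨α, hα⟩ := h1
  set l := ∑ a, α a * v a with hl
  have hlw : ∀ b, v b = l * w b := by
    intro b
    rw [hl, Finset.sum_mul]
    conv_lhs => rw [← mul_one (v b), ← hα, Finset.mul_sum]
    refine Finset.sum_congr rfl fun a _ => ?_
    rw [mul_assoc, ← hvw b a]; ring
  have hle : ∀ b, T.basicOpen (v b) ≤ T.basicOpen (w b) := by
    intro b
    rw [hlw b, T.basicOpen_mul]
    exact inf_le_right
  refine P1.hom_ext (by rw [P1.ofPair_toSpec, P1.ofPair_toSpec]) fun x => ?_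
  have hx : ∃ b, x ∈ T.basicOpen (v b) := by
    have : x ∈ P1.ofPair f v hv ⁻¹ᵁ (P1.chart k 0 ⊔ P1.chart k 1) := by
      rw [P1.chart_sup]; trivial
    rcases this with h | h
    · exact ⟨0, (P1.ofPair_preimage f v hv 0).le h⟩
    · exact ⟨1, (P1.ofPair_preimage f v hv 1).le h⟩
  obtain ⟨b, hb⟩ := hx
  refine ⟨b, T.basicOpen (v b), hb, (P1.ofPair_preimage f v hv b).ge,
    (hle b).trans (P1.ofPair_preimage f w hw b).ge, fun a => ?_⟩
  have e1 := P1.ofPair_ratio f v hv a b (T.basicOpen (v b)) (P1.ofPair_preimage f v hv b).ge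
  have e2 := P1.ofPair_ratio f w hw a b (T.basicOpen (v b))
    ((hle b).trans (P1.ofPair_preimage f w hw b).ge)
  have hu : IsUnit (res (le_top : T.basicOpen (v b) ≤ ⊤) (v b)) :=
    isUnit_res_of_le_basicOpen _ _ le_rfl
  apply hu.mul_right_cancel
  refine Eq.trans e1 ?_
  have hr : ∀ a, res (le_top : T.basicOpen (v b) ≤ ⊤) (v a) = res le_top l * res le_top (w a) :=
    fun a => (congrArg _ (hlw a)).trans (map_mul _ _ _)
  change res _ (v a) = _ * res _ (v b)
  rw [hr, hr, mul_left_comm]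
  exact congrArg _ e2.symm

theorem P1.span_eq_top_map {S : Scheme.{u}} (g : S ⟶ T) {u : Fin 2 → Γ(T, ⊤)}
    (hu : Ideal.span (Set.range u) = ⊤) :
    Ideal.span (Set.range fun a => g.appTop.hom (u a)) = ⊤ := by
  rw [← Ideal.map_top g.appTop.hom, ← hu, Ideal.map_span, ← Set.range_comp]
  rfl

theorem P1.comp_ofPair {S : Scheme.{u}} (g : S ⟶ T) (f : T ⟶ Spec (CommRingCat.of k))
    {u : Fin 2 → Γ(T, ⊤)} (hu : Ideal.span (Set.range u) = ⊤) :
    g ≫ P1.ofPair f u hu = P1.ofPair (g ≫ f) (fun a => g.appTop.hom (u a))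
      (P1.span_eq_top_map g hu) := by
  refine P1.hom_ext (by rw [Category.assoc, P1.ofPair_toSpec, P1.ofPair_toSpec]) fun x => ?_
  have hx : ∃ b, x ∈ S.basicOpen (g.appTop.hom (u b)) := by
    have : x ∈ P1.ofPair (g ≫ f) _ (P1.span_eq_top_map g hu) ⁻¹ᵁ (P1.chart k 0 ⊔ P1.chart k 1) := by
      rw [P1.chart_sup]; trivial
    rcases this with h | h
    · exact ⟨0, (P1.ofPair_preimage (g ≫ f) _ (P1.span_eq_top_map g hu) 0).le h⟩
    · exact ⟨1, (P1.ofPair_preimage (g ≫ f) _ (P1.span_eq_top_map g hu) 1).le h⟩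
  obtain ⟨b, hb⟩ := hx
  have hW : S.basicOpen (g.appTop.hom (u b)) ≤ g ⁻¹ᵁ T.basicOpen (u b) := by
    rw [Scheme.preimage_basicOpen_top]
  have h1 : S.basicOpen (g.appTop.hom (u b)) ≤ (g ≫ P1.ofPair f u hu) ⁻¹ᵁ P1.chart k b :=
    hW.trans (Scheme.Hom.preimage_mono g (P1.ofPair_preimage f u hu b).ge)
  have h2 := (P1.ofPair_preimage (g ≫ f) _ (P1.span_eq_top_map g hu) b).ge
  refine ⟨b, _, hb, h1, h2, fun a => ?_⟩
  have hunit : IsUnit (res (le_top : S.basicOpen (g.appTop.hom (u b)) ≤ ⊤) (g.appTop.hom (u b))) :=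
    isUnit_res_of_le_basicOpen _ _ le_rfl
  apply hunit.mul_right_cancel
  refine Eq.trans ?_ (P1.ofPair_ratio (g ≫ f) _ (P1.span_eq_top_map g hu) a b _ h2).symm
  have e := congrArg (g.appLE _ _ hW).hom (P1.ofPair_ratio f u hu a b (T.basicOpen (u b))
    (P1.ofPair_preimage f u hu b).ge)
  rw [map_mul, appLE_coordRatio] at e
  have e2 : ∀ a, (g.appLE _ _ hW).hom (T.presheaf.map (homOfLE le_top).op (u a)) =
      res (le_top : S.basicOpen (g.appTop.hom (u b)) ≤ ⊤) (g.appTop.hom (u a)) := by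
    intro a
    refine (appLE_res g le_top hW (u a)).trans ?_
    have := res_appLE g (le_top : S.basicOpen (g.appTop.hom (u b)) ≤ ⊤)
      (by simp : ⊤ ≤ g ⁻¹ᵁ ⊤) (u a)
    rw [← this]
    congr 2
    rw [Scheme.Hom.appTop, Scheme.Hom.app_eq_appLE]
    rfl
  rw [e2, e2] at e
  exact e

/-- A family of pairs of functions without common zeros on an open cover, proportional on the
overlaps, defines a morphism to the projective line. -/
theorem P1.exists_hom_of_pairs (f : T ⟶ Spec (CommRingCat.of k)) {ι : Type u} (V : ι → T.Opens)
    (hV : ⨆ i, V i = ⊤) (u : ∀ i, Fin 2 → Γ(T, V i)) (hu : ∀ i, Ideal.span (Set.range (u i)) = ⊤)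
    (hc : ∀ i j, res inf_le_left (u i 0) * res inf_le_right (u j 1) =
      res (inf_le_left : V i ⊓ V j ≤ V i) (u i 1) * res inf_le_right (u j 0)) :
    ∃ φ : T ⟶ P1 k, φ ≫ P1.toSpec k = f ∧
      (∀ i b, V i ⊓ φ ⁻¹ᵁ P1.chart k b = T.basicOpen (u i b)) ∧
      ∀ i a b (W : T.Opens) (hW : W ≤ V i) (h : W ≤ φ ⁻¹ᵁ P1.chart k b),
        coordRatio φ a b W h * res hW (u i b) = res hW (u i a) := by
  let 𝒰 := T.openCoverOfIsOpenCover V hV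
  have he : ∀ i, V i ≤ (V i).ι ''ᵁ ⊤ := fun i => by simp
  have hι : ∀ i, ⊤ ≤ (V i).ι ⁻¹ᵁ V i := fun i => by simp
  let u' : ∀ i, Fin 2 → Γ(V i, ⊤) := fun i a => ((V i).ι.appLE (V i) ⊤ (hι i)).hom (u i a)
  have hu' : ∀ i, Ideal.span (Set.range (u' i)) = ⊤ := fun i => by
    rw [← Ideal.map_top ((V i).ι.appLE (V i) ⊤ (hι i)).hom, ← hu i, Ideal.map_span,
      ← Set.range_comp]
    rfl
  let φ : ∀ i, (V i).toScheme ⟶ P1 k := fun i => P1.ofPair ((V i).ι ≫ f) (u' i) (hu' i)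
  have hφ : ∀ i j, pullback.fst (V i).ι (V j).ι ≫ φ i = pullback.snd (V i).ι (V j).ι ≫ φ j := by
    intro i j
    rw [P1.comp_ofPair, P1.comp_ofPair]
    have hf : pullback.snd (V i).ι (V j).ι ≫ (V j).ι ≫ f =
      pullback.fst (V i).ι (V j).ι ≫ (V i).ι ≫ f := by rw [pullback.condition_assoc]
    have hle : ⊤ ≤ (pullback.fst (V i).ι (V j).ι ≫ (V i).ι) ⁻¹ᵁ (V i ⊓ V j) := by
      intro x _
      refine ⟨(pullback.fst (V i).ι (V j).ι x).2, ?_⟩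
      rw [pullback.condition]
      exact (pullback.snd (V i).ι (V j).ι x).2
    have hle' : ⊤ ≤ (pullback.snd (V i).ι (V j).ι ≫ (V j).ι) ⁻¹ᵁ (V i ⊓ V j) := by
      rwa [← pullback.condition]
    have h1 : ∀ a, (pullback.fst (V i).ι (V j).ι).appTop.hom (u' i a) =
        ((pullback.fst (V i).ι (V j).ι ≫ (V i).ι).appLE _ _ hle).hom (res inf_le_left (u i a)) := by
      intro a
      rw [appLE_res, Scheme.Hom.appTop, Scheme.Hom.app_eq_appLE]
      exact appLE_appLE _ _ _ _ _
    have h2 : ∀ a, (pullback.snd (V i).ι (V j).ι).appTop.hom (u' j a) =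
        ((pullback.fst (V i).ι (V j).ι ≫ (V i).ι).appLE _ _ hle).hom
          (res inf_le_right (u j a)) := by
      intro a
      have : ∀ (g : pullback (V i).ι (V j).ι ⟶ T) (hg : ⊤ ≤ g ⁻¹ᵁ (V i ⊓ V j)),
        g = pullback.snd (V i).ι (V j).ι ≫ (V j).ι →
        (pullback.snd (V i).ι (V j).ι).appTop.hom (u' j a) =
          (g.appLE _ _ hg).hom (res inf_le_right (u j a)) := by
        rintro g hg rfl
        rw [appLE_res, Scheme.Hom.appTop, Scheme.Hom.app_eq_appLE]
        exact appLE_appLE _ _ _ _ _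
      exact this _ hle pullback.condition
    have h3 := congrArg ((pullback.fst (V i).ι (V j).ι ≫ (V i).ι).appLE _ _ hle).hom (hc i j)
    rw [map_mul, map_mul, ← h1, ← h1, ← h2, ← h2] at h3
    have h4 : ∀ (f1 f2 : pullback (V i).ι (V j).ι ⟶ Spec (CommRingCat.of k)), f1 = f2 →
      ∀ (w : Fin 2 → Γ(pullback (V i).ι (V j).ι, ⊤)) (hw : Ideal.span (Set.range w) = ⊤),
        P1.ofPair f1 w hw = P1.ofPair f2 w hw := by
      rintro f1 _ rfl w hw; rfl
    rw [h4 _ _ hf]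
    exact P1.ofPair_congr _ _ _ h3
  let Φ : T ⟶ P1 k := 𝒰.glueMorphisms φ hφ
  have hΦ : ∀ i, (V i).ι ≫ Φ = φ i := fun i => 𝒰.ι_glueMorphisms φ hφ i
  refine ⟨Φ, ?_, ?_, ?_⟩
  · refine 𝒰.hom_ext _ _ fun i => ?_
    change (V i).ι ≫ Φ ≫ _ = (V i).ι ≫ f
    rw [reassoc_of% (hΦ i), P1.ofPair_toSpec]
  · intro i b
    have h1 := P1.ofPair_preimage ((V i).ι ≫ f) (u' i) (hu' i) b
    change φ i ⁻¹ᵁ _ = _ at h1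
    rw [← hΦ i, Scheme.Hom.comp_preimage, preimage_basicOpen_appLE] at h1
    ext x
    constructor
    · rintro ⟨hx, hx2⟩
      have : (⟨x, hx⟩ : (V i).toScheme) ∈ (V i).ι ⁻¹ᵁ Φ ⁻¹ᵁ P1.chart k b := hx2
      rw [h1] at this
      exact this.2
    · intro hx
      have hxV : x ∈ V i := T.basicOpen_le _ hx
      have : (⟨x, hxV⟩ : (V i).toScheme) ∈ (V i).ι ⁻¹ᵁ Φ ⁻¹ᵁ P1.chart k b := by
        rw [h1]; exact ⟨trivial, hx⟩
      exact ⟨hxV, this⟩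
  · intro i a b W hW h
    have hW' : (V i).ι ''ᵁ ((V i).ι ⁻¹ᵁ W) ≤ W := by
      rw [Scheme.Hom.image_preimage_eq_opensRange_inf]; exact inf_le_right
    have hchart : (V i).ι ⁻¹ᵁ W ≤ φ i ⁻¹ᵁ P1.chart k b := by
      rw [← hΦ i]; exact Scheme.Hom.preimage_mono _ h
    have h1 := P1.ofPair_ratio ((V i).ι ≫ f) (u' i) (hu' i) a b ((V i).ι ⁻¹ᵁ W) hchart
    have hinj : Function.Injective ((V i).ι.appLE W ((V i).ι ⁻¹ᵁ W) le_rfl).hom := by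
      have : IsIso ((V i).ι.appLE W ((V i).ι ⁻¹ᵁ W) le_rfl) := by
        rw [← Scheme.Hom.app_eq_appLE]
        exact Scheme.Hom.isIso_app _ _ (by simpa using hW)
      exact (ConcreteCategory.bijective_of_isIso ((V i).ι.appLE W ((V i).ι ⁻¹ᵁ W) le_rfl)).1
    apply hinj
    rw [map_mul, appLE_coordRatio]
    have h2 : ∀ a, ((V i).ι.appLE W ((V i).ι ⁻¹ᵁ W) le_rfl).hom (res hW (u i a)) =
        res (le_top : (V i).ι ⁻¹ᵁ W ≤ ⊤) (u' i a) := by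
      intro a
      rw [appLE_res]
      exact (res_appLE _ _ _ _).symm
    rw [h2, h2]
    have h3 : ∀ (ψ : (V i).toScheme ⟶ P1 k) (hψ : ψ = φ i) h', coordRatio ψ a b _ h' =
        coordRatio (φ i) a b _ hchart := by
      rintro _ rfl _; rfl
    rw [h3 _ (hΦ i)]
    exact h1

end Glue

section Eval
variable {k : Type u} [Field k] {X Y : Scheme.{u}}

theorem eq_closedPoint (x : Spec (CommRingCat.of k)) : x = IsLocalRing.closedPoint k :=
  Subsingleton.elim (α := PrimeSpectrum k) x _

theorem top_le_preimage {s : Spec (CommRingCat.of k) ⟶ X} {W : X.Opens} (h : point s ∈ W) :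
    ⊤ ≤ s ⁻¹ᵁ W := by
  intro x _
  rw [eq_closedPoint x]
  exact h

theorem point_comp (s : Spec (CommRingCat.of k) ⟶ X) (q : X ⟶ Y) :
    point (s ≫ q) = q (point s) :=
  Scheme.Hom.comp_apply s q _

theorem point_specMap {K : Type u} [Field K] [Algebra k K] (s : Spec (CommRingCat.of k) ⟶ X) :
    point (Spec.map (CommRingCat.ofHom (algebraMap k K)) ≫ s) = point s := by
  rw [point_comp, eq_closedPoint (point _), point]

/-- The value of a function at a rational point. -/
def evalAt (s : Spec (CommRingCat.of k) ⟶ X) (W : X.Opens) (h : point s ∈ W) : Γ(X, W) →+* k :=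
  (Scheme.ΓSpecIso (CommRingCat.of k)).hom.hom.comp (s.appLE W ⊤ (top_le_preimage h)).hom

theorem evalAt_res (s : Spec (CommRingCat.of k) ⟶ X) {V W : X.Opens} (i : V ≤ W)
    (h : point s ∈ V) (f : Γ(X, W)) : evalAt s V h (res i f) = evalAt s W (i h) f := by
  rw [evalAt, evalAt, RingHom.comp_apply, appLE_res]; rfl

theorem evalAt_comp (s : Spec (CommRingCat.of k) ⟶ Y) (q : Y ⟶ X) {W : X.Opens} {V : Y.Opens}
    (i : V ≤ q ⁻¹ᵁ W) (h : point s ∈ V) (h' : point (s ≫ q) ∈ W) (f : Γ(X, W)) :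
    evalAt (s ≫ q) W h' f = evalAt s V h ((q.appLE W V i).hom f) := by
  rw [evalAt, evalAt, RingHom.comp_apply, RingHom.comp_apply, appLE_appLE]

theorem evalAt_scalar {l : Type u} [Field l] (φ : l →+* k) {f : X ⟶ Spec (CommRingCat.of l)}
    {s : Spec (CommRingCat.of k) ⟶ X} (hs : s ≫ f = Spec.map (CommRingCat.ofHom φ))
    (W : X.Opens) (h : point s ∈ W) (c : l) : evalAt s W h (scalar f W c) = φ c := by
  rw [evalAt, RingHom.comp_apply, appLE_scalar, hs]
  have h1 : scalar (Spec.map (CommRingCat.ofHom φ)) ⊤ c =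
      (Scheme.ΓSpecIso (CommRingCat.of k)).inv.hom (φ c) := by
    rw [scalar, RingHom.comp_apply]
    have := congrArg (fun g => g.hom c) (Scheme.ΓSpecIso_inv_naturality (CommRingCat.ofHom φ))
    refine Eq.trans ?_ this.symm
    rw [Scheme.Hom.appTop, Scheme.Hom.app_eq_appLE]
    rfl
  rw [h1]
  exact (congrArg (fun g => g.hom (φ c)) (Scheme.ΓSpecIso (CommRingCat.of k)).inv_hom_id : _)

theorem evalAt_scalar_self {f : X ⟶ Spec (CommRingCat.of k)}
    {s : Spec (CommRingCat.of k) ⟶ X} (hs : s ≫ f = 𝟙 _)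
    (W : X.Opens) (h : point s ∈ W) (c : k) : evalAt s W h (scalar f W c) = c :=
  evalAt_scalar (RingHom.id k) (by rw [hs]; exact Spec.map_id _ |>.symm) W h c

theorem mem_basicOpen_iff (s : Spec (CommRingCat.of k) ⟶ X) (W : X.Opens) (h : point s ∈ W)
    (f : Γ(X, W)) : point s ∈ X.basicOpen f ↔ evalAt s W h f ≠ 0 := by
  constructor
  · intro hs h0
    have hu := (isUnit_res_of_le_basicOpen (X.basicOpen_le f) f le_rfl).map
      (evalAt s (X.basicOpen f) hs)
    rw [evalAt_res, h0] at hu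
    exact hu.ne_zero rfl
  · intro hne
    have hu : IsUnit ((s.appLE W ⊤ (top_le_preimage h)).hom f) := by
      have h1 : IsUnit (evalAt s W h f) := isUnit_iff_ne_zero.2 hne
      have h2 := h1.map (Scheme.ΓSpecIso (CommRingCat.of k)).inv.hom
      have e : (Scheme.ΓSpecIso (CommRingCat.of k)).inv.hom (evalAt s W h f) =
          (s.appLE W ⊤ (top_le_preimage h)).hom f :=
        (congrArg (fun g => g.hom ((s.appLE W ⊤ (top_le_preimage h)).hom f))
          (Scheme.ΓSpecIso (CommRingCat.of k)).hom_inv_id : _)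
      rwa [e] at h2
    have h3 := Scheme.basicOpen_of_isUnit _ hu
    rw [preimage_basicOpen_appLE] at h3
    have : (IsLocalRing.closedPoint k : Spec (CommRingCat.of k)) ∈
      (⊤ ⊓ s ⁻¹ᵁ X.basicOpen f : (Spec (CommRingCat.of k)).Opens) := by rw [h3]; trivial
    exact this.2

instance quasiCompact_of_field (s : Spec (CommRingCat.of k) ⟶ X) : QuasiCompact s :=
  ⟨fun _ _ _ => (Set.Subsingleton.finite fun _ _ _ _ =>
    Subsingleton.elim (α := PrimeSpectrum k) _ _).isCompact⟩

theorem mem_ker_iff (s : Spec (CommRingCat.of k) ⟶ X) (W : X.affineOpens) (f : Γ(X, W)) :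
    f ∈ (Scheme.Hom.ker s).ideal W ↔ ∀ h : point s ∈ W.1, evalAt s W.1 h f = 0 := by
  rw [Scheme.Hom.ker_apply, RingHom.mem_ker]
  constructor
  · intro h0 h
    rw [evalAt, RingHom.comp_apply, Scheme.Hom.appLE, CommRingCat.comp_apply]
    have : (s.app W.1).hom f = 0 := h0
    erw [this]
    simp
  · intro h
    by_cases hs : point s ∈ W.1
    · have h1 := h hs
      have hle : s ⁻¹ᵁ W.1 ≤ ⊤ := le_top
      have e : (s.app W.1).hom f = res hle ((s.appLE W.1 ⊤ (top_le_preimage hs)).hom f) := by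
        rw [res_appLE, Scheme.Hom.app_eq_appLE]
      have h2 : (s.appLE W.1 ⊤ (top_le_preimage hs)).hom f = 0 := by
        have e : (Scheme.ΓSpecIso (CommRingCat.of k)).inv.hom (evalAt s W.1 hs f) =
          (s.appLE W.1 ⊤ (top_le_preimage hs)).hom f :=
          (congrArg (fun g => g.hom ((s.appLE W.1 ⊤ (top_le_preimage hs)).hom f))
            (Scheme.ΓSpecIso (CommRingCat.of k)).hom_inv_id : _)
        rw [← e, h1, map_zero]
      refine Eq.trans e ?_
      rw [h2, map_zero]
    · have : s ⁻¹ᵁ W.1 = ⊥ := by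
        rw [eq_bot_iff]
        intro x hx
        rw [eq_closedPoint x] at hx
        exact hs hx
      have hsub : Subsingleton Γ(Spec (CommRingCat.of k), s ⁻¹ᵁ W.1) := by
        rw [this]; infer_instance
      exact Subsingleton.elim _ _

theorem hom_ext_of_evalAt {s t : Spec (CommRingCat.of k) ⟶ X} (W : X.Opens) (hW : IsAffineOpen W)
    (hs : point s ∈ W) (ht : point t ∈ W) (h : ∀ f, evalAt s W hs f = evalAt t W ht f) : s = t := by
  have e : s.appLE W ⊤ (top_le_preimage hs) = t.appLE W ⊤ (top_le_preimage ht) := by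
    rw [← cancel_mono (Scheme.ΓSpecIso (CommRingCat.of k)).hom]
    ext f
    exact h f
  have h1 := hW.SpecMap_appLE_fromSpec s (isAffineOpen_top _) (top_le_preimage hs)
  have h2 := hW.SpecMap_appLE_fromSpec t (isAffineOpen_top _) (top_le_preimage ht)
  rw [e, h2, cancel_epi] at h1
  exact h1.symm

end Eval

section Geometry
variable (k : Type u) [Field k]

/-- The index of the other homogeneous coordinate. -/
abbrev other (b : Fin 2) : Fin 2 := 1 - b

/-- The inclusion of the affine line as the chart `D₊(X_b)`. -/
def P1.affineLine (b : Fin 2) : Spec (CommRingCat.of (Polynomial k)) ⟶ P1 k :=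
  P1.ofPair (Spec.map (CommRingCat.ofHom Polynomial.C))
    (fun a => (Scheme.ΓSpecIso (CommRingCat.of (Polynomial k))).inv.hom
      (if a = b then 1 else Polynomial.X))
    (Ideal.eq_top_of_isUnit_mem _ (Ideal.subset_span ⟨b, rfl⟩) (by simp))

variable {k}

/-- The rational point with `X_b = 1` and the other homogeneous coordinate `r`. -/
def P1.pt (b : Fin 2) (r : k) : Spec (CommRingCat.of k) ⟶ P1 k :=
  P1.ofPair (𝟙 _) (fun a => (Scheme.ΓSpecIso (CommRingCat.of k)).inv.hom
      (if a = b then 1 else r))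
    (Ideal.eq_top_of_isUnit_mem _ (Ideal.subset_span ⟨b, rfl⟩) (by simp))

theorem P1.pt_toSpec (b : Fin 2) (r : k) : P1.pt b r ≫ P1.toSpec k = 𝟙 _ := P1.ofPair_toSpec _ _ _

theorem P1.pt_mem_chart (b : Fin 2) (r : k) : point (P1.pt b r) ∈ P1.chart k b := by
  have := P1.ofPair_preimage (𝟙 _) (fun a => (Scheme.ΓSpecIso (CommRingCat.of k)).inv.hom
      (if a = b then 1 else r))
    (Ideal.eq_top_of_isUnit_mem _ (Ideal.subset_span ⟨b, rfl⟩) (by simp)) b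
  have h2 : IsLocalRing.closedPoint k ∈ (P1.pt b r) ⁻¹ᵁ P1.chart k b := by
    refine this.ge ?_
    simp
    trivial
  exact h2

theorem P1.evalAt_ratio (b : Fin 2) (r : k) :
    evalAt (P1.pt b r) (P1.chart k b) (P1.pt_mem_chart b r) (P1.ratio k (other b) b) = r := by
  have h := P1.ofPair_ratio (𝟙 _) (fun a => (Scheme.ΓSpecIso (CommRingCat.of k)).inv.hom
      (if a = b then 1 else r))
    (Ideal.eq_top_of_isUnit_mem _ (Ideal.subset_span ⟨b, rfl⟩) (by simp)) (other b) b ⊤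
    (top_le_preimage (P1.pt_mem_chart b r))
  have hb : other b ≠ b := by fin_cases b <;> decide
  simp only [if_true, map_one, mul_one, if_neg hb] at h
  have h2 := congrArg (Scheme.ΓSpecIso (CommRingCat.of k)).hom.hom h
  refine Eq.trans h2 ?_
  have : ∀ y : Γ(Spec (CommRingCat.of k), ⊤), ((Spec (CommRingCat.of k)).presheaf.map
    (homOfLE (le_refl ⊤)).op).hom y = y := fun y => res_self le_rfl y
  refine (congrArg _ (this _)).trans ?_
  exact (congrArg (fun g => g.hom r) (Scheme.ΓSpecIso (CommRingCat.of k)).inv_hom_id : _)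

/-- Polynomials in the affine coordinate on a standard chart. -/
def P1.poly (b : Fin 2) : Polynomial k →+* Γ(P1 k, P1.chart k b) :=
  Polynomial.eval₂RingHom (scalar (P1.toSpec k) (P1.chart k b)) (P1.ratio k (other b) b)

theorem P1.poly_surjective (b : Fin 2) : Function.Surjective (P1.poly (k := k) b) := by
  intro s
  obtain ⟨p, rfl⟩ := P1.dehom_surjective b s
  refine ⟨MvPolynomial.eval₂Hom Polynomial.C (fun a => if a = b then 1 else Polynomial.X) p, ?_⟩
  rw [← RingHom.comp_apply]
  congr 1
  apply MvPolynomial.ringHom_ext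
  · intro c
    simp [P1.poly]
  · intro a
    simp only [RingHom.comp_apply, MvPolynomial.eval₂Hom_X']
    split_ifs with h
    · subst h; rw [map_one, P1.ratio_self]
    · have : a = other b := by revert h; fin_cases a <;> fin_cases b <;> decide
      subst this
      simp [P1.poly]

theorem P1.evalAt_poly (b : Fin 2) (r : k) (p : Polynomial k) :
    evalAt (P1.pt b r) (P1.chart k b) (P1.pt_mem_chart b r) (P1.poly b p) = p.eval r := by
  have : (evalAt (P1.pt b r) (P1.chart k b) (P1.pt_mem_chart b r)).comp (P1.poly b) =
      Polynomial.evalRingHom r := by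
    apply Polynomial.ringHom_ext
    · intro c
      simp only [RingHom.comp_apply, P1.poly, Polynomial.coe_eval₂RingHom, Polynomial.eval₂_C,
        Polynomial.coe_evalRingHom, Polynomial.eval_C]
      exact evalAt_scalar_self (P1.pt_toSpec b r) _ _ c
    · simp only [RingHom.comp_apply, P1.poly, Polynomial.coe_eval₂RingHom, Polynomial.eval₂_X,
        Polynomial.coe_evalRingHom, Polynomial.eval_X]
      exact P1.evalAt_ratio b r
  exact congrArg (fun g => g p) this

theorem P1.poly_injective (b : Fin 2) : Function.Injective (P1.poly (k := k) b) := by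
  rw [injective_iff_map_eq_zero]
  intro p hp
  let φ := P1.affineLine k b
  have hpre := P1.ofPair_preimage (Spec.map (CommRingCat.ofHom (Polynomial.C (R := k))))
    (fun a => (Scheme.ΓSpecIso (CommRingCat.of (Polynomial k))).inv.hom
      (if a = b then 1 else Polynomial.X))
    (Ideal.eq_top_of_isUnit_mem _ (Ideal.subset_span ⟨b, rfl⟩) (by simp)) b
  have hle : ⊤ ≤ φ ⁻¹ᵁ P1.chart k b := by
    refine le_trans ?_ hpre.ge
    simp
  have h := P1.ofPair_ratio (Spec.map (CommRingCat.ofHom (Polynomial.C (R := k))))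
    (fun a => (Scheme.ΓSpecIso (CommRingCat.of (Polynomial k))).inv.hom
      (if a = b then 1 else Polynomial.X))
    (Ideal.eq_top_of_isUnit_mem _ (Ideal.subset_span ⟨b, rfl⟩) (by simp)) (other b) b ⊤ hle
  have hb : other b ≠ b := by fin_cases b <;> decide
  simp only [if_true, map_one, mul_one, if_neg hb] at h
  have hcomp : (φ.appLE _ ⊤ hle).hom.comp (P1.poly b) =
      (Scheme.ΓSpecIso (CommRingCat.of (Polynomial k))).inv.hom := by
    apply Polynomial.ringHom_ext
    · intro c
      simp only [RingHom.comp_apply, P1.poly, Polynomial.coe_eval₂RingHom, Polynomial.eval₂_C]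
      have hφ : φ ≫ P1.toSpec k = _ := P1.ofPair_toSpec _ _ _
      rw [appLE_scalar, hφ, scalar, RingHom.comp_apply]
      have := congrArg (fun g => g.hom c)
        (Scheme.ΓSpecIso_inv_naturality (CommRingCat.ofHom (Polynomial.C (R := k))))
      refine Eq.trans ?_ this.symm
      rw [Scheme.Hom.appTop, Scheme.Hom.app_eq_appLE]
      rfl
    · simp only [RingHom.comp_apply, P1.poly, Polynomial.coe_eval₂RingHom, Polynomial.eval₂_X]
      refine h.trans ?_
      exact res_self le_rfl _
  have h2 : (Scheme.ΓSpecIso (CommRingCat.of (Polynomial k))).inv.hom p = 0 := by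
    rw [← hcomp, RingHom.comp_apply, hp, map_zero]
  have h3 := congrArg (Scheme.ΓSpecIso (CommRingCat.of (Polynomial k))).hom.hom h2
  rw [map_zero] at h3
  exact (congrArg (fun g => g.hom p)
    (Scheme.ΓSpecIso (CommRingCat.of (Polynomial k))).inv_hom_id : _).symm.trans h3

/-- A rational point of the projective line, over the base, is determined by its coordinate. -/
theorem P1.eq_pt {s : Spec (CommRingCat.of k) ⟶ P1 k} (hs : s ≫ P1.toSpec k = 𝟙 _) (b : Fin 2)
    (h : point s ∈ P1.chart k b) : s = P1.pt b (evalAt s _ h (P1.ratio k (other b) b)) := by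
  refine hom_ext_of_evalAt _ (P1.isAffineOpen_chart b) h (P1.pt_mem_chart b _) fun f => ?_
  obtain ⟨p, rfl⟩ := P1.poly_surjective b f
  rw [P1.evalAt_poly, P1.poly, Polynomial.coe_eval₂RingHom, Polynomial.hom_eval₂]
  have : (evalAt s _ h).comp (scalar (P1.toSpec k) (P1.chart k b)) = RingHom.id k := by
    ext c; exact evalAt_scalar_self hs _ h c
  rw [this]; rfl

theorem P1.exists_eq_pt {s : Spec (CommRingCat.of k) ⟶ P1 k} (hs : s ≫ P1.toSpec k = 𝟙 _) :
    ∃ b r, s = P1.pt b r := by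
  have : point s ∈ P1.chart k 0 ⊔ P1.chart k 1 := by rw [P1.chart_sup]; trivial
  rcases this with h | h
  · exact ⟨0, _, P1.eq_pt hs 0 h⟩
  · exact ⟨1, _, P1.eq_pt hs 1 h⟩

end Geometry

section Integral
variable {k : Type u} [Field k]

instance P1.isReduced : IsReduced (P1 k) :=
  ⟨fun U => ⟨fun f ⟨n, hn⟩ => P1.section_ext fun p => by
    have h1 : P1.valueHom p f ^ n = 0 := by rw [← map_pow, hn, map_zero]
    have : IsDomain (Localization.AtPrime (P1.prime p.1)) :=
      IsLocalization.isDomain_localization (P1.prime p.1).primeCompl_le_nonZeroDivisors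
    have h2 : P1.valueHom p f = 0 := eq_zero_of_pow_eq_zero h1
    exact h2.trans (map_zero (P1.valueHom p)).symm⟩⟩

/-- The point of the projective line given by the zero ideal. -/
def P1.zeroPoint (k : Type u) [Field k] : P1 k :=
  (⟨⊥, Ideal.isPrime_bot, fun h => by
    have hX : (MvPolynomial.X 0 : MvPolynomial (Fin 2) k) ∈ HomogeneousIdeal.irrelevant
        (MvPolynomial.homogeneousSubmodule (Fin 2) k) := by
      rw [HomogeneousIdeal.mem_irrelevant_iff, GradedRing.proj_apply]
      exact DirectSum.decompose_of_mem_ne _ (X_mem k 0) one_ne_zero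
    exact MvPolynomial.X_ne_zero (R := k) (0 : Fin 2) (h hX)⟩ :
    ProjectiveSpectrum (MvPolynomial.homogeneousSubmodule (Fin 2) k))

theorem P1.mem_closure_zeroPoint (p : P1 k) : p ∈ closure {P1.zeroPoint k} :=
  (ProjectiveSpectrum.le_iff_mem_closure
    (MvPolynomial.homogeneousSubmodule (Fin 2) k) (P1.zeroPoint k) p).1 (fun x hx => by
      have : x = 0 := hx
      subst this
      exact Submodule.zero_mem _)

instance P1.irreducibleSpace : IrreducibleSpace (P1 k) where
  isPreirreducible_univ := by
    have h := (isIrreducible_singleton (x := P1.zeroPoint k)).closure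
    have e : closure {P1.zeroPoint k} = Set.univ :=
      Set.eq_univ_of_forall P1.mem_closure_zeroPoint
    rw [e] at h
    exact h.2
  toNonempty := ⟨P1.zeroPoint k⟩

instance P1.isIntegral : IsIntegral (P1 k) := isIntegral_of_irreducibleSpace_of_isReduced _

theorem algebraMap_zero_bijective : Function.Bijective
    (algebraMap k (MvPolynomial.homogeneousSubmodule (Fin 2) k 0)) := by
  constructor
  · intro c d h
    exact MvPolynomial.C_injective _ _ (congrArg Subtype.val h)
  · rintro ⟨f, hf⟩
    have h0 : f.totalDegree = 0 := by
      have h1 := ((MvPolynomial.mem_homogeneousSubmodule _ _).1 hf).totalDegree_le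
      omega
    refine ⟨MvPolynomial.coeff 0 f, Subtype.ext ?_⟩
    exact (MvPolynomial.totalDegree_eq_zero_iff_eq_C.1 h0).symm

instance P1.isProper : IsProper (P1.toSpec k) := by
  have h0 : IsScalarTower k (MvPolynomial.homogeneousSubmodule (Fin 2) k 0)
      (MvPolynomial (Fin 2) k) := ⟨fun c a p => smul_mul_assoc c a.1 p⟩
  have h1 : Algebra.FiniteType (MvPolynomial.homogeneousSubmodule (Fin 2) k 0)
      (MvPolynomial (Fin 2) k) :=
    Algebra.FiniteType.of_restrictScalars_finiteType k _ _
  have h2 : IsIso (CommRingCat.ofHom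
      (algebraMap k (MvPolynomial.homogeneousSubmodule (Fin 2) k 0))) :=
    (ConcreteCategory.isIso_iff_bijective _).2 algebraMap_zero_bijective
  have h3 : IsIso (Spec.map (CommRingCat.ofHom
    (algebraMap k (MvPolynomial.homogeneousSubmodule (Fin 2) k 0)))) := inferInstance
  have h4 : IsProper (Proj.toSpecZero (MvPolynomial.homogeneousSubmodule (Fin 2) k)) :=
    inferInstance
  exact MorphismProperty.comp_mem @IsProper _ _ h4 inferInstance

theorem mem_basicOpen_iff_notMem_primeIdealOf {X : Scheme.{u}} {U : X.Opens} (hU : IsAffineOpen U)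
    (x : U) (f : Γ(X, U)) : x.1 ∈ X.basicOpen f ↔ f ∉ (hU.primeIdealOf x).asIdeal := by
  have h := hU.fromSpec_preimage_basicOpen f
  have h2 := hU.fromSpec_primeIdealOf x
  rw [← h2]
  change hU.primeIdealOf x ∈ hU.fromSpec ⁻¹ᵁ X.basicOpen f ↔ _
  rw [h]; rfl

theorem eq_of_basicOpen {X : Scheme.{u}} {U : X.Opens} (hU : IsAffineOpen U) {x y : X}
    (hx : x ∈ U) (hy : y ∈ U) (h : ∀ f : Γ(X, U), x ∈ X.basicOpen f ↔ y ∈ X.basicOpen f) : x = y := by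
  have h1 := hU.fromSpec_primeIdealOf ⟨x, hx⟩
  have h2 := hU.fromSpec_primeIdealOf ⟨y, hy⟩
  have e : hU.primeIdealOf ⟨x, hx⟩ = hU.primeIdealOf ⟨y, hy⟩ := by
    ext f
    have hh := h f
    rw [mem_basicOpen_iff_notMem_primeIdealOf hU ⟨x, hx⟩,
      mem_basicOpen_iff_notMem_primeIdealOf hU ⟨y, hy⟩] at hh
    exact not_iff_not.1 hh
  rw [e, h2] at h1
  exact h1.symm

theorem genericPoint_mem {X : Scheme.{u}} [IsIntegral X] {U : X.Opens} {x : X} (h : x ∈ U) :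
    genericPoint X ∈ U :=
  ((genericPoint_spec X).mem_open_set_iff U.2).2 ⟨x, trivial, h⟩

/-- The points of the projective line over an algebraically closed field. -/
theorem P1.eq_genericPoint_or [IsAlgClosed k] {b : Fin 2} {y : P1 k} (hy : y ∈ P1.chart k b) :
    y = genericPoint (P1 k) ∨ ∃ r, y = point (P1.pt b r) := by
  have hU := P1.isAffineOpen_chart (k := k) b
  let I : Ideal (Polynomial k) := (hU.primeIdealOf ⟨y, hy⟩).asIdeal.comap (P1.poly b)
  have hI : I.IsPrime := Ideal.IsPrime.comap _
  have hmem : ∀ p, y ∈ (P1 k).basicOpen (P1.poly b p) ↔ p ∉ I := fun p =>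
    mem_basicOpen_iff_notMem_primeIdealOf hU ⟨y, hy⟩ _
  by_cases hbot : I = ⊥
  · left
    refine eq_of_basicOpen hU hy (genericPoint_mem hy) fun f => ?_
    obtain ⟨p, rfl⟩ := P1.poly_surjective b f
    rw [hmem, hbot]
    constructor
    · intro hp
      exact genericPoint_mem ((hmem p).2 (hbot ▸ hp))
    · rintro hg hp
      have : p = 0 := hp
      rw [this, map_zero] at hg
      simp at hg
  · right
    obtain ⟨g, hg⟩ := (IsPrincipalIdealRing.principal I).principal
    have hg0 : g ≠ 0 := by
      rintro rfl
      apply hbot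
      rw [hg]; simp
    have hdeg : g.degree ≠ 0 := by
      intro h0
      apply hI.ne_top
      rw [hg]
      exact Ideal.span_singleton_eq_top.2 (Polynomial.isUnit_iff_degree_eq_zero.2 h0)
    obtain ⟨r, hr⟩ := IsAlgClosed.exists_root g hdeg
    have hroot : ∀ p, p ∈ I → p.eval r = 0 := by
      intro p hp
      rw [hg] at hp
      obtain ⟨q, rfl⟩ := Ideal.mem_span_singleton.1 hp
      rw [Polynomial.eval_mul, hr.eq_zero, zero_mul]
    have hX : Polynomial.X - Polynomial.C r ∈ I := by
      have : I.IsMaximal := IsPrime.to_maximal_ideal hbot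
      by_contra hn
      obtain ⟨q, i, hi, e⟩ := this.exists_inv hn
      have h1 := hroot i hi
      have h2 := congrArg (Polynomial.eval r) e
      simp [h1] at h2
    refine ⟨r, eq_of_basicOpen hU hy (P1.pt_mem_chart b r) fun f => ?_⟩
    obtain ⟨p, rfl⟩ := P1.poly_surjective b f
    rw [hmem, mem_basicOpen_iff _ _ (P1.pt_mem_chart b r), P1.evalAt_poly, ne_eq, not_iff_not]
    refine ⟨hroot p, fun h0 => ?_⟩
    obtain ⟨q, rfl⟩ := Polynomial.dvd_iff_isRoot.2 h0
    exact Ideal.mul_mem_right _ _ hX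

theorem P1.point_cases [IsAlgClosed k] (y : P1 k) :
    y = genericPoint (P1 k) ∨ ∃ b r, y = point (P1.pt b r) := by
  have : y ∈ P1.chart k 0 ⊔ P1.chart k 1 := by rw [P1.chart_sup]; trivial
  rcases this with h | h
  · exact (P1.eq_genericPoint_or h).imp_right fun ⟨r, hr⟩ => ⟨0, r, hr⟩
  · exact (P1.eq_genericPoint_or h).imp_right fun ⟨r, hr⟩ => ⟨1, r, hr⟩

end Integral

section HasVal
variable {k : Type u} [Field k] {X : Scheme.{u}} [IsIntegral X]

/-- A function on a nonempty open subset of an integral scheme as a rational function. -/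
def fn (U : X.Opens) (h : genericPoint X ∈ U) : Γ(X, U) →+* X.functionField :=
  (X.presheaf.germ U (genericPoint X) h).hom

theorem fn_injective (U : X.Opens) (h : genericPoint X ∈ U) : Function.Injective (fn U h) :=
  germ_injective_of_isIntegral _ _ h

theorem fn_res {U V : X.Opens} (i : U ≤ V) (h : genericPoint X ∈ U) (f : Γ(X, V)) :
    fn U h (res i f) = fn V (i h) f :=
  X.presheaf.germ_res_apply (homOfLE i) _ h f

/-- The rational function `F` is regular at the rational point `s`, with value `c`. -/
def HasVal (s : Spec (CommRingCat.of k) ⟶ X) (F : X.functionField) (c : k) : Prop :=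
  ∃ (U : X.Opens) (h : point s ∈ U) (f : Γ(X, U)),
    fn U (genericPoint_mem h) f = F ∧ evalAt s U h f = c

variable {s : Spec (CommRingCat.of k) ⟶ X} {F G : X.functionField} {c d : k}

theorem hasVal_fn (s : Spec (CommRingCat.of k) ⟶ X) (U : X.Opens) (h : point s ∈ U)
    (h' : genericPoint X ∈ U) (f : Γ(X, U)) : HasVal s (fn U h' f) (evalAt s U h f) :=
  ⟨U, h, f, rfl, rfl⟩

theorem HasVal.exists_common (hF : HasVal s F c) (hG : HasVal s G d) :
    ∃ (U : X.Opens) (h : point s ∈ U) (f g : Γ(X, U)),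
      fn U (genericPoint_mem h) f = F ∧ evalAt s U h f = c ∧
      fn U (genericPoint_mem h) g = G ∧ evalAt s U h g = d := by
  obtain ⟨U, h, f, rfl, rfl⟩ := hF
  obtain ⟨V, h', g, rfl, rfl⟩ := hG
  refine ⟨U ⊓ V, ⟨h, h'⟩, res inf_le_left f, res inf_le_right g, ?_, ?_, ?_, ?_⟩
  · rw [fn_res]
  · exact evalAt_res s inf_le_left ⟨h, h'⟩ f
  · rw [fn_res]
  · exact evalAt_res s inf_le_right ⟨h, h'⟩ g

theorem HasVal.add (hF : HasVal s F c) (hG : HasVal s G d) : HasVal s (F + G) (c + d) := by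
  obtain ⟨U, h, f, g, rfl, rfl, rfl, rfl⟩ := hF.exists_common hG
  exact ⟨U, h, f + g, map_add _ _ _, map_add _ _ _⟩

theorem HasVal.sub (hF : HasVal s F c) (hG : HasVal s G d) : HasVal s (F - G) (c - d) := by
  obtain ⟨U, h, f, g, rfl, rfl, rfl, rfl⟩ := hF.exists_common hG
  exact ⟨U, h, f - g, map_sub _ _ _, map_sub _ _ _⟩

theorem HasVal.mul (hF : HasVal s F c) (hG : HasVal s G d) : HasVal s (F * G) (c * d) := by
  obtain ⟨U, h, f, g, rfl, rfl, rfl, rfl⟩ := hF.exists_common hG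
  exact ⟨U, h, f * g, map_mul _ _ _, map_mul _ _ _⟩

theorem HasVal.unique (hF : HasVal s F c) (hG : HasVal s F d) : c = d := by
  obtain ⟨U, h, f, g, rfl, rfl, e, rfl⟩ := hF.exists_common hG
  rw [fn_injective _ _ e]

theorem HasVal.inv (hF : HasVal s F c) (hc : c ≠ 0) : HasVal s F⁻¹ c⁻¹ := by
  obtain ⟨U, h, f, rfl, rfl⟩ := hF
  have hb : point s ∈ X.basicOpen f := (mem_basicOpen_iff s U h f).2 hc
  obtain ⟨g, hg⟩ := (isUnit_res_of_le_basicOpen (X.basicOpen_le f) f le_rfl).exists_right_inv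
  refine ⟨X.basicOpen f, hb, g, ?_, ?_⟩
  · have := congrArg (fn _ (genericPoint_mem hb)) hg
    rw [map_mul, map_one, fn_res] at this
    exact eq_inv_of_mul_eq_one_right this
  · have := congrArg (evalAt s _ hb) hg
    rw [map_mul, map_one, evalAt_res] at this
    exact eq_inv_of_mul_eq_one_right this

theorem HasVal.ne_zero (hF : HasVal s F c) (hc : c ≠ 0) : F ≠ 0 := by
  rintro rfl
  obtain ⟨U, h, f, e, rfl⟩ := hF
  rw [fn_injective _ _ (e.trans (map_zero _).symm), map_zero] at hc
  exact hc rfl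

theorem HasVal.congr (hF : HasVal s F c) (h : c = d) : HasVal s F d := h ▸ hF

end HasVal

section Rational
variable {k : Type u} [Field k]

theorem P1.generic_mem (b : Fin 2) : genericPoint (P1 k) ∈ P1.chart k b :=
  genericPoint_mem (P1.pt_mem_chart b 0)

/-- A polynomial in the affine coordinate as a rational function on the projective line. -/
def P1.rat (b : Fin 2) : Polynomial k →+* (P1 k).functionField :=
  (fn (P1.chart k b) (P1.generic_mem b)).comp (P1.poly b)

/-- The affine coordinate on the projective line as a rational function. -/
def P1.x (k : Type u) [Field k] : (P1 k).functionField := P1.rat 0 Polynomial.X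

/-- Constants as rational functions on the projective line. -/
def P1.const : k →+* (P1 k).functionField := (P1.rat 0).comp Polynomial.C

theorem P1.rat_injective (b : Fin 2) : Function.Injective (P1.rat (k := k) b) :=
  (fn_injective _ _).comp (P1.poly_injective b)

theorem P1.fn_scalar (U : (P1 k).Opens) (h : genericPoint (P1 k) ∈ U) (c : k) :
    fn U h (scalar (P1.toSpec k) U c) = P1.const c := by
  have h1 := fn_res (inf_le_left : U ⊓ P1.chart k 0 ≤ U) ⟨h, P1.generic_mem 0⟩
    (scalar (P1.toSpec k) U c)
  have h2 := fn_res (inf_le_right : U ⊓ P1.chart k 0 ≤ P1.chart k 0) ⟨h, P1.generic_mem 0⟩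
    (scalar (P1.toSpec k) (P1.chart k 0) c)
  rw [res_scalar] at h1 h2
  rw [← h1, h2, P1.const, P1.rat, RingHom.comp_apply, RingHom.comp_apply, P1.poly,
    Polynomial.coe_eval₂RingHom, Polynomial.eval₂_C]

theorem P1.rat_C (b : Fin 2) (c : k) : P1.rat b (Polynomial.C c) = P1.const c := by
  rw [P1.rat, RingHom.comp_apply, P1.poly, Polynomial.coe_eval₂RingHom, Polynomial.eval₂_C,
    P1.fn_scalar]

theorem P1.rat_X (b : Fin 2) : P1.rat b Polynomial.X =
    fn (P1.chart k b) (P1.generic_mem b) (P1.ratio k (other b) b) := by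
  rw [P1.rat, RingHom.comp_apply, P1.poly, Polynomial.coe_eval₂RingHom, Polynomial.eval₂_X]

theorem P1.rat_eq (b : Fin 2) (p : Polynomial k) :
    P1.rat b p = p.eval₂ P1.const (P1.rat b Polynomial.X) := by
  have : P1.rat b = Polynomial.eval₂RingHom (P1.const (k := k)) (P1.rat b Polynomial.X) := by
    apply Polynomial.ringHom_ext
    · intro c; simp [P1.rat_C]
    · simp
  exact congrArg (fun g => g p) this

theorem P1.x_ne_zero : P1.x k ≠ 0 := by
  intro h
  exact Polynomial.X_ne_zero (P1.rat_injective 0 (h.trans (map_zero _).symm))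

theorem P1.rat_one_X : P1.rat 1 Polynomial.X = (P1.x k)⁻¹ := by
  have h := P1.ratio_mul_ratio (k := k) 0 1 1 (P1.chart k 0 ⊓ P1.chart k 1) inf_le_left inf_le_right
  have hη : genericPoint (P1 k) ∈ P1.chart k 0 ⊓ P1.chart k 1 := ⟨P1.generic_mem 0, P1.generic_mem 1⟩
  have h2 := congrArg (fn _ hη) h
  rw [map_mul] at h2
  have e1 := fn_res (inf_le_left : P1.chart k 0 ⊓ P1.chart k 1 ≤ _) hη (P1.ratio k 1 0)
  have e2 := fn_res (inf_le_right : P1.chart k 0 ⊓ P1.chart k 1 ≤ _) hη (P1.ratio k 0 1)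
  have e3 := fn_res (inf_le_right : P1.chart k 0 ⊓ P1.chart k 1 ≤ _) hη (P1.ratio k 1 1)
  have h3 : P1.rat 0 Polynomial.X * P1.rat 1 Polynomial.X = (1 : (P1 k).functionField) := by
    rw [P1.rat_X, P1.rat_X]
    refine Eq.trans ?_ (h2.trans ?_)
    · exact congrArg₂ _ e1.symm e2.symm
    · exact e3.trans (by rw [P1.ratio_self, map_one])
  exact eq_inv_of_mul_eq_one_right h3

theorem P1.hasVal_rat (b : Fin 2) (r : k) (p : Polynomial k) :
    HasVal (P1.pt b r) (P1.rat b p) (p.eval r) := by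
  have := hasVal_fn (P1.pt b r) _ (P1.pt_mem_chart b r) (P1.generic_mem b) (P1.poly b p)
  rwa [P1.evalAt_poly] at this

theorem P1.hasVal_const (b : Fin 2) (r c : k) : HasVal (P1.pt b r) (P1.const c) c := by
  have := P1.hasVal_rat b r (Polynomial.C c)
  rwa [P1.rat_C, Polynomial.eval_C] at this

theorem P1.hasVal_x (r : k) : HasVal (P1.pt 0 r) (P1.x k) r := by
  have := P1.hasVal_rat 0 r Polynomial.X
  rwa [Polynomial.eval_X] at this

theorem P1.hasVal_x_inv (r : k) : HasVal (P1.pt 1 r) (P1.x k)⁻¹ r := by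
  have := P1.hasVal_rat 1 r Polynomial.X
  rwa [Polynomial.eval_X, P1.rat_one_X] at this

/-- A rational function that is regular at a rational point is a fraction of polynomials. -/
theorem P1.exists_fraction {b : Fin 2} {r : k} {F : (P1 k).functionField} {c : k}
    (h : HasVal (P1.pt b r) F c) : ∃ p q : Polynomial k, q.eval r ≠ 0 ∧
      F * P1.rat b q = P1.rat b p ∧ p.eval r = c * q.eval r := by
  obtain ⟨U, hU, f, rfl, rfl⟩ := h
  obtain ⟨h, hle, hh⟩ := (P1.isAffineOpen_chart (k := k) b).exists_basicOpen_le (V := U)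
    ⟨point (P1.pt b r), hU⟩ (P1.pt_mem_chart b r)
  let := (P1.isAffineOpen_chart (k := k) b).isLocalization_basicOpen h
  obtain ⟨n, g, hg⟩ := IsLocalization.Away.surj h (res hle f)
  change res hle f * res ((P1 k).basicOpen_le h) (h ^ n) = res ((P1 k).basicOpen_le h) g at hg
  obtain ⟨p, rfl⟩ := P1.poly_surjective b g
  obtain ⟨q, rfl⟩ := P1.poly_surjective b h
  refine ⟨p, q ^ n, ?_, ?_, ?_⟩
  · rw [mem_basicOpen_iff _ _ (P1.pt_mem_chart b r), P1.evalAt_poly] at hh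
    rw [Polynomial.eval_pow]
    exact pow_ne_zero n hh
  · have := congrArg (fn _ (genericPoint_mem hh)) hg
    rw [map_mul, fn_res, fn_res, fn_res, ← map_pow] at this
    exact this
  · have := congrArg (evalAt (P1.pt b r) _ hh) hg
    rw [map_mul, evalAt_res, evalAt_res, evalAt_res, ← map_pow, P1.evalAt_poly,
      P1.evalAt_poly] at this
    exact this.symm

theorem P1.rat_ne_zero {b : Fin 2} {p : Polynomial k} (h : p ≠ 0) : P1.rat b p ≠ 0 :=
  fun h0 => h (P1.rat_injective b (h0.trans (map_zero _).symm))

/-- A rational function vanishing at `r` is divisible by `x - r`. -/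
theorem P1.hasVal_div {b : Fin 2} {r : k} {F : (P1 k).functionField}
    (h : HasVal (P1.pt b r) F 0) :
    ∃ c, HasVal (P1.pt b r) (F / P1.rat b (Polynomial.X - Polynomial.C r)) c := by
  obtain ⟨p, q, hq, e, hp⟩ := P1.exists_fraction h
  rw [zero_mul] at hp
  obtain ⟨p', rfl⟩ := Polynomial.dvd_iff_isRoot.2 hp
  refine ⟨p'.eval r * (q.eval r)⁻¹, ?_⟩
  have hq0 : P1.rat b q ≠ 0 := P1.rat_ne_zero (by rintro rfl; simp at hq)
  have hX : P1.rat b (Polynomial.X - Polynomial.C r) ≠ 0 :=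
    P1.rat_ne_zero (Polynomial.X_sub_C_ne_zero r)
  have : F / P1.rat b (Polynomial.X - Polynomial.C r) = P1.rat b p' * (P1.rat b q)⁻¹ := by
    rw [map_mul] at e
    field_simp
    rw [e]
  rw [this]
  exact (P1.hasVal_rat b r p').mul ((P1.hasVal_rat b r q).inv hq)

theorem P1.eq_rat_of_regular [IsAlgClosed k] {b : Fin 2} {F : (P1 k).functionField}
    (h : ∀ r, ∃ c, HasVal (P1.pt b r) F c) : ∃ p, F = P1.rat b p := by
  let I : Ideal (Polynomial k) :=
    { carrier := {q | ∃ p, F * P1.rat b q = P1.rat b p}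
      add_mem' := by
        rintro q q' ⟨p, hp⟩ ⟨p', hp'⟩
        exact ⟨p + p', by rw [map_add, mul_add, hp, hp', map_add]⟩
      zero_mem' := ⟨0, by simp⟩
      smul_mem' := by
        rintro c q ⟨p, hp⟩
        exact ⟨c * p, by rw [smul_eq_mul, map_mul, mul_left_comm, hp, map_mul]⟩ }
  have hI : I = ⊤ := by
    obtain ⟨g, hg⟩ := (IsPrincipalIdealRing.principal I).principal
    by_contra hne
    have hdeg : g.degree ≠ 0 := by
      intro h0
      apply hne
      rw [hg]
      exact Ideal.span_singleton_eq_top.2 (Polynomial.isUnit_iff_degree_eq_zero.2 h0)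
    obtain ⟨r, hr⟩ := IsAlgClosed.exists_root g hdeg
    obtain ⟨c, hc⟩ := h r
    obtain ⟨p, q, hq, e, -⟩ := P1.exists_fraction hc
    have hqI : q ∈ I := ⟨p, e⟩
    rw [hg] at hqI
    obtain ⟨q', rfl⟩ := Ideal.mem_span_singleton.1 hqI
    rw [Polynomial.eval_mul, hr.eq_zero, zero_mul] at hq
    exact hq rfl
  have h1 : (1 : Polynomial k) ∈ I := by rw [hI]; trivial
  obtain ⟨p, hp⟩ := h1
  exact ⟨p, by rw [← hp, map_one, mul_one]⟩

/-- A rational function without poles on the projective line is constant. -/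
theorem P1.eq_const_of_regular [IsAlgClosed k] {F : (P1 k).functionField}
    (h : ∀ b r, ∃ c, HasVal (P1.pt b r) F c) : ∃ c, F = P1.const c := by
  obtain ⟨p, rfl⟩ := P1.eq_rat_of_regular (h 0)
  by_cases hd : p.natDegree = 0
  · exact ⟨p.coeff 0, by rw [Polynomial.eq_C_of_natDegree_eq_zero hd, P1.rat_C, Polynomial.coeff_C_zero]⟩
  · exfalso
    obtain ⟨c, hc⟩ := h 1 0
    have hx := (P1.hasVal_x_inv (0 : k))
    have hpow : HasVal (P1.pt 1 (0 : k)) ((P1.x k)⁻¹ ^ p.natDegree) 0 := by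
      have := P1.hasVal_rat 1 (0 : k) (Polynomial.X ^ p.natDegree)
      rw [map_pow, P1.rat_one_X] at this
      rwa [Polynomial.eval_pow, Polynomial.eval_X, zero_pow hd] at this
    have h1 := hc.mul hpow
    have h2 := P1.hasVal_rat 1 (0 : k) p.reverse
    have h3 : P1.rat 0 p * (P1.x k)⁻¹ ^ p.natDegree = P1.rat 1 p.reverse := by
      let : Invertible (P1.x k) := invertibleOfNonzero P1.x_ne_zero
      have := Polynomial.eval₂_reverse_mul_pow (P1.const (k := k)) (P1.x k) p
      rw [P1.rat_eq 1, P1.rat_one_X, P1.rat_eq 0]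
      rw [invOf_eq_inv] at this
      change Polynomial.eval₂ _ (P1.x k) p * _ = _
      rw [← this, inv_pow, mul_assoc, mul_inv_cancel₀ (pow_ne_zero _ P1.x_ne_zero), mul_one]
    rw [h3] at h1
    have h4 := h1.unique h2
    rw [mul_zero, ← Polynomial.coeff_zero_eq_eval_zero, Polynomial.coeff_zero_reverse] at h4
    have := Polynomial.leadingCoeff_eq_zero.1 h4.symm
    rw [this] at hd
    simp at hd

end Rational

section HasCoords
variable {k : Type u} [Field k] {S T : Scheme.{u}}

/-- The morphism `φ` is given on the open set `W` by the homogeneous coordinates `v`. -/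
structure HasCoords (φ : T ⟶ P1 k) (W : T.Opens) (v : Fin 2 → Γ(T, W)) : Prop where
  preimage : ∀ b, W ⊓ φ ⁻¹ᵁ P1.chart k b = T.basicOpen (v b)
  ratio : ∀ a b (V : T.Opens) (hV : V ≤ W) (h : V ≤ φ ⁻¹ᵁ P1.chart k b),
    coordRatio φ a b V h * res hV (v b) = res hV (v a)

theorem exists_mem_chart (φ : T ⟶ P1 k) (x : T) : ∃ b, x ∈ φ ⁻¹ᵁ P1.chart k b := by
  have : x ∈ φ ⁻¹ᵁ (P1.chart k 0 ⊔ P1.chart k 1) := by rw [P1.chart_sup]; trivial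
  rcases this with h | h
  · exact ⟨0, h⟩
  · exact ⟨1, h⟩

theorem exists_mem_basicOpen {φ : T ⟶ P1 k} {W : T.Opens} {v : Fin 2 → Γ(T, W)}
    (hv : HasCoords φ W v) {x : T} (hx : x ∈ W) : ∃ b, x ∈ T.basicOpen (v b) := by
  obtain ⟨b, hb⟩ := exists_mem_chart φ x
  exact ⟨b, (hv.preimage b).le ⟨hx, hb⟩⟩

theorem HasCoords.basicOpen_le {φ : T ⟶ P1 k} {W : T.Opens} {v : Fin 2 → Γ(T, W)}
    (hv : HasCoords φ W v) (b : Fin 2) : T.basicOpen (v b) ≤ φ ⁻¹ᵁ P1.chart k b :=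
  (hv.preimage b).ge.trans inf_le_right

theorem id_appLE {X : Scheme.{u}} (U V : X.Opens) (h : V ≤ (𝟙 X : X ⟶ X) ⁻¹ᵁ U) :
    (𝟙 X : X ⟶ X).appLE U V h = X.presheaf.map (homOfLE h).op := by
  rw [Scheme.Hom.appLE, Scheme.Hom.id_app]
  exact Category.id_comp _

theorem hasCoords_id (b : Fin 2) : HasCoords (𝟙 (P1 k)) (P1.chart k b) (fun a => P1.ratio k a b) := by
  have hr : ∀ a b (V : (P1 k).Opens) (h : V ≤ P1.chart k b),
      coordRatio (𝟙 (P1 k)) a b V h = res h (P1.ratio k a b) := by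
    intro a b V h
    exact congrArg (fun g => g.hom (P1.ratio k a b)) (id_appLE (P1.chart k b) V h)
  have hm : ∀ (a b c : Fin 2) (W : (P1 k).Opens) (ha : W ≤ P1.chart k a) (hb : W ≤ P1.chart k b),
    res ha (P1.ratio k c a) * res hb (P1.ratio k a b) = res hb (P1.ratio k c b) :=
    P1.ratio_mul_ratio
  constructor
  · intro a
    change P1.chart k b ⊓ P1.chart k a = _
    apply le_antisymm
    · intro x hx
      have h1 := hm a b b _ inf_le_right inf_le_left
      rw [P1.ratio_self, map_one] at h1
      have hu : IsUnit (res (inf_le_left : P1.chart k b ⊓ P1.chart k a ≤ _) (P1.ratio k a b)) :=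
        IsUnit.of_mul_eq_one_right _ h1
      have h2 := Scheme.basicOpen_of_isUnit _ hu
      rw [basicOpen_res_eq] at h2
      have : x ∈ (P1.chart k b ⊓ P1.chart k a) ⊓ (P1 k).basicOpen (P1.ratio k a b) := by
        rw [h2]; exact hx
      exact this.2
    · intro x hx
      have hxb : x ∈ P1.chart k b := (P1 k).basicOpen_le _ hx
      refine ⟨hxb, ?_⟩
      have hu := isUnit_res_of_le_basicOpen ((P1 k).basicOpen_le _) (P1.ratio k a b) le_rfl
      have h3 : IsUnit (P1.valueHom (⟨x, hx⟩ : (P1 k).basicOpen (P1.ratio k a b))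
        (res ((P1 k).basicOpen_le _) (P1.ratio k a b))) := hu.map _
      have h4 := P1.value_ratio a b ⟨x, hxb⟩
      have h5 : IsUnit (P1.coord x (MvPolynomial.X a)) := by
        rw [← h4]
        exact IsUnit.mul h3 (P1.isUnit_coord b ⟨x, hxb⟩)
      refine (P1.mem_chart x a).2 fun hmem => ?_
      exact (IsLocalization.AtPrime.isUnit_to_map_iff (Localization.AtPrime (P1.prime x))
        (P1.prime x) _).1 h5 hmem
  · intro a c V hV h
    rw [hr a c V h]
    exact hm c b a V h hV

theorem HasCoords.comp {φ : T ⟶ P1 k} {W : T.Opens} {v : Fin 2 → Γ(T, W)}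
    (hv : HasCoords φ W v) (g : S ⟶ T) {V : S.Opens} (hV : V ≤ g ⁻¹ᵁ W) :
    HasCoords (g ≫ φ) V (fun a => (g.appLE W V hV).hom (v a)) := by
  constructor
  · intro b
    rw [preimage_basicOpen_appLE, ← hv.preimage b]
    ext x
    exact ⟨fun ⟨h1, h2⟩ => ⟨h1, hV h1, h2⟩, fun ⟨h1, _, h2⟩ => ⟨h1, h2⟩⟩
  · intro a b V' hV' h
    set U := g ⁻¹ᵁ T.basicOpen (v b) with hU
    have hle : V' ≤ U := fun x hx => (hv.preimage b).le ⟨hV (hV' hx), h hx⟩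
    have h1 := hv.ratio a b (T.basicOpen (v b)) (T.basicOpen_le _) (hv.basicOpen_le b)
    have h2 := congrArg (g.appLE _ V' hle).hom h1
    rw [map_mul, appLE_coordRatio, appLE_res, appLE_res] at h2
    rw [res_appLE, res_appLE]
    exact h2

theorem HasCoords.restrict {φ : T ⟶ P1 k} {W : T.Opens} {v : Fin 2 → Γ(T, W)}
    (hv : HasCoords φ W v) {V : T.Opens} (hV : V ≤ W) :
    HasCoords φ V (fun a => res hV (v a)) := by
  constructor
  · intro b
    rw [basicOpen_res_eq, ← hv.preimage b, ← inf_assoc, inf_eq_left.2 hV]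
  · intro a b V' hV' h
    rw [res_res, res_res]
    exact hv.ratio a b V' _ h

theorem hasCoords_coordRatio (φ : T ⟶ P1 k) (b : Fin 2) (W : T.Opens)
    (h : W ≤ φ ⁻¹ᵁ P1.chart k b) : HasCoords φ W (fun a => coordRatio φ a b W h) := by
  have := (hasCoords_id (k := k) b).comp φ h
  rw [Category.comp_id] at this
  exact this

/-- Homogeneous coordinates determine a morphism. -/
theorem P1.hom_ext_of_hasCoords {φ ψ : T ⟶ P1 k} (hs : φ ≫ P1.toSpec k = ψ ≫ P1.toSpec k)
    (h : ∀ x : T, ∃ (W : T.Opens) (_ : x ∈ W) (v w : Fin 2 → Γ(T, W)), HasCoords φ W v ∧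
      HasCoords ψ W w ∧ v 0 * w 1 = v 1 * w 0) : φ = ψ := by
  refine P1.hom_ext hs fun x => ?_
  obtain ⟨W, hx, v, w, hv, hw, hc⟩ := h x
  have hc' : ∀ a b, v a * w b = v b * w a := by
    intro a b
    fin_cases a <;> fin_cases b <;> first | rfl | exact hc | exact hc.symm
  obtain ⟨b, hb⟩ := exists_mem_basicOpen hv hx
  obtain ⟨b', hb'⟩ := exists_mem_basicOpen hw hx
  have hb2 : x ∈ T.basicOpen (w b) := by
    have : x ∈ T.basicOpen (v b * w b') := by rw [T.basicOpen_mul]; exact ⟨hb, hb'⟩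
    rw [hc', T.basicOpen_mul] at this
    exact this.2
  have h1 : T.basicOpen (v b) ⊓ T.basicOpen (w b) ≤ φ ⁻¹ᵁ P1.chart k b :=
    inf_le_left.trans (hv.basicOpen_le b)
  have h2 : T.basicOpen (v b) ⊓ T.basicOpen (w b) ≤ ψ ⁻¹ᵁ P1.chart k b :=
    inf_le_right.trans (hw.basicOpen_le b)
  have hW : T.basicOpen (v b) ⊓ T.basicOpen (w b) ≤ W := inf_le_left.trans (T.basicOpen_le _)
  refine ⟨b, T.basicOpen (v b) ⊓ T.basicOpen (w b), ⟨hb, hb2⟩, h1, h2, fun a => ?_⟩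
  have e1 := hv.ratio a b _ hW h1
  have e2 := hw.ratio a b _ hW h2
  have u1 := isUnit_res_of_le_basicOpen hW (v b) inf_le_left
  have u2 := isUnit_res_of_le_basicOpen hW (w b) inf_le_right
  apply (u1.mul u2).mul_right_cancel
  rw [← mul_assoc, e1, mul_left_comm, e2, ← map_mul, ← map_mul, hc']

theorem eq_of_locally_res {X : Scheme.{u}} {W : X.Opens} {f g : Γ(X, W)}
    (h : ∀ x ∈ W, ∃ (V : X.Opens) (_ : x ∈ V) (hV : V ≤ W), res hV f = res hV g) :
    f = g := by
  choose V hx hV he using h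
  refine X.sheaf.eq_of_locally_eq' (fun x : W => V x.1 x.2) W (fun x => homOfLE (hV x.1 x.2)) ?_ f g
    fun x => he x.1 x.2
  intro x hxW
  exact TopologicalSpace.Opens.mem_iSup.2 ⟨⟨x, hxW⟩, hx x hxW⟩

theorem HasCoords.cross {φ : T ⟶ P1 k} {W : T.Opens} {v w : Fin 2 → Γ(T, W)}
    (hv : HasCoords φ W v) (hw : HasCoords φ W w) (a b : Fin 2) : v a * w b = v b * w a := by
  refine eq_of_locally_res fun x hx => ?_
  obtain ⟨c, hc⟩ := exists_mem_chart φ x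
  refine ⟨W ⊓ φ ⁻¹ᵁ P1.chart k c, ⟨hx, hc⟩, inf_le_left, ?_⟩
  have e : ∀ a, _ := fun a => hv.ratio a c (W ⊓ φ ⁻¹ᵁ P1.chart k c) inf_le_left inf_le_right
  have e' : ∀ a, _ := fun a => hw.ratio a c (W ⊓ φ ⁻¹ᵁ P1.chart k c) inf_le_left inf_le_right
  rw [map_mul, map_mul, ← e a, ← e b, ← e' a, ← e' b]
  ring

theorem P1.exists_hom_of_coords (f : T ⟶ Spec (CommRingCat.of k)) {ι : Type u} (V : ι → T.Opens)
    (hV : ⨆ i, V i = ⊤) (u : ∀ i, Fin 2 → Γ(T, V i))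
    (hu : ∀ i, V i ≤ T.basicOpen (u i 0) ⊔ T.basicOpen (u i 1))
    (hc : ∀ i j, res inf_le_left (u i 0) * res inf_le_right (u j 1) =
      res (inf_le_left : V i ⊓ V j ≤ V i) (u i 1) * res inf_le_right (u j 0)) :
    ∃ φ : T ⟶ P1 k, φ ≫ P1.toSpec k = f ∧ ∀ i, HasCoords φ (V i) (u i) := by
  have hιX : ∀ i b, IsUnit (res (T.basicOpen_le (u i b)) (u i b)) := fun i b =>
    isUnit_res_of_le_basicOpen _ _ le_rfl
  obtain ⟨φ, hφ, h1, h2⟩ := P1.exists_hom_of_pairs f (ι := ι × ULift.{u} (Fin 2))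
    (fun i => T.basicOpen (u i.1 i.2.down))
    (by
      rw [eq_top_iff, ← hV]
      refine iSup_le fun i => (hu i).trans (sup_le ?_ ?_)
      · exact le_iSup (fun i : ι × ULift.{u} (Fin 2) => T.basicOpen (u i.1 i.2.down)) (i, ⟨0⟩)
      · exact le_iSup (fun i : ι × ULift.{u} (Fin 2) => T.basicOpen (u i.1 i.2.down)) (i, ⟨1⟩))
    (fun i a => res (T.basicOpen_le _) (u i.1 a))
    (fun i => Ideal.eq_top_of_isUnit_mem _ (Ideal.subset_span ⟨i.2.down, rfl⟩) (hιX _ _))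
    (by
      intro i j
      have hle : T.basicOpen (u i.1 i.2.down) ⊓ T.basicOpen (u j.1 j.2.down) ≤ V i.1 ⊓ V j.1 :=
        inf_le_inf (T.basicOpen_le _) (T.basicOpen_le _)
      have := congrArg (res hle) (hc i.1 j.1)
      simpa only [map_mul, res_res] using this)
  have h3 : ∀ i b, V i ⊓ φ ⁻¹ᵁ P1.chart k b = T.basicOpen (u i b) := by
    intro i b
    have key : ∀ b', T.basicOpen (u i b') ⊓ φ ⁻¹ᵁ P1.chart k b =
        T.basicOpen (u i b') ⊓ T.basicOpen (u i b) := by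
      intro b'
      have := h1 (i, ⟨b'⟩) b
      rwa [basicOpen_res_eq] at this
    have hx : ∀ x ∈ V i, ∃ b', x ∈ T.basicOpen (u i b') := by
      intro x hx
      rcases hu i hx with h | h
      · exact ⟨0, h⟩
      · exact ⟨1, h⟩
    apply le_antisymm
    · rintro x ⟨hxV, hxb⟩
      obtain ⟨b', hb'⟩ := hx x hxV
      exact ((key b').le ⟨hb', hxb⟩).2
    · intro x hxb
      have hxV := T.basicOpen_le _ hxb
      obtain ⟨b', hb'⟩ := hx x hxV
      exact ⟨hxV, ((key b').ge ⟨hb', hxb⟩).2⟩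
  refine ⟨φ, hφ, fun i => ⟨h3 i, fun a b W hW h => ?_⟩⟩
  have hle : W ≤ T.basicOpen (u i b) := fun x hx => (h3 i b).le ⟨hW hx, h hx⟩
  have := h2 (i, ⟨b⟩) a b W hle h
  rwa [res_res, res_res] at this

/-- The pair obtained from a pair of functions by a linear substitution. -/
def linPair (f : T ⟶ Spec (CommRingCat.of k)) (M : Matrix (Fin 2) (Fin 2) k) {W : T.Opens}
    (v : Fin 2 → Γ(T, W)) (a : Fin 2) : Γ(T, W) :=
  ∑ c, scalar f W (M a c) * v c

theorem linPair_linPair (f : T ⟶ Spec (CommRingCat.of k)) (M N : Matrix (Fin 2) (Fin 2) k)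
    {W : T.Opens} (v : Fin 2 → Γ(T, W)) :
    linPair f N (linPair f M v) = linPair f (N * M) v := by
  funext a
  simp only [linPair, Matrix.mul_apply, Fin.sum_univ_two, map_add, map_mul]
  ring

theorem linPair_one (f : T ⟶ Spec (CommRingCat.of k)) {W : T.Opens} (v : Fin 2 → Γ(T, W)) :
    linPair f 1 v = v := by
  funext a
  rw [linPair, Finset.sum_eq_single a (fun c _ hc => by rw [Matrix.one_apply_ne' hc]; simp)
    (fun h => absurd (Finset.mem_univ a) h), Matrix.one_apply_eq, map_one, one_mul]

theorem appLE_linPair (g : S ⟶ T) (f : T ⟶ Spec (CommRingCat.of k))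
    (M : Matrix (Fin 2) (Fin 2) k) {W : T.Opens} (v : Fin 2 → Γ(T, W)) {V : S.Opens}
    (hV : V ≤ g ⁻¹ᵁ W) (a : Fin 2) : (g.appLE W V hV).hom (linPair f M v a) =
      linPair (g ≫ f) M (fun c => (g.appLE W V hV).hom (v c)) a := by
  simp only [linPair, map_sum, map_mul, appLE_scalar]

theorem res_linPair (f : T ⟶ Spec (CommRingCat.of k))
    (M : Matrix (Fin 2) (Fin 2) k) {W : T.Opens} (v : Fin 2 → Γ(T, W)) {V : T.Opens}
    (hV : V ≤ W) (a : Fin 2) : res hV (linPair f M v a) =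
      linPair f M (fun c => res hV (v c)) a := by
  simp only [linPair, map_sum, map_mul, res_scalar]

theorem le_basicOpen_linPair (f : T ⟶ Spec (CommRingCat.of k)) {M N : Matrix (Fin 2) (Fin 2) k}
    (h : N * M = 1) {W : T.Opens} (v : Fin 2 → Γ(T, W)) (b : Fin 2) :
    T.basicOpen (v b) ≤ T.basicOpen (linPair f M v 0) ⊔ T.basicOpen (linPair f M v 1) := by
  have e : v b = linPair f N (linPair f M v) b := by rw [linPair_linPair, h, linPair_one]
  conv_lhs => rw [e]
  rw [linPair, Fin.sum_univ_two]
  refine (T.basicOpen_add_le _ _).trans ?_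
  rw [T.basicOpen_mul, T.basicOpen_mul]
  exact sup_le_sup inf_le_right inf_le_right

/-- The linear substitution of the homogeneous coordinates. -/
theorem P1.exists_linear {M N : Matrix (Fin 2) (Fin 2) k} (h : N * M = 1) (φ : T ⟶ P1 k) :
    ∃ ψ : T ⟶ P1 k, ψ ≫ P1.toSpec k = φ ≫ P1.toSpec k ∧
      ∀ b, HasCoords ψ (φ ⁻¹ᵁ P1.chart k b) (linPair (φ ≫ P1.toSpec k) M
        (fun a => coordRatio φ a b _ le_rfl)) := by
  obtain ⟨ψ, h1, h2⟩ := P1.exists_hom_of_coords (φ ≫ P1.toSpec k) (ι := ULift.{u} (Fin 2))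
    (fun b => φ ⁻¹ᵁ P1.chart k b.down)
    (by
      rw [eq_top_iff]
      intro x _
      obtain ⟨b, hb⟩ := exists_mem_chart φ x
      exact TopologicalSpace.Opens.mem_iSup.2 ⟨⟨b⟩, hb⟩)
    (fun b => linPair (φ ≫ P1.toSpec k) M (fun a => coordRatio φ a b.down _ le_rfl))
    (by
      intro b
      refine le_trans ?_ (le_basicOpen_linPair _ h _ b.down)
      rw [coordRatio_self]
      simp)
    (by
      intro i j
      have hr : ∀ c, res (inf_le_right : φ ⁻¹ᵁ P1.chart k i.down ⊓ φ ⁻¹ᵁ P1.chart k j.down ≤ _)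
          (coordRatio φ c j.down _ le_rfl) =
          res inf_le_left (coordRatio φ c i.down _ le_rfl) *
          res inf_le_right (coordRatio φ i.down j.down _ le_rfl) := by
        intro c
        rw [res_coordRatio, res_coordRatio, res_coordRatio, coordRatio_mul]
      rw [res_linPair, res_linPair, res_linPair, res_linPair]
      simp only [linPair, Fin.sum_univ_two]
      rw [hr 0, hr 1]
      ring)
  exact ⟨ψ, h1, fun b => h2 ⟨b⟩⟩

theorem HasCoords.linear {M : Matrix (Fin 2) (Fin 2) k} {φ ψ : T ⟶ P1 k}
    (hψ : ∀ b, HasCoords ψ (φ ⁻¹ᵁ P1.chart k b) (linPair (φ ≫ P1.toSpec k) M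
        (fun a => coordRatio φ a b _ le_rfl))) {W : T.Opens} {v : Fin 2 → Γ(T, W)}
    (hv : HasCoords φ W v) : HasCoords ψ W (linPair (φ ≫ P1.toSpec k) M v) := by
  have key : ∀ b (V : T.Opens) (hV : V ≤ W) (h : V ≤ φ ⁻¹ᵁ P1.chart k b) a,
      res h (linPair (φ ≫ P1.toSpec k) M (fun a => coordRatio φ a b _ le_rfl) a) *
        res hV (v b) = res hV (linPair (φ ≫ P1.toSpec k) M v a) := by
    intro b V hV hb a
    rw [res_linPair, res_linPair]
    simp only [res_coordRatio, linPair, Finset.sum_mul]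
    refine Finset.sum_congr rfl fun c _ => ?_
    rw [mul_assoc, hv.ratio c b V hV hb]
  have hpre : ∀ b, W ⊓ ψ ⁻¹ᵁ P1.chart k b = T.basicOpen (linPair (φ ≫ P1.toSpec k) M v b) := by
    intro b
    have key2 : ∀ c, T.basicOpen (v c) ⊓ ψ ⁻¹ᵁ P1.chart k b =
        T.basicOpen (v c) ⊓ T.basicOpen (linPair (φ ≫ P1.toSpec k) M v b) := by
      intro c
      have hle := hv.basicOpen_le c
      have h1 := ((hψ c).restrict hle).preimage b
      rw [h1, ← basicOpen_res_eq (T.basicOpen_le _), ← key c _ (T.basicOpen_le _) hle b,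
        T.basicOpen_mul, Scheme.basicOpen_of_isUnit _ (isUnit_res_of_le_basicOpen _ (v c) le_rfl)]
      exact (inf_eq_left.2 (T.basicOpen_le _)).symm
    apply le_antisymm
    · rintro x ⟨hxW, hx⟩
      obtain ⟨c, hc⟩ := exists_mem_basicOpen hv hxW
      exact ((key2 c).le ⟨hc, hx⟩).2
    · intro x hx
      have hxW := T.basicOpen_le _ hx
      obtain ⟨c, hc⟩ := exists_mem_basicOpen hv hxW
      exact ⟨hxW, ((key2 c).ge ⟨hc, hx⟩).2⟩
  refine ⟨hpre, fun a b V hV hb => ?_⟩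
  refine eq_of_locally_res fun x hx => ?_
  obtain ⟨c, hc⟩ := exists_mem_chart φ x
  refine ⟨V ⊓ φ ⁻¹ᵁ P1.chart k c, ⟨hx, hc⟩, inf_le_left, ?_⟩
  have e := (hψ c).ratio a b (V ⊓ φ ⁻¹ᵁ P1.chart k c) inf_le_right (inf_le_left.trans hb)
  rw [map_mul, res_coordRatio, res_res, res_res, ← key c _ (inf_le_left.trans hV) inf_le_right,
    ← key c _ (inf_le_left.trans hV) inf_le_right, ← mul_assoc, e]

/-- The automorphism of the projective line defined by an invertible matrix. -/
theorem P1.exists_iso {M N : Matrix (Fin 2) (Fin 2) k} (h : N * M = 1) (h' : M * N = 1) :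
    ∃ e : P1 k ≅ P1 k, e.hom ≫ P1.toSpec k = P1.toSpec k ∧
      ∀ b, HasCoords e.hom (P1.chart k b) (linPair (P1.toSpec k) M (fun a => P1.ratio k a b)) := by
  obtain ⟨φ, hφ, hφc⟩ := P1.exists_linear h (𝟙 (P1 k))
  obtain ⟨ψ, hψ, hψc⟩ := P1.exists_linear h' (𝟙 (P1 k))
  have gen : ∀ {M N : Matrix (Fin 2) (Fin 2) k} (h : N * M = 1) (h' : M * N = 1) (φ ψ : P1 k ⟶ P1 k)
      (_ : φ ≫ P1.toSpec k = P1.toSpec k) (_ : ψ ≫ P1.toSpec k = P1.toSpec k)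
      (_ : ∀ b, HasCoords φ (P1.chart k b) (linPair (P1.toSpec k) M (fun a => P1.ratio k a b)))
      (_ : ∀ b, HasCoords ψ (P1.chart k b) (linPair (P1.toSpec k) N (fun a => P1.ratio k a b))),
      φ ≫ ψ = 𝟙 _ := by
    intro M N h h' φ ψ hφ hψ hφc hψc
    refine P1.hom_ext_of_hasCoords (by rw [Category.assoc, hψ, hφ, Category.id_comp]) fun x => ?_
    obtain ⟨b, hb⟩ := exists_mem_chart (𝟙 (P1 k)) x
    have hφψ : ∀ c, HasCoords (φ ≫ ψ) (φ ⁻¹ᵁ P1.chart k c)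
        (linPair (φ ≫ P1.toSpec k) N (fun a => coordRatio φ a c _ le_rfl)) := by
      intro c
      have := (hψc c).comp φ (le_refl (φ ⁻¹ᵁ P1.chart k c))
      simp only [appLE_linPair] at this
      exact this
    have := HasCoords.linear hφψ (hφc b)
    rw [hφ, linPair_linPair, h, linPair_one] at this
    exact ⟨P1.chart k b, hb, _, _, this, hasCoords_id b, mul_comm _ _⟩
  simp only [Category.id_comp] at hφ hψ hφc hψc
  refine ⟨⟨φ, ψ, gen h h' φ ψ hφ hψ hφc hψc, gen h' h ψ φ hψ hφ hψc hφc⟩, hφ, hφc⟩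

end HasCoords

section RationalPoints
variable {k : Type u} [Field k] {T : Scheme.{u}}

theorem hasCoords_ofPair (f : T ⟶ Spec (CommRingCat.of k)) (u : Fin 2 → Γ(T, ⊤))
    (hu : Ideal.span (Set.range u) = ⊤) : HasCoords (P1.ofPair f u hu) ⊤ u :=
  ⟨fun b => by rw [top_inf_eq]; exact P1.ofPair_preimage f u hu b,
    fun a b V _ h => P1.ofPair_ratio f u hu a b V h⟩

theorem P1.hasCoords_pt (b : Fin 2) (r : k) : HasCoords (P1.pt b r) ⊤
    (fun a => (Scheme.ΓSpecIso (CommRingCat.of k)).inv.hom (if a = b then 1 else r)) :=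
  hasCoords_ofPair _ _ _

theorem ΓSpecIso_hom_inv (y : k) : (Scheme.ΓSpecIso (CommRingCat.of k)).hom.hom
    ((Scheme.ΓSpecIso (CommRingCat.of k)).inv.hom y) = y :=
  (congrArg (fun g => g.hom y) (Scheme.ΓSpecIso (CommRingCat.of k)).inv_hom_id : _)

theorem ΓSpecIso_hom_injective :
    Function.Injective (Scheme.ΓSpecIso (CommRingCat.of k)).hom.hom :=
  (ConcreteCategory.bijective_of_isIso (Scheme.ΓSpecIso (CommRingCat.of k)).hom).1

theorem evalAt_eq (s : Spec (CommRingCat.of k) ⟶ T) (W : T.Opens) (h : point s ∈ W) (f : Γ(T, W)) :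
    evalAt s W h f = (Scheme.ΓSpecIso (CommRingCat.of k)).hom.hom
      ((s.appLE W ⊤ (top_le_preimage h)).hom f) := rfl

theorem comp_eq_pt_iff {φ : T ⟶ P1 k} {W : T.Opens} {v : Fin 2 → Γ(T, W)} (hv : HasCoords φ W v)
    {t : Spec (CommRingCat.of k) ⟶ T} (ht : t ≫ φ ≫ P1.toSpec k = 𝟙 _) (h : point t ∈ W)
    (b : Fin 2) (r : k) : t ≫ φ = P1.pt b r ↔
      evalAt t W h (v (other b)) = r * evalAt t W h (v b) := by
  have hb : other b ≠ b := by fin_cases b <;> decide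
  have h1 := hv.comp t (top_le_preimage h)
  constructor
  · intro e
    rw [e] at h1
    have := h1.cross (P1.hasCoords_pt b r) (other b) b
    simp only [if_true, map_one, mul_one, if_neg hb] at this
    rw [evalAt_eq, this, map_mul, ΓSpecIso_hom_inv, mul_comm]
    rfl
  · intro e
    refine P1.hom_ext_of_hasCoords (by rw [Category.assoc, ht, P1.pt_toSpec]) fun x =>
      ⟨⊤, trivial, _, _, h1, P1.hasCoords_pt b r, ?_⟩
    apply ΓSpecIso_hom_injective
    rw [map_mul, map_mul, ΓSpecIso_hom_inv, ΓSpecIso_hom_inv]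
    change evalAt t W h (v 0) * _ = evalAt t W h (v 1) * _
    fin_cases b
    · simp at e ⊢
      rw [e]; ring
    · simp at e ⊢
      rw [e]; ring

theorem P1.pt_one_eq {r : k} (hr : r ≠ 0) : P1.pt 1 r = P1.pt 0 r⁻¹ := by
  have := (comp_eq_pt_iff (hasCoords_id 1) (t := P1.pt 1 r)
    (by rw [Category.id_comp, P1.pt_toSpec]) (P1.pt_mem_chart 1 r) 0 r⁻¹).2 (by
      have h := P1.evalAt_ratio 1 r
      simp only [other, sub_self] at h
      simp only [other, sub_zero, P1.ratio_self, map_one, h, inv_mul_cancel₀ hr])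
  rw [Category.comp_id] at this
  exact this

theorem P1.pt_cases (b : Fin 2) (r : k) : P1.pt b r = P1.pt 1 0 ∨ ∃ r', P1.pt b r = P1.pt 0 r' := by
  fin_cases b
  · exact Or.inr ⟨r, rfl⟩
  · by_cases hr : r = 0
    · subst hr; exact Or.inl rfl
    · exact Or.inr ⟨_, P1.pt_one_eq hr⟩

theorem P1.pt_injective (b : Fin 2) {r r' : k} (h : P1.pt b r = P1.pt b r') : r = r' := by
  have h1 := P1.evalAt_ratio b r
  have h2 := P1.evalAt_ratio b r'
  rw [← h1, ← h2]
  congr 1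
  simp only [h]

theorem P1.point_pt_one_notMem : point (P1.pt 1 (0 : k)) ∉ P1.chart k 0 := by
  intro h
  have h1 : point (P1.pt 1 (0 : k)) ∈ P1.chart k 1 ⊓ (𝟙 (P1 k) : P1 k ⟶ P1 k) ⁻¹ᵁ P1.chart k 0 :=
    ⟨P1.pt_mem_chart 1 0, h⟩
  rw [(hasCoords_id 1).preimage 0, mem_basicOpen_iff _ _ (P1.pt_mem_chart 1 0)] at h1
  exact h1 (P1.evalAt_ratio 1 0)

theorem evalAt_eq_of_point_eq {K : Type u} [Field K] [Algebra k K] {f : T ⟶ Spec (CommRingCat.of k)}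
    {s : Spec (CommRingCat.of k) ⟶ T} (hs : s ≫ f = 𝟙 _) {t : Spec (CommRingCat.of K) ⟶ T}
    (ht : t ≫ f = Spec.map (CommRingCat.ofHom (algebraMap k K))) {W : T.Opens} (h : point s ∈ W)
    (h' : point t ∈ W) (e : point t = point s) (g : Γ(T, W)) :
    evalAt t W h' g = algebraMap k K (evalAt s W h g) := by
  have h1 : point s ∉ T.basicOpen (g - scalar f W (evalAt s W h g)) := by
    rw [mem_basicOpen_iff _ _ h, map_sub, evalAt_scalar_self hs, sub_self]
    exact fun h => h rfl
  rw [← e, mem_basicOpen_iff _ _ h', map_sub, evalAt_scalar _ ht, not_not] at h1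
  exact sub_eq_zero.1 h1

theorem eq_of_point_eq {K : Type u} [Field K] [Algebra k K] {f : T ⟶ Spec (CommRingCat.of k)}
    {s : Spec (CommRingCat.of k) ⟶ T} (hs : s ≫ f = 𝟙 _) {t : Spec (CommRingCat.of K) ⟶ T}
    (ht : t ≫ f = Spec.map (CommRingCat.ofHom (algebraMap k K))) (e : point t = point s) :
    t = Spec.map (CommRingCat.ofHom (algebraMap k K)) ≫ s := by
  obtain ⟨_, ⟨W, hW, rfl⟩, hx, -⟩ :=
    T.isBasis_affineOpens.exists_subset_of_mem_open (Set.mem_univ (point s)) isOpen_univ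
  have ht' : point t ∈ W := e ▸ hx
  have hs' : point (Spec.map (CommRingCat.ofHom (algebraMap k K)) ≫ s) ∈ W := by
    rw [point_specMap]; exact hx
  refine hom_ext_of_evalAt W hW ht' hs' fun g => ?_
  rw [evalAt_eq_of_point_eq hs ht hx ht' e, evalAt_eq_of_point_eq hs (by
    rw [Category.assoc, hs, Category.comp_id]) hx hs' (point_specMap s)]

theorem eq_of_point_eq_self {f : T ⟶ Spec (CommRingCat.of k)}
    {s t : Spec (CommRingCat.of k) ⟶ T} (hs : s ≫ f = 𝟙 _) (ht : t ≫ f = 𝟙 _)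
    (e : point t = point s) : t = s := by
  have h : Spec.map (CommRingCat.ofHom (algebraMap k k)) = 𝟙 _ := Spec.map_id _
  have := eq_of_point_eq (K := k) hs (by rw [ht, h]) e
  rwa [h, Category.id_comp] at this

/-- Any two distinct rational points of the projective line are the images of the standard poles
under an automorphism. -/
theorem P1.exists_iso_poles {p q : Spec (CommRingCat.of k) ⟶ P1 k} (hp : p ≫ P1.toSpec k = 𝟙 _)
    (hq : q ≫ P1.toSpec k = 𝟙 _) (hpq : p ≠ q) : ∃ e : P1 k ≅ P1 k, e.hom ≫ P1.toSpec k = P1.toSpec k ∧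
      P1.pt 0 0 ≫ e.hom = p ∧ P1.pt 1 0 ≫ e.hom = q := by
  have hc : ∀ {p : Spec (CommRingCat.of k) ⟶ P1 k} (_ : p ≫ P1.toSpec k = 𝟙 _),
      ∃ w : Fin 2 → k, w ≠ 0 ∧ ∀ b r, p = P1.pt b r ↔ w (other b) = r * w b := by
    intro p hp
    obtain ⟨b, r, rfl⟩ := P1.exists_eq_pt hp
    refine ⟨fun a => evalAt (P1.pt b r) _ (P1.pt_mem_chart b r) (P1.ratio k a b), fun h => ?_,
      fun b' r' => ?_⟩
    · have := congrFun h b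
      rw [P1.ratio_self, map_one] at this
      exact one_ne_zero this
    · have := comp_eq_pt_iff (hasCoords_id b) (t := P1.pt b r)
        (by rw [Category.id_comp, P1.pt_toSpec]) (P1.pt_mem_chart b r) b' r'
      rwa [Category.comp_id] at this
  obtain ⟨v, hv0, hv⟩ := hc hp
  obtain ⟨w, hw0, hw⟩ := hc hq
  let M : Matrix (Fin 2) (Fin 2) k := !![v 0, w 0; v 1, w 1]
  have hdet : M.det ≠ 0 := by
    rw [Matrix.det_fin_two_of]
    intro h0
    apply hpq
    obtain ⟨b, r, hbr⟩ := P1.exists_eq_pt hp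
    rw [hbr]
    have h1 := (hv b r).1 hbr
    refine ((hw b r).2 ?_).symm
    have hb : v b ≠ 0 := by
      intro hb
      apply hv0
      rw [hb, mul_zero] at h1
      funext a
      fin_cases a <;> fin_cases b <;> simp_all
    apply mul_left_cancel₀ hb
    fin_cases b
    · simp only [other, Fin.zero_eta, sub_zero] at h1 hb ⊢
      rw [h1] at h0
      linear_combination h0
    · simp only [other, Fin.mk_one, sub_self] at h1 hb ⊢
      rw [h1] at h0
      linear_combination -h0
  have hu : IsUnit M.det := isUnit_iff_ne_zero.2 hdet
  obtain ⟨e, he, hec⟩ := P1.exists_iso (Matrix.nonsing_inv_mul M hu) (Matrix.mul_nonsing_inv M hu)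
  refine ⟨e, he, ?_, ?_⟩
  · obtain ⟨b, r, hbr⟩ := P1.exists_eq_pt hp
    rw [hbr, comp_eq_pt_iff (hec 0) (by rw [he, P1.pt_toSpec]) (P1.pt_mem_chart 0 0)]
    have h1 := (hv b r).1 hbr
    have h0 := P1.evalAt_ratio 0 (0 : k)
    simp only [linPair, Fin.sum_univ_two, map_add, map_mul,
      evalAt_scalar_self (P1.pt_toSpec 0 (0 : k)), P1.ratio_self, map_one]
    simp only [other, sub_zero] at h0
    rw [h0]
    fin_cases b <;> simpa [M] using h1
  · obtain ⟨b, r, hbr⟩ := P1.exists_eq_pt hq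
    rw [hbr, comp_eq_pt_iff (hec 1) (by rw [he, P1.pt_toSpec]) (P1.pt_mem_chart 1 0)]
    have h1 := (hw b r).1 hbr
    have h0 := P1.evalAt_ratio 1 (0 : k)
    simp only [linPair, Fin.sum_univ_two, map_add, map_mul,
      evalAt_scalar_self (P1.pt_toSpec 1 (0 : k)), P1.ratio_self, map_one]
    simp only [other, sub_self] at h0
    rw [h0]
    fin_cases b <;> simpa [M] using h1

end RationalPoints

section BaseChange
variable {k : Type u} [Field k] {K : Type u} [Field K] [Algebra k K] {C : Scheme.{u}}
  (π : C ⟶ Spec (CommRingCat.of k))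

variable (K) in
/-- The base change of a `k`-scheme to a field extension. -/
abbrev bc : Scheme.{u} := pullback π (Spec.map (CommRingCat.ofHom (algebraMap k K)))

variable (K) in
abbrev bcFst : bc K π ⟶ C := pullback.fst _ _

variable (K) in
abbrev bcSnd : bc K π ⟶ Spec (CommRingCat.of K) := pullback.snd _ _

theorem appLE_top_eq {X : Scheme.{u}} (f : X ⟶ Spec (CommRingCat.of k)) (W : X.Opens)
    (h : W ≤ f ⁻¹ᵁ ⊤) : f.appLE ⊤ W h =
      (Scheme.ΓSpecIso (CommRingCat.of k)).hom ≫ CommRingCat.ofHom (scalar f W) := by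
  rw [← Iso.inv_comp_eq, scalar_eq f W h]
  rfl

theorem appLE_specMap_ΓSpecIso {R S : CommRingCat.{u}} (φ : R ⟶ S)
    (h : ⊤ ≤ Spec.map φ ⁻¹ᵁ ⊤) : (Spec.map φ).appLE ⊤ ⊤ h ≫ (Scheme.ΓSpecIso S).hom =
      (Scheme.ΓSpecIso R).hom ≫ φ := by
  refine Eq.trans ?_ (Scheme.ΓSpecIso_naturality φ)
  refine congrArg (· ≫ _) ?_
  exact Scheme.Hom.appLE_eq_app ..

variable (K) in
theorem isPushout_bc {W : C.Opens} (hW : IsAffineOpen W) :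
    IsPushout (CommRingCat.ofHom (scalar π W)) (CommRingCat.ofHom (algebraMap k K))
      ((bcFst K π).appLE W (bcFst K π ⁻¹ᵁ W) le_rfl)
      (CommRingCat.ofHom (scalar (bcSnd K π) (bcFst K π ⁻¹ᵁ W))) := by
  have H : IsPullback (bcFst K π) (bcSnd K π) π
    (Spec.map (CommRingCat.ofHom (algebraMap k K))) := IsPullback.of_hasPullback _ _
  have h1 := isIso_pushoutSection_of_isAffineOpen H (US := ⊤) (UT := ⊤) (UX := W)
    (UY := bcFst K π ⁻¹ᵁ W) (by simp) (by simp) (by simp) (isAffineOpen_top _) (isAffineOpen_top _) hW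
  refine ((isIso_pushoutSection_iff H _ _ _).1 h1).of_iso (Scheme.ΓSpecIso _) (Iso.refl _)
    (Scheme.ΓSpecIso _) (Iso.refl _) ?_ ?_ ?_ ?_
  · exact (Category.comp_id _).trans (appLE_top_eq _ _ _)
  · exact appLE_specMap_ΓSpecIso _ _
  · exact (Category.comp_id _).trans (Category.id_comp _).symm
  · exact (Category.comp_id _).trans (appLE_top_eq _ _ _)

open TensorProduct in
variable (K) in
theorem exists_tensor_iso {W : C.Opens} (hW : IsAffineOpen W) :
    letI := (scalar π W).toAlgebra
    ∃ e : (Γ(C, W) ⊗[k] K) ≃+* Γ(bc K π, bcFst K π ⁻¹ᵁ W), ∀ g c, e (g ⊗ₜ c) =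
      ((bcFst K π).appLE W (bcFst K π ⁻¹ᵁ W) le_rfl).hom g * scalar (bcSnd K π) _ c := by
  let := (scalar π W).toAlgebra
  let i := (CommRingCat.isPushout_tensorProduct k Γ(C, W) K).isoIsPushout _ _ (isPushout_bc K π hW)
  refine ⟨i.commRingCatIsoToRingEquiv, fun g c => ?_⟩
  have h1 := congrArg (fun f => f.hom g)
    ((CommRingCat.isPushout_tensorProduct k Γ(C, W) K).inl_isoIsPushout_hom _ _ (isPushout_bc K π hW))
  have h2 := congrArg (fun f => f.hom c)
    ((CommRingCat.isPushout_tensorProduct k Γ(C, W) K).inr_isoIsPushout_hom _ _ (isPushout_bc K π hW))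
  have : (g ⊗ₜ[k] c) = (g ⊗ₜ[k] (1 : K)) * ((1 : Γ(C, W)) ⊗ₜ[k] c) := by simp
  rw [this, map_mul]
  exact congrArg₂ _ h1 h2

end BaseChange

section ClosedImmersions

/-- The pull-back of functions along a morphism of schemes. -/
abbrev pb {X Y : Scheme.{u}} (q : Y ⟶ X) (W : X.Opens) : Γ(X, W) →+* Γ(Y, q ⁻¹ᵁ W) :=
  (q.appLE W (q ⁻¹ᵁ W) le_rfl).hom

theorem pb_surjective {X Y : Scheme.{u}} (q : Y ⟶ X) [IsClosedImmersion q] {W : X.Opens}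
    (hW : IsAffineOpen W) : Function.Surjective (pb q W) := by
  have := q.app_surjective W hW
  rwa [← Scheme.Hom.appLE_eq_app] at this

theorem basicOpen_pb {X Y : Scheme.{u}} (q : Y ⟶ X) {W : X.Opens} (f : Γ(X, W)) :
    Y.basicOpen (pb q W f) = q ⁻¹ᵁ X.basicOpen f := by
  rw [preimage_basicOpen_appLE]
  exact inf_eq_right.2 (Scheme.Hom.preimage_mono q (X.basicOpen_le f))

/-- A function on the second of two closed subschemes that vanishes on their intersection, if the
latter is reduced, extends to a function that vanishes on the first. -/
theorem exists_extension {X Y₁ Y₂ : Scheme.{u}} (q₁ : Y₁ ⟶ X) (q₂ : Y₂ ⟶ X) [IsClosedImmersion q₁]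
    [IsClosedImmersion q₂] [IsReduced (pullback q₁ q₂)] {W : X.Opens} (hW : IsAffineOpen W)
    (d : Γ(Y₂, q₂ ⁻¹ᵁ W)) (hd : ∀ x y, q₁ x = q₂ y → y ∉ Y₂.basicOpen d) :
    ∃ f, pb q₁ W f = 0 ∧ pb q₂ W f = d := by
  have H : IsPullback (pullback.fst q₁ q₂) (pullback.snd q₁ q₂) q₁ q₂ :=
    IsPullback.of_hasPullback _ _
  have h1 := isIso_pushoutSection_of_isAffineOpen H (US := W) (UT := q₂ ⁻¹ᵁ W) (UX := q₁ ⁻¹ᵁ W)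
    le_rfl le_rfl rfl hW (hW.preimage q₂) (hW.preimage q₁)
  have h2 := (isIso_pushoutSection_iff H _ _ _).1 h1
  have h3 : ((pullback.snd q₁ q₂).appLE (q₂ ⁻¹ᵁ W)
      (pullback.fst q₁ q₂ ⁻¹ᵁ q₁ ⁻¹ᵁ W ⊓ pullback.snd q₁ q₂ ⁻¹ᵁ q₂ ⁻¹ᵁ W) inf_le_right).hom d = 0 := by
    rw [← basicOpen_eq_bot_iff, preimage_basicOpen_appLE, eq_bot_iff]
    rintro p ⟨-, hp⟩
    refine hd (pullback.fst q₁ q₂ p) (pullback.snd q₁ q₂ p) ?_ hp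
    have := congrArg (fun f => f p) H.w
    exact this
  let I := (RingHom.ker (pb q₁ W)).map (pb q₂ W)
  let ψ : {ψ : Γ(X, W) →+* Γ(Y₂, q₂ ⁻¹ᵁ W) ⧸ I // RingHom.ker (pb q₁ W) ≤ RingHom.ker ψ} :=
    ⟨(Ideal.Quotient.mk I).comp (pb q₂ W), fun x hx => Ideal.Quotient.eq_zero_iff_mem.2
      (Ideal.mem_map_of_mem _ hx)⟩
  let φ := RingHom.liftOfSurjective (pb q₁ W) (pb_surjective q₁ hW) ψ
  have h4 := h2.inr_desc (CommRingCat.ofHom φ) (CommRingCat.ofHom (Ideal.Quotient.mk I)) (by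
    ext x
    exact RingHom.liftOfRightInverse_comp_apply (pb q₁ W) _
      (Function.rightInverse_surjInv (pb_surjective q₁ hW)) ψ x)
  have h5 : ∀ {A B C : CommRingCat.{u}} (f : A ⟶ B) (g : B ⟶ C) (h : A ⟶ C) (_ : f ≫ g = h) (d : A)
      (_ : f.hom d = 0), h.hom d = 0 := by
    rintro _ _ _ f g _ rfl d hd
    simp [hd]
  obtain ⟨f, hf, hfd⟩ := (Ideal.mem_map_iff_of_surjective _ (pb_surjective q₂ hW)).1
    (Ideal.Quotient.eq_zero_iff_mem.1 (h5 _ _ _ h4 d h3))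
  exact ⟨f, hf, hfd⟩

theorem exists_glue {R : Type*} [CommRing R] {m : ℕ} {S : Fin (m + 1) → Type*}
    [∀ r, CommRing (S r)] (ρ : ∀ r, R →+* S r) (f : ∀ r, S r) (h0 : ∃ F, ρ 0 F = f 0)
    (hdis : ∀ r s : Fin (m + 1), r.1 + 1 < s.1 → ∃ u, ρ r u = 0 ∧ ρ s u = 1)
    (hstep : ∀ (j : Fin m) F, ρ j.castSucc F = f j.castSucc →
      ∃ u, ρ j.castSucc u = 0 ∧ ρ j.succ u = f j.succ - ρ j.succ F) :
    ∃ F, ∀ r, ρ r F = f r := by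
  suffices h : ∀ j : Fin (m + 1), ∃ F, ∀ r ≤ j, ρ r F = f r by
    obtain ⟨F, hF⟩ := h (Fin.last m)
    exact ⟨F, fun r => hF r (Fin.le_last r)⟩
  intro j
  induction j using Fin.induction with
  | zero =>
    obtain ⟨F, hF⟩ := h0
    exact ⟨F, fun r hr => by rw [Fin.le_zero_iff.1 hr, hF]⟩
  | succ j ih =>
    obtain ⟨F, hF⟩ := ih
    obtain ⟨u, hu, hu'⟩ := hstep j F (hF _ le_rfl)
    have hp : ∃ p, (∀ r : Fin (m + 1), r < j.castSucc → ρ r p = 0) ∧ ρ j.succ p = 1 := by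
      choose! p hp hp' using fun r => hdis r j.succ
      refine ⟨∏ r ∈ Finset.univ.filter (· < j.castSucc), p r, fun r hr => ?_, ?_⟩
      · rw [map_prod]
        exact Finset.prod_eq_zero (i := r) (by simpa using hr) (hp r (by
          have : r.1 < j.1 := hr
          simpa using this))
      · rw [map_prod]
        refine Finset.prod_eq_one fun r hr => hp' r ?_
        have : r.1 < j.1 := (Finset.mem_filter.1 hr).2
        simpa using this
    obtain ⟨p, hp, hp'⟩ := hp
    refine ⟨F + u * p, fun r hr => ?_⟩
    rcases hr.lt_or_eq with hr | rfl
    · rw [map_add, map_mul, hF r (Fin.le_castSucc_iff.2 hr)]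
      rcases (Fin.le_castSucc_iff.2 hr).lt_or_eq with hr' | rfl
      · rw [hp r hr', mul_zero, add_zero]
      · rw [hu, zero_mul, add_zero]
    · rw [map_add, map_mul, hu', hp', mul_one, add_sub_cancel]

end ClosedImmersions

section Descent
variable {k : Type u} [Field k] {K : Type u} [Field K] [Algebra k K] {C : Scheme.{u}}
  (π : C ⟶ Spec (CommRingCat.of k))

variable (K) in
theorem bc_induction {W : C.Opens} (hW : IsAffineOpen W) {P : Γ(bc K π, bcFst K π ⁻¹ᵁ W) → Prop}
    (h : ∀ g c, P (pb (bcFst K π) W g * scalar (bcSnd K π) _ c))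
    (hadd : ∀ F G, P F → P G → P (F + G)) (F) : P F := by
  let := (scalar π W).toAlgebra
  obtain ⟨e, he⟩ := exists_tensor_iso K π hW
  obtain ⟨F, rfl⟩ := e.surjective F
  induction F with
  | zero => simpa using h 0 0
  | tmul g c => rw [he]; exact h g c
  | add F G hF hG => rw [map_add]; exact hadd _ _ hF hG

theorem exists_descent (l : K →ₗ[k] k) {W : C.Opens} (hW : IsAffineOpen W) :
    ∃ L : Γ(bc K π, bcFst K π ⁻¹ᵁ W) →+ Γ(C, W), ∀ g c,
      L (pb (bcFst K π) W g * scalar (bcSnd K π) _ c) = g * scalar π W (l c) := by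
  let := (scalar π W).toAlgebra
  obtain ⟨e, he⟩ := exists_tensor_iso K π hW
  refine ⟨((TensorProduct.rid k Γ(C, W)).toLinearMap ∘ₗ
    LinearMap.lTensor Γ(C, W) l).toAddMonoidHom.comp e.symm.toAddMonoidHom, fun g c => ?_⟩
  rw [← he]
  change (TensorProduct.rid k Γ(C, W)) (LinearMap.lTensor Γ(C, W) l (e.symm (e _))) = _
  rw [e.symm_apply_apply, LinearMap.lTensor_tmul, TensorProduct.rid_tmul, Algebra.smul_def,
    mul_comm]
  rfl

/-- The map `Γ(C_K, W_K) → Γ(C, W)` induced by a `k`-linear form on `K`. -/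
def descend (l : K →ₗ[k] k) {W : C.Opens} (hW : IsAffineOpen W) :
    Γ(bc K π, bcFst K π ⁻¹ᵁ W) →+ Γ(C, W) :=
  (exists_descent π l hW).choose

variable (l : K →ₗ[k] k) {W : C.Opens} (hW : IsAffineOpen W)

theorem descend_pb_mul_scalar (g : Γ(C, W)) (c : K) :
    descend π l hW (pb (bcFst K π) W g * scalar (bcSnd K π) _ c) = g * scalar π W (l c) :=
  (exists_descent π l hW).choose_spec g c

theorem descend_mul (g : Γ(C, W)) (F) :
    descend π l hW (pb (bcFst K π) W g * F) = g * descend π l hW F := by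
  induction F using bc_induction K π hW with
  | h g' c => rw [← mul_assoc, ← map_mul, descend_pb_mul_scalar, descend_pb_mul_scalar, mul_assoc]
  | hadd F G hF hG => rw [mul_add, map_add, hF, hG, map_add, mul_add]

theorem descend_pb (hl : l 1 = 1) (g : Γ(C, W)) : descend π l hW (pb (bcFst K π) W g) = g := by
  have := descend_pb_mul_scalar π l hW g 1
  rwa [map_one, mul_one, hl, map_one, mul_one] at this

theorem res_pb {X Y : Scheme.{u}} (q : Y ⟶ X) {V W : X.Opens} (h : V ≤ W) (f : Γ(X, W)) :
    res (Scheme.Hom.preimage_mono q h) (pb q W f) = pb q V (res h f) := by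
  rw [res_appLE, appLE_res]

theorem res_descend {V : C.Opens} (hV : IsAffineOpen V) (h : V ≤ W) (F) :
    res h (descend π l hW F) = descend π l hV (res (Scheme.Hom.preimage_mono _ h) F) := by
  induction F using bc_induction K π hW with
  | h g c => rw [descend_pb_mul_scalar, map_mul, map_mul, res_scalar, res_scalar, res_pb,
      descend_pb_mul_scalar]
  | hadd F G hF hG => rw [map_add, map_add, hF, hG, map_add, map_add]

theorem evalAt_pb {X Y : Scheme.{u}} (q : Y ⟶ X) (s : Spec (CommRingCat.of K) ⟶ Y) {W : X.Opens}
    (h : point s ∈ q ⁻¹ᵁ W) (h' : point (s ≫ q) ∈ W) (f : Γ(X, W)) :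
    evalAt s (q ⁻¹ᵁ W) h (pb q W f) = evalAt (s ≫ q) W h' f :=
  (evalAt_comp s q le_rfl h h' f).symm

variable {π} in
theorem evalAt_specMap {s : Spec (CommRingCat.of k) ⟶ C} (hs : s ≫ π = 𝟙 _) (h : point s ∈ W)
    (h' : point (Spec.map (CommRingCat.ofHom (algebraMap k K)) ≫ s) ∈ W) (g : Γ(C, W)) :
    evalAt (Spec.map (CommRingCat.ofHom (algebraMap k K)) ≫ s) W h' g =
      algebraMap k K (evalAt s W h g) :=
  evalAt_eq_of_point_eq hs (by rw [Category.assoc, hs, Category.comp_id]) h h' (point_specMap s) g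

variable {π} in
theorem evalAt_descend {s : Spec (CommRingCat.of k) ⟶ C} (hs : s ≫ π = 𝟙 _) (h : point s ∈ W)
    {t : Spec (CommRingCat.of K) ⟶ bc K π} (ht : t ≫ bcSnd K π = 𝟙 _)
    (hts : t ≫ bcFst K π = Spec.map (CommRingCat.ofHom (algebraMap k K)) ≫ s)
    (h' : point t ∈ bcFst K π ⁻¹ᵁ W) (F) :
    evalAt s W h (descend π l hW F) = l (evalAt t _ h' F) := by
  induction F using bc_induction K π hW with
  | h g c =>
    have h'' : point (t ≫ bcFst K π) ∈ W := by rw [point_comp]; exact h'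
    rw [descend_pb_mul_scalar, map_mul, evalAt_scalar_self hs, map_mul, evalAt_scalar_self ht,
      evalAt_pb _ _ _ h'']
    have : evalAt (t ≫ bcFst K π) W h'' g = algebraMap k K (evalAt s W h g) := by
      rw [← evalAt_specMap hs h (hts ▸ h'')]
      congr 1
      simp only [hts]
    rw [this, ← Algebra.smul_def, map_smul, smul_eq_mul]
  | hadd F G hF hG => rw [map_add, map_add, hF, hG, map_add, map_add]

end Descent

section LineFn
variable {K : Type u} [Field K] {X : Scheme.{u}}

/-- The rational function on the projective line obtained by pulling back a regular function. -/
def lineFn (q : P1 K ⟶ X) (W : X.Opens) (h : genericPoint (P1 K) ∈ q ⁻¹ᵁ W) :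
    Γ(X, W) →+* (P1 K).functionField :=
  (fn (q ⁻¹ᵁ W) h).comp (pb q W)

theorem lineFn_res (q : P1 K ⟶ X) {V W : X.Opens} (i : V ≤ W) (h : genericPoint (P1 K) ∈ q ⁻¹ᵁ V)
    (f : Γ(X, W)) : lineFn q V h (res i f) = lineFn q W (i h) f := by
  change fn _ _ _ = fn _ _ _
  rw [← res_pb, fn_res]

theorem lineFn_pb {Y : Scheme.{u}} (q : P1 K ⟶ Y) (p : Y ⟶ X) (W : X.Opens)
    (h : genericPoint (P1 K) ∈ q ⁻¹ᵁ p ⁻¹ᵁ W) (f : Γ(X, W)) :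
    lineFn q (p ⁻¹ᵁ W) h (pb p W f) = lineFn (q ≫ p) W h f := by
  change fn _ _ _ = fn _ _ _
  congr 1
  exact appLE_appLE q p _ _ f

theorem generic_mem_preimage {q : P1 K ⟶ X} {W : X.Opens} {s : Spec (CommRingCat.of K) ⟶ P1 K}
    (h : point (s ≫ q) ∈ W) : genericPoint (P1 K) ∈ q ⁻¹ᵁ W :=
  genericPoint_mem (x := point s) (by rw [point_comp] at h; exact h)

theorem hasVal_lineFn (q : P1 K ⟶ X) {W : X.Opens} (s : Spec (CommRingCat.of K) ⟶ P1 K)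
    (h : point (s ≫ q) ∈ W) (h' : genericPoint (P1 K) ∈ q ⁻¹ᵁ W) (f : Γ(X, W)) :
    HasVal s (lineFn q W h' f) (evalAt (s ≫ q) W h f) := by
  have h1 : point s ∈ q ⁻¹ᵁ W := by rw [point_comp] at h; exact h
  rw [← evalAt_pb q s h1 h]
  exact hasVal_fn s _ h1 _ _

theorem lineFn_scalar {q : P1 K ⟶ X} {f : X ⟶ Spec (CommRingCat.of K)} (hq : q ≫ f = P1.toSpec K)
    (W : X.Opens) (h : genericPoint (P1 K) ∈ q ⁻¹ᵁ W) (c : K) :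
    lineFn q W h (scalar f W c) = P1.const c := by
  change fn _ _ _ = _
  have := appLE_scalar f q W (q ⁻¹ᵁ W) le_rfl c
  rw [hq] at this
  refine (congrArg _ this).trans ?_
  exact P1.fn_scalar _ _ _

theorem pb_eq_zero {q : P1 K ⟶ X} {W : X.Opens} {f : Γ(X, W)}
    (h : ∀ h, lineFn q W h f = 0) : pb q W f = 0 := by
  rw [← basicOpen_eq_bot_iff, eq_bot_iff]
  intro y hy
  have h1 := genericPoint_mem ((P1 K).basicOpen_le _ hy)
  have h2 : pb q W f = 0 := fn_injective _ h1 ((h h1).trans (map_zero _).symm)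
  rw [h2, Scheme.basicOpen_zero] at hy
  exact hy

theorem isClosed_point {X : Scheme.{u}} {f : X ⟶ Spec (CommRingCat.of K)} [IsSeparated f]
    {s : Spec (CommRingCat.of K) ⟶ X} (hs : s ≫ f = 𝟙 _) : IsClosed {point s} := by
  have := isClosedImmersion_of_comp_eq_id f s hs
  have h := s.isClosedEmbedding.isClosed_range
  convert h
  ext x
  constructor
  · rintro rfl
    exact ⟨_, rfl⟩
  · rintro ⟨y, rfl⟩
    rw [eq_closedPoint y]
    rfl

end LineFn

/-- A chain of projective lines over an extension field `K` of `k`, with underlying `k`-curve `C`,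
parametrised such that the poles of each line are `0` and `∞`. The `i`-th marked point is the point
with coordinate `a i` on the line with index `c i`. -/
structure IsLineChain {k : Type u} [Field k] {K : Type u} [Field K] [Algebra k K] {C : Scheme.{u}}
    (π : C ⟶ Spec (CommRingCat.of k)) (sMinus sPlus : Spec (CommRingCat.of k) ⟶ C) {n : ℕ}
    (s : Fin (n + 1) → (Spec (CommRingCat.of k) ⟶ C)) {m : ℕ} (line : Fin (m + 1) → (P1 K ⟶ bc K π))
    (c : Fin (n + 1) → Fin (m + 1)) (a : Fin (n + 1) → K) : Prop where
  isProper : IsProper π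
  isReduced : IsReduced (bc K π)
  line_over : ∀ j, line j ≫ bcSnd K π = P1.toSpec K
  line_closed : ∀ j, IsClosedImmersion (line j)
  cover : ∀ x, ∃ j y, line j y = x
  node : ∀ j : Fin m, P1.pt 1 0 ≫ line j.castSucc = P1.pt 0 0 ≫ line j.succ
  inter : ∀ i j : Fin (m + 1), i < j → ∀ x y, line i x = line j y →
    i.1 + 1 = j.1 ∧ y = point (P1.pt 0 (0 : K))
  transversal : ∀ j : Fin m, IsReduced (pullback (line j.castSucc) (line j.succ))
  sMinus_over : sMinus ≫ π = 𝟙 _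
  sPlus_over : sPlus ≫ π = 𝟙 _
  s_over : ∀ i, s i ≫ π = 𝟙 _
  minus : P1.pt 0 0 ≫ line 0 ≫ bcFst K π = Spec.map (CommRingCat.ofHom (algebraMap k K)) ≫ sMinus
  plus : P1.pt 1 0 ≫ line (Fin.last m) ≫ bcFst K π =
    Spec.map (CommRingCat.ofHom (algebraMap k K)) ≫ sPlus
  marked : ∀ i, P1.pt 0 (a i) ≫ line (c i) ≫ bcFst K π =
    Spec.map (CommRingCat.ofHom (algebraMap k K)) ≫ s i
  ne_zero : ∀ i, a i ≠ 0
  stable : ∀ j, ∃ i, c i = j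

theorem isAffineOpen_bc {k : Type u} [Field k] {K : Type u} [Field K] [Algebra k K] {C : Scheme.{u}}
    {π : C ⟶ Spec (CommRingCat.of k)} {W : C.Opens} (hW : IsAffineOpen W) : IsAffineOpen (bcFst K π ⁻¹ᵁ W) :=
  have : IsAffineHom (bcFst K π) := 
    MorphismProperty.of_isPullback (P := @IsAffineHom.{u})
      (IsPullback.of_hasPullback π (Spec.map (CommRingCat.ofHom (algebraMap k K)))).flip inferInstance
  hW.preimage (bcFst K π)

namespace IsLineChain
variable {k : Type u} [Field k] {K : Type u} [Field K] [Algebra k K] {C : Scheme.{u}}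
    {π : C ⟶ Spec (CommRingCat.of k)} {sMinus sPlus : Spec (CommRingCat.of k) ⟶ C} {n : ℕ}
    {s : Fin (n + 1) → (Spec (CommRingCat.of k) ⟶ C)} {m : ℕ} {line : Fin (m + 1) → (P1 K ⟶ bc K π)}
    {c : Fin (n + 1) → Fin (m + 1)} {a : Fin (n + 1) → K}
    (H : IsLineChain π sMinus sPlus s line c a)
include H

theorem eq_zero_of_pb {W : (bc K π).Opens} {F : Γ(bc K π, W)} (h : ∀ j, pb (line j) W F = 0) :
    F = 0 := by
  have := H.isReduced
  rw [← basicOpen_eq_bot_iff, eq_bot_iff]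
  intro x hx
  obtain ⟨j, y, rfl⟩ := H.cover x
  have h1 : y ∈ (P1 K).basicOpen (pb (line j) W F) := by
    rw [basicOpen_pb]
    exact hx
  rw [h j, Scheme.basicOpen_zero] at h1
  exact h1

theorem exists_glue {W : C.Opens} (hW : IsAffineOpen W) (f : ∀ j, Γ(P1 K, line j ⁻¹ᵁ bcFst K π ⁻¹ᵁ W))
    (hf : ∀ (j : Fin m) (h : point (P1.pt 1 (0 : K)) ∈ line j.castSucc ⁻¹ᵁ bcFst K π ⁻¹ᵁ W)
      (h' : point (P1.pt 0 (0 : K)) ∈ line j.succ ⁻¹ᵁ bcFst K π ⁻¹ᵁ W),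
      evalAt _ _ h (f j.castSucc) = evalAt _ _ h' (f j.succ)) :
    ∃ F, ∀ j, pb (line j) (bcFst K π ⁻¹ᵁ W) F = f j := by
  have hW' := isAffineOpen_bc (K := K) (π := π) hW
  have := H.line_closed
  refine LosevManin.exists_glue (fun j => pb (line j) (bcFst K π ⁻¹ᵁ W)) f (pb_surjective _ hW' _)
    (fun r t hrt => ?_) (fun j F hF => ?_)
  · have : IsEmpty (pullback (line r) (line t) : Scheme.{u}) := ⟨fun p => by
      have h := congrArg (fun f => f p) (pullback.condition (f := line r) (g := line t))
      have := (H.inter r t (Fin.lt_def.2 (by omega)) _ _ h).1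
      omega⟩
    have := isReduced_of_isOpenImmersion (pullback.fst (line r) (line t))
    exact exists_extension (line r) (line t) hW' 1 fun x y h => by
      have := (H.inter r t (Fin.lt_def.2 (by omega)) _ _ h).1
      omega
  · have := H.transversal j
    refine exists_extension (line j.castSucc) (line j.succ) hW' _ fun x y h hy => ?_
    obtain rfl := (H.inter _ _ (Fin.castSucc_lt_succ) _ _ h).2
    have h' : point (P1.pt 0 (0 : K)) ∈ line j.succ ⁻¹ᵁ bcFst K π ⁻¹ᵁ W := (P1 K).basicOpen_le _ hy
    have h1 : point (P1.pt 0 (0 : K) ≫ line j.succ) ∈ bcFst K π ⁻¹ᵁ W := by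
      rw [point_comp]; exact h'
    have h2 : point (P1.pt 1 (0 : K) ≫ line j.castSucc) ∈ bcFst K π ⁻¹ᵁ W := by
      rw [H.node]; exact h1
    have h3 : point (P1.pt 1 (0 : K)) ∈ line j.castSucc ⁻¹ᵁ bcFst K π ⁻¹ᵁ W := by
      rw [point_comp] at h2; exact h2
    refine (mem_basicOpen_iff _ _ h' _).1 hy ?_
    rw [map_sub, ← hf j h3 h', ← hF, evalAt_pb _ _ _ h1, evalAt_pb _ _ _ h2, sub_eq_zero]
    congr 1
    simp only [H.node]

end IsLineChain

section OfAnCurve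
variable {K : Type u} [Field K] [IsAlgClosed K]

theorem P1.exists_pt_of_isClosed {y z : P1 K} (h : IsClosed {y}) (hz : y ≠ z) :
    ∃ b r, y = point (P1.pt b r) := by
  refine (P1.point_cases y).resolve_left ?_
  rintro rfl
  apply hz
  have := genericPoint_closure (α := P1 K)
  rw [h.closure_eq] at this
  exact (Set.mem_singleton_iff.1 (this ▸ Set.mem_univ z)).symm

theorem IsStablePointedChain.exists_normalised {C : Scheme.{u}} {π : C ⟶ Spec (CommRingCat.of K)}
    {sMinus sPlus : Spec (CommRingCat.of K) ⟶ C} {n : ℕ}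
    {s : Fin (n + 1) → (Spec (CommRingCat.of K) ⟶ C)} {m : ℕ}
    {line : Fin (m + 1) → (P1 K ⟶ C)} {poleMinus polePlus : Fin (m + 1) → P1 K}
    (H : IsStablePointedChain π sMinus sPlus s m line poleMinus polePlus) :
    ∃ line', IsStablePointedChain π sMinus sPlus s m line' (fun _ => point (P1.pt 0 0))
      (fun _ => point (P1.pt 1 0)) := by
  have h1 : ∀ j, ∃ e : P1 K ≅ P1 K, e.hom ≫ P1.toSpec K = P1.toSpec K ∧
      e.hom (point (P1.pt 0 0)) = poleMinus j ∧ e.hom (point (P1.pt 1 0)) = polePlus j := by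
    intro j
    obtain ⟨b, r, hbr⟩ := P1.exists_pt_of_isClosed (H.poleMinus_closed j) (H.poles_ne j)
    obtain ⟨b', r', hbr'⟩ := P1.exists_pt_of_isClosed (H.polePlus_closed j) (H.poles_ne j).symm
    obtain ⟨e, he, he0, he1⟩ := P1.exists_iso_poles (P1.pt_toSpec b r) (P1.pt_toSpec b' r')
      (fun h => H.poles_ne j (by rw [hbr, hbr', h]))
    exact ⟨e, he, by rw [← point_comp, he0, hbr], by rw [← point_comp, he1, hbr']⟩
  choose e he he0 he1 using h1
  have hr : ∀ j, Set.range ((e j).hom ≫ line j) = Set.range (line j) := fun j => by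
    rw [Scheme.Hom.comp_base, TopCat.coe_comp, Set.range_comp,
      (e j).hom.surjective.range_eq, Set.image_univ]
  have hc0 : ∀ j, ((e j).hom ≫ line j) (point (P1.pt 0 0)) = line j (poleMinus j) := fun j =>
    congrArg (line j) (he0 j)
  have hc1 : ∀ j, ((e j).hom ≫ line j) (point (P1.pt 1 0)) = line j (polePlus j) := fun j =>
    congrArg (line j) (he1 j)
  have hp : (point (P1.pt 0 (0 : K))) ≠ point (P1.pt 1 0) := fun h => H.poles_ne 0 (by
    rw [← he0 0, ← he1 0, h])
  exact ⟨fun j => (e j).hom ≫ line j,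
    { isProper := H.isProper
      isReduced := H.isReduced
      line_over := fun j => by rw [Category.assoc, H.line_over, he]
      line_closed := fun j => by
        have := H.line_closed j
        infer_instance
      cover := fun x => by
        obtain ⟨j, hj⟩ := H.cover x
        exact ⟨j, by rwa [hr]⟩
      poleMinus_closed := fun _ => isClosed_point (P1.pt_toSpec 0 0)
      polePlus_closed := fun _ => isClosed_point (P1.pt_toSpec 1 0)
      poles_ne := fun _ => hp
      disjoint := fun i j h => by rw [hr, hr]; exact H.disjoint i j h
      pole_eq := fun j => by rw [hc1, hc0, H.pole_eq]
      inter := fun j => by rw [hr, hr, hc1, H.inter]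
      transversal := fun j => by
        have := H.transversal j
        have := pullback.map_isIso ((e j.castSucc).hom ≫ line j.castSucc)
          ((e j.succ).hom ≫ line j.succ) (line j.castSucc) (line j.succ) (e j.castSucc).hom (e j.succ).hom (𝟙 _)
          (by simp) (by simp)
        exact isReduced_of_isOpenImmersion (pullback.map ((e j.castSucc).hom ≫ line j.castSucc)
          ((e j.succ).hom ≫ line j.succ) (line j.castSucc) (line j.succ) (e j.castSucc).hom (e j.succ).hom (𝟙 _)
          (by simp) (by simp))
      sMinus_over := H.sMinus_over
      sPlus_over := H.sPlus_over
      s_over := H.s_over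
      sMinus_eq := by rw [hc0, H.sMinus_eq]
      sPlus_eq := by rw [hc1, H.sPlus_eq]
      s_ne := fun i j => by rw [hc0, hc1]; exact H.s_ne i j
      stable := fun j => by rw [hr]; exact H.stable j }⟩

variable (K) in
theorem IsAnCurve.exists_lineChain {k : Type u} [Field k] [Algebra k K] {C : Scheme.{u}}
    {π : C ⟶ Spec (CommRingCat.of k)} {sMinus sPlus : Spec (CommRingCat.of k) ⟶ C} {n : ℕ}
    {s : Fin (n + 1) → (Spec (CommRingCat.of k) ⟶ C)} (H : IsAnCurve π sMinus sPlus s) :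
    ∃ (m : ℕ) (line : Fin (m + 1) → (P1 K ⟶ bc K π)) (c : Fin (n + 1) → Fin (m + 1))
      (a : Fin (n + 1) → K), IsLineChain π sMinus sPlus s line c a := by
  obtain ⟨m, line, _, _, h⟩ := H.geometric K
  obtain ⟨line, h⟩ := h.exists_normalised
  have hinter : ∀ i j : Fin (m + 1), i < j → ∀ x y, line i x = line j y →
      i.1 + 1 = j.1 ∧ y = point (P1.pt 0 (0 : K)) := by
    intro i j hij x y hxy
    have h1 : i.1 + 1 = j.1 := by
      by_contra hne
      have := Fin.lt_def.1 hij
      exact Set.disjoint_left.1 (h.disjoint i j (by omega)) ⟨x, rfl⟩ ⟨y, hxy.symm⟩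
    refine ⟨h1, ?_⟩
    obtain ⟨l, rfl, rfl⟩ : ∃ l : Fin m, i = l.castSucc ∧ j = l.succ :=
      ⟨⟨i.1, by omega⟩, rfl, Fin.ext h1.symm⟩
    have h2 : line l.succ y ∈ Set.range (line l.castSucc) ∩ Set.range (line l.succ) :=
      ⟨⟨x, hxy⟩, ⟨y, rfl⟩⟩
    rw [h.inter, Set.mem_singleton_iff, h.pole_eq] at h2
    have := h.line_closed l.succ
    exact (line l.succ).isClosedEmbedding.injective h2
  have hmark : ∀ i j, point (baseChangeSection K (s i) (H.s_over i)) ∈ Set.range (line j) →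
      ∃ a : K, a ≠ 0 ∧ point (baseChangeSection K (s i) (H.s_over i)) =
        point (P1.pt 0 a ≫ line j) := by
    rintro i j ⟨y, hy⟩
    have := h.isProper
    have := h.line_closed j
    have h1 : y ≠ point (P1.pt 0 0) := fun e => (h.s_ne i j).1 (by rw [← hy, e])
    have h2 : y ≠ point (P1.pt 1 0) := fun e => (h.s_ne i j).2 (by rw [← hy, e])
    have h3 : IsClosed {y} := by
      have := (isClosed_point (h.s_over i)).preimage (line j).continuous
      convert this
      ext z
      constructor
      · rintro rfl; exact hy
      · intro hz; exact (line j).isClosedEmbedding.injective (Eq.trans hz hy.symm)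
    obtain ⟨b, r, rfl⟩ := P1.exists_pt_of_isClosed h3 h1
    rcases P1.pt_cases b r with e | ⟨r', e⟩
    · exact absurd (by rw [e]) h2
    · refine ⟨r', ?_, by rw [← hy, point_comp, e]⟩
      rintro rfl
      exact h1 (by rw [e])
  have hov : ∀ (t : Spec (CommRingCat.of K) ⟶ P1 K) (_ : t ≫ P1.toSpec K = 𝟙 _) j,
      (t ≫ line j) ≫ bcSnd K π = 𝟙 _ := fun t ht j => by rw [Category.assoc, h.line_over, ht]
  have hfst : ∀ (t : Spec (CommRingCat.of k) ⟶ C) (ht : t ≫ π = 𝟙 _), baseChangeSection K t ht ≫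
      bcFst K π = Spec.map (CommRingCat.ofHom (algebraMap k K)) ≫ t := fun t ht =>
    pullback.lift_fst _ _ _
  have hsnd : ∀ (t : Spec (CommRingCat.of k) ⟶ C) (ht : t ≫ π = 𝟙 _), baseChangeSection K t ht ≫
      bcSnd K π = 𝟙 _ := fun t ht => pullback.lift_snd _ _ _
  have h1 : ∀ i, ∃ j, ∃ a : K, a ≠ 0 ∧ point (baseChangeSection K (s i) (H.s_over i)) =
      point (P1.pt 0 a ≫ line j) := fun i => by
    obtain ⟨j, hj⟩ := h.cover (point (baseChangeSection K (s i) (H.s_over i)))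
    exact ⟨j, hmark i j hj⟩
  choose c a ha hca using h1
  refine ⟨m, line, c, a,
    { isProper := H.isProper
      isReduced := h.isReduced
      line_over := h.line_over
      line_closed := h.line_closed
      cover := h.cover
      node := fun j => eq_of_point_eq_self (hov _ (P1.pt_toSpec 0 0) _) (hov _ (P1.pt_toSpec 1 0) _)
        (by rw [point_comp, point_comp, h.pole_eq])
      inter := hinter
      transversal := h.transversal
      sMinus_over := H.sMinus_over
      sPlus_over := H.sPlus_over
      s_over := H.s_over
      minus := ?_
      plus := ?_
      marked := fun i => ?_
      ne_zero := ha
      stable := fun j => ?_ }⟩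
  · rw [← hfst sMinus H.sMinus_over, ← Category.assoc]
    congr 1
    exact eq_of_point_eq_self (hsnd _ _) (hov _ (P1.pt_toSpec 0 0) _)
      (by rw [point_comp, h.sMinus_eq])
  · rw [← hfst sPlus H.sPlus_over, ← Category.assoc]
    congr 1
    exact eq_of_point_eq_self (hsnd _ _) (hov _ (P1.pt_toSpec 1 0) _)
      (by rw [point_comp, h.sPlus_eq])
  · rw [← hfst (s i) (H.s_over i), ← Category.assoc]
    congr 1
    exact eq_of_point_eq_self (hsnd _ _) (hov _ (P1.pt_toSpec 0 _) _) (hca i).symm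
  · obtain ⟨i, y, hy⟩ := h.stable j
    refine ⟨i, ?_⟩
    rcases lt_trichotomy (c i) j with hlt | heq | hgt
    · have h2 := (hinter _ _ hlt (point (P1.pt 0 (a i))) y (by rw [hy, hca, point_comp])).2
      exact absurd (by rw [← hy, h2]) (h.s_ne i j).1
    · exact heq
    · have h2 := (hinter _ _ hgt y (point (P1.pt 0 (a i))) (by rw [hy, hca, point_comp])).2
      exact absurd (by rw [hca, point_comp, h2]) (h.s_ne i (c i)).1

end OfAnCurve

section Rational
variable {K : Type u} [Field K]

/-- The rational function `x / (x - a)` on the projective line. -/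
def P1.pole (a : K) : (P1 K).functionField := P1.x K / (P1.x K - P1.const a)

theorem P1.rat_X_sub (r : K) : P1.rat 0 (Polynomial.X - Polynomial.C r) = P1.x K - P1.const r := by
  rw [map_sub, P1.rat_C]
  rfl

theorem P1.x_sub_ne_zero (r : K) : P1.x K - P1.const r ≠ 0 := by
  rw [← P1.rat_X_sub]
  exact P1.rat_ne_zero (Polynomial.X_sub_C_ne_zero r)

theorem P1.hasVal_x_sub (a r : K) : HasVal (P1.pt 0 r) (P1.x K - P1.const a) (r - a) :=
  (P1.hasVal_x r).sub (P1.hasVal_const 0 r a)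

theorem P1.hasVal_pole {a r : K} (h : r ≠ a) : HasVal (P1.pt 0 r) (P1.pole a) (r / (r - a)) := by
  have := (P1.hasVal_x r).mul ((P1.hasVal_x_sub a r).inv (sub_ne_zero.2 h))
  rwa [← div_eq_mul_inv, ← div_eq_mul_inv] at this

theorem P1.hasVal_pole_infty (a : K) : HasVal (P1.pt 1 0) (P1.pole a) 1 := by
  have h1 := ((P1.hasVal_const 1 0 1).sub ((P1.hasVal_const 1 0 a).mul (P1.hasVal_x_inv 0))).inv
    (by simp)
  convert h1 using 1
  · rw [P1.pole, map_one]
    have hx := P1.x_ne_zero (k := K)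
    have hxa := P1.x_sub_ne_zero a
    have : 1 - P1.const a * (P1.x K)⁻¹ ≠ 0 := by
      intro h
      apply hxa
      have : P1.x K * (1 - P1.const a * (P1.x K)⁻¹) = 0 := by rw [h, mul_zero]
      rwa [mul_sub, mul_one, mul_left_comm, mul_inv_cancel₀ hx, mul_one] at this
    field_simp
  · simp

theorem P1.hasVal_pole_mul {a : K} {G : (P1 K).functionField} (h : HasVal (P1.pt 0 a) G 0) :
    ∃ c, HasVal (P1.pt 0 a) (G / (P1.x K - P1.const a)) c ∧
      HasVal (P1.pt 0 a) (P1.pole a * G) (a * c) := by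
  obtain ⟨c, hc⟩ := P1.hasVal_div h
  rw [P1.rat_X_sub] at hc
  refine ⟨c, hc, ?_⟩
  have := (P1.hasVal_x a).mul hc
  rwa [← mul_div_assoc, mul_div_right_comm] at this

theorem P1.forall_pt {P : (Spec (CommRingCat.of K) ⟶ P1 K) → Prop} (h : P (P1.pt 1 0))
    (h0 : ∀ r, P (P1.pt 0 r)) (b : Fin 2) (r : K) : P (P1.pt b r) := by
  rcases P1.pt_cases b r with e | ⟨r', e⟩
  · rwa [e]
  · rw [e]; exact h0 r'

/-- An open subset of the projective line that contains a point contains a rational point. -/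
theorem P1.mem_of_forall_pt [IsAlgClosed K] {U V : (P1 K).Opens}
    (h : ∀ b r, point (P1.pt b (r : K)) ∈ U → point (P1.pt b r) ∈ V) : U ≤ V := by
  intro x hx
  rcases P1.point_cases x with rfl | ⟨b, r, rfl⟩
  · by_contra hV
    have h1 : ∀ b r, point (P1.pt b (r : K)) ∉ U := fun b r h' =>
      hV (genericPoint_mem (h b r h'))
    obtain ⟨b, hb⟩ := exists_mem_chart (𝟙 (P1 K)) (genericPoint (P1 K))
    obtain ⟨f, hf, hfx⟩ := (P1.isAffineOpen_chart b).exists_basicOpen_le ⟨_, hx⟩ (P1.generic_mem b)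
    obtain ⟨p, rfl⟩ := P1.poly_surjective b f
    have hp : p ≠ 0 := by
      rintro rfl
      rw [map_zero, Scheme.basicOpen_zero] at hfx
      exact hfx
    obtain ⟨r, hr⟩ := Polynomial.exists_eval_ne_zero_of_natDegree_lt_card p hp
      ((Cardinal.natCast_lt_aleph0).trans_le (Cardinal.aleph0_le_mk K))
    refine h1 b r (hf ((mem_basicOpen_iff _ _ (P1.pt_mem_chart b r) _).2 ?_))
    rwa [P1.evalAt_poly]
  · exact h b r hx

/-- A rational function that is regular at all rational points of an open set is regular. -/
theorem P1.exists_section [IsAlgClosed K] (U : (P1 K).Opens) (hU : genericPoint (P1 K) ∈ U)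
    (F : (P1 K).functionField) (h : ∀ b r, point (P1.pt b (r : K)) ∈ U →
      ∃ c, HasVal (P1.pt b r) F c) : ∃ f : Γ(P1 K, U), fn U hU f = F := by
  let ι := {V : (P1 K).Opens // V ≤ U ∧ ∃ (h : genericPoint (P1 K) ∈ V) (f : Γ(P1 K, V)), fn V h f = F}
  let V : ι → (P1 K).Opens := fun i => i.1
  choose hV f hf using fun i : ι => i.2.2
  have hcover : U ≤ iSup V := P1.mem_of_forall_pt fun b r hb => by
    obtain ⟨c, W, hW, f, hf, -⟩ := h b r hb
    exact TopologicalSpace.Opens.mem_iSup.2 ⟨⟨U ⊓ W, inf_le_left, genericPoint_mem ⟨hb, hW⟩,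
      res inf_le_right f, by rw [fn_res, hf]⟩, ⟨hb, hW⟩⟩
  obtain ⟨s, hs, -⟩ := (P1 K).sheaf.existsUnique_gluing' V U (fun i => homOfLE i.2.1) hcover f
    (fun i j => by
      change res inf_le_left (f i) = res inf_le_right (f j)
      have hij : genericPoint (P1 K) ∈ V i ⊓ V j := ⟨hV i, hV j⟩
      apply fn_injective _ hij
      rw [fn_res, fn_res, hf, hf])
  refine ⟨s, ?_⟩
  obtain ⟨i, -⟩ := TopologicalSpace.Opens.mem_iSup.1 (hcover hU)
  rw [← hf i]
  have : res i.2.1 s = f i := hs i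
  rw [← this]
  exact (fn_res i.2.1 (hV i) s).symm

end Rational

/-- The `j`-th component of a chain of projective lines, as a morphism to the underlying curve. -/
abbrev comp {k : Type u} [Field k] {K : Type u} [Field K] [Algebra k K] {C : Scheme.{u}}
    {π : C ⟶ Spec (CommRingCat.of k)} {m : ℕ} (line : Fin (m + 1) → (P1 K ⟶ bc K π))
    (j : Fin (m + 1)) : P1 K ⟶ C :=
  line j ≫ bcFst K π

/-- The rational function on the `j`-th component by which the section with coefficients `κ`, `γ` of
the line bundle of a point with coordinate `a` on the `i`-th component is a multiple of the
canonical section. -/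
def coeff {K : Type u} [Field K] {m : ℕ} (i j : Fin (m + 1)) (a κ γ : K) : (P1 K).functionField :=
  if j < i then P1.const κ else if i < j then P1.const (κ + γ) else
    P1.const κ + P1.const γ * P1.pole a

section Coeff
variable {K : Type u} [Field K] {m : ℕ} {i j : Fin (m + 1)} {a κ γ κ' γ' : K}

theorem coeff_add : coeff i j a (κ + κ') (γ + γ') = coeff i j a κ γ + coeff i j a κ' γ' := by
  unfold coeff
  split_ifs <;> simp only [map_add] <;> ring

theorem coeff_mul (r : K) : coeff i j a (r * κ) (r * γ) = P1.const r * coeff i j a κ γ := by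
  unfold coeff
  split_ifs <;> simp only [map_add, map_mul] <;> ring

theorem hasVal_coeff_of_lt (h : j < i) (b : Fin 2) (r : K) :
    HasVal (P1.pt b r) (coeff i j a κ γ) κ := by
  rw [coeff, if_pos h]
  exact P1.hasVal_const b r κ

theorem hasVal_coeff_of_gt (h : i < j) (b : Fin 2) (r : K) :
    HasVal (P1.pt b r) (coeff i j a κ γ) (κ + γ) := by
  rw [coeff, if_neg h.not_gt, if_pos h]
  exact P1.hasVal_const b r _

theorem hasVal_coeff_self {r : K} (h : r ≠ a) :
    HasVal (P1.pt 0 r) (coeff i i a κ γ) (κ + γ * (r / (r - a))) := by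
  rw [coeff, if_neg (lt_irrefl _), if_neg (lt_irrefl _)]
  exact (P1.hasVal_const 0 r κ).add ((P1.hasVal_const 0 r γ).mul (P1.hasVal_pole h))

theorem hasVal_coeff_zero (ha : a ≠ 0) (h : j ≤ i) : HasVal (P1.pt 0 0) (coeff i j a κ γ) κ := by
  rcases h.lt_or_eq with h | rfl
  · exact hasVal_coeff_of_lt h 0 0
  · exact (hasVal_coeff_self ha.symm).congr (by simp)

theorem hasVal_coeff_infty (h : i ≤ j) : HasVal (P1.pt 1 0) (coeff i j a κ γ) (κ + γ) := by
  rcases h.lt_or_eq with h | rfl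
  · exact hasVal_coeff_of_gt h 1 0
  · rw [coeff, if_neg (lt_irrefl _), if_neg (lt_irrefl _)]
    exact ((P1.hasVal_const 1 0 κ).add ((P1.hasVal_const 1 0 γ).mul (P1.hasVal_pole_infty a))).congr
      (by simp)

/-- Outside the marked point, the coefficient functions are regular. -/
theorem exists_hasVal_coeff (b : Fin 2) (r : K) (h : i = j → P1.pt b r ≠ P1.pt 0 a) :
    ∃ v, HasVal (P1.pt b r) (coeff i j a κ γ) v := by
  rcases lt_trichotomy i j with hij | rfl | hij
  · exact ⟨_, hasVal_coeff_of_gt hij b r⟩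
  · revert h
    refine P1.forall_pt (P := fun p => (i = i → p ≠ P1.pt 0 a) → ∃ v, HasVal p _ v) ?_ ?_ b r
    · exact fun _ => ⟨_, hasVal_coeff_infty le_rfl⟩
    · exact fun r h => ⟨_, hasVal_coeff_self fun e => h rfl (by rw [e])⟩
  · exact ⟨_, hasVal_coeff_of_lt hij b r⟩

end Coeff

namespace IsLineChain
variable {k : Type u} [Field k] {K : Type u} [Field K] [Algebra k K] {C : Scheme.{u}}
    {π : C ⟶ Spec (CommRingCat.of k)} {sMinus sPlus : Spec (CommRingCat.of k) ⟶ C} {n : ℕ}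
    {s : Fin (n + 1) → (Spec (CommRingCat.of k) ⟶ C)} {m : ℕ} {line : Fin (m + 1) → (P1 K ⟶ bc K π)}
    {c : Fin (n + 1) → Fin (m + 1)} {a : Fin (n + 1) → K}
    (H : IsLineChain π sMinus sPlus s line c a)
include H

theorem comp_over (j : Fin (m + 1)) :
    comp line j ≫ π = P1.toSpec K ≫ Spec.map (CommRingCat.ofHom (algebraMap k K)) := by
  rw [Category.assoc, pullback.condition, ← Category.assoc, H.line_over]

/-- Points of the chain that agree in the curve with a rational point. -/
theorem eq_of_point_eq {t t' : Spec (CommRingCat.of K) ⟶ P1 K} (ht : t ≫ P1.toSpec K = 𝟙 _)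
    (ht' : t' ≫ P1.toSpec K = 𝟙 _) {j j' : Fin (m + 1)} {s : Spec (CommRingCat.of k) ⟶ C}
    (hs : s ≫ π = 𝟙 _)
    (e' : t' ≫ comp line j' = Spec.map (CommRingCat.ofHom (algebraMap k K)) ≫ s)
    (e : point (t ≫ comp line j) = point s) : t ≫ line j = t' ≫ line j' := by
  apply pullback.hom_ext
  · rw [Category.assoc, Category.assoc]
    refine Eq.trans ?_ e'.symm
    refine LosevManin.eq_of_point_eq hs ?_ e
    rw [Category.assoc, H.comp_over, ← Category.assoc, ht, Category.id_comp]
  · rw [Category.assoc, Category.assoc]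
    change t ≫ line j ≫ bcSnd K π = t' ≫ line j' ≫ bcSnd K π
    rw [H.line_over, H.line_over, ht, ht']

theorem line_injective {j : Fin (m + 1)} {t t' : Spec (CommRingCat.of K) ⟶ P1 K}
    (h : t ≫ line j = t' ≫ line j) : t = t' := by
  have := H.line_closed j
  exact (cancel_mono (line j)).1 h

theorem node_cases {i j : Fin (m + 1)} (hij : i < j) {t t' : Spec (CommRingCat.of K) ⟶ P1 K}
    (ht' : t' ≫ P1.toSpec K = 𝟙 _)
    (h : t ≫ line i = t' ≫ line j) : i.1 + 1 = j.1 ∧ t = P1.pt 1 0 ∧ t' = P1.pt 0 0 := by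
  have h1 := H.inter i j hij (point t) (point t') (by rw [← point_comp, ← point_comp, h])
  have h2 : t' = P1.pt 0 0 := eq_of_point_eq_self (P1.pt_toSpec 0 0) ht' h1.2
  refine ⟨h1.1, ?_, h2⟩
  obtain ⟨l, rfl, rfl⟩ : ∃ l : Fin m, i = l.castSucc ∧ j = l.succ :=
    ⟨⟨i.1, by omega⟩, rfl, Fin.ext h1.1.symm⟩
  rw [h2, ← H.node] at h
  exact H.line_injective h

theorem marked_unique {j : Fin (m + 1)} {i : Fin (n + 1)} {b : Fin 2} {r : K}
    (e : point (P1.pt b r ≫ comp line j) = point (s i)) : c i = j ∧ P1.pt b r = P1.pt 0 (a i) := by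
  have h := H.eq_of_point_eq (P1.pt_toSpec b r) (P1.pt_toSpec 0 (a i)) (H.s_over i) (H.marked i) e
  rcases lt_trichotomy (c i) j with hlt | rfl | hgt
  · have := (H.node_cases hlt (P1.pt_toSpec _ _) h.symm).2.1
    exact absurd (this ▸ P1.pt_mem_chart 0 (a i)) P1.point_pt_one_notMem
  · exact ⟨rfl, H.line_injective h⟩
  · have := (H.node_cases hgt (P1.pt_toSpec _ _) h).2.2
    exact absurd (P1.pt_injective 0 this) (H.ne_zero i)

theorem pt_minus_ne {i : Fin (n + 1)} : P1.pt 0 0 ≠ P1.pt 0 (a i) := fun h =>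
  H.ne_zero i (P1.pt_injective 0 h).symm

omit H in
theorem pt_plus_ne (a : K) : P1.pt 1 0 ≠ P1.pt 0 a := fun h =>
  P1.point_pt_one_notMem (h ▸ P1.pt_mem_chart 0 a)

omit H in
theorem mem_comp {j : Fin (m + 1)} {s : Spec (CommRingCat.of k) ⟶ C}
    {t : Spec (CommRingCat.of K) ⟶ P1 K}
    (e : t ≫ comp line j = Spec.map (CommRingCat.ofHom (algebraMap k K)) ≫ s) {W : C.Opens} :
    point (t ≫ comp line j) ∈ W ↔ point s ∈ W := by
  rw [e, point_specMap]

omit H in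
theorem hasVal_rational {j : Fin (m + 1)} {s : Spec (CommRingCat.of k) ⟶ C} (hs : s ≫ π = 𝟙 _)
    {t : Spec (CommRingCat.of K) ⟶ P1 K}
    (e : t ≫ comp line j = Spec.map (CommRingCat.ofHom (algebraMap k K)) ≫ s) {W : C.Opens}
    (h : point s ∈ W) (h') (g : Γ(C, W)) :
    HasVal t (lineFn (comp line j) W h' g) (algebraMap k K (evalAt s W h g)) := by
  have h1 : point (t ≫ comp line j) ∈ W := (mem_comp e).2 h
  have h2 := hasVal_lineFn (comp line j) t h1 h' g
  refine h2.congr ?_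
  refine evalAt_eq_of_point_eq hs ?_ h h1 (by rw [e, point_specMap]) g
  rw [e, Category.assoc, hs, Category.comp_id]

/-- Around a point different from the `i`-th marked point, the ideal of the latter is trivial. -/
theorem exists_affine_of_ne {x : C} {i : Fin (n + 1)} (h : x ≠ point (s i)) :
    ∃ W : C.affineOpens, x ∈ W.1 ∧ ∀ g, g ∈ (Scheme.Hom.ker (s i)).ideal W := by
  have := H.isProper
  have h1 := isClosed_point (H.s_over i)
  obtain ⟨_, ⟨W, hW, rfl⟩, hx, hWs⟩ := C.isBasis_affineOpens.exists_subset_of_mem_open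
    (show x ∈ ({point (s i)}ᶜ : Set C) from h) h1.isOpen_compl
  exact ⟨⟨W, hW⟩, hx, fun g => (mem_ker_iff _ _ _).2 fun hs => absurd rfl (hWs hs)⟩

theorem evalAt_ideal {i : Fin (n + 1)} {W : C.affineOpens} {g : Γ(C, W)}
    (hg : g ∈ (Scheme.Hom.ker (s i)).ideal W) (h : point (s i) ∈ W.1) (h') :
    HasVal (P1.pt 0 (a i)) (lineFn (comp line (c i)) W h' g) 0 :=
  (hasVal_rational (H.s_over i) (H.marked i) h h' g).congr (by
    rw [(mem_ker_iff _ _ _).1 hg h, map_zero])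

end IsLineChain

theorem scalar_comp_specMap {k : Type u} [Field k] {K : Type u} [Field K] {X : Scheme.{u}}
    (f : X ⟶ Spec (CommRingCat.of K)) (φ : k →+* K) (W : X.Opens) (r : k) :
    scalar (f ≫ Spec.map (CommRingCat.ofHom φ)) W r = scalar f W (φ r) := by
  rw [← appLE_scalar (Spec.map (CommRingCat.ofHom φ)) f ⊤ W (by simp)]
  have h1 : scalar (Spec.map (CommRingCat.ofHom φ)) ⊤ r =
      (Scheme.ΓSpecIso (CommRingCat.of K)).inv.hom (φ r) := by
    have h2 := congrArg (fun g => g.hom r) (Scheme.ΓSpecIso_inv_naturality (CommRingCat.ofHom φ))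
    refine Eq.trans ?_ h2.symm
    exact congrArg (fun g => g.hom ((Scheme.ΓSpecIso (CommRingCat.of k)).inv.hom r))
      (Scheme.Hom.appLE_eq_app (Spec.map (CommRingCat.ofHom φ)))
  rw [h1]
  rfl

namespace IsLineChain
variable {k : Type u} [Field k] {K : Type u} [Field K] [Algebra k K] {C : Scheme.{u}}
    {π : C ⟶ Spec (CommRingCat.of k)} {sMinus sPlus : Spec (CommRingCat.of k) ⟶ C} {n : ℕ}
    {s : Fin (n + 1) → (Spec (CommRingCat.of k) ⟶ C)} {m : ℕ} {line : Fin (m + 1) → (P1 K ⟶ bc K π)}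
    {c : Fin (n + 1) → Fin (m + 1)} {a : Fin (n + 1) → K}
    (H : IsLineChain π sMinus sPlus s line c a)
include H

theorem lineFn_comp_scalar (j : Fin (m + 1)) (W : C.Opens) (h) (r : k) :
    lineFn (comp line j) W h (scalar π W r) = P1.const (algebraMap k K r) := by
  rw [← P1.fn_scalar _ h, ← scalar_comp_specMap, ← H.comp_over j,
    ← appLE_scalar π (comp line j) W _ le_rfl]
  rfl

theorem exists_uniformizer (i : Fin (n + 1)) : ∃ (W : C.affineOpens) (_ : point (s i) ∈ W.1)
    (h' : _) (g : Γ(C, W)) (_ : g ∈ (Scheme.Hom.ker (s i)).ideal W) (d : K) (_ : d ≠ 0),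
    HasVal (P1.pt 0 (a i))
      (lineFn (comp line (c i)) W.1 h' g / (P1.x K - P1.const (a i))) d := by
  obtain ⟨_, ⟨W, hW, rfl⟩, hs, -⟩ := C.isBasis_affineOpens.exists_subset_of_mem_open
    (Set.mem_univ (point (s i))) isOpen_univ
  have ht : point (P1.pt 0 (a i) ≫ comp line (c i)) ∈ W := (mem_comp (H.marked i)).2 hs
  have h' : genericPoint (P1 K) ∈ comp line (c i) ⁻¹ᵁ W := generic_mem_preimage ht
  have ht' : point (P1.pt 0 (a i) ≫ line (c i)) ∈ bcFst K π ⁻¹ᵁ W := by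
    have := ht
    rw [← Category.assoc, point_comp] at this
    exact this
  have ht'' : point (P1.pt 0 (a i)) ∈ line (c i) ⁻¹ᵁ bcFst K π ⁻¹ᵁ W := by
    have := ht'
    rw [point_comp] at this
    exact this
  have h'' : genericPoint (P1 K) ∈ line (c i) ⁻¹ᵁ bcFst K π ⁻¹ᵁ W := h'
  by_contra hcon
  have h0 : ∀ g ∈ (Scheme.Hom.ker (s i)).ideal ⟨W, hW⟩, HasVal (P1.pt 0 (a i))
      (lineFn (comp line (c i)) W h' g / (P1.x K - P1.const (a i))) 0 := by
    intro g hg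
    obtain ⟨d, hd, -⟩ := P1.hasVal_pole_mul (H.evalAt_ideal hg hs h')
    by_cases hd0 : d = 0
    · rwa [hd0] at hd
    · exact absurd ⟨⟨W, hW⟩, hs, h', g, hg, d, hd0, hd⟩ hcon
  have h1 : ∀ F : Γ(bc K π, bcFst K π ⁻¹ᵁ W), HasVal (P1.pt 0 (a i))
      ((lineFn (line (c i)) _ h'' F - P1.const (evalAt _ _ ht' F)) / (P1.x K - P1.const (a i))) 0 := by
    intro F
    induction F using bc_induction K π hW with
    | h g r =>
      have h2 := h0 (g - scalar π W (evalAt (s i) W hs g)) ((mem_ker_iff _ _ _).2 fun _ => by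
        rw [map_sub, evalAt_scalar_self (H.s_over i), sub_self])
      have h3 := (P1.hasVal_const 0 (a i) r).mul h2
      rw [mul_zero, map_sub, H.lineFn_comp_scalar] at h3
      have h4 : evalAt (P1.pt 0 (a i) ≫ comp line (c i)) W ht g =
          algebraMap k K (evalAt (s i) W hs g) :=
        ((hasVal_lineFn _ _ ht h' g).unique (hasVal_rational (H.s_over i) (H.marked i) hs h' g))
      have h5 : evalAt _ _ ht' (pb (bcFst K π) W g) = algebraMap k K (evalAt (s i) W hs g) :=
        (evalAt_pb _ _ ht' ht g).trans h4
      have h6 : lineFn (line (c i)) _ h'' (pb (bcFst K π) W g) = lineFn (comp line (c i)) W h' g :=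
        lineFn_pb _ _ _ _ _
      rw [map_mul, h6, lineFn_scalar (H.line_over (c i)), map_mul,
        evalAt_scalar_self (by rw [Category.assoc, H.line_over, P1.pt_toSpec]), map_mul, h5]
      convert h3 using 1
      ring
    | hadd F G hF hG =>
      have := hF.add hG
      rw [add_zero] at this
      convert this using 1
      rw [map_add, map_add, map_add]
      ring
  have := H.line_closed (c i)
  have hO := (isAffineOpen_bc (K := K) (π := π) hW).preimage (line (c i))
  obtain ⟨f, hf, hfx⟩ := hO.exists_basicOpen_le ⟨_, P1.pt_mem_chart 0 (a i)⟩ ht''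
  have := hO.isLocalization_basicOpen f
  obtain ⟨N, y, hy⟩ := IsLocalization.Away.surj f
    (res hf (P1.poly (k := K) 0 (Polynomial.X - Polynomial.C (a i))))
  obtain ⟨F, hF⟩ := pb_surjective (line (c i)) (isAffineOpen_bc (K := K) (π := π) hW) y
  have hy' : res ((P1 K).basicOpen_le f) y = res hf (P1.poly (k := K) 0 (Polynomial.X - Polynomial.C (a i))) *
    res ((P1 K).basicOpen_le f) f ^ N := hy.symm
  have hgen : genericPoint (P1 K) ∈ (P1 K).basicOpen f := genericPoint_mem hfx
  have h2 : lineFn (line (c i)) _ h'' F = (P1.x K - P1.const (a i)) * fn _ h'' f ^ N := by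
    change fn _ _ (pb (line (c i)) _ F) = _
    rw [hF, ← fn_res ((P1 K).basicOpen_le f) hgen, hy', map_mul, map_pow, fn_res, fn_res,
      ← P1.rat_X_sub]
    rfl
  have h3 : evalAt _ _ ht' F = 0 := by
    refine (hasVal_lineFn (line (c i)) _ ht' h'' F).unique ?_
    rw [h2]
    have := (P1.hasVal_x_sub (a i) (a i)).mul
      (hasVal_fn (P1.pt 0 (a i)) _ ht'' h'' (f ^ N))
    rw [sub_self, zero_mul, map_pow] at this
    exact this
  have h4 := h1 F
  rw [h3, map_zero, sub_zero, h2, mul_div_cancel_left₀ _ (P1.x_sub_ne_zero _), ← map_pow] at h4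
  have h5 := h4.unique (hasVal_fn (P1.pt 0 (a i)) _ ht'' h'' (f ^ N))
  rw [map_pow] at h5
  exact pow_ne_zero N ((mem_basicOpen_iff _ _ ht'' f).1 hfx) h5.symm

omit H in
theorem app_mul_comm {i : Fin (n + 1)} (σ : H0 π (Scheme.Hom.ker (s i))) (j : Fin (m + 1))
    (W W' : C.affineOpens) (h h') (g : (Scheme.Hom.ker (s i)).ideal W)
    (g' : (Scheme.Hom.ker (s i)).ideal W') :
    lineFn (comp line j) W.1 h (σ.app W g) * lineFn (comp line j) W'.1 h' g'.1 =
      lineFn (comp line j) W'.1 h' (σ.app W' g') * lineFn (comp line j) W.1 h g.1 := by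
  obtain ⟨_, ⟨V, hV, rfl⟩, hx, hVW⟩ := C.isBasis_affineOpens.exists_subset_of_mem_open
    (show comp line j (genericPoint (P1 K)) ∈ ((W.1 ⊓ W'.1 : C.Opens) : Set C) from ⟨h, h'⟩)
    (W.1 ⊓ W'.1).isOpen
  have h1 : V ≤ W.1 := fun x hx => (hVW hx).1
  have h2 : V ≤ W'.1 := fun x hx => (hVW hx).2
  have hx' : genericPoint (P1 K) ∈ comp line j ⁻¹ᵁ V := hx
  have e1 := σ.compat ⟨V, hV⟩ W h1 g
  have e2 := σ.compat ⟨V, hV⟩ W' h2 g'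
  rw [← lineFn_res _ h1 hx', ← lineFn_res _ h1 hx', ← lineFn_res _ h2 hx', ← lineFn_res _ h2 hx']
  refine (map_mul _ _ _).symm.trans (Eq.trans ?_ (map_mul _ _ _))
  congr 1
  refine (congrArg (· * res h2 g'.1) e1).trans (Eq.trans ?_ (congrArg (· * res h1 g.1) e2).symm)
  have := (σ.app ⟨V, hV⟩).map_smul (res h2 g'.1) ⟨_, (Scheme.Hom.ker (s i)).ideal_le_comap_ideal h1 g.2⟩
  have h3 := (σ.app ⟨V, hV⟩).map_smul (res h1 g.1) ⟨_, (Scheme.Hom.ker (s i)).ideal_le_comap_ideal h2 g'.2⟩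
  rw [smul_eq_mul] at this h3
  rw [mul_comm, mul_comm _ (res h1 g.1)]
  refine this.symm.trans (Eq.trans ?_ h3)
  congr 1
  exact Subtype.ext (mul_comm _ _)

/-- A section `σ` of the line bundle of the `i`-th marked point has coefficients `κ`, `γ`. -/
def HasCoeffs (line : Fin (m + 1) → (P1 K ⟶ bc K π)) (j₀ : Fin (m + 1)) (a₀ : K)
    {I : C.IdealSheafData} (σ : H0 π I) (κ γ : k) : Prop :=
  ∀ j (W : C.affineOpens) h (g : I.ideal W), lineFn (comp line j) W.1 h (σ.app W g) =
    coeff j₀ j a₀ (algebraMap k K κ) (algebraMap k K γ) * lineFn (comp line j) W.1 h g.1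

/-- Near a point of a component that is not the `i`-th marked point, a section of the line bundle is
a regular function. -/
theorem exists_regular {i : Fin (n + 1)} (σ : H0 π (Scheme.Hom.ker (s i))) {x : C}
    (hx : x ≠ point (s i)) : ∃ (W : C.affineOpens) (_ : x ∈ W.1) (f : Γ(C, W)),
    ∀ j h, ∃ g : (Scheme.Hom.ker (s i)).ideal W, σ.app W g = f ∧ lineFn (comp line j) W.1 h g.1 = 1 := by
  obtain ⟨W, hW, h1⟩ := H.exists_affine_of_ne hx
  exact ⟨W, hW, σ.app W ⟨1, h1 1⟩, fun j h => ⟨⟨1, h1 1⟩, rfl, map_one _⟩⟩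

theorem exists_coeffs_aux [IsAlgClosed K] {i : Fin (n + 1)} (σ : H0 π (Scheme.Hom.ker (s i)))
    {j : Fin (m + 1)} {F : (P1 K).functionField}
    (hF : ∀ (W : C.affineOpens) h (g : (Scheme.Hom.ker (s i)).ideal W),
      lineFn (comp line j) W.1 h (σ.app W g) = F * lineFn (comp line j) W.1 h g.1) :
    ∃ κ γ, F = coeff (c i) j (a i) κ γ := by
  have hreg : ∀ b r, (c i = j → P1.pt b r ≠ P1.pt 0 (a i)) → ∃ v, HasVal (P1.pt b r) F v := by
    intro b r hbr
    have hne : point (P1.pt b r ≫ comp line j) ≠ point (s i) := fun e =>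
      hbr (H.marked_unique e).1 (H.marked_unique e).2
    obtain ⟨W, hW, f, hf⟩ := H.exists_regular σ hne
    obtain ⟨g, hg, hg1⟩ := hf j (generic_mem_preimage hW)
    have := hF W (generic_mem_preimage hW) g
    rw [hg, hg1, mul_one] at this
    exact ⟨_, this ▸ hasVal_lineFn _ _ hW _ _⟩
  by_cases hj : c i = j
  · subst hj
    obtain ⟨W, hs, h', g, hg, d, hd, hgd⟩ := H.exists_uniformizer i
    have hG := P1.x_sub_ne_zero (a i)
    obtain ⟨ρ, hρ⟩ : ∃ ρ, HasVal (P1.pt 0 (a i)) ((P1.x K - P1.const (a i)) * F) ρ := by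
      have h1 := hasVal_lineFn (comp line (c i)) (P1.pt 0 (a i)) ((mem_comp (H.marked i)).2 hs) h'
        (σ.app W ⟨g, hg⟩)
      have h2 := h1.mul (hgd.inv hd)
      rw [hF W h' ⟨g, hg⟩] at h2
      have h3 := hgd.ne_zero hd
      have h4 : lineFn (comp line (c i)) W.1 h' g ≠ 0 := fun h => h3 (by rw [h, zero_div])
      have h5 : (P1.x K - P1.const (a i)) * F = F * lineFn (comp line (c i)) W.1 h' g *
          (lineFn (comp line (c i)) W.1 h' g / (P1.x K - P1.const (a i)))⁻¹ := by
        field_simp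
      exact ⟨_, h5 ▸ h2⟩
    obtain ⟨e, he⟩ := P1.hasVal_div ((hρ.sub (P1.hasVal_const 0 (a i) ρ)).congr (sub_self ρ))
    rw [P1.rat_X_sub] at he
    have hpole : P1.pole (a i) = 1 + P1.const (a i) / (P1.x K - P1.const (a i)) := by
      rw [P1.pole]; field_simp; ring
    have ha : P1.const (a i) ≠ 0 := fun h => H.ne_zero i ((map_eq_zero _).1 h)
    have hkey : ((P1.x K - P1.const (a i)) * F - P1.const ρ) / (P1.x K - P1.const (a i)) =
        F + P1.const (ρ / a i) - P1.const (ρ / a i) * P1.pole (a i) := by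
      rw [hpole, map_div₀]; field_simp; ring
    rw [hkey] at he
    obtain ⟨μ, hμ⟩ := P1.eq_const_of_regular
      (F := F + P1.const (ρ / a i) - P1.const (ρ / a i) * P1.pole (a i)) (by
      intro b r
      by_cases hbr : P1.pt b r = P1.pt 0 (a i)
      · rw [hbr]; exact ⟨e, he⟩
      · obtain ⟨v, hv⟩ := hreg b r fun _ => hbr
        obtain ⟨w, hw⟩ := exists_hasVal_coeff (i := c i) (j := c i) (κ := 0) (γ := ρ / a i) b r
          fun _ => hbr
        rw [coeff, if_neg (lt_irrefl _), if_neg (lt_irrefl _), map_zero, zero_add] at hw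
        exact ⟨_, (hv.add (P1.hasVal_const b r _)).sub hw⟩)
    refine ⟨μ - ρ / a i, ρ / a i, ?_⟩
    rw [coeff, if_neg (lt_irrefl _), if_neg (lt_irrefl _), map_sub, ← hμ]
    ring
  · obtain ⟨μ, hμ⟩ := P1.eq_const_of_regular fun b r => hreg b r fun h => absurd h hj
    refine ⟨μ, 0, ?_⟩
    rw [hμ, coeff]
    rcases lt_or_gt_of_ne hj with h | h
    · rw [if_neg h.not_gt, if_pos h, add_zero]
    · rw [if_pos h]

theorem exists_ratio {i : Fin (n + 1)} (σ : H0 π (Scheme.Hom.ker (s i))) :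
    ∃ F : Fin (m + 1) → (P1 K).functionField,
      (∀ j (W : C.affineOpens) h (g : (Scheme.Hom.ker (s i)).ideal W),
        lineFn (comp line j) W.1 h (σ.app W g) = F j * lineFn (comp line j) W.1 h g.1) ∧
      ∀ j b r, P1.pt b r ≠ P1.pt 0 (a i) →
        ∃ (W : C.affineOpens) (_ : point (P1.pt b r ≫ comp line j) ∈ W.1) (f : Γ(C, W)),
          ∀ j' h, F j' = lineFn (comp line j') W.1 h f := by
  have h2 : ∀ j b r, P1.pt b r ≠ P1.pt 0 (a i) → point (P1.pt b r ≫ comp line j) ≠ point (s i) :=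
    fun j b r hbr e => hbr (H.marked_unique e).2
  have h1 : ∀ j, ∃ F, ∀ (W : C.affineOpens) h (g : (Scheme.Hom.ker (s i)).ideal W),
      lineFn (comp line j) W.1 h (σ.app W g) = F * lineFn (comp line j) W.1 h g.1 := by
    intro j
    obtain ⟨W, hW, f, hf⟩ := H.exists_regular σ (h2 j 1 0 (pt_plus_ne _))
    obtain ⟨g, hg, hg1⟩ := hf j (generic_mem_preimage hW)
    refine ⟨lineFn (comp line j) W.1 (generic_mem_preimage hW) f, fun W' h' g' => ?_⟩
    have := app_mul_comm σ j W' W h' (generic_mem_preimage hW) g' g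
    rwa [hg1, mul_one, hg] at this
  choose F hF using h1
  refine ⟨F, hF, fun j b r hbr => ?_⟩
  obtain ⟨W, hW, f, hf⟩ := H.exists_regular σ (h2 j b r hbr)
  refine ⟨W, hW, f, fun j' h => ?_⟩
  obtain ⟨g, hg, hg1⟩ := hf j' h
  have := hF j' W h g
  rw [hg, hg1, mul_one] at this
  exact this.symm

omit H in
theorem eq_coeff {i : Fin (m + 1)} {a : K} (ha : a ≠ 0) {F : Fin (m + 1) → (P1 K).functionField}
    (hF : ∀ j, ∃ κ γ, F j = coeff i j a κ γ) {N P : Fin (m + 1) → K}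
    (hN : ∀ j, HasVal (P1.pt 0 0) (F j) (N j)) (hP : ∀ j, HasVal (P1.pt 1 0) (F j) (P j))
    (hnode : ∀ l : Fin m, P l.castSucc = N l.succ) (j : Fin (m + 1)) :
    F j = coeff i j a (N 0) (P (Fin.last m) - N 0) := by
  choose κ γ hκγ using hF
  have hN' : ∀ j ≤ i, N j = κ j := fun j h =>
    (hN j).unique (by rw [hκγ]; exact hasVal_coeff_zero ha h)
  have hP' : ∀ j, i ≤ j → P j = κ j + γ j := fun j h =>
    (hP j).unique (by rw [hκγ]; exact hasVal_coeff_infty h)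
  have hlt : ∀ j, j < i → P j = κ j := fun j h =>
    (hP j).unique (by rw [hκγ]; exact hasVal_coeff_of_lt h 1 0)
  have hgt : ∀ j, i < j → N j = κ j + γ j := fun j h =>
    (hN j).unique (by rw [hκγ]; exact hasVal_coeff_of_gt h 0 0)
  have hN0 : ∀ j, j ≤ i → N j = N 0 := by
    intro j
    induction j using Fin.induction with
    | zero => exact fun _ => rfl
    | succ l ih =>
      intro h
      have hl : l.castSucc < i := lt_of_lt_of_le Fin.castSucc_lt_succ h
      rw [← hnode, hlt _ hl, ← hN' _ hl.le, ih hl.le]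
  have hPm : ∀ j, i ≤ j → P j = P (Fin.last m) := by
    intro j
    induction j using Fin.reverseInduction with
    | last => exact fun _ => rfl
    | cast l ih =>
      intro h
      have hl : i < l.succ := lt_of_le_of_lt h Fin.castSucc_lt_succ
      rw [hnode, hgt _ hl, ← hP' _ hl.le, ih hl.le]
  rw [hκγ]
  rcases lt_trichotomy j i with h | rfl | h
  · rw [coeff, coeff, if_pos h, if_pos h, ← hN' j h.le, hN0 j h.le]
  · rw [← hN0 j le_rfl, ← hPm j le_rfl, hN' j le_rfl, hP' j le_rfl, add_sub_cancel_left]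
  · rw [coeff, coeff, if_neg h.not_gt, if_neg h.not_gt, if_pos h, if_pos h, ← hP' j h.le,
      hPm j h.le, add_sub_cancel]

theorem exists_hasCoeffs [IsAlgClosed K] {i : Fin (n + 1)} (σ : H0 π (Scheme.Hom.ker (s i))) :
    ∃ κ γ, HasCoeffs line (c i) (a i) σ κ γ := by
  obtain ⟨F, hF, hreg⟩ := H.exists_ratio σ
  have hval : ∀ j b r, P1.pt b r ≠ P1.pt 0 (a i) → ∃ v, HasVal (P1.pt b r) (F j) v ∧
      (∀ j' b' r', P1.pt b r ≫ line j = P1.pt b' r' ≫ line j' → HasVal (P1.pt b' r') (F j') v) ∧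
      ∀ t : Spec (CommRingCat.of k) ⟶ C, t ≫ π = 𝟙 _ →
        P1.pt b r ≫ comp line j = Spec.map (CommRingCat.ofHom (algebraMap k K)) ≫ t →
        ∃ v₀, v = algebraMap k K v₀ := by
    intro j b r hbr
    obtain ⟨W, hW, f, hf⟩ := hreg j b r hbr
    have h1 := hf j (generic_mem_preimage hW) ▸ hasVal_lineFn (comp line j) (P1.pt b r) hW _ f
    refine ⟨_, h1, fun j' b' r' e => ?_, fun t ht e => ?_⟩
    · have e' : P1.pt b r ≫ comp line j = P1.pt b' r' ≫ comp line j' := by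
        rw [← Category.assoc, e, Category.assoc]
      have hW' : point (P1.pt b' r' ≫ comp line j') ∈ W.1 := e' ▸ hW
      rw [hf j' (generic_mem_preimage hW')]
      refine (hasVal_lineFn (comp line j') (P1.pt b' r') hW' _ f).congr ?_
      simp only [e']
    · refine ⟨evalAt t W.1 ((mem_comp e).1 hW) f, h1.unique ?_⟩
      rw [hf j (generic_mem_preimage hW)]
      exact hasVal_rational ht e ((mem_comp e).1 hW) _ f
  choose N hN using fun j => hval j 0 0 H.pt_minus_ne
  choose P hP using fun j => hval j 1 0 (pt_plus_ne _)
  obtain ⟨κ₀, hκ₀⟩ := (hN 0).2.2 sMinus H.sMinus_over H.minus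
  obtain ⟨μ₀, hμ₀⟩ := (hP (Fin.last m)).2.2 sPlus H.sPlus_over H.plus
  have := eq_coeff (H.ne_zero i) (fun j => H.exists_coeffs_aux σ (hF j)) (fun j => (hN j).1)
    (fun j => (hP j).1) (fun l => ((hP l.castSucc).2.1 l.succ 0 0 (H.node l)).unique (hN l.succ).1)
  refine ⟨κ₀, μ₀ - κ₀, fun j W h g => ?_⟩
  rw [hF j W h g, this j, hκ₀, hμ₀, map_sub]

end IsLineChain

theorem evalAt_congr {k : Type u} [Field k] {X : Scheme.{u}} {s t : Spec (CommRingCat.of k) ⟶ X}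
    (e : s = t) {W : X.Opens} (h : point s ∈ W) (h' : point t ∈ W) (f : Γ(X, W)) :
    evalAt s W h f = evalAt t W h' f := by
  subst e
  rfl

namespace IsLineChain
variable {k : Type u} [Field k] {K : Type u} [Field K] [Algebra k K] {C : Scheme.{u}}
    {π : C ⟶ Spec (CommRingCat.of k)} {sMinus sPlus : Spec (CommRingCat.of k) ⟶ C} {n : ℕ}
    {s : Fin (n + 1) → (Spec (CommRingCat.of k) ⟶ C)} {m : ℕ} {line : Fin (m + 1) → (P1 K ⟶ bc K π)}
    {c : Fin (n + 1) → Fin (m + 1)} {a : Fin (n + 1) → K}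

section
variable {I : C.IdealSheafData} {σ τ : H0 π I} {j₀ : Fin (m + 1)} {a₀ : K} {κ γ κ' γ' : k}

theorem HasCoeffs.add (h : HasCoeffs line j₀ a₀ σ κ γ) (h' : HasCoeffs line j₀ a₀ τ κ' γ') :
    HasCoeffs line j₀ a₀ (σ + τ) (κ + κ') (γ + γ') := fun j W hW g => by
  rw [H0.add_app, LinearMap.add_apply, map_add, h j W hW g, h' j W hW g, map_add, map_add,
    coeff_add, add_mul]

end

variable (H : IsLineChain π sMinus sPlus s line c a)
include H

theorem HasCoeffs.smul {I : C.IdealSheafData} {σ : H0 π I} {j₀ : Fin (m + 1)} {a₀ : K} {κ γ : k}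
    (h : HasCoeffs line j₀ a₀ σ κ γ) (r : k) : HasCoeffs line j₀ a₀ (r • σ) (r * κ) (r * γ) :=
  fun j W hW g => by
    rw [H0.smul_app, LinearMap.smul_apply, smul_eq_mul, map_mul, h j W hW g, map_mul, map_mul,
      coeff_mul, H.lineFn_comp_scalar, mul_assoc]

omit H in
theorem exists_left_inverse : ∃ l : K →ₗ[k] k, l 1 = 1 := by
  obtain ⟨l, hl⟩ := (Algebra.linearMap k K).exists_leftInverse_of_injective
    (LinearMap.ker_eq_bot.2 (algebraMap k K).injective)
  exact ⟨l, by simpa using LinearMap.congr_fun hl 1⟩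

theorem eq_zero_of_lineFn_bc {W : (bc K π).Opens} {F : Γ(bc K π, W)}
    (h : ∀ j h, lineFn (line j) W h F = 0) : F = 0 :=
  H.eq_zero_of_pb fun j => pb_eq_zero (h j)

theorem eq_zero_of_lineFn {W : C.Opens} (hW : IsAffineOpen W) {g : Γ(C, W)}
    (h : ∀ j h, lineFn (comp line j) W h g = 0) : g = 0 := by
  obtain ⟨l, hl⟩ := exists_left_inverse (k := k) (K := K)
  rw [← descend_pb π l hW hl g, H.eq_zero_of_lineFn_bc (F := pb (bcFst K π) W g) fun j h' =>
    (lineFn_pb _ _ _ _ _).trans (h j h'), map_zero]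

theorem eq_of_hasCoeffs {I : C.IdealSheafData} {σ τ : H0 π I} {j₀ : Fin (m + 1)} {a₀ : K} {κ γ : k}
    (hσ : HasCoeffs line j₀ a₀ σ κ γ) (hτ : HasCoeffs line j₀ a₀ τ κ γ) : σ = τ := by
  ext W g
  rw [← sub_eq_zero]
  apply H.eq_zero_of_lineFn W.2
  intro j h
  rw [map_sub, hσ j W h g, hτ j W h g, sub_self]

omit H in
/-- The section `1` of the line bundle of a divisor. -/
def oneSection (π : C ⟶ Spec (CommRingCat.of k)) (I : C.IdealSheafData) : H0 π I where
  app _ := Submodule.subtype _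
  compat _ _ _ _ := rfl

omit H in
theorem hasCoeffs_oneSection (I : C.IdealSheafData) (j₀ : Fin (m + 1)) (a₀ : K) :
    HasCoeffs line j₀ a₀ (oneSection π I) 1 0 := fun j W h g => by
  have : coeff j₀ j a₀ (algebraMap k K 1) (algebraMap k K 0) = 1 := by
    unfold coeff
    simp
  rw [this, one_mul]
  rfl

/-- The functions on the base change that the second basic section assigns to local equations of the
marked point. -/
theorem exists_bc_section [IsAlgClosed K] (i : Fin (n + 1)) (W : C.affineOpens)
    (g : (Scheme.Hom.ker (s i)).ideal W) : ∃ F : Γ(bc K π, bcFst K π ⁻¹ᵁ W.1),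
    ∀ j (h : genericPoint (P1 K) ∈ comp line j ⁻¹ᵁ W.1),
      lineFn (line j) (bcFst K π ⁻¹ᵁ W.1) h F =
        coeff (c i) j (a i) 0 1 * lineFn (comp line j) W.1 h g.1 := by
  have hval : ∀ j (h : genericPoint (P1 K) ∈ comp line j ⁻¹ᵁ W.1) b r
      (hb : point (P1.pt b r ≫ comp line j) ∈ W.1), ∃ v, HasVal (P1.pt b r)
        (coeff (c i) j (a i) 0 1 * lineFn (comp line j) W.1 h g.1) v := by
    intro j h b r hb
    by_cases hbr : c i = j ∧ P1.pt b r = P1.pt 0 (a i)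
    · obtain ⟨rfl, hbr⟩ := hbr
      rw [hbr] at hb ⊢
      obtain ⟨d, -, hd⟩ := P1.hasVal_pole_mul
        (H.evalAt_ideal g.2 ((mem_comp (H.marked i)).1 hb) h)
      rw [coeff, if_neg (lt_irrefl _), if_neg (lt_irrefl _), map_zero, map_one, zero_add, one_mul]
      exact ⟨_, hd⟩
    · obtain ⟨v, hv⟩ := exists_hasVal_coeff (i := c i) (j := j) (a := a i) (κ := 0) (γ := 1) b r
        fun h1 h2 => hbr ⟨h1, h2⟩
      exact ⟨_, hv.mul (hasVal_lineFn _ _ hb _ _)⟩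
  have h1 : ∀ j, ∃ f : Γ(P1 K, line j ⁻¹ᵁ bcFst K π ⁻¹ᵁ W.1),
      ∀ h : genericPoint (P1 K) ∈ comp line j ⁻¹ᵁ W.1, fn (line j ⁻¹ᵁ bcFst K π ⁻¹ᵁ W.1) h f =
        coeff (c i) j (a i) 0 1 * lineFn (comp line j) W.1 h g.1 := by
    intro j
    by_cases h : genericPoint (P1 K) ∈ comp line j ⁻¹ᵁ W.1
    · obtain ⟨f, hf⟩ := P1.exists_section (line j ⁻¹ᵁ bcFst K π ⁻¹ᵁ W.1) h
        (coeff (c i) j (a i) 0 1 * lineFn (comp line j) W.1 h g.1) fun b r hb =>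
          hval j h b r (by rw [← Category.assoc, point_comp, point_comp]; exact hb)
      exact ⟨f, fun _ => hf⟩
    · exact ⟨0, fun h' => absurd h' h⟩
  choose f hf using h1
  obtain ⟨F, hF⟩ := H.exists_glue W.2 f (by
    intro l h h'
    have hl : P1.pt 1 0 ≫ comp line l.castSucc = P1.pt 0 0 ≫ comp line l.succ := by
      rw [← Category.assoc, H.node, Category.assoc]
    have e1 : point (P1.pt 1 0 ≫ comp line l.castSucc) ∈ W.1 := by
      rw [← Category.assoc, point_comp, point_comp]; exact h
    have e2 : point (P1.pt 0 0 ≫ comp line l.succ) ∈ W.1 := hl ▸ e1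
    have g1 := generic_mem_preimage e1
    have g2 := generic_mem_preimage e2
    have v1 := hasVal_fn _ _ h g1 (f l.castSucc)
    have v2 := hasVal_fn _ _ h' g2 (f l.succ)
    have w1 := hasVal_lineFn (comp line l.castSucc) (P1.pt 1 0) e1 g1 g.1
    have w2 := hasVal_lineFn (comp line l.succ) (P1.pt 0 0) e2 g2 g.1
    have hw : evalAt _ W.1 e1 g.1 = evalAt _ W.1 e2 g.1 := evalAt_congr hl _ _ _
    rw [hf l.castSucc g1] at v1
    rw [hf l.succ g2] at v2
    rcases le_or_gt (c i) l.castSucc with hc | hc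
    · rw [v1.unique ((hasVal_coeff_infty hc).mul w1), v2.unique ((hasVal_coeff_of_gt (lt_of_le_of_lt hc Fin.castSucc_lt_succ) 0
        0).mul w2), hw]
    · have h3 : l.succ ≤ c i := Fin.castSucc_lt_iff_succ_le.1 hc
      rw [v1.unique ((hasVal_coeff_of_lt hc 1 0).mul w1),
        v2.unique ((hasVal_coeff_zero (H.ne_zero i) h3).mul w2), hw])
  refine ⟨F, fun j h => ?_⟩
  rw [← hf j h, ← hF]
  rfl

end IsLineChain

theorem H0.vanishesAt_iff {k : Type u} [Field k] {X : Scheme.{u}} {f : X ⟶ Spec (CommRingCat.of k)}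
    {I : X.IdealSheafData} (σ : H0 f I) (x : X) :
    σ.VanishesAt x ↔ ∀ (W : X.affineOpens) (g : I.ideal W), x ∉ X.basicOpen (σ.app W g) := by
  simp only [H0.VanishesAt, H0.nonvanishing, TopologicalSpace.Opens.mem_iSup, not_exists]

namespace IsLineChain
variable {k : Type u} [Field k] {K : Type u} [Field K] [Algebra k K] {C : Scheme.{u}}
    {π : C ⟶ Spec (CommRingCat.of k)} {sMinus sPlus : Spec (CommRingCat.of k) ⟶ C} {n : ℕ}
    {s : Fin (n + 1) → (Spec (CommRingCat.of k) ⟶ C)} {m : ℕ} {line : Fin (m + 1) → (P1 K ⟶ bc K π)}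
    {c : Fin (n + 1) → Fin (m + 1)} {a : Fin (n + 1) → K}
    (H : IsLineChain π sMinus sPlus s line c a)

theorem HasCoeffs.evalAt_app {I : C.IdealSheafData} {σ : H0 π I} {j₀ : Fin (m + 1)} {a₀ : K}
    {κ γ : k} (hσ : HasCoeffs line j₀ a₀ σ κ γ) {j : Fin (m + 1)}
    {t : Spec (CommRingCat.of K) ⟶ P1 K} {v : K}
    (hv : HasVal t (coeff j₀ j a₀ (algebraMap k K κ) (algebraMap k K γ)) v)
    (W : C.affineOpens) (h : point (t ≫ comp line j) ∈ W.1) (g : I.ideal W) :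
    evalAt _ W.1 h (σ.app W g) = v * evalAt _ W.1 h g.1 := by
  have h1 := hasVal_lineFn (comp line j) t h (generic_mem_preimage h) (σ.app W g)
  rw [hσ j W _ g] at h1
  exact h1.unique (hv.mul (hasVal_lineFn (comp line j) t h (generic_mem_preimage h) g.1))

include H

theorem HasCoeffs.vanishesAt_iff {i : Fin (n + 1)} {σ : H0 π (Scheme.Hom.ker (s i))} {κ γ : k}
    (hσ : HasCoeffs line (c i) (a i) σ κ γ) {j : Fin (m + 1)} {b : Fin 2} {r v : K}
    (hbr : c i = j → P1.pt b r ≠ P1.pt 0 (a i))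
    (hv : HasVal (P1.pt b r) (coeff (c i) j (a i) (algebraMap k K κ) (algebraMap k K γ)) v) :
    σ.VanishesAt (point (P1.pt b r ≫ comp line j)) ↔ v = 0 := by
  rw [H0.vanishesAt_iff]
  constructor
  · intro h
    obtain ⟨W, hW, h1⟩ := H.exists_affine_of_ne (x := point (P1.pt b r ≫ comp line j)) (i := i)
      fun e => hbr (H.marked_unique e).1 (H.marked_unique e).2
    have := h W ⟨1, h1 1⟩
    rw [mem_basicOpen_iff _ _ hW, not_not, hσ.evalAt_app hv] at this
    simpa using this
  · rintro rfl W g hx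
    have hW := C.basicOpen_le _ hx
    rw [mem_basicOpen_iff _ _ hW, hσ.evalAt_app hv, zero_mul] at hx
    exact hx rfl

theorem HasCoeffs.vanishesAt_marked_iff {i : Fin (n + 1)} {σ : H0 π (Scheme.Hom.ker (s i))}
    {κ γ : k} (hσ : HasCoeffs line (c i) (a i) σ κ γ) : σ.VanishesAt (point (s i)) ↔ γ = 0 := by
  have key : ∀ (W : C.affineOpens) (hW : point (s i) ∈ W.1) (g : (Scheme.Hom.ker (s i)).ideal W) h' d,
      HasVal (P1.pt 0 (a i)) (lineFn (comp line (c i)) W.1 h' g.1 / (P1.x K - P1.const (a i))) d →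
      algebraMap k K (evalAt (s i) W.1 hW (σ.app W g)) = algebraMap k K γ * (a i * d) := by
    intro W hW g h' d hd
    obtain ⟨d', hd', hp⟩ := P1.hasVal_pole_mul (H.evalAt_ideal g.2 hW h')
    obtain rfl := hd.unique hd'
    have h1 := hasVal_rational (H.s_over i) (H.marked i) hW h' (σ.app W g)
    refine h1.unique ?_
    rw [hσ (c i) W h' g, coeff, if_neg (lt_irrefl _), if_neg (lt_irrefl _), add_mul, mul_assoc]
    have h2 := ((P1.hasVal_const 0 (a i) (algebraMap k K κ)).mul (H.evalAt_ideal g.2 hW h')).add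
      ((P1.hasVal_const 0 (a i) (algebraMap k K γ)).mul hp)
    rwa [mul_zero, zero_add] at h2
  rw [H0.vanishesAt_iff]
  constructor
  · intro h
    obtain ⟨W, hW, h', g, hg, d, hd, hgd⟩ := H.exists_uniformizer i
    have h1 := h W ⟨g, hg⟩
    rw [mem_basicOpen_iff _ _ hW, not_not] at h1
    have h2 := key W hW ⟨g, hg⟩ h' d hgd
    rw [h1, map_zero, eq_comm, mul_eq_zero] at h2
    exact (map_eq_zero _).1 (h2.resolve_right (mul_ne_zero (H.ne_zero i) hd))
  · rintro rfl W g hx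
    have hW := C.basicOpen_le _ hx
    have h' := generic_mem_preimage ((mem_comp (H.marked i)).2 hW)
    obtain ⟨d, hd, -⟩ := P1.hasVal_pole_mul (H.evalAt_ideal g.2 hW h')
    have := key W hW g h' d hd
    rw [map_zero, zero_mul] at this
    exact (mem_basicOpen_iff _ _ hW _).1 hx ((map_eq_zero _).1 this)

omit H in
theorem point_eq {t : Spec (CommRingCat.of K) ⟶ P1 K} {j : Fin (m + 1)}
    {s : Spec (CommRingCat.of k) ⟶ C}
    (e : t ≫ comp line j = Spec.map (CommRingCat.ofHom (algebraMap k K)) ≫ s) :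
    point s = point (t ≫ comp line j) := by
  rw [e, point_specMap]

theorem HasCoeffs.vanishesAt_minus_iff {i : Fin (n + 1)} {σ : H0 π (Scheme.Hom.ker (s i))}
    {κ γ : k} (hσ : HasCoeffs line (c i) (a i) σ κ γ) : σ.VanishesAt (point sMinus) ↔ κ = 0 := by
  rw [point_eq H.minus, hσ.vanishesAt_iff H (fun _ => H.pt_minus_ne)
    (hasVal_coeff_zero (H.ne_zero i) (Fin.zero_le _)), map_eq_zero]

theorem HasCoeffs.vanishesAt_plus_iff {i : Fin (n + 1)} {σ : H0 π (Scheme.Hom.ker (s i))}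
    {κ γ : k} (hσ : HasCoeffs line (c i) (a i) σ κ γ) :
    σ.VanishesAt (point sPlus) ↔ κ + γ = 0 := by
  rw [point_eq H.plus, hσ.vanishesAt_iff H (fun _ => pt_plus_ne _)
    (hasVal_coeff_infty (Fin.le_last _)), ← map_add, map_eq_zero]

theorem exists_section_zero_one [IsAlgClosed K] (i : Fin (n + 1)) :
    ∃ σ : H0 π (Scheme.Hom.ker (s i)), HasCoeffs line (c i) (a i) σ 0 1 := by
  obtain ⟨l, hl⟩ := exists_left_inverse (k := k) (K := K)
  choose w hw using H.exists_bc_section i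
  have huniq : ∀ (W : C.affineOpens) (F G : Γ(bc K π, bcFst K π ⁻¹ᵁ W.1)), (∀ j h,
      lineFn (line j) (bcFst K π ⁻¹ᵁ W.1) h F = lineFn (line j) (bcFst K π ⁻¹ᵁ W.1) h G) → F = G :=
    fun W F G h => sub_eq_zero.1 (H.eq_zero_of_lineFn_bc fun j h' => by
      rw [map_sub, h j h', sub_self])
  let σ : H0 π (Scheme.Hom.ker (s i)) :=
    { app := fun W =>
        { toFun := fun g => descend π l W.2 (w W g)
          map_add' := fun g g' => by
            rw [← map_add]
            congr 1
            apply huniq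
            intro j h
            rw [map_add, hw W _ j h, hw W _ j h, hw W _ j h, ← mul_add, ← map_add]
            rfl
          map_smul' := fun r g => by
            refine Eq.trans ?_ (descend_mul π l W.2 r (w W g))
            congr 1
            apply huniq
            intro j h
            have h1 : lineFn (line j) (bcFst K π ⁻¹ᵁ W.1) h (pb (bcFst K π) W.1 r) =
              lineFn (comp line j) W.1 h r := lineFn_pb _ _ _ _ _
            rw [map_mul, hw W _ j h, hw W _ j h, h1, mul_left_comm, ← map_mul]
            rfl }
      compat := fun V W h g => by
        refine (res_descend π l W.2 V.2 h (w W g)).trans ?_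
        change descend π l V.2 _ = descend π l V.2 _
        congr 1
        apply huniq
        intro j h'
        refine (lineFn_res (line j) _ _ _).trans ?_
        rw [hw V _ j h']
        refine (hw W g j (Scheme.Hom.preimage_mono (comp line j) h h')).trans ?_
        congr 1
        exact (lineFn_res (comp line j) h h' g.1).symm }
  obtain ⟨κ, γ, hσ⟩ := H.exists_hasCoeffs σ
  have key : ∀ j b r (_ : P1.pt b r ≠ P1.pt 0 (a i)) (t : Spec (CommRingCat.of k) ⟶ C)
      (_ : t ≫ π = 𝟙 _) (_ : P1.pt b r ≫ comp line j =
        Spec.map (CommRingCat.ofHom (algebraMap k K)) ≫ t) (v : K) (u : k)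
      (_ : HasVal (P1.pt b r) (coeff (c i) j (a i) (algebraMap k K κ) (algebraMap k K γ)) v)
      (_ : HasVal (P1.pt b r) (coeff (c i) j (a i) 0 1) (algebraMap k K u)),
      v = algebraMap k K u := by
    intro j b r hbr t ht e v u hv hu
    obtain ⟨W, hW, h1⟩ := H.exists_affine_of_ne (x := point (P1.pt b r ≫ comp line j)) (i := i)
      fun e => hbr (H.marked_unique e).2
    have htW := (mem_comp e).1 hW
    have hW' : point (P1.pt b r ≫ line j) ∈ bcFst K π ⁻¹ᵁ W.1 := by
      have := hW
      rw [← Category.assoc, point_comp] at this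
      exact this
    have h2 := hσ.evalAt_app hv W hW ⟨1, h1 1⟩
    rw [map_one, mul_one] at h2
    have h3 : evalAt _ W.1 hW (σ.app W ⟨1, h1 1⟩) =
        algebraMap k K (evalAt t W.1 htW (σ.app W ⟨1, h1 1⟩)) :=
      (hasVal_lineFn _ _ hW (generic_mem_preimage hW) _).unique
        (hasVal_rational ht e htW (generic_mem_preimage hW) _)
    have h4 : evalAt t W.1 htW (σ.app W ⟨1, h1 1⟩) = l (evalAt _ _ hW' (w W ⟨1, h1 1⟩)) :=
      evalAt_descend l W.2 ht htW (by rw [Category.assoc, H.line_over, P1.pt_toSpec])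
        (by rw [Category.assoc]; exact e) hW' _
    have h5 := hasVal_lineFn (line j) _ hW' (generic_mem_preimage hW') (w W ⟨1, h1 1⟩)
    rw [hw W _ j (generic_mem_preimage hW), map_one, mul_one] at h5
    have hlu : l (algebraMap k K u) = u := by
      rw [Algebra.algebraMap_eq_smul_one, map_smul, hl, smul_eq_mul, mul_one]
    rw [← h2, h3, h4, h5.unique hu, hlu]
  have e1 := key 0 0 0 H.pt_minus_ne sMinus H.sMinus_over H.minus _ 0
    (hasVal_coeff_zero (H.ne_zero i) (Fin.zero_le _))
    ((hasVal_coeff_zero (H.ne_zero i) (Fin.zero_le _)).congr (by simp))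
  have e2 := key (Fin.last m) 1 0 (pt_plus_ne _) sPlus H.sPlus_over H.plus _ 1
    (hasVal_coeff_infty (Fin.le_last _))
    ((hasVal_coeff_infty (Fin.le_last _)).congr (by simp))
  have hκ : κ = 0 := (algebraMap k K).injective e1
  have hγ : γ = 1 := by
    rw [← map_add] at e2
    have := (algebraMap k K).injective e2
    rwa [hκ, zero_add] at this
  exact ⟨σ, hκ ▸ hγ ▸ hσ⟩

theorem exists_basis [IsAlgClosed K] (i : Fin (n + 1)) :
    ∃ z : Module.Basis (Fin 2) k (H0 π (Scheme.Hom.ker (s i))),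
      IsNormalised sMinus sPlus (s i) z := by
  obtain ⟨τ, hτ⟩ := H.exists_section_zero_one i
  let ι : H0 π (Scheme.Hom.ker (s i)) := oneSection π _
  have hι : HasCoeffs line (c i) (a i) ι 1 0 := hasCoeffs_oneSection _ _ _
  have hsum : ∀ x y : k, HasCoeffs line (c i) (a i) (x • (τ + (-1 : k) • ι) + y • τ) (-x) (x + y) :=
    fun x y => by
      have := (HasCoeffs.smul H (hτ.add (HasCoeffs.smul H hι (-1))) x).add (HasCoeffs.smul H hτ y)
      convert this using 1 <;> ring
  let v : Fin 2 → H0 π (Scheme.Hom.ker (s i)) := ![τ + (-1 : k) • ι, τ]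
  have hzero : ∀ σ : H0 π (Scheme.Hom.ker (s i)), ∀ x y : k, HasCoeffs line (c i) (a i) σ x y →
      σ = 0 → x = 0 ∧ y = 0 := by
    rintro _ x y h rfl
    have h0 : ∀ p, (0 : H0 π (Scheme.Hom.ker (s i))).VanishesAt p := fun p => by
      rw [H0.vanishesAt_iff]
      intro W g
      rw [H0.zero_app, LinearMap.zero_apply, Scheme.basicOpen_zero]
      exact fun h => h
    exact ⟨(h.vanishesAt_minus_iff H).1 (h0 _), (h.vanishesAt_marked_iff H).1 (h0 _)⟩
  have hli : LinearIndependent k v := by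
    rw [LinearIndependent.pair_iff]
    intro x y hxy
    have := hzero _ _ _ (hsum x y) hxy
    have hx : x = 0 := neg_eq_zero.1 this.1
    exact ⟨hx, by have := this.2; rwa [hx, zero_add] at this⟩
  have hsp : ⊤ ≤ Submodule.span k (Set.range v) := by
    intro σ _
    obtain ⟨κ, γ, hσ⟩ := H.exists_hasCoeffs σ
    rw [H.eq_of_hasCoeffs hσ (by
      have := hsum (-κ) (κ + γ)
      rwa [neg_neg, neg_add_cancel_left] at this)]
    exact Submodule.add_mem _ (Submodule.smul_mem _ _ (Submodule.subset_span ⟨0, rfl⟩))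
      (Submodule.smul_mem _ _ (Submodule.subset_span ⟨1, rfl⟩))
  refine ⟨Module.Basis.mk hli hsp, ?_, ?_, ?_, ?_⟩ <;> simp only [Module.Basis.mk_apply]
  · exact (HasCoeffs.vanishesAt_minus_iff H hτ).2 rfl
  · have : HasCoeffs line (c i) (a i) (v 0) (-1) 1 := by
      have := hsum 1 0
      rwa [one_smul, zero_smul, add_zero, add_zero] at this
    exact (this.vanishesAt_plus_iff H).2 (by ring)
  · have : v 1 - v 0 = ι := by simp [v]
    rw [this]
    exact (hι.vanishesAt_marked_iff H).2 rfl
  · exact fun h => one_ne_zero ((hτ.vanishesAt_marked_iff H).1 h)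

end IsLineChain

namespace IsLineChain
variable {k : Type u} [Field k] {K : Type u} [Field K] [Algebra k K] {C : Scheme.{u}}
    {π : C ⟶ Spec (CommRingCat.of k)} {sMinus sPlus : Spec (CommRingCat.of k) ⟶ C} {n : ℕ}
    {s : Fin (n + 1) → (Spec (CommRingCat.of k) ⟶ C)} {m : ℕ} {line : Fin (m + 1) → (P1 K ⟶ bc K π)}
    {c : Fin (n + 1) → Fin (m + 1)} {a : Fin (n + 1) → K}
    (H : IsLineChain π sMinus sPlus s line c a)
include H

theorem HasCoeffs.combination {I : C.IdealSheafData} {σ τ : H0 π I} {j₀ : Fin (m + 1)} {a₀ : K}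
    {κ γ κ' γ' : k} (hσ : HasCoeffs line j₀ a₀ σ κ γ) (hτ : HasCoeffs line j₀ a₀ τ κ' γ') (x y : k) :
    HasCoeffs line j₀ a₀ (x • σ - y • τ) (x * κ - y * κ') (x * γ - y * γ') := by
  have := (HasCoeffs.smul H hσ x).add (HasCoeffs.smul H hτ (-y))
  rwa [neg_smul, ← sub_eq_add_neg, neg_mul, neg_mul, ← sub_eq_add_neg, ← sub_eq_add_neg] at this

theorem normalised_coeffs [IsAlgClosed K] {i : Fin (n + 1)}
    {z : Module.Basis (Fin 2) k (H0 π (Scheme.Hom.ker (s i)))}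
    (hz : IsNormalised sMinus sPlus (s i) z) : ∃ γ : k, γ ≠ 0 ∧
      HasCoeffs line (c i) (a i) (z 0) (-γ) γ ∧ HasCoeffs line (c i) (a i) (z 1) 0 γ := by
  obtain ⟨κ₀, γ₀, h0⟩ := H.exists_hasCoeffs (z 0)
  obtain ⟨κ₁, γ₁, h1⟩ := H.exists_hasCoeffs (z 1)
  have e1 := (h1.vanishesAt_minus_iff H).1 hz.minus
  have e2 := (h0.vanishesAt_plus_iff H).1 hz.plus
  have h3 := HasCoeffs.combination H h1 h0 1 1
  rw [one_smul, one_smul] at h3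
  have e3 := (h3.vanishesAt_marked_iff H).1 hz.eq
  have e4 : γ₀ = γ₁ := by linear_combination -e3
  subst e4
  obtain rfl : κ₀ = -γ₀ := by linear_combination e2
  subst e1
  exact ⟨γ₀, fun h => hz.ne ((h1.vanishesAt_marked_iff H).2 h), h0, h1⟩

/-- The ratios of the values of the normalised sections at the marked points, in terms of the
coordinates of the marked points. -/
theorem vanishesAt_marked_iff {i j : Fin (n + 1)} {σ : H0 π (Scheme.Hom.ker (s j))} {γ x y : k}
    (hγ : γ ≠ 0) (hσ : HasCoeffs line (c j) (a j) σ (y * γ) ((x - y) * γ)) :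
    σ.VanishesAt (point (s i)) ↔ (c i < c j → y = 0) ∧ (c j < c i → x = 0) ∧
      (c i = c j → algebraMap k K x * a i = algebraMap k K y * a j) := by
  have hγ' : algebraMap k K γ ≠ 0 := fun h => hγ ((map_eq_zero _).1 h)
  rw [point_eq (H.marked i)]
  rcases lt_trichotomy (c i) (c j) with h | h | h
  · rw [hσ.vanishesAt_iff H (fun e => absurd e h.ne') (hasVal_coeff_of_lt h 0 (a i))]
    simp [h, h.not_gt, h.ne, hγ]
  · simp only [h, lt_irrefl, false_imp_iff, true_and, true_imp_iff]
    by_cases ha : a i = a j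
    · rw [ha, ← point_eq (H.marked j), hσ.vanishesAt_marked_iff H, mul_left_inj' (H.ne_zero j),
        mul_eq_zero, or_iff_left hγ, sub_eq_zero, (algebraMap k K).injective.eq_iff]
    · rw [hσ.vanishesAt_iff H (fun _ e => ha (P1.pt_injective 0 e)) (hasVal_coeff_self ha)]
      have ha' := sub_ne_zero.2 ha
      have key : algebraMap k K (y * γ) + algebraMap k K ((x - y) * γ) * (a i / (a i - a j)) =
          algebraMap k K γ * (algebraMap k K x * a i - algebraMap k K y * a j) / (a i - a j) := by
        rw [map_mul, map_mul, map_sub]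
        field_simp
        ring
      rw [key, div_eq_zero_iff, or_iff_left ha', mul_eq_zero, or_iff_right hγ', sub_eq_zero]
  · rw [hσ.vanishesAt_iff H (fun e => absurd e h.ne) (hasVal_coeff_of_gt h 0 (a i)), ← map_add,
      map_eq_zero]
    have : y * γ + (x - y) * γ = x * γ := by ring
    rw [this]
    simp [h, h.not_gt, h.ne', hγ]

theorem hasRatioAt_iff [IsAlgClosed K] {i j : Fin (n + 1)}
    {z : Module.Basis (Fin 2) k (H0 π (Scheme.Hom.ker (s j)))}
    (hz : IsNormalised sMinus sPlus (s j) z) (x y : k) :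
    H0.HasRatioAt (z 0) (z 1) (point (s i)) x y ↔ ¬ (x = 0 ∧ y = 0) ∧ (c i < c j → y = 0) ∧
      (c j < c i → x = 0) ∧ (c i = c j → algebraMap k K x * a i = algebraMap k K y * a j) := by
  obtain ⟨γ, hγ, h0, h1⟩ := H.normalised_coeffs hz
  have h2 := HasCoeffs.combination H h1 h0 x y
  rw [show x * 0 - y * -γ = y * γ by ring, show x * γ - y * γ = (x - y) * γ by ring] at h2
  rw [← H.vanishesAt_marked_iff hγ h2, H0.HasRatioAt, and_iff_right]
  rintro ⟨v0, v1⟩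
  have e0 := (H.vanishesAt_marked_iff (x := 0) (y := -1) hγ (by
    convert h0 using 1 <;> ring)).1 v0
  have e1 := (H.vanishesAt_marked_iff (x := 1) (y := 0) hγ (by
    convert h1 using 1 <;> ring)).1 v1
  rcases lt_trichotomy (c i) (c j) with h | h | h
  · simpa using e0.1 h
  · have := e1.2.2 h
    rw [map_one, map_zero, one_mul, zero_mul] at this
    exact H.ne_zero i this
  · simpa using e1.2.1 h

theorem isExtracted_iff [IsAlgClosed K]
    {z : ∀ i, Module.Basis (Fin 2) k (H0 π (Scheme.Hom.ker (s i)))}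
    (hz : ∀ i, IsNormalised sMinus sPlus (s i) (z i)) (t : Fin (n + 1) → Fin (n + 1) → k) :
    IsExtracted z t ↔ ∀ i j, i ≠ j → ¬ (t i j = 0 ∧ t j i = 0) ∧ (c i < c j → t j i = 0) ∧
      (c i = c j → algebraMap k K (t i j) * a i = algebraMap k K (t j i) * a j) := by
  constructor
  · intro h i j hij
    have := (H.hasRatioAt_iff (hz j) _ _).1 (h i j hij)
    exact ⟨this.1, this.2.1, this.2.2.2⟩
  · intro h i j hij
    exact (H.hasRatioAt_iff (hz j) _ _).2
      ⟨(h i j hij).1, (h i j hij).2.1, (h j i hij.symm).2.1, (h i j hij).2.2⟩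

theorem isAnData [IsAlgClosed K]
    {z : ∀ i, Module.Basis (Fin 2) k (H0 π (Scheme.Hom.ker (s i)))}
    (hz : ∀ i, IsNormalised sMinus sPlus (s i) (z i)) {t : Fin (n + 1) → Fin (n + 1) → k}
    (ht : IsExtracted z t) : IsAnData t := by
  rw [H.isExtracted_iff hz] at ht
  refine ⟨fun i j hij => (ht i j hij).1, fun i j l hij hjl hil => ?_⟩
  have hle : ∀ {i j}, i ≠ j → t i j ≠ 0 → c i ≤ c j := fun {i j} hij h =>
    le_of_not_gt fun hlt => h ((ht j i hij.symm).2.1 hlt)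
  by_cases hc : c i = c j ∧ c j = c l
  · have e1 := (ht i j hij).2.2 hc.1
    have e2 := (ht j l hjl).2.2 hc.2
    have e3 := (ht l i hil.symm).2.2 (hc.1.trans hc.2).symm
    apply (algebraMap k K).injective
    have h1 := H.ne_zero i
    have h2 := H.ne_zero j
    have h3 := H.ne_zero l
    have h4 : a i * a j * a l ≠ 0 := mul_ne_zero (mul_ne_zero h1 h2) h3
    apply mul_right_cancel₀ h4
    simp only [map_mul]
    calc _ = (algebraMap k K (t i j) * a i) * (algebraMap k K (t j l) * a j) *
          (algebraMap k K (t l i) * a l) := by ring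
      _ = _ := by rw [e1, e2, e3]; ring
  · have hl : t i j * t j l * t l i = 0 := by
      by_contra h
      have h1 := hle hij fun e => h (by rw [e]; ring)
      have h2 := hle hjl fun e => h (by rw [e]; ring)
      have h3 := hle hil.symm fun e => h (by rw [e]; ring)
      exact hc ⟨le_antisymm h1 (h2.trans h3), le_antisymm h2 (h3.trans h1)⟩
    have hr : t j i * t l j * t i l = 0 := by
      by_contra h
      have h1 := hle hij.symm fun e => h (by rw [e]; ring)
      have h2 := hle hjl.symm fun e => h (by rw [e]; ring)
      have h3 := hle hil fun e => h (by rw [e]; ring)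
      exact hc ⟨le_antisymm (h3.trans h2) h1, le_antisymm (h1.trans h3) h2⟩
    rw [hl, hr]

theorem exists_quotient [IsAlgClosed K] {i j : Fin (n + 1)} (hij : c i = c j) :
    ∃ ρ : k, a j = algebraMap k K ρ * a i := by
  by_cases ha : a i = a j
  · exact ⟨1, by rw [map_one, one_mul, ha]⟩
  obtain ⟨τ, hτ⟩ := H.exists_section_zero_one j
  obtain ⟨W, hW, h1⟩ := H.exists_affine_of_ne (x := point (P1.pt 0 (a i) ≫ comp line (c i))) (i := j)
    fun e => ha (P1.pt_injective 0 (H.marked_unique e).2)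
  have hs := (mem_comp (H.marked i)).1 hW
  have h2 := hτ.evalAt_app (by rw [← hij]; exact hasVal_coeff_self ha) W hW ⟨1, h1 1⟩
  have h3 : evalAt _ W.1 hW (τ.app W ⟨1, h1 1⟩) =
      algebraMap k K (evalAt (s i) W.1 hs (τ.app W ⟨1, h1 1⟩)) :=
    (hasVal_lineFn _ _ hW (generic_mem_preimage hW) _).unique
      (hasVal_rational (H.s_over i) (H.marked i) hs (generic_mem_preimage hW) _)
  rw [h3, map_one, map_zero, map_one, zero_add, one_mul, mul_one] at h2
  set v := evalAt (s i) W.1 hs (τ.app W ⟨1, h1 1⟩)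
  have ha' := sub_ne_zero.2 ha
  have hv : algebraMap k K v ≠ 0 := by
    rw [h2]
    exact div_ne_zero (H.ne_zero i) ha'
  refine ⟨(v - 1) / v, ?_⟩
  rw [map_div₀, map_sub, map_one]
  field_simp
  rw [h2]
  field_simp
  ring

theorem exists_isExtracted [IsAlgClosed K]
    {z : ∀ i, Module.Basis (Fin 2) k (H0 π (Scheme.Hom.ker (s i)))}
    (hz : ∀ i, IsNormalised sMinus sPlus (s i) (z i)) : ∃ t, IsExtracted z t := by
  choose r hr using H.stable
  choose ρ hρ using fun i => H.exists_quotient (hr (c i))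
  have hρ0 : ∀ i, ρ i ≠ 0 := fun i h => H.ne_zero i (by rw [hρ i, h, map_zero, zero_mul])
  refine ⟨fun i j => if c i < c j then 1 else if c j < c i then 0 else ρ j, ?_⟩
  rw [H.isExtracted_iff hz]
  intro i j hij
  rcases lt_trichotomy (c i) (c j) with h | h | h
  · simp [h, h.not_gt, h.ne]
  · have h1 := hρ i
    have h2 := hρ j
    simp only [h, lt_irrefl, if_false, false_imp_iff, true_and, true_imp_iff]
    refine ⟨fun h => hρ0 _ h.1, ?_⟩
    rw [h] at h1
    rw [h1, h2]
    ring
  · simp [h, h.not_gt, h.ne']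

end IsLineChain

section P1Pow

variable {k : Type u} [Field k] {n : ℕ} {T : Scheme.{u}}

theorem P1Pow.proj_toSpec (i : Fin (n + 1)) :
    P1Pow.proj k n i ≫ P1.toSpec k = P1Pow.toSpec k n :=
  WidePullback.π_arrow _ i

theorem P1Pow.hom_ext {f g : T ⟶ P1Pow k n}
    (h : ∀ i, f ≫ P1Pow.proj k n i = g ≫ P1Pow.proj k n i) : f = g := by
  refine WidePullback.hom_ext _ _ _ h ?_
  change f ≫ P1Pow.toSpec k n = g ≫ P1Pow.toSpec k n
  rw [← P1Pow.proj_toSpec 0, ← Category.assoc, h 0, Category.assoc]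

theorem P1Pow.exists_lift (f : T ⟶ Spec (CommRingCat.of k)) (φ : Fin (n + 1) → (T ⟶ P1 k))
    (h : ∀ i, φ i ≫ P1.toSpec k = f) :
    ∃ Φ : T ⟶ P1Pow k n, Φ ≫ P1Pow.toSpec k n = f ∧ ∀ i, Φ ≫ P1Pow.proj k n i = φ i :=
  ⟨WidePullback.lift f φ h, WidePullback.lift_base _ _ _ _, fun i => WidePullback.lift_π _ _ _ _ i⟩

variable (k) in
theorem exists_proper_power (r : ℕ) :
    ∃ (X : Scheme.{u}) (f : X ⟶ Spec (CommRingCat.of k)) (p : Fin r → (X ⟶ P1 k)),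
      IsProper f ∧ (∀ i, p i ≫ P1.toSpec k = f) ∧
      (∀ (T : Scheme.{u}) (a b : T ⟶ X), a ≫ f = b ≫ f → (∀ i, a ≫ p i = b ≫ p i) → a = b) ∧
      ∀ (T : Scheme.{u}) (g : T ⟶ Spec (CommRingCat.of k)) (φ : Fin r → (T ⟶ P1 k)),
        (∀ i, φ i ≫ P1.toSpec k = g) → ∃ Φ : T ⟶ X, Φ ≫ f = g ∧ ∀ i, Φ ≫ p i = φ i := by
  induction r with
  | zero =>
    exact ⟨_, 𝟙 _, fun i => i.elim0, inferInstance, fun i => i.elim0,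
      fun T a b h _ => by simpa using h, fun T g φ _ => ⟨g, by simp, fun i => i.elim0⟩⟩
  | succ r ih =>
    obtain ⟨X, f, p, hf, hp, hext, hlift⟩ := ih
    refine ⟨pullback f (P1.toSpec k), pullback.fst _ _ ≫ f,
      Fin.cons (pullback.snd _ _) (fun i => pullback.fst _ _ ≫ p i), inferInstance, ?_, ?_, ?_⟩
    · refine Fin.cases ?_ fun i => ?_
      · simp [pullback.condition]
      · simp [hp]
    · intro T a b h hi
      refine pullback.hom_ext (hext T _ _ (by simpa using h) fun i => ?_) (by simpa using hi 0)
      simpa using hi i.succ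
    · intro T g φ hφ
      obtain ⟨Φ, h1, h2⟩ := hlift T g (fun i => φ i.succ) fun i => hφ _
      refine ⟨pullback.lift Φ (φ 0) (by rw [h1, hφ]), (pullback.lift_fst_assoc _ _ _ _).trans h1,
        Fin.cases (pullback.lift_snd _ _ _) fun i => (pullback.lift_fst_assoc _ _ _ _).trans (h2 i)⟩

instance P1Pow.isProper : IsProper (P1Pow.toSpec k n) := by
  obtain ⟨X, f, p, hf, hp, hext, hlift⟩ := exists_proper_power k (n + 1)
  obtain ⟨Φ, h1, h2⟩ := hlift _ (P1Pow.toSpec k n) (P1Pow.proj k n) P1Pow.proj_toSpec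
  obtain ⟨Ψ, h3, h4⟩ := P1Pow.exists_lift f p hp
  have e1 : Φ ≫ Ψ = 𝟙 _ := P1Pow.hom_ext fun i => by simp [h4, h2]
  have e2 : Ψ ≫ Φ = 𝟙 _ := hext _ _ _ (by simp [h1, h3]) fun i => by simp [h4, h2]
  have : IsIso Φ := ⟨Ψ, e1, e2⟩
  rw [← h1]
  infer_instance

/-- The chart of `(ℙ¹)^(n+1)` where the homogeneous coordinates `X_{i, ε i}` are invertible. -/
def P1Pow.chart (ε : Fin (n + 1) → Fin 2) : (P1Pow k n).Opens :=
  ⨅ i, P1Pow.proj k n i ⁻¹ᵁ P1.chart k (ε i)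

theorem P1Pow.chart_le (ε : Fin (n + 1) → Fin 2) (i : Fin (n + 1)) :
    P1Pow.chart ε ≤ P1Pow.proj k n i ⁻¹ᵁ P1.chart k (ε i) :=
  iInf_le _ i

theorem P1Pow.mem_chart {ε : Fin (n + 1) → Fin 2} {p : P1Pow k n} :
    p ∈ P1Pow.chart ε ↔ ∀ i, P1Pow.proj k n i p ∈ P1.chart k (ε i) := by
  rw [P1Pow.chart, ← SetLike.mem_coe, TopologicalSpace.Opens.coe_iInf, Set.mem_iInter]
  rfl

/-- The polynomial functions on a chart of `(ℙ¹)^(n+1)`. -/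
def P1Pow.poly (ε : Fin (n + 1) → Fin 2) :
    MvPolynomial (Fin (n + 1)) k →+* Γ(P1Pow k n, P1Pow.chart ε) :=
  MvPolynomial.eval₂Hom (scalar (P1Pow.toSpec k n) _)
    (fun i => coordRatio (P1Pow.proj k n i) (other (ε i)) (ε i) _ (P1Pow.chart_le ε i))

theorem exists_affineSpace (ε : Fin (n + 1) → Fin 2) :
    ∃ h : Spec (CommRingCat.of (MvPolynomial (Fin (n + 1)) k)) ⟶ P1Pow k n,
      h ≫ P1Pow.toSpec k n = Spec.map (CommRingCat.ofHom MvPolynomial.C) ∧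
      ∀ i, HasCoords (h ≫ P1Pow.proj k n i) ⊤ (fun a => (Scheme.ΓSpecIso (CommRingCat.of
        (MvPolynomial (Fin (n + 1)) k))).inv.hom (if a = ε i then 1 else MvPolynomial.X i)) := by
  have hu : ∀ i, Ideal.span (Set.range fun a => (Scheme.ΓSpecIso (CommRingCat.of
      (MvPolynomial (Fin (n + 1)) k))).inv.hom (if a = ε i then 1 else MvPolynomial.X i)) = ⊤ :=
    fun i => Ideal.eq_top_of_isUnit_mem _ (Ideal.subset_span ⟨ε i, rfl⟩) (by simp)
  obtain ⟨h, h1, h2⟩ := P1Pow.exists_lift (n := n)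
    (Spec.map (CommRingCat.ofHom (MvPolynomial.C : k →+* MvPolynomial (Fin (n + 1)) k)))
    (fun i => P1.ofPair _ _ (hu i)) fun i => P1.ofPair_toSpec _ _ _
  exact ⟨h, h1, fun i => by rw [h2]; exact hasCoords_ofPair _ _ _⟩

theorem P1Pow.isIso_chart (ε : Fin (n + 1) → Fin 2) :
    IsIso ((P1Pow.chart (k := k) ε).toSpecΓ ≫ Spec.map (CommRingCat.ofHom (P1Pow.poly ε))) := by
  obtain ⟨h, h1, h2⟩ := exists_affineSpace (k := k) ε
  set U := P1Pow.chart (k := k) ε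
  let g := U.toSpecΓ ≫ Spec.map (CommRingCat.ofHom (P1Pow.poly ε))
  have hU : ⊤ ≤ h ⁻¹ᵁ U := by
    intro x _
    change h x ∈ P1Pow.chart ε
    rw [P1Pow.mem_chart]
    intro i
    refine (h2 i).basicOpen_le (ε i) ?_
    rw [if_pos rfl, map_one, Scheme.basicOpen_of_isUnit _ isUnit_one]
    trivial
  have hr : ∀ i a, (h.appLE U ⊤ hU).hom (coordRatio (P1Pow.proj k n i) a (ε i) U
      (P1Pow.chart_le ε i)) = (Scheme.ΓSpecIso (CommRingCat.of
        (MvPolynomial (Fin (n + 1)) k))).inv.hom (if a = ε i then 1 else MvPolynomial.X i) := by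
    intro i a
    rw [appLE_coordRatio]
    have := (h2 i).ratio a (ε i) ⊤ le_rfl (hU.trans (Scheme.Hom.preimage_mono h
      (P1Pow.chart_le ε i)))
    rw [if_pos rfl, map_one, map_one, mul_one, res_self] at this
    exact this
  have e : CommRingCat.ofHom (P1Pow.poly ε) ≫ h.appLE U ⊤ hU =
      (Scheme.ΓSpecIso (CommRingCat.of (MvPolynomial (Fin (n + 1)) k))).inv := by
    ext1
    refine MvPolynomial.ringHom_ext (fun r => ?_) fun i => ?_
    · change (h.appLE U ⊤ hU).hom (P1Pow.poly ε (MvPolynomial.C r)) = _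
      rw [P1Pow.poly, MvPolynomial.eval₂Hom_C, appLE_scalar, h1]
      rw [scalar_eq _ _ le_top, CommRingCat.hom_comp, RingHom.comp_apply]
      apply (ConcreteCategory.bijective_of_isIso (Scheme.ΓSpecIso (CommRingCat.of
        (MvPolynomial (Fin (n + 1)) k))).hom).1
      have := congrArg (fun f => f.hom ((Scheme.ΓSpecIso (CommRingCat.of k)).inv.hom r))
        (appLE_specMap_ΓSpecIso (CommRingCat.ofHom
          (MvPolynomial.C : k →+* MvPolynomial (Fin (n + 1)) k)) le_top)
      refine Eq.trans this ?_
      simp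
    · change (h.appLE U ⊤ hU).hom (P1Pow.poly ε (MvPolynomial.X i)) = _
      rw [P1Pow.poly, MvPolynomial.eval₂Hom_X', hr, if_neg]
      generalize ε i = b
      fin_cases b <;> decide
  have e1 : g ≫ h = U.ι := by
    have hg : ∀ q, (g.appLE ⊤ ⊤ le_top).hom ((Scheme.ΓSpecIso (CommRingCat.of
        (MvPolynomial (Fin (n + 1)) k))).inv.hom q) =
        (U.ι.appLE U ⊤ U.ι_preimage_self.ge).hom (P1Pow.poly ε q) := by
      intro q
      have : (Scheme.ΓSpecIso (CommRingCat.of (MvPolynomial (Fin (n + 1)) k))).inv ≫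
          g.appLE ⊤ ⊤ le_top =
          CommRingCat.ofHom (P1Pow.poly ε) ≫ U.ι.appLE U ⊤ U.ι_preimage_self.ge := by
        have e2 : g.appLE ⊤ ⊤ le_top = (Spec.map (CommRingCat.ofHom (P1Pow.poly ε))).appTop ≫
            U.toSpecΓ.appTop := by
          rw [← Scheme.Hom.comp_appTop, Scheme.Hom.appTop, Scheme.Hom.app_eq_appLE]
          rfl
        rw [e2, ← Category.assoc, ← Scheme.ΓSpecIso_inv_naturality, Category.assoc,
          Scheme.Opens.toSpecΓ_appTop]
        congr 1
        refine (Iso.inv_hom_id_assoc _ _).trans ?_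
        rw [Scheme.Opens.ι_appLE]
        rfl
      exact congrArg (fun f => f.hom q) this
    refine P1Pow.hom_ext fun i => P1.hom_ext_of_hasCoords ?_ fun x => ⟨⊤, trivial, _, _,
      (h2 i).comp g le_top, hasCoords_coordRatio (U.ι ≫ P1Pow.proj k n i) (ε i) ⊤
      (U.ι_preimage_self.ge.trans (Scheme.Hom.preimage_mono U.ι (P1Pow.chart_le ε i))), ?_⟩
    · simp only [Category.assoc, P1Pow.proj_toSpec, h1]
      rw [ι_comp_eq_toSpecΓ]
      simp only [g, Category.assoc, ← Spec.map_comp]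
      congr 2
      ext r
      exact (MvPolynomial.eval₂Hom_C _ _ r)
    · have hc : ∀ a, (g.appLE ⊤ ⊤ le_top).hom ((Scheme.ΓSpecIso (CommRingCat.of
          (MvPolynomial (Fin (n + 1)) k))).inv.hom (if a = ε i then 1 else MvPolynomial.X i)) =
          coordRatio (U.ι ≫ P1Pow.proj k n i) a (ε i) ⊤ (U.ι_preimage_self.ge.trans
            (Scheme.Hom.preimage_mono U.ι (P1Pow.chart_le ε i))) := by
        intro a
        rw [hg, ← appLE_coordRatio U.ι _ a (ε i) U (P1Pow.chart_le ε i) ⊤ U.ι_preimage_self.ge]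
        congr 1
        split_ifs with ha
        · rw [map_one, ha, coordRatio_self]
        · have : a = other (ε i) := by
            revert ha; generalize ε i = b; fin_cases a <;> fin_cases b <;> decide
          rw [this, P1Pow.poly, MvPolynomial.eval₂Hom_X']
      refine Eq.trans (congrArg₂ _ (hc 0) rfl) (Eq.trans (mul_comm _ _) ?_)
      exact Eq.symm (Eq.trans (congrArg₂ _ (hc 1) rfl) rfl)
  have e2 : h.resLE U ⊤ hU ≫ g = (⊤ : Scheme.Opens _).toSpecΓ ≫ Spec.map
      (Scheme.ΓSpecIso (CommRingCat.of (MvPolynomial (Fin (n + 1)) k))).inv := by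
    rw [← e, Spec.map_comp, ← Category.assoc, ← Category.assoc (⊤ : Scheme.Opens _).toSpecΓ,
      Scheme.Opens.toSpecΓ_SpecMap_appLE]
  have : IsIso (⊤ : (Spec (CommRingCat.of (MvPolynomial (Fin (n + 1)) k))).Opens).toSpecΓ :=
    isIso_toSpecΓ_of_isAffineOpen (isAffineOpen_top _)
  have hi : IsIso (h.resLE U ⊤ hU ≫ g) := by rw [e2]; infer_instance
  have hmono : Mono g := by
    have : Mono (g ≫ h) := by rw [e1]; infer_instance
    exact mono_of_mono g h
  have : IsSplitEpi g := ⟨⟨inv (h.resLE U ⊤ hU ≫ g) ≫ h.resLE U ⊤ hU, by simp⟩⟩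
  exact isIso_of_mono_of_isSplitEpi g

theorem P1Pow.isAffineOpen_chart (ε : Fin (n + 1) → Fin 2) :
    IsAffineOpen (P1Pow.chart (k := k) ε) :=
  have := P1Pow.isIso_chart (k := k) ε
  IsAffine.of_isIso ((P1Pow.chart (k := k) ε).toSpecΓ ≫ Spec.map (CommRingCat.ofHom (P1Pow.poly ε)))

theorem P1Pow.poly_surjective (ε : Fin (n + 1) → Fin 2) :
    Function.Surjective (P1Pow.poly (k := k) ε) := by
  have := P1Pow.isIso_chart (k := k) ε
  have := isIso_toSpecΓ_of_isAffineOpen (P1Pow.isAffineOpen_chart (k := k) ε)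
  have : IsIso (Spec.map (CommRingCat.ofHom (P1Pow.poly (k := k) ε))) :=
    IsIso.of_isIso_comp_left (P1Pow.chart (k := k) ε).toSpecΓ _
  rw [isIso_SpecMap_iff] at this
  exact this.2

end P1Pow

theorem exists_affine_le {X : Scheme.{u}} {x : X} {U : X.Opens} (hx : x ∈ U) :
    ∃ W : X.affineOpens, x ∈ W.1 ∧ W.1 ≤ U := by
  obtain ⟨_, ⟨W, hW, rfl⟩, h1, h2⟩ := X.isBasis_affineOpens.exists_subset_of_mem_open hx U.2
  exact ⟨⟨W, hW⟩, h1, h2⟩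

section Morphism

variable {k : Type u} [Field k] {X : Scheme.{u}} {f : X ⟶ Spec (CommRingCat.of k)}
  {I : X.IdealSheafData}

theorem H0.mem_nonvanishing {σ : H0 f I} {x : X} :
    x ∈ σ.nonvanishing ↔ ∃ (W : X.affineOpens) (g : I.ideal W), x ∈ X.basicOpen (σ.app W g) := by
  simp [H0.nonvanishing]

theorem H0.res_app (σ : H0 f I) {V W : X.affineOpens} (h : V.1 ≤ W.1) (g : I.ideal W) :
    res h (σ.app W g) = σ.app V ⟨res h g.1, I.ideal_le_comap_ideal h g.2⟩ :=
  σ.compat V W h g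

/-- A morphism to `ℙ¹` given by a line bundle and two sections is unique. -/
theorem H0.IsMorphismOf.unique {φ ψ : X ⟶ P1 k} {z : Fin 2 → H0 f I}
    (hφ : H0.IsMorphismOf φ z) (hψ : H0.IsMorphismOf ψ z) : φ = ψ := by
  refine P1.hom_ext (hφ.comp_toSpec.trans hψ.comp_toSpec.symm) fun x => ?_
  obtain ⟨b, hb⟩ := exists_mem_chart φ x
  have hb' := hb
  rw [hφ.preimage, H0.mem_nonvanishing] at hb'
  obtain ⟨W, g, hx⟩ := hb'
  obtain ⟨V, hxV, hV⟩ := exists_affine_le (show x ∈ X.basicOpen ((z b).app W g) ⊓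
    φ ⁻¹ᵁ P1.chart k b from ⟨hx, hb⟩)
  have h1 : V.1 ≤ φ ⁻¹ᵁ P1.chart k b := hV.trans inf_le_right
  have h2 : V.1 ≤ ψ ⁻¹ᵁ P1.chart k b := by rwa [hψ.preimage, ← hφ.preimage]
  have hVW : V.1 ≤ W.1 := hV.trans (inf_le_left.trans (X.basicOpen_le _))
  refine ⟨b, V.1, hxV, h1, h2, fun a => ?_⟩
  have e1 := hφ.ratio a b V h1 ⟨res hVW g.1, I.ideal_le_comap_ideal hVW g.2⟩
  have e2 := hψ.ratio a b V h2 ⟨res hVW g.1, I.ideal_le_comap_ideal hVW g.2⟩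
  have hu : IsUnit ((z b).app V ⟨res hVW g.1, I.ideal_le_comap_ideal hVW g.2⟩) := by
    rw [← H0.res_app]
    exact isUnit_res_of_le_basicOpen hVW _ (hV.trans inf_le_left)
  exact hu.mul_right_cancel (e1.symm.trans e2)

/-- Two sections of a line bundle without common zeros, that satisfy the cross relations, define
a morphism to `ℙ¹`. -/
theorem H0.exists_isMorphismOf {z : Fin 2 → H0 f I}
    (hz : ∀ x, x ∈ (z 0).nonvanishing ∨ x ∈ (z 1).nonvanishing)
    (hc : ∀ (W W' V : X.affineOpens) (h : V.1 ≤ W.1) (h' : V.1 ≤ W'.1) (g : I.ideal W)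
      (g' : I.ideal W'), res h ((z 0).app W g) * res h' ((z 1).app W' g') =
        res h ((z 1).app W g) * res h' ((z 0).app W' g')) :
    ∃ φ : X ⟶ P1 k, H0.IsMorphismOf φ z := by
  have hcr : ∀ (W W' : X.affineOpens) (V : X.Opens) (h : V ≤ W.1) (h' : V ≤ W'.1) (g : I.ideal W)
      (g' : I.ideal W') (a b : Fin 2), res h ((z a).app W g) * res h' ((z b).app W' g') =
        res h ((z b).app W g) * res h' ((z a).app W' g') := by
    intro W W' V h h' g g' a b
    refine eq_of_locally_res fun x hx => ?_
    obtain ⟨U, hxU, hU⟩ := exists_affine_le hx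
    refine ⟨U.1, hxU, hU, ?_⟩
    simp only [map_mul, res_res]
    have := hc W W' U (hU.trans h) (hU.trans h') g g'
    fin_cases a <;> fin_cases b
    · rfl
    · exact this
    · exact this.symm
    · rfl
  let V : (Σ W : X.affineOpens, I.ideal W) → X.Opens := fun p =>
    X.basicOpen ((z 0).app p.1 p.2) ⊔ X.basicOpen ((z 1).app p.1 p.2)
  have hVle : ∀ p, V p ≤ p.1.1 := fun p => sup_le (X.basicOpen_le _) (X.basicOpen_le _)
  have hbV : ∀ p b, X.basicOpen ((z b).app p.1 p.2) ≤ V p := by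
    intro p b
    fin_cases b
    · exact le_sup_left
    · exact le_sup_right
  have hV : ⨆ p, V p = ⊤ := by
    rw [eq_top_iff]
    intro x _
    rw [TopologicalSpace.Opens.mem_iSup]
    rcases hz x with h | h <;> obtain ⟨W, g, h⟩ := H0.mem_nonvanishing.1 h
    · exact ⟨⟨W, g⟩, hbV ⟨W, g⟩ 0 h⟩
    · exact ⟨⟨W, g⟩, hbV ⟨W, g⟩ 1 h⟩
  have hb : ∀ p b, X.basicOpen (res (hVle p) ((z b).app p.1 p.2)) =
      X.basicOpen ((z b).app p.1 p.2) := by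
    intro p b
    rw [basicOpen_res_eq, inf_eq_right]
    exact hbV p b
  obtain ⟨φ, h1, h2⟩ := P1.exists_hom_of_coords f V hV
    (fun p b => res (hVle p) ((z b).app p.1 p.2)) (fun p => by rw [hb, hb]) fun p q => by
      simp only [res_res]
      exact hcr _ _ _ _ _ _ _ 0 1
  refine ⟨φ, h1, fun b => ?_, fun a b W h g => ?_⟩
  · ext x
    constructor
    · intro hx
      have : x ∈ ⨆ p, V p := by rw [hV]; trivial
      obtain ⟨p, hp⟩ := TopologicalSpace.Opens.mem_iSup.1 this
      have h3 : x ∈ X.basicOpen (res (hVle p) ((z b).app p.1 p.2)) :=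
        ((h2 p).preimage b).le ⟨hp, hx⟩
      rw [hb] at h3
      exact H0.mem_nonvanishing.2 ⟨_, _, h3⟩
    · intro hx
      obtain ⟨W, g, hx⟩ := H0.mem_nonvanishing.1 hx
      have h3 := (h2 ⟨W, g⟩).basicOpen_le b
      rw [hb ⟨W, g⟩ b] at h3
      exact h3 hx
  · refine eq_of_locally_res fun x hx => ?_
    have : x ∈ ⨆ p, V p := by rw [hV]; trivial
    obtain ⟨p, hp⟩ := TopologicalSpace.Opens.mem_iSup.1 this
    refine ⟨W.1 ⊓ V p, ⟨hx, hp⟩, inf_le_left, ?_⟩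
    have h3 := (h2 p).ratio a b (W.1 ⊓ V p) inf_le_right (inf_le_left.trans h)
    have h4 := hcr W p.1 (W.1 ⊓ V p) inf_le_left (inf_le_right.trans (hVle p)) g p.2 a b
    simp only [res_res] at h3
    have hu : IsUnit (res (inf_le_right.trans (hVle p) : W.1 ⊓ V p ≤ p.1.1)
        ((z b).app p.1 p.2)) := by
      refine isUnit_res_of_le_basicOpen _ _ ?_
      rw [← hb, ← (h2 p).preimage b]
      exact le_inf inf_le_right (inf_le_left.trans h)
    refine hu.mul_right_cancel (h4.trans ?_)
    rw [← h3, map_mul, res_coordRatio]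
    ring

end Morphism

namespace IsLineChain

variable {k : Type u} [Field k] {K : Type u} [Field K] [Algebra k K] [IsAlgClosed K]
  {C : Scheme.{u}}
  {π : C ⟶ Spec (CommRingCat.of k)} {sMinus sPlus : Spec (CommRingCat.of k) ⟶ C} {n : ℕ}
  {s : Fin (n + 1) → (Spec (CommRingCat.of k) ⟶ C)} {m : ℕ}
  {line : Fin (m + 1) → (P1 K ⟶ bc K π)} {c : Fin (n + 1) → Fin (m + 1)}
  {a : Fin (n + 1) → K} (H : IsLineChain π sMinus sPlus s line c a)
include H

omit [IsAlgClosed K] in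
theorem exists_comp_eq (x : C) : ∃ j y, comp line j y = x := by
  obtain ⟨y, rfl⟩ := (bcFst K π).surjective x
  obtain ⟨j, w, rfl⟩ := H.cover y
  exact ⟨j, w, by simp⟩

theorem le_of_forall_pt {U V : C.Opens} (h : ∀ j b r, point (P1.pt b r ≫ comp line j) ∈ U →
    point (P1.pt b r ≫ comp line j) ∈ V) : U ≤ V := by
  intro x hx
  obtain ⟨j, y, rfl⟩ := H.exists_comp_eq x
  refine P1.mem_of_forall_pt (U := comp line j ⁻¹ᵁ U) (V := comp line j ⁻¹ᵁ V) (fun b r h' => ?_) hx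
  have := h j b r (by rw [point_comp]; exact h')
  rwa [point_comp] at this

/-- The locus on the `j`-th line where the coordinate `X_b` of the `i`-th morphism to `ℙ¹` does not
vanish. -/
def _root_.LosevManin.coordLocus (c j : Fin (m + 1)) (b : Fin 2)
    (p : Spec (CommRingCat.of K) ⟶ P1 K) : Prop :=
  (if b = 0 then j < c else c < j) ∨ (c = j ∧ p ≠ P1.pt (other b) 0)

theorem mem_nonvanishing_iff {i : Fin (n + 1)}
    {z : Module.Basis (Fin 2) k (H0 π (Scheme.Hom.ker (s i)))}
    (hz : IsNormalised sMinus sPlus (s i) z) (b : Fin 2) (j : Fin (m + 1)) (b' : Fin 2) (r : K) :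
    point (P1.pt b' r ≫ comp line j) ∈ (z b).nonvanishing ↔
      coordLocus (c i) j b (P1.pt b' r) := by
  obtain ⟨γ, hγ, h0, h1⟩ := H.normalised_coeffs hz
  have hγ' : algebraMap k K γ ≠ 0 := by simpa using hγ
  have ha := H.ne_zero i
  rw [← not_iff_not]
  change (z b).VanishesAt _ ↔ _
  by_cases hm : c i = j ∧ P1.pt b' r = P1.pt 0 (a i)
  · obtain ⟨rfl, e⟩ := hm
    have h2 : ∀ b, ¬ (z b).VanishesAt (point (s i)) := by
      intro b
      fin_cases b
      · exact fun h => hγ (HasCoeffs.vanishesAt_marked_iff H h0 |>.1 h)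
      · exact fun h => hγ (HasCoeffs.vanishesAt_marked_iff H h1 |>.1 h)
    rw [e, ← point_eq (H.marked i)]
    refine iff_of_false (h2 b) (not_not.2 (Or.inr ⟨rfl, ?_⟩))
    fin_cases b
    · exact (pt_plus_ne _).symm
    · exact H.pt_minus_ne.symm
  · have key : ∀ b'' r', ¬ (c i = j ∧ P1.pt b'' r' = P1.pt 0 (a i)) → ∀ v w,
        HasVal (P1.pt b'' r') (coeff (c i) j (a i) (algebraMap k K (-γ)) (algebraMap k K γ)) v →
        HasVal (P1.pt b'' r') (coeff (c i) j (a i) (algebraMap k K 0) (algebraMap k K γ)) w →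
        (v = 0 ↔ ¬ coordLocus (c i) j 0 (P1.pt b'' r')) →
        (w = 0 ↔ ¬ coordLocus (c i) j 1 (P1.pt b'' r')) →
        ((z b).VanishesAt (point (P1.pt b'' r' ≫ comp line j)) ↔
          ¬ coordLocus (c i) j b (P1.pt b'' r')) := by
      intro b'' r' hm v w hv hw hv' hw'
      fin_cases b
      · exact (HasCoeffs.vanishesAt_iff H h0 (fun e e' => hm ⟨e, e'⟩) hv).trans hv'
      · exact (HasCoeffs.vanishesAt_iff H h1 (fun e e' => hm ⟨e, e'⟩) hw).trans hw'
    rcases lt_trichotomy j (c i) with hj | rfl | hj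
    · refine key b' r hm _ _ (hasVal_coeff_of_lt hj _ _) (hasVal_coeff_of_lt hj _ _) ?_ ?_
      · simp [coordLocus, hj, hγ]
      · simp [coordLocus, hj.ne', hj.le]
    · rcases P1.pt_cases b' r with e | ⟨r', e⟩
      · rw [e] at hm ⊢
        refine key 1 0 hm _ _ (hasVal_coeff_infty le_rfl) (hasVal_coeff_infty le_rfl) ?_ ?_
        · simp [coordLocus]
        · simp [coordLocus, hγ, pt_plus_ne]
      · rw [e] at hm ⊢
        have hr : r' ≠ a i := fun h => hm ⟨rfl, by rw [h]⟩
        have hr' := sub_ne_zero.2 hr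
        refine key 0 r' hm _ _ (hasVal_coeff_self hr) (hasVal_coeff_self hr) ?_ ?_
        · have : algebraMap k K (-γ) + algebraMap k K γ * (r' / (r' - a i)) =
              algebraMap k K γ * (a i / (r' - a i)) := by
            rw [map_neg]; field_simp; ring
          rw [this]
          simp [coordLocus, hγ, ha, hr', (pt_plus_ne r').symm]
        · have : P1.pt 0 r' = P1.pt 0 0 ↔ r' = 0 :=
            ⟨fun h => P1.pt_injective 0 h, fun h => by rw [h]⟩
          simp [coordLocus, hγ, hr', this]
    · refine key b' r hm _ _ (hasVal_coeff_of_gt hj _ _) (hasVal_coeff_of_gt hj _ _) ?_ ?_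
      · simp [coordLocus, hj.ne, hj.le]
      · simp [coordLocus, hj, hγ]

/-- The sections of a normalised basis define a morphism to `ℙ¹`. -/
theorem exists_isMorphismOf {i : Fin (n + 1)}
    {z : Module.Basis (Fin 2) k (H0 π (Scheme.Hom.ker (s i)))}
    (hz : IsNormalised sMinus sPlus (s i) z) : ∃ φ : C ⟶ P1 k, H0.IsMorphismOf φ z := by
  obtain ⟨γ, hγ, h0, h1⟩ := H.normalised_coeffs hz
  refine H0.exists_isMorphismOf (fun x => ?_) fun W W' V h h' g g' => ?_
  · have : (⊤ : C.Opens) ≤ (z 0).nonvanishing ⊔ (z 1).nonvanishing := by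
      refine H.le_of_forall_pt fun j b r _ => ?_
      rw [← SetLike.mem_coe, TopologicalSpace.Opens.coe_sup]
      refine (?_ : _ ∨ _)
      rw [SetLike.mem_coe, SetLike.mem_coe, H.mem_nonvanishing_iff hz,
        H.mem_nonvanishing_iff hz]
      rcases lt_trichotomy j (c i) with hj | rfl | hj
      · exact Or.inl (Or.inl hj)
      · by_cases e : P1.pt b r = P1.pt 1 0
        · exact Or.inr (Or.inr ⟨rfl, by rw [e]; exact pt_plus_ne _⟩)
        · exact Or.inl (Or.inr ⟨rfl, e⟩)
      · exact Or.inr (Or.inl hj)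
    exact this (show x ∈ (⊤ : C.Opens) from trivial)
  · rw [← sub_eq_zero]
    refine H.eq_zero_of_lineFn V.2 fun j hj => ?_
    rw [map_sub, map_mul, map_mul, lineFn_res, lineFn_res, lineFn_res, lineFn_res]
    refine (congrArg₂ (· - ·) (congrArg₂ (· * ·) (h0 j W _ g) (h1 j W' _ g'))
      (congrArg₂ (· * ·) (h1 j W _ g) (h0 j W' _ g'))).trans ?_
    ring

/-- The morphism `C ⟶ (ℙ¹)^(n+1)` given by normalised bases exists and is unique. -/
theorem existsUnique_morphism {z : ∀ i, Module.Basis (Fin 2) k (H0 π (Scheme.Hom.ker (s i)))}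
    (hz : ∀ i, IsNormalised sMinus sPlus (s i) (z i)) :
    ∃! φ : C ⟶ P1Pow k n, φ ≫ P1Pow.toSpec k n = π ∧
      ∀ i, H0.IsMorphismOf (φ ≫ P1Pow.proj k n i) (z i) := by
  choose φ hφ using fun i => H.exists_isMorphismOf (hz i)
  obtain ⟨Φ, h1, h2⟩ := P1Pow.exists_lift π φ fun i => (hφ i).comp_toSpec
  refine ⟨Φ, ⟨h1, fun i => by rw [h2]; exact hφ i⟩, fun Ψ hΨ => P1Pow.hom_ext fun i => ?_⟩
  rw [h2]
  exact (hΨ.2 i).unique (hφ i)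

end IsLineChain

/-- The coordinates of a morphism `C ⟶ (ℙ¹)^(n+1)` on the lines of a chain: on the `j`-th line, the
ratio `X_{i,1} / X_{i,0}` is `0`, `x / a i` and `∞`, for `j < c i`, `j = c i` and `j > c i`. -/
structure HasLineCoords {k : Type u} [Field k] {K : Type u} [Field K] [Algebra k K] {C : Scheme.{u}}
    {π : C ⟶ Spec (CommRingCat.of k)} {n m : ℕ} (line : Fin (m + 1) → (P1 K ⟶ bc K π))
    (c : Fin (n + 1) → Fin (m + 1)) (a : Fin (n + 1) → K) (φ : Fin (n + 1) → (C ⟶ P1 k)) :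
    Prop where
  mem : ∀ i b j b' r, point (P1.pt b' r ≫ comp line j) ∈ φ i ⁻¹ᵁ P1.chart k b ↔
    coordLocus (c i) j b (P1.pt b' r)
  zero : ∀ i j W h h', j < c i → lineFn (comp line j) W h' (coordRatio (φ i) 1 0 W h) = 0
  infty : ∀ i j W h h', c i < j → lineFn (comp line j) W h' (coordRatio (φ i) 0 1 W h) = 0
  coord : ∀ i W h h', lineFn (comp line (c i)) W h' (coordRatio (φ i) 1 0 W h) =
    P1.x K / P1.const (a i)

namespace IsLineChain

variable {k : Type u} [Field k] {K : Type u} [Field K] [Algebra k K] [IsAlgClosed K]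
  {C : Scheme.{u}}
  {π : C ⟶ Spec (CommRingCat.of k)} {sMinus sPlus : Spec (CommRingCat.of k) ⟶ C} {n : ℕ}
  {s : Fin (n + 1) → (Spec (CommRingCat.of k) ⟶ C)} {m : ℕ}
  {line : Fin (m + 1) → (P1 K ⟶ bc K π)} {c : Fin (n + 1) → Fin (m + 1)}
  {a : Fin (n + 1) → K} (H : IsLineChain π sMinus sPlus s line c a)
include H

omit [IsAlgClosed K] in
theorem exists_lineFn_ne_zero (i : Fin (n + 1)) (j : Fin (m + 1)) {W : C.Opens}
    (hW : genericPoint (P1 K) ∈ comp line j ⁻¹ᵁ W) :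
    ∃ (V : C.affineOpens) (_ : V.1 ≤ W) (h : genericPoint (P1 K) ∈ comp line j ⁻¹ᵁ V.1)
      (g : (Scheme.Hom.ker (s i)).ideal V), lineFn (comp line j) V.1 h g.1 = 1 := by
  have hne : point (P1.pt 1 0 ≫ comp line j) ≠ point (s i) := fun e =>
    pt_plus_ne _ (H.marked_unique e).2
  obtain ⟨W', hx, hW'⟩ := H.exists_affine_of_ne hne
  have hx' : genericPoint (P1 K) ∈ comp line j ⁻¹ᵁ W'.1 := generic_mem_preimage hx
  obtain ⟨V, hV, hVW⟩ := exists_affine_le (show comp line j (genericPoint (P1 K)) ∈ W ⊓ W'.1 from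
    ⟨hW, hx'⟩)
  have hV1 : V.1 ≤ W'.1 := hVW.trans inf_le_right
  have h1 : (1 : Γ(C, V)) ∈ (Scheme.Hom.ker (s i)).ideal V := by
    have := Scheme.IdealSheafData.ideal_le_comap_ideal _ hV1 (hW' 1)
    rwa [Ideal.mem_comap, map_one] at this
  exact ⟨V, hVW.trans inf_le_left, hV, ⟨1, h1⟩, map_one _⟩

theorem hasLineCoords {z : ∀ i, Module.Basis (Fin 2) k (H0 π (Scheme.Hom.ker (s i)))}
    (hz : ∀ i, IsNormalised sMinus sPlus (s i) (z i)) {φ : Fin (n + 1) → (C ⟶ P1 k)}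
    (hφ : ∀ i, H0.IsMorphismOf (φ i) (z i)) : HasLineCoords line c a φ := by
  have key : ∀ i, ∃ γ : k, γ ≠ 0 ∧ ∀ a' b j W h h',
      lineFn (comp line j) W h' (coordRatio (φ i) a' b W h) *
        coeff (c i) j (a i) (algebraMap k K (if b = 0 then -γ else 0)) (algebraMap k K γ) =
        coeff (c i) j (a i) (algebraMap k K (if a' = 0 then -γ else 0)) (algebraMap k K γ) := by
    intro i
    obtain ⟨γ, hγ, h0, h1⟩ := H.normalised_coeffs (hz i)
    have hb : ∀ b : Fin 2, HasCoeffs line (c i) (a i) (z i b) (if b = 0 then -γ else 0) γ := by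
      intro b
      fin_cases b
      · exact h0
      · exact h1
    refine ⟨γ, hγ, fun a' b j W h h' => ?_⟩
    obtain ⟨V, hVW, hV, g, hg⟩ := H.exists_lineFn_ne_zero i j h'
    have e := congrArg (lineFn (comp line j) V.1 hV) ((hφ i).ratio a' b V (hVW.trans h) g)
    rw [map_mul, hb, hb, hg, mul_one, mul_one, ← res_coordRatio _ _ _ hVW h, lineFn_res] at e
    exact e.symm
  refine ⟨fun i b j b' r => ?_, fun i j W h h' hj => ?_, fun i j W h h' hj => ?_,
    fun i W h h' => ?_⟩
  · rw [(hφ i).preimage, H.mem_nonvanishing_iff (hz i)]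
  all_goals
    obtain ⟨γ, hγ, hk⟩ := key i
    have hγ' : P1.const (algebraMap k K γ) ≠ 0 := by simpa using hγ
  · have := hk 1 0 j W h h'
    simp only [coeff, if_pos hj, if_true, map_neg, one_ne_zero, if_false, map_zero] at this
    simpa [hγ] using this
  · have := hk 0 1 j W h h'
    simp only [coeff, if_pos hj, if_neg hj.not_gt, if_true, one_ne_zero, if_false, map_neg,
      map_zero, zero_add, neg_add_cancel] at this
    simpa [hγ] using this
  · have := hk 1 0 (c i) W h h'
    simp only [coeff, lt_irrefl, if_true, one_ne_zero, if_false, map_neg, map_zero, zero_add,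
      P1.pole] at this
    have hx := P1.x_sub_ne_zero (a i)
    have ha : P1.const (a i) ≠ 0 := by simpa using H.ne_zero i
    rw [eq_div_iff ha]
    field_simp at this
    linear_combination this

end IsLineChain

namespace IsLineChain

variable {k : Type u} [Field k] {K : Type u} [Field K] [Algebra k K] [IsAlgClosed K]
  {C : Scheme.{u}}
  {π : C ⟶ Spec (CommRingCat.of k)} {sMinus sPlus : Spec (CommRingCat.of k) ⟶ C} {n : ℕ}
  {s : Fin (n + 1) → (Spec (CommRingCat.of k) ⟶ C)} {m : ℕ}
  {line : Fin (m + 1) → (P1 K ⟶ bc K π)} {c : Fin (n + 1) → Fin (m + 1)}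
  {a : Fin (n + 1) → K} (H : IsLineChain π sMinus sPlus s line c a)
  {Φ : C ⟶ P1Pow k n} (hΦ : Φ ≫ P1Pow.toSpec k n = π)
  (L : HasLineCoords line c a fun i => Φ ≫ P1Pow.proj k n i)

/-- The chart of `(ℙ¹)^(n+1)` that contains the lines before the `l`-th intersection point in the
charts at infinity, and those after it in the charts at zero. -/
def _root_.LosevManin.cut (c : Fin (n + 1) → Fin (m + 1)) (l : ℕ) (i : Fin (n + 1)) : Fin 2 :=
  if (c i).1 < l then 1 else 0

include H

omit [IsAlgClosed K] in
theorem hasVal_coord {i : Fin (n + 1)} (r : K) : HasVal (P1.pt 0 r) (P1.x K / P1.const (a i))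
    (r / a i) := by
  rw [div_eq_mul_inv, div_eq_mul_inv]
  exact (P1.hasVal_x r).mul ((P1.hasVal_const _ _ _).inv (H.ne_zero i))

include L

omit [IsAlgClosed K] in
theorem mem_cut {l : ℕ} (hl : l ≤ m + 1) (j : Fin (m + 1)) (b : Fin 2) (r : K) :
    point (P1.pt b r ≫ comp line j) ∈ Φ ⁻¹ᵁ P1Pow.chart (cut c l) ↔
      (j.1 = l ∧ P1.pt b r ≠ P1.pt 1 0) ∨ (j.1 + 1 = l ∧ P1.pt b r ≠ P1.pt 0 0) := by
  have h1 : point (P1.pt b r ≫ comp line j) ∈ Φ ⁻¹ᵁ P1Pow.chart (cut c l) ↔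
      ∀ i, coordLocus (c i) j (cut c l i) (P1.pt b r) := by
    refine Iff.trans P1Pow.mem_chart (forall_congr' fun i => ?_)
    rw [← L.mem i]
    simp
  rw [h1]
  constructor
  · intro h
    obtain ⟨i, hi⟩ := H.stable j
    have hh := h i
    rcases lt_or_ge j.1 l with hj | hj
    · right
      have hc : cut c l i = 1 := if_pos (by rw [hi]; exact hj)
      rw [hc] at hh
      simp only [coordLocus, one_ne_zero, if_false, hi, lt_irrefl, true_and, false_or] at hh
      refine ⟨?_, hh⟩
      by_contra hne
      obtain ⟨i', hi'⟩ := H.stable ⟨j.1 + 1, by omega⟩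
      have hc' : cut c l i' = 1 := if_pos (by rw [hi']; simp only; omega)
      have := h i'
      rw [hc'] at this
      simp only [coordLocus, one_ne_zero, if_false, hi', Fin.lt_def, Fin.ext_iff] at this
      omega
    · left
      have hc : cut c l i = 0 := if_neg (by rw [hi]; exact hj.not_gt)
      rw [hc] at hh
      simp only [coordLocus, if_true, hi, lt_irrefl, true_and, false_or] at hh
      refine ⟨?_, hh⟩
      by_contra hne
      obtain ⟨i', hi'⟩ := H.stable ⟨l, by omega⟩
      have hc' : cut c l i' = 0 := if_neg (by rw [hi']; simp)
      have := h i'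
      rw [hc'] at this
      simp only [coordLocus, if_true, hi', Fin.lt_def, Fin.ext_iff] at this
      omega
  · intro h i
    simp only [cut, coordLocus, Fin.lt_def, Fin.ext_iff]
    rcases h with ⟨hj, h⟩ | ⟨hj, h⟩
    · split_ifs with h2 h3
      · exact absurd h3 (by simp)
      · left; omega
      · rcases Nat.lt_or_ge j.1 (c i).1 with h4 | h4
        · exact Or.inl h4
        · exact Or.inr ⟨by omega, h⟩
      · exact absurd rfl ‹_›
    · split_ifs with h2 h3
      · exact absurd h3 (by simp)
      · rcases Nat.lt_or_ge (c i).1 j.1 with h4 | h4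
        · exact Or.inl h4
        · exact Or.inr ⟨by omega, h⟩
      · left; omega
      · exact absurd rfl ‹_›

theorem exists_cut (x : C) : ∃ l : Fin (m + 2), x ∈ Φ ⁻¹ᵁ P1Pow.chart (cut c l) := by
  have : (⊤ : C.Opens) ≤ ⨆ l : Fin (m + 2), Φ ⁻¹ᵁ P1Pow.chart (cut c l) := by
    refine H.le_of_forall_pt fun j b r _ => ?_
    rw [TopologicalSpace.Opens.mem_iSup]
    by_cases h : P1.pt b r = P1.pt 1 0
    · refine ⟨j.succ, (H.mem_cut L (by simp; omega) j b r).2 (Or.inr ⟨rfl, ?_⟩)⟩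
      rw [h]
      exact pt_plus_ne 0
    · exact ⟨j.castSucc, (H.mem_cut L (by simp) j b r).2 (Or.inl ⟨rfl, h⟩)⟩
  exact TopologicalSpace.Opens.mem_iSup.1 (this (show x ∈ (⊤ : C.Opens) from trivial))

include hΦ

theorem isFinite [Algebra.IsAlgebraic k K] : IsFinite Φ := by
  have := H.isProper
  have hp : IsProper Φ := by
    have : IsProper (Φ ≫ P1Pow.toSpec k n) := by rw [hΦ]; infer_instance
    exact IsProper.of_comp Φ (P1Pow.toSpec k n)
  have : LocallyQuasiFinite Φ := by
    refine LocallyQuasiFinite.of_finite_preimage_singleton _ fun p => ?_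
    have hfin : ∀ j, {r : K | Φ (point (P1.pt 0 r ≫ comp line j)) = p}.Finite := by
      intro j
      by_cases hex : ∃ r : K, Φ (point (P1.pt 0 r ≫ comp line j)) = p
      swap
      · convert Set.finite_empty
        ext r
        simp only [Set.mem_ofPred_eq, Set.mem_empty_iff_false, iff_false]
        exact fun h => hex ⟨r, h⟩
      obtain ⟨r₀, hr₀⟩ := hex
      obtain ⟨i, hi⟩ := H.stable j
      subst hi
      obtain ⟨f, hf, hf0⟩ := Algebra.IsAlgebraic.isAlgebraic (R := k) (r₀ / a i)
      have hmem : ∀ r, point (P1.pt 0 r ≫ comp line (c i)) ∈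
          (Φ ≫ P1Pow.proj k n i) ⁻¹ᵁ P1.chart k 0 := fun r =>
        (L.mem i 0 _ 0 r).2 (Or.inr ⟨rfl, (pt_plus_ne r).symm⟩)
      have hev : ∀ r, f.aeval (r / a i) = 0 ↔
          P1Pow.proj k n i (Φ (point (P1.pt 0 r ≫ comp line (c i)))) ∉
            (P1 k).basicOpen (P1.poly 0 f) := by
        intro r
        have hmem' : point ((P1.pt 0 r ≫ comp line (c i)) ≫ Φ ≫ P1Pow.proj k n i) ∈
            P1.chart k 0 := by
          rw [point_comp]
          exact hmem r
        have h1 := mem_basicOpen_iff _ _ hmem' (P1.poly 0 f)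
        have h2 : point ((P1.pt 0 r ≫ comp line (c i)) ≫ Φ ≫ P1Pow.proj k n i) =
            P1Pow.proj k n i (Φ (point (P1.pt 0 r ≫ comp line (c i)))) := by
          rw [point_comp, Scheme.Hom.comp_apply]
        rw [← h2, h1, not_not]
        have h3 : evalAt _ _ hmem' (P1.poly 0 f) = f.aeval (r / a i) := by
          have e : (evalAt _ _ hmem').comp (P1.poly 0) =
              (Polynomial.aeval (R := k) (r / a i)).toRingHom := by
            refine Polynomial.ringHom_ext (fun x => ?_) ?_
            · simp only [RingHom.comp_apply, P1.poly, Polynomial.coe_eval₂RingHom,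
                Polynomial.eval₂_C, AlgHom.toRingHom_eq_coe, RingHom.coe_coe, Polynomial.aeval_C]
              refine evalAt_scalar (algebraMap k K) ?_ _ _ _
              simp only [Category.assoc, P1Pow.proj_toSpec, hΦ]
              rw [← Category.assoc (line _), H.comp_over, ← Category.assoc, P1.pt_toSpec,
                Category.id_comp]
            · simp only [RingHom.comp_apply, P1.poly, Polynomial.coe_eval₂RingHom,
                Polynomial.eval₂_X, AlgHom.toRingHom_eq_coe, RingHom.coe_coe, Polynomial.aeval_X]
              rw [evalAt_comp _ _ le_rfl (hmem r) hmem']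
              have h4 := hasVal_lineFn (comp line (c i)) (P1.pt 0 r) (hmem r)
                (generic_mem_preimage (hmem r)) (coordRatio (Φ ≫ P1Pow.proj k n i) 1 0 _ le_rfl)
              rw [L.coord] at h4
              exact h4.unique (H.hasVal_coord r)
          exact congrArg (fun ρ => ρ f) e
        rw [h3]
      refine (f.rootSet_finite K).preimage (f := fun r => r / a i) ?_ |>.subset ?_
      · intro r _ r' _ h
        exact (div_left_inj' (H.ne_zero i)).1 h
      · intro r hr
        rw [Set.mem_preimage, Polynomial.mem_rootSet]
        refine ⟨hf, (hev r).2 ?_⟩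
        rw [show Φ (point (P1.pt 0 r ≫ comp line (c i))) = p from hr, ← hr₀]
        exact (hev r₀).1 hf0
    refine ((Set.finite_iUnion fun j => ((hfin j).image fun r => point (P1.pt 0 r ≫ comp line j)) |>.union
      (Set.toFinite {comp line j (genericPoint (P1 K)), point (P1.pt 1 0 ≫ comp line j)}))).subset ?_
    intro x hx
    obtain ⟨j, y, rfl⟩ := H.exists_comp_eq x
    rw [Set.mem_iUnion]
    refine ⟨j, ?_⟩
    rcases P1.point_cases y with rfl | ⟨b, r, rfl⟩
    · exact Or.inr (Or.inl rfl)
    · rw [← point_comp] at hx ⊢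
      rcases P1.pt_cases b r with e | ⟨r', e⟩
      · rw [e]; exact Or.inr (Or.inr rfl)
      · rw [e] at hx ⊢
        exact Or.inl ⟨r', hx, rfl⟩
  exact IsFinite.of_isProper_of_locallyQuasiFinite Φ

end IsLineChain

section Equations

variable {k : Type u} [Field k] {n : ℕ} {S T : Scheme.{u}}

theorem appLE_dehomogenise (g : S ⟶ T) (f : T ⟶ Spec (CommRingCat.of k))
    (φ : Fin (n + 1) → (T ⟶ P1 k)) (ε : Fin (n + 1) → Fin 2) (W : T.Opens)
    (h : ∀ i, W ≤ φ i ⁻¹ᵁ P1.chart k (ε i)) (V : S.Opens) (hV : V ≤ g ⁻¹ᵁ W)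
    (p : MvPolynomial (Fin (n + 1) × Fin 2) k) :
    (g.appLE W V hV).hom (dehomogenise f φ ε W h p) = dehomogenise (g ≫ f) (fun i => g ≫ φ i) ε V
      (fun i => hV.trans (Scheme.Hom.preimage_mono g (h i))) p := by
  rw [dehomogenise, dehomogenise, MvPolynomial.eval₂_comp_left]
  congr 1
  · ext c
    exact appLE_scalar f g W V hV c
  · funext ib
    exact appLE_coordRatio g (φ ib.1) ib.2 (ε ib.1) W (h ib.1) V hV

theorem res_dehomogenise (f : T ⟶ Spec (CommRingCat.of k))
    (φ : Fin (n + 1) → (T ⟶ P1 k)) (ε : Fin (n + 1) → Fin 2) {V W : T.Opens} (i : V ≤ W)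
    (h : ∀ i, W ≤ φ i ⁻¹ᵁ P1.chart k (ε i)) (p : MvPolynomial (Fin (n + 1) × Fin 2) k) :
    res i (dehomogenise f φ ε W h p) = dehomogenise f φ ε V (fun j => i.trans (h j)) p := by
  rw [dehomogenise, dehomogenise, MvPolynomial.eval₂_comp_left]
  congr 1
  · ext c
    exact res_scalar f i c
  · funext ib
    exact res_coordRatio (φ ib.1) ib.2 (ε ib.1) i (h ib.1)

/-- The dehomogenisation of an equation on a standard chart of `(ℙ¹)^(n+1)`. -/
def chartEquation (ε : Fin (n + 1) → Fin 2) (p : MvPolynomial (Fin (n + 1) × Fin 2) k) :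
    Γ(P1Pow k n, P1Pow.chart ε) :=
  dehomogenise (P1Pow.toSpec k n) (P1Pow.proj k n) ε _ (P1Pow.chart_le ε) p

/-- A criterion for a quasi-compact morphism to `(ℙ¹)^(n+1)` to have the closed subscheme defined by
a set of equations as its scheme-theoretic image. -/
theorem ker_eq_equationIdeal {Y : Scheme.{u}} (f : Y ⟶ P1Pow k n) [QuasiCompact f]
    (E : Set (MvPolynomial (Fin (n + 1) × Fin 2) k))
    (h1 : ∀ p ∈ E, ∀ (ε : Fin (n + 1) → Fin 2) (W : (P1Pow k n).affineOpens)
      (h : ∀ i, W.1 ≤ P1Pow.proj k n i ⁻¹ᵁ P1.chart k (ε i)),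
      dehomogenise (P1Pow.toSpec k n) (P1Pow.proj k n) ε W.1 h p ∈ (Scheme.Hom.ker f).ideal W)
    (h2 : ∀ x : P1Pow k n, ∃ ε, x ∈ P1Pow.chart ε ∧
      ((∃ p ∈ E, x ∈ (P1Pow k n).basicOpen (chartEquation ε p)) ∨
        ∀ g ∈ (Scheme.Hom.ker f).ideal ⟨P1Pow.chart ε, P1Pow.isAffineOpen_chart ε⟩,
          g ∈ Ideal.span (chartEquation ε '' E))) :
    Scheme.Hom.ker f = equationIdeal E := by
  refine le_antisymm (le_sInf fun J hJ => ?_) (sInf_le h1)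
  have h3 : ∀ x : P1Pow k n, ∃ W : (P1Pow k n).affineOpens, x ∈ W.1 ∧
      (Scheme.Hom.ker f).ideal W ≤ J.ideal W := by
    intro x
    obtain ⟨ε, hx, ⟨p, hp, hxp⟩ | hε⟩ := h2 x
    · have hW := (P1Pow.isAffineOpen_chart (k := k) ε).basicOpen (chartEquation ε p)
      refine ⟨⟨_, hW⟩, hxp, le_top.trans (top_le_iff.2 ?_)⟩
      have hle : (P1Pow k n).basicOpen (chartEquation ε p) ≤ P1Pow.chart ε :=
        (P1Pow k n).basicOpen_le _
      have := hJ p hp ε ⟨_, hW⟩ fun i => hle.trans (P1Pow.chart_le ε i)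
      refine Ideal.eq_top_of_isUnit_mem _ this ?_
      have hu := isUnit_res_of_le_basicOpen hle (chartEquation ε p) le_rfl
      rw [show res hle (chartEquation ε p) = _ from res_dehomogenise _ _ ε hle (P1Pow.chart_le ε) p]
        at hu
      exact hu
    · refine ⟨⟨_, P1Pow.isAffineOpen_chart ε⟩, hx, fun g hg => ?_⟩
      refine Ideal.span_le.2 ?_ (hε g hg)
      rintro _ ⟨p, hp, rfl⟩
      exact hJ p hp ε ⟨_, P1Pow.isAffineOpen_chart ε⟩ (P1Pow.chart_le ε)
  choose W hW hle using h3
  refine Scheme.IdealSheafData.le_of_iSup_eq_top W ?_ hle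
  rw [eq_top_iff]
  intro x _
  exact TopologicalSpace.Opens.mem_iSup.2 ⟨x, hW x⟩

/-- The coordinates `X_{i,b} / X_{i, ε i}` on a standard chart of `(ℙ¹)^(n+1)`. -/
def chartCoord (ε : Fin (n + 1) → Fin 2) (i : Fin (n + 1)) (b : Fin 2) :
    Γ(P1Pow k n, P1Pow.chart ε) :=
  coordRatio (P1Pow.proj k n i) b (ε i) _ (P1Pow.chart_le ε i)

theorem chartCoord_self (ε : Fin (n + 1) → Fin 2) (i : Fin (n + 1)) :
    chartCoord (k := k) ε i (ε i) = 1 :=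
  coordRatio_self _ _ _ _

theorem chartEquation_X (ε : Fin (n + 1) → Fin 2) (ib : Fin (n + 1) × Fin 2) :
    chartEquation (k := k) ε (MvPolynomial.X ib) = chartCoord ε ib.1 ib.2 :=
  MvPolynomial.eval₂_X _ _ _

theorem chartEquation_sub (ε : Fin (n + 1) → Fin 2) (p q : MvPolynomial (Fin (n + 1) × Fin 2) k) :
    chartEquation ε (p - q) = chartEquation ε p - chartEquation ε q :=
  MvPolynomial.eval₂_sub _ _ _

theorem chartEquation_curve (ε : Fin (n + 1) → Fin 2) (r r' : k) (i j : Fin (n + 1)) :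
    chartEquation ε (MvPolynomial.C r * MvPolynomial.X (j, 1) * MvPolynomial.X (i, 0) -
      MvPolynomial.C r' * MvPolynomial.X (j, 0) * MvPolynomial.X (i, 1)) =
    scalar (P1Pow.toSpec k n) _ r * chartCoord ε j 1 * chartCoord ε i 0 -
      scalar (P1Pow.toSpec k n) _ r' * chartCoord ε j 0 * chartCoord ε i 1 := by
  simp only [chartEquation, dehomogenise, MvPolynomial.eval₂_sub, MvPolynomial.eval₂_mul,
    MvPolynomial.eval₂_C, MvPolynomial.eval₂_X]
  rfl

theorem mem_basicOpen_chartCoord {ε : Fin (n + 1) → Fin 2} {x : P1Pow k n} (hx : x ∈ P1Pow.chart ε)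
    (i : Fin (n + 1)) (b : Fin 2) : x ∈ (P1Pow k n).basicOpen (chartCoord ε i b) ↔
      P1Pow.proj k n i x ∈ P1.chart k b := by
  have := (hasCoords_coordRatio (P1Pow.proj k n i) (ε i) _ (P1Pow.chart_le ε i)).preimage b
  rw [chartCoord, ← this]
  exact ⟨fun h => h.2, fun h => ⟨hx, h⟩⟩

/-- A point where the equation of the curve for `(i, j)` vanishes. -/
theorem mem_chart_iff_of_notMem {ε : Fin (n + 1) → Fin 2} {x : P1Pow k n} (hx : x ∈ P1Pow.chart ε)
    {r r' : k} {i j : Fin (n + 1)} (h : x ∉ (P1Pow k n).basicOpen (chartEquation ε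
      (MvPolynomial.C r * MvPolynomial.X (j, 1) * MvPolynomial.X (i, 0) -
        MvPolynomial.C r' * MvPolynomial.X (j, 0) * MvPolynomial.X (i, 1)))) :
    (r ≠ 0 ∧ P1Pow.proj k n j x ∈ P1.chart k 1 ∧ P1Pow.proj k n i x ∈ P1.chart k 0) ↔
      (r' ≠ 0 ∧ P1Pow.proj k n j x ∈ P1.chart k 0 ∧ P1Pow.proj k n i x ∈ P1.chart k 1) := by
  rw [← Scheme.evaluation_eq_zero_iff_notMem_basicOpen _ _ hx, chartEquation_curve] at h
  have h0 : ∀ (q : k), ((P1Pow k n).evaluation _ x hx).hom (scalar (P1Pow.toSpec k n) _ q) ≠ 0 ↔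
      q ≠ 0 := fun q => by
    have := (((P1Pow k n).evaluation _ x hx).hom.comp (scalar (P1Pow.toSpec k n) _)).injective
    exact not_congr (map_eq_zero_iff _ this)
  simp only [← mem_basicOpen_chartCoord hx, ← h0 r, ← h0 r',
    ← Scheme.evaluation_ne_zero_iff_mem_basicOpen _ _ hx]
  change ((P1Pow k n).evaluation _ x hx).hom _ = 0 at h
  rw [map_sub, sub_eq_zero, map_mul, map_mul, map_mul, map_mul] at h
  rw [← and_assoc, ← and_assoc]
  change (_ ≠ 0 ∧ ((P1Pow k n).evaluation _ x hx).hom _ ≠ 0) ∧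
    ((P1Pow k n).evaluation _ x hx).hom _ ≠ 0 ↔ (_ ≠ 0 ∧
    ((P1Pow k n).evaluation _ x hx).hom _ ≠ 0) ∧ ((P1Pow k n).evaluation _ x hx).hom _ ≠ 0
  rw [← mul_ne_zero_iff, ← mul_ne_zero_iff, ← mul_ne_zero_iff, ← mul_ne_zero_iff, h]

/-- A point where the equation `X_{i,1} = X_{i,0}` holds. -/
theorem mem_chart_of_notMem {ε : Fin (n + 1) → Fin 2} {x : P1Pow k n} (hx : x ∈ P1Pow.chart ε)
    {i : Fin (n + 1)} (h : x ∉ (P1Pow k n).basicOpen (chartEquation ε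
      (MvPolynomial.X (i, 1) - MvPolynomial.X (i, 0)))) (b : Fin 2) :
    P1Pow.proj k n i x ∈ P1.chart k b := by
  rw [← Scheme.evaluation_eq_zero_iff_notMem_basicOpen _ _ hx, chartEquation_sub, chartEquation_X,
    chartEquation_X] at h
  change ((P1Pow k n).evaluation _ x hx).hom _ = 0 at h
  rw [map_sub, sub_eq_zero] at h
  have key : ∀ b b', ((P1Pow k n).evaluation _ x hx).hom (chartCoord ε i b) =
      ((P1Pow k n).evaluation _ x hx).hom (chartCoord ε i b') := by
    intro b b'
    fin_cases b <;> fin_cases b'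
    exacts [rfl, h.symm, h, rfl]
  rw [← mem_basicOpen_chartCoord hx, ← Scheme.evaluation_ne_zero_iff_mem_basicOpen _ _ hx]
  change ((P1Pow k n).evaluation _ x hx).hom _ ≠ 0
  rw [key b (ε i), chartCoord_self, map_one]
  exact one_ne_zero

theorem P1Pow.exists_mem_chart (x : P1Pow k n) : ∃ ε, x ∈ P1Pow.chart ε := by
  choose ε hε using fun i => LosevManin.exists_mem_chart (P1Pow.proj k n i) x
  exact ⟨ε, P1Pow.mem_chart.2 hε⟩

theorem mul_eval₂_of_mul_eq_zero {R : Type*} [CommRing R] (ψ : k →+* R) {u v : R} (h : u * v = 0)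
    (Q : Polynomial k) : u * Q.eval₂ ψ v = u * ψ (Q.eval 0) := by
  conv_lhs => rw [← Polynomial.divX_mul_X_add Q]
  rw [Polynomial.eval₂_add, Polynomial.eval₂_mul, Polynomial.eval₂_X, Polynomial.eval₂_C,
    Polynomial.coeff_zero_eq_eval_zero]
  linear_combination (Q.divX.eval₂ ψ v) * h

/-- If, modulo an ideal, all coordinates on a chart are multiples of one of two elements with
product zero, then all functions are sums of polynomials in these two elements. -/
theorem exists_polynomials {ε : Fin (n + 1) → Fin 2} {R : Type u} [CommRing R]
    (q : Γ(P1Pow k n, P1Pow.chart ε) →+* R) {u v : R} (huv : u * v = 0)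
    (h : ∀ i, ∃ ρ, q (chartCoord ε i (other (ε i))) = q (scalar (P1Pow.toSpec k n) _ ρ) * u ∨
      q (chartCoord ε i (other (ε i))) = q (scalar (P1Pow.toSpec k n) _ ρ) * v)
    (f : Γ(P1Pow k n, P1Pow.chart ε)) : ∃ P Q : Polynomial k,
      q f = P.eval₂ (q.comp (scalar (P1Pow.toSpec k n) _)) u +
        Q.eval₂ (q.comp (scalar (P1Pow.toSpec k n) _)) v := by
  set ψ := q.comp (scalar (P1Pow.toSpec k n) (P1Pow.chart ε))
  obtain ⟨p, rfl⟩ := P1Pow.poly_surjective ε f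
  induction p using MvPolynomial.induction_on with
  | C r =>
    refine ⟨Polynomial.C r, 0, ?_⟩
    rw [P1Pow.poly, MvPolynomial.eval₂Hom_C]
    simp [ψ]
  | add p p' hp hp' =>
    obtain ⟨P, Q, e⟩ := hp
    obtain ⟨P', Q', e'⟩ := hp'
    refine ⟨P + P', Q + Q', ?_⟩
    rw [map_add, map_add, e, e', Polynomial.eval₂_add, Polynomial.eval₂_add]
    ring
  | mul_X p i hp =>
    obtain ⟨P, Q, e⟩ := hp
    rw [map_mul, map_mul, e]
    have hX : P1Pow.poly ε (MvPolynomial.X i) = chartCoord (k := k) ε i (other (ε i)) := by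
      rw [P1Pow.poly, MvPolynomial.eval₂Hom_X']
      rfl
    rw [hX]
    obtain ⟨ρ, hρ | hρ⟩ := h i
    · refine ⟨(P + Polynomial.C (Q.eval 0)) * Polynomial.X * Polynomial.C ρ, 0, ?_⟩
      have := mul_eval₂_of_mul_eq_zero ψ huv Q
      simp only [Polynomial.eval₂_add, Polynomial.eval₂_mul, Polynomial.eval₂_C, Polynomial.eval₂_X,
        Polynomial.eval₂_zero]
      rw [hρ]
      change _ * (ψ ρ * u) = _
      linear_combination (ψ ρ) * this
    · refine ⟨0, (Q + Polynomial.C (P.eval 0)) * Polynomial.X * Polynomial.C ρ, ?_⟩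
      have := mul_eval₂_of_mul_eq_zero ψ ((mul_comm v u).trans huv) P
      simp only [Polynomial.eval₂_add, Polynomial.eval₂_mul, Polynomial.eval₂_C, Polynomial.eval₂_X,
        Polynomial.eval₂_zero]
      rw [hρ]
      change _ * (ψ ρ * v) = _
      linear_combination (ψ ρ) * this

end Equations

/-- The relation between ratios `t` and the positions of the marked points on a chain. -/
def IsAdapted {k : Type u} [Field k] {K : Type u} [Field K] [Algebra k K] {n m : ℕ}
    (c : Fin (n + 1) → Fin (m + 1)) (a : Fin (n + 1) → K) (t : Fin (n + 1) → Fin (n + 1) → k) :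
    Prop :=
  ∀ i j, i ≠ j → ¬ (t i j = 0 ∧ t j i = 0) ∧ (c i < c j → t j i = 0) ∧
    (c i = c j → algebraMap k K (t i j) * a i = algebraMap k K (t j i) * a j)

theorem IsAdapted.ne_zero {k : Type u} [Field k] {K : Type u} [Field K] [Algebra k K] {n m : ℕ}
    {c : Fin (n + 1) → Fin (m + 1)} {a : Fin (n + 1) → K} {t : Fin (n + 1) → Fin (n + 1) → k}
    (ht : IsAdapted c a t) (ha : ∀ i, a i ≠ 0) {i j : Fin (n + 1)} (hij : i ≠ j)
    (h : c i ≤ c j) : t i j ≠ 0 := by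
  intro h0
  obtain ⟨h1, h2, h3⟩ := ht i j hij
  rcases h.lt_or_eq with h | h
  · exact h1 ⟨h0, h2 h⟩
  · have := h3 h
    rw [h0, map_zero, zero_mul, eq_comm, mul_eq_zero] at this
    exact h1 ⟨h0, by simpa [ha] using this⟩

namespace IsLineChain

variable {k : Type u} [Field k] {K : Type u} [Field K] [Algebra k K]
  {C : Scheme.{u}}
  {π : C ⟶ Spec (CommRingCat.of k)} {sMinus sPlus : Spec (CommRingCat.of k) ⟶ C} {n : ℕ}
  {s : Fin (n + 1) → (Spec (CommRingCat.of k) ⟶ C)} {m : ℕ}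
  {line : Fin (m + 1) → (P1 K ⟶ bc K π)} {c : Fin (n + 1) → Fin (m + 1)}
  {a : Fin (n + 1) → K} (H : IsLineChain π sMinus sPlus s line c a)
  {Φ : C ⟶ P1Pow k n}
  (L : HasLineCoords line c a fun i => Φ ≫ P1Pow.proj k n i)
  {t : Fin (n + 1) → Fin (n + 1) → k} (ht : IsAdapted c a t)

section
include L

theorem _root_.LosevManin.HasLineCoords.generic_mem (i : Fin (n + 1)) (b : Fin 2) :
    genericPoint (P1 K) ∈ comp line (c i) ⁻¹ᵁ (Φ ≫ P1Pow.proj k n i) ⁻¹ᵁ P1.chart k b := by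
  fin_cases b
  · exact generic_mem_preimage ((L.mem i 0 _ 0 0).2 (Or.inr ⟨rfl, (pt_plus_ne 0).symm⟩))
  · exact generic_mem_preimage ((L.mem i 1 _ 1 0).2 (Or.inr ⟨rfl, pt_plus_ne 0⟩))

theorem _root_.LosevManin.HasLineCoords.coord_inv (i : Fin (n + 1)) (W h h') :
    lineFn (comp line (c i)) W h' (coordRatio (Φ ≫ P1Pow.proj k n i) 0 1 W h) =
      P1.const (a i) / P1.x K := by
  have hg : genericPoint (P1 K) ∈ comp line (c i) ⁻¹ᵁ (W ⊓ (Φ ≫ P1Pow.proj k n i) ⁻¹ᵁ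
      P1.chart k 0) := ⟨h', L.generic_mem i 0⟩
  have h1 := coordRatio_mul (Φ ≫ P1Pow.proj k n i) 1 0 0 (W ⊓ (Φ ≫ P1Pow.proj k n i) ⁻¹ᵁ
      P1.chart k 0) (inf_le_left.trans h) inf_le_right
  have h2 := congrArg (lineFn (comp line (c i)) _ hg) h1
  rw [map_mul, coordRatio_self, map_one, L.coord, ← res_coordRatio _ _ _ inf_le_left h,
    lineFn_res] at h2
  rw [eq_inv_of_mul_eq_one_left h2, inv_div]

end

theorem pb_chartCoord (Φ : C ⟶ P1Pow k n) (ε : Fin (n + 1) → Fin 2) (i : Fin (n + 1)) (b : Fin 2) :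
    pb Φ (P1Pow.chart ε) (chartCoord ε i b) = coordRatio (Φ ≫ P1Pow.proj k n i) b (ε i) _
      (Scheme.Hom.preimage_mono Φ (P1Pow.chart_le ε i)) :=
  appLE_coordRatio Φ _ _ _ _ _ _ _

include H L ht

/-- Generators for the functions on a cut chart, modulo the equations of the curve. -/
theorem exists_generators {l : ℕ} (hl : l ≤ m + 1) :
    ∃ (u v : Γ(P1Pow k n, P1Pow.chart (cut c l))) (α β : K), α ≠ 0 ∧ β ≠ 0 ∧
      (∀ j h, j.1 = l → lineFn (comp line j) (Φ ⁻¹ᵁ P1Pow.chart (cut c l)) h (pb Φ _ u) =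
        P1.const α * P1.x K) ∧
      (∀ j h, j.1 + 1 = l → lineFn (comp line j) (Φ ⁻¹ᵁ P1Pow.chart (cut c l)) h (pb Φ _ u) = 0) ∧
      (∀ j h, j.1 = l → lineFn (comp line j) (Φ ⁻¹ᵁ P1Pow.chart (cut c l)) h (pb Φ _ v) = 0) ∧
      (∀ j h, j.1 + 1 = l → lineFn (comp line j) (Φ ⁻¹ᵁ P1Pow.chart (cut c l)) h (pb Φ _ v) =
        P1.const β * (P1.x K)⁻¹) ∧
      (l = m + 1 → u = 0) ∧ (l = 0 → v = 0) ∧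
      ∀ (R : Type u) [CommRing R] (q : Γ(P1Pow k n, P1Pow.chart (cut c l)) →+* R),
        (∀ p ∈ curveEquations t, q (chartEquation _ p) = 0) → q u * q v = 0 ∧
        ∀ i, ∃ ρ, q (chartCoord _ i (other (cut c l i))) =
            q (scalar (P1Pow.toSpec k n) _ ρ) * q u ∨
          q (chartCoord _ i (other (cut c l i))) = q (scalar (P1Pow.toSpec k n) _ ρ) * q v := by
  set ε := cut c l with hε
  have hε0 : ∀ i, l ≤ (c i).1 → ε i = 0 := fun i hi => if_neg hi.not_gt
  have hε1 : ∀ i, (c i).1 < l → ε i = 1 := fun i hi => if_pos hi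
  have hself : ∀ i b, ε i = b → chartCoord (k := k) ε i b = 1 := by
    rintro i _ rfl
    exact chartCoord_self ε i
  have heq : ∀ (R : Type u) [CommRing R] (q : Γ(P1Pow k n, P1Pow.chart ε) →+* R),
      (∀ p ∈ curveEquations t, q (chartEquation ε p) = 0) → ∀ i j, i ≠ j →
      q (scalar (P1Pow.toSpec k n) _ (t i j)) * q (chartCoord ε j 1) * q (chartCoord ε i 0) =
      q (scalar (P1Pow.toSpec k n) _ (t j i)) * q (chartCoord ε j 0) * q (chartCoord ε i 1) := by
    intro R _ q hq i j hij
    have := hq _ ⟨i, j, hij, rfl⟩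
    rw [chartEquation_curve, map_sub, sub_eq_zero] at this
    simpa only [map_mul] using this
  have hdiv : ∀ (R : Type u) [CommRing R] (q : Γ(P1Pow k n, P1Pow.chart ε) →+* R) (x y : k)
      (f g : R), x ≠ 0 → q (scalar (P1Pow.toSpec k n) _ x) * f =
        q (scalar (P1Pow.toSpec k n) _ y) * g →
      f = q (scalar (P1Pow.toSpec k n) _ (y / x)) * g := by
    intro R _ q x y f g hx h
    have h1 : q (scalar (P1Pow.toSpec k n) _ x⁻¹) * q (scalar (P1Pow.toSpec k n) _ x) = 1 := by
      rw [← map_mul, ← map_mul, inv_mul_cancel₀ hx, map_one, map_one]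
    rw [div_eq_mul_inv, map_mul, map_mul]
    linear_combination (q (scalar (P1Pow.toSpec k n) _ x⁻¹)) * h - f * h1
  have hu : ∃ u, ∃ α : K, α ≠ 0 ∧
      (∀ j h, j.1 = l → lineFn (comp line j) (Φ ⁻¹ᵁ P1Pow.chart ε) h (pb Φ _ u) =
        P1.const α * P1.x K) ∧
      (∀ j h, j.1 + 1 = l → lineFn (comp line j) (Φ ⁻¹ᵁ P1Pow.chart ε) h (pb Φ _ u) = 0) ∧
      (l = m + 1 → u = 0) ∧ (u = 0 ∨ ∃ i, (c i).1 = l ∧ u = chartCoord ε i 1) ∧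
      ∀ (R : Type u) [CommRing R] (q : Γ(P1Pow k n, P1Pow.chart ε) →+* R),
        (∀ p ∈ curveEquations t, q (chartEquation _ p) = 0) → ∀ i, l ≤ (c i).1 →
        ∃ ρ, q (chartCoord ε i 1) = q (scalar (P1Pow.toSpec k n) _ ρ) * q u := by
    rcases hl.eq_or_lt with rfl | hl
    · refine ⟨0, 1, one_ne_zero, fun j h hj => by omega, fun j h hj => by simp, fun _ => rfl,
        Or.inl rfl, fun R _ q hq i hi => by omega⟩
    · obtain ⟨i₁, hi⟩ := H.stable ⟨l, hl⟩
      have hi₁ : (c i₁).1 = l := by rw [hi]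
      refine ⟨chartCoord ε i₁ 1, (a i₁)⁻¹, inv_ne_zero (H.ne_zero _), fun j h hj => ?_,
        fun j h hj => ?_, fun h => by omega, Or.inr ⟨i₁, hi₁, rfl⟩, fun R _ q hq i hi => ?_⟩
      · obtain rfl : j = c i₁ := Fin.ext (by omega)
        rw [pb_chartCoord]
        have : ∀ b hb, b = 0 → lineFn (comp line (c i₁)) (Φ ⁻¹ᵁ P1Pow.chart ε) h
            (coordRatio (Φ ≫ P1Pow.proj k n i₁) 1 b _ hb) = P1.x K / P1.const (a i₁) := by
          rintro _ hb rfl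
          exact L.coord _ _ _ _
        refine (this _ _ (hε0 _ hi₁.ge)).trans ?_
        rw [map_inv₀, div_eq_inv_mul]
      · rw [pb_chartCoord]
        have : ∀ b hb, b = 0 → lineFn (comp line j) (Φ ⁻¹ᵁ P1Pow.chart ε) h
            (coordRatio (Φ ≫ P1Pow.proj k n i₁) 1 b _ hb) = 0 := by
          rintro _ hb rfl
          exact L.zero _ _ _ _ _ (Fin.lt_def.2 (by omega))
        exact this _ _ (hε0 _ hi₁.ge)
      · by_cases hii : i₁ = i
        · exact ⟨1, by simp [hii]⟩
        · have := heq R q hq i₁ i hii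
          rw [hself i₁ 0 (hε0 _ hi₁.ge), hself i 0 (hε0 _ hi), map_one, mul_one, mul_one] at this
          exact ⟨_, hdiv R q _ _ _ _ (ht.ne_zero H.ne_zero hii (Fin.le_def.2 (by omega))) this⟩
  have hv : ∃ v, ∃ β : K, β ≠ 0 ∧
      (∀ j h, j.1 = l → lineFn (comp line j) (Φ ⁻¹ᵁ P1Pow.chart ε) h (pb Φ _ v) = 0) ∧
      (∀ j h, j.1 + 1 = l → lineFn (comp line j) (Φ ⁻¹ᵁ P1Pow.chart ε) h (pb Φ _ v) =
        P1.const β * (P1.x K)⁻¹) ∧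
      (l = 0 → v = 0) ∧ (v = 0 ∨ ∃ i, (c i).1 < l ∧ v = chartCoord ε i 0) ∧
      ∀ (R : Type u) [CommRing R] (q : Γ(P1Pow k n, P1Pow.chart ε) →+* R),
        (∀ p ∈ curveEquations t, q (chartEquation _ p) = 0) → ∀ i, (c i).1 < l →
        ∃ ρ, q (chartCoord ε i 0) = q (scalar (P1Pow.toSpec k n) _ ρ) * q v := by
    rcases Nat.eq_zero_or_pos l with h0 | hl0
    · refine ⟨0, 1, one_ne_zero, fun j h hj => by simp, fun j h hj => by omega, fun _ => rfl,
        Or.inl rfl, fun R _ q hq i hi => by omega⟩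
    · obtain ⟨i₁, hi⟩ := H.stable ⟨l - 1, by omega⟩
      have hi₁ : (c i₁).1 + 1 = l := by rw [hi]; simp only; omega
      refine ⟨chartCoord ε i₁ 0, a i₁, H.ne_zero _, fun j h hj => ?_,
        fun j h hj => ?_, fun h => by omega, Or.inr ⟨i₁, by omega, rfl⟩, fun R _ q hq i hi => ?_⟩
      · rw [pb_chartCoord]
        have : ∀ b hb, b = 1 → lineFn (comp line j) (Φ ⁻¹ᵁ P1Pow.chart ε) h
            (coordRatio (Φ ≫ P1Pow.proj k n i₁) 0 b _ hb) = 0 := by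
          rintro _ hb rfl
          exact L.infty _ _ _ _ _ (Fin.lt_def.2 (by omega))
        exact this _ _ (hε1 _ (by omega))
      · obtain rfl : j = c i₁ := Fin.ext (by omega)
        rw [pb_chartCoord]
        have : ∀ b hb, b = 1 → lineFn (comp line (c i₁)) (Φ ⁻¹ᵁ P1Pow.chart ε) h
            (coordRatio (Φ ≫ P1Pow.proj k n i₁) 0 b _ hb) = P1.const (a i₁) / P1.x K := by
          rintro _ hb rfl
          exact L.coord_inv _ _ _ _
        refine (this _ _ (hε1 i₁ (by omega))).trans ?_
        rw [div_eq_mul_inv]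
      · by_cases hii : i = i₁
        · exact ⟨1, by simp [hii]⟩
        · have := heq R q hq i i₁ hii
          rw [hself i₁ 1 (hε1 _ (by omega)), hself i 1 (hε1 _ hi), map_one, mul_one, mul_one]
            at this
          exact ⟨_, hdiv R q _ _ _ _ (ht.ne_zero H.ne_zero hii (Fin.le_def.2 (by omega))) this⟩
  obtain ⟨u, α, hα, hu1, hu2, hu3, hu4, hu5⟩ := hu
  obtain ⟨v, β, hβ, hv1, hv2, hv3, hv4, hv5⟩ := hv
  refine ⟨u, v, α, β, hα, hβ, hu1, hu2, hv1, hv2, hu3, hv3, fun R _ q hq => ⟨?_, fun i => ?_⟩⟩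
  · rcases hu4 with rfl | ⟨i₁, h1, rfl⟩
    · simp
    rcases hv4 with rfl | ⟨i₀, h0, rfl⟩
    · simp
    have hlt : c i₀ < c i₁ := Fin.lt_def.2 (by omega)
    have hne : i₀ ≠ i₁ := fun h => by rw [h] at hlt; exact lt_irrefl _ hlt
    have := heq R q hq i₀ i₁ hne
    rw [(ht i₀ i₁ hne).2.1 hlt, map_zero, map_zero, zero_mul, zero_mul, mul_assoc] at this
    have h2 := hdiv R q (t i₀ i₁) 0 _ 0 (ht.ne_zero H.ne_zero hne hlt.le) (by rw [this, mul_zero])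
    rw [h2, mul_zero]
  · rcases Nat.lt_or_ge (c i).1 l with hi | hi
    · obtain ⟨ρ, hρ⟩ := hv5 R q hq i hi
      refine ⟨ρ, Or.inr ?_⟩
      rw [hε1 i hi]
      exact hρ
    · obtain ⟨ρ, hρ⟩ := hu5 R q hq i hi
      refine ⟨ρ, Or.inl ?_⟩
      rw [hε0 i hi]
      exact hρ

end IsLineChain

theorem P1.exists_pt_mem {K : Type u} [Field K] [IsAlgClosed K] {U : (P1 K).Opens}
    (hU : genericPoint (P1 K) ∈ U) : ∃ b r, point (P1.pt b (r : K)) ∈ U := by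
  by_contra! h
  exact (P1.mem_of_forall_pt (V := ⊥) fun b r hr => (h b r hr).elim) hU

theorem P1.eq_C_of_eval₂ {k : Type u} [Field k] {K : Type u} [Field K] [Algebra k K] (b : Fin 2)
    {α : K} (hα : α ≠ 0) {d : K} {P : Polynomial k}
    (h : P.eval₂ (P1.const.comp (algebraMap k K)) (P1.const α * P1.rat b Polynomial.X) =
      P1.const d) : P = Polynomial.C (P.eval 0) := by
  have h1 : P1.rat b ((P.map (algebraMap k K)).comp (Polynomial.C α * Polynomial.X)) =
      P1.rat b (Polynomial.C d) := by
    rw [P1.rat_C, ← h, P1.rat_eq, Polynomial.eval₂_comp, Polynomial.eval₂_map]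
    simp
  have h2 := congrArg Polynomial.natDegree (P1.rat_injective b h1)
  rw [Polynomial.natDegree_comp, Polynomial.natDegree_C_mul_X _ hα, mul_one,
    Polynomial.natDegree_map, Polynomial.natDegree_C] at h2
  rw [← Polynomial.coeff_zero_eq_eval_zero]
  exact Polynomial.eq_C_of_natDegree_eq_zero h2

theorem scalar_congr {k : Type u} [Field k] {X : Scheme.{u}} {f g : X ⟶ Spec (CommRingCat.of k)}
    (h : f = g) (W : X.Opens) (r : k) : scalar f W r = scalar g W r := by rw [h]

theorem eval₂_mul_left {R S : Type*} [CommRing R] [Field S] (ψ : S →+* R) {α : S} (hα : α ≠ 0)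
    (y : R) (P : Polynomial S) :
    (P.comp (Polynomial.C α⁻¹ * Polynomial.X)).eval₂ ψ (ψ α * y) = P.eval₂ ψ y := by
  rw [Polynomial.eval₂_comp]
  congr 1
  rw [Polynomial.eval₂_mul, Polynomial.eval₂_C, Polynomial.eval₂_X, ← mul_assoc, ← map_mul,
    inv_mul_cancel₀ hα, map_one, one_mul]

theorem eval₂_zero_right {R S : Type*} [CommRing R] [CommRing S] (ψ : S →+* R)
    (P : Polynomial S) : P.eval₂ ψ 0 = ψ (P.eval 0) := by
  rw [← Polynomial.coeff_zero_eq_eval_zero]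
  exact Polynomial.eval₂_at_zero ψ

namespace IsLineChain

variable {k : Type u} [Field k] {K : Type u} [Field K] [Algebra k K] [IsAlgClosed K]
  {C : Scheme.{u}}
  {π : C ⟶ Spec (CommRingCat.of k)} {sMinus sPlus : Spec (CommRingCat.of k) ⟶ C} {n : ℕ}
  {s : Fin (n + 1) → (Spec (CommRingCat.of k) ⟶ C)} {m : ℕ}
  {line : Fin (m + 1) → (P1 K ⟶ bc K π)} {c : Fin (n + 1) → Fin (m + 1)}
  {a : Fin (n + 1) → K} (H : IsLineChain π sMinus sPlus s line c a)
  {Φ : C ⟶ P1Pow k n} (hΦ : Φ ≫ P1Pow.toSpec k n = π)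
  (L : HasLineCoords line c a fun i => Φ ≫ P1Pow.proj k n i)
  {t : Fin (n + 1) → Fin (n + 1) → k} (ht : IsAdapted c a t)

include H L

theorem cut_cases {l : ℕ} (hl : l ≤ m + 1) {j : Fin (m + 1)}
    (h : genericPoint (P1 K) ∈ comp line j ⁻¹ᵁ Φ ⁻¹ᵁ P1Pow.chart (cut c l)) :
    j.1 = l ∨ j.1 + 1 = l := by
  obtain ⟨b, r, hbr⟩ := P1.exists_pt_mem h
  have : point (P1.pt b r ≫ comp line j) ∈ Φ ⁻¹ᵁ P1Pow.chart (cut c l) := by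
    rw [point_comp]; exact hbr
  exact ((H.mem_cut L hl j b r).1 this).imp And.left And.left

theorem exists_line_polynomials {l : ℕ} (hl : l ≤ m + 1)
    (g : Γ(C, Φ ⁻¹ᵁ P1Pow.chart (cut c l))) : ∃ P Q : Polynomial K, P.eval 0 = Q.eval 0 ∧
      (∀ j h, j.1 = l → lineFn (comp line j) _ h g = P1.rat 0 P) ∧
      (∀ j h, j.1 + 1 = l → lineFn (comp line j) _ h g = P1.rat 1 Q) := by
  have h0 : ∀ j : Fin (m + 1), j.1 = l → ∀ r, point (P1.pt 0 r ≫ comp line j) ∈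
      Φ ⁻¹ᵁ P1Pow.chart (cut c l) := fun j hj r =>
    (H.mem_cut L hl j 0 r).2 (Or.inl ⟨hj, (pt_plus_ne r).symm⟩)
  have h1 : ∀ j : Fin (m + 1), j.1 + 1 = l → ∀ r, point (P1.pt 1 r ≫ comp line j) ∈
      Φ ⁻¹ᵁ P1Pow.chart (cut c l) := by
    refine fun j hj r => (H.mem_cut L hl j 1 r).2 (Or.inr ⟨hj, ?_⟩)
    by_cases hr : r = 0
    · rw [hr]; exact pt_plus_ne 0
    · rw [P1.pt_one_eq hr]
      exact fun e => inv_ne_zero hr (P1.pt_injective 0 e)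
  have hP : ∀ j : Fin (m + 1), j.1 = l → ∃ P : Polynomial K,
      ∀ h, lineFn (comp line j) (Φ ⁻¹ᵁ P1Pow.chart (cut c l)) h g = P1.rat 0 P := by
    intro j hj
    obtain ⟨P, hP⟩ := P1.eq_rat_of_regular (b := 0)
      (F := lineFn (comp line j) _ (generic_mem_preimage (h0 j hj 0)) g)
      fun r => ⟨_, hasVal_lineFn (comp line j) _ (h0 j hj r) _ g⟩
    exact ⟨P, fun _ => hP⟩
  have hQ : ∀ j : Fin (m + 1), j.1 + 1 = l → ∃ P : Polynomial K,
      ∀ h, lineFn (comp line j) (Φ ⁻¹ᵁ P1Pow.chart (cut c l)) h g = P1.rat 1 P := by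
    intro j hj
    obtain ⟨P, hP⟩ := P1.eq_rat_of_regular (b := 1)
      (F := lineFn (comp line j) _ (generic_mem_preimage (h1 j hj 0)) g)
      fun r => ⟨_, hasVal_lineFn (comp line j) _ (h1 j hj r) _ g⟩
    exact ⟨P, fun _ => hP⟩
  rcases hl.eq_or_lt with rfl | hl'
  · obtain ⟨Q, hQ⟩ := hQ (Fin.last m) rfl
    refine ⟨Polynomial.C (Q.eval 0), Q, by simp, fun j h hj => by omega, fun j h hj => ?_⟩
    obtain rfl : j = Fin.last m := Fin.ext (by simp at hj ⊢; omega)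
    exact hQ _
  · obtain ⟨P, hP⟩ := hP ⟨l, hl'⟩ rfl
    rcases Nat.eq_zero_or_pos l with rfl | hl0
    · refine ⟨P, Polynomial.C (P.eval 0), by simp, fun j h hj => ?_, fun j h hj => by omega⟩
      obtain rfl : j = ⟨0, hl'⟩ := Fin.ext hj
      exact hP _
    · obtain ⟨l, rfl⟩ : ∃ l', l = l' + 1 := ⟨l - 1, by omega⟩
      have hl2 : l < m + 1 := by omega
      obtain ⟨Q, hQ⟩ := hQ ⟨l, hl2⟩ rfl
      refine ⟨P, Q, ?_, fun j h hj => ?_, fun j h hj => ?_⟩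
      · let j' : Fin m := ⟨l, by omega⟩
        have e : P1.pt 1 0 ≫ comp line j'.castSucc = P1.pt 0 0 ≫ comp line j'.succ := by
          rw [comp, comp, ← Category.assoc, H.node, Category.assoc]
        have e1 := hasVal_lineFn (comp line j'.castSucc) _ (h1 j'.castSucc rfl 0)
          (generic_mem_preimage (h1 j'.castSucc rfl 0)) g
        have e2 := hasVal_lineFn (comp line j'.succ) _ (h0 j'.succ rfl 0)
          (generic_mem_preimage (h0 j'.succ rfl 0)) g
        rw [show lineFn (comp line j'.castSucc) _ _ g = _ from hQ _] at e1
        rw [show lineFn (comp line j'.succ) _ _ g = _ from hP _] at e2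
        rw [← e1.unique (P1.hasVal_rat 1 0 Q), ← e2.unique (P1.hasVal_rat 0 0 P)]
        exact (evalAt_congr e _ _ g).symm
      · obtain rfl : j = ⟨l + 1, hl'⟩ := Fin.ext hj
        exact hP _
      · obtain rfl : j = ⟨l, hl2⟩ := Fin.ext (by simpa using hj)
        exact hQ _

omit H L [IsAlgClosed K] in
theorem descend_eval₂_mem (lam : K →ₗ[k] k) {V : C.Opens} (hV : IsAffineOpen V)
    (S : Subring Γ(C, V)) (hS : ∀ r, scalar π V r ∈ S) {w : Γ(C, V)} (hw : w ∈ S)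
    (P : Polynomial K) : descend π lam hV (P.eval₂ (scalar (bcSnd K π) _) (pb (bcFst K π) V w)) ∈ S := by
  induction P using Polynomial.induction_on' with
  | add P Q hP hQ =>
    rw [Polynomial.eval₂_add, map_add]
    exact S.add_mem hP hQ
  | monomial i r =>
    rw [Polynomial.eval₂_monomial, ← map_pow, mul_comm, descend_pb_mul_scalar]
    exact S.mul_mem (S.pow_mem hw _) (hS _)

include hΦ ht

theorem pb_chart_surjective {l : ℕ} (hl : l ≤ m + 1)
    (hV : IsAffineOpen (Φ ⁻¹ᵁ P1Pow.chart (cut c l))) :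
    Function.Surjective (pb Φ (P1Pow.chart (cut c l))) := by
  set V := Φ ⁻¹ᵁ P1Pow.chart (cut c l)
  intro g
  obtain ⟨u, v, α, β, hα, hβ, hu1, hu2, hv1, hv2, -⟩ := H.exists_generators L ht hl
  obtain ⟨P, Q, hPQ, hP, hQ⟩ := H.exists_line_polynomials L hl g
  obtain ⟨lam, hlam⟩ := exists_left_inverse (k := k) (K := K)
  set P' := P.comp (Polynomial.C α⁻¹ * Polynomial.X)
  set Q' := Q.comp (Polynomial.C β⁻¹ * Polynomial.X)
  have hP0 : P'.eval 0 = P.eval 0 := by simp [P']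
  have hQ0 : Q'.eval 0 = P.eval 0 := by simp [Q', hPQ]
  have key : pb (bcFst K π) V g =
      P'.eval₂ (scalar (bcSnd K π) _) (pb (bcFst K π) V (pb Φ _ u)) +
      Q'.eval₂ (scalar (bcSnd K π) _) (pb (bcFst K π) V (pb Φ _ v)) -
      pb (bcFst K π) V 1 * scalar (bcSnd K π) _ (P.eval 0) := by
    rw [← sub_eq_zero]
    refine H.eq_zero_of_lineFn_bc fun j h => ?_
    have hj' : genericPoint (P1 K) ∈ comp line j ⁻¹ᵁ V := h
    have hs : (lineFn (line j) (bcFst K π ⁻¹ᵁ V) h).comp (scalar (bcSnd K π) _) = P1.const := by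
      ext r
      exact lineFn_scalar (H.line_over j) _ h r
    have hs' : ∀ r, lineFn (line j) (bcFst K π ⁻¹ᵁ V) h (scalar (bcSnd K π) _ r) = P1.const r :=
      fun r => lineFn_scalar (H.line_over j) _ h r
    have hpb : ∀ w, lineFn (line j) (bcFst K π ⁻¹ᵁ V) h (pb (bcFst K π) V w) =
        lineFn (comp line j) V hj' w := fun w => lineFn_pb (line j) (bcFst K π) V h w
    rw [map_sub, map_sub, map_add, map_mul, map_one, map_one, one_mul, hs',
      Polynomial.hom_eval₂, Polynomial.hom_eval₂, hs, hpb, hpb, hpb]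
    rcases H.cut_cases L hl hj' with hj | hj
    · have e1 : lineFn (comp line j) V hj' (pb Φ _ u) = _ := hu1 j hj' hj
      have e2 : lineFn (comp line j) V hj' (pb Φ _ v) = _ := hv1 j hj' hj
      rw [e1, e2, hP j hj' hj, eval₂_mul_left _ hα, eval₂_zero_right, hQ0, P1.rat_eq]
      change Polynomial.eval₂ P1.const (P1.x K) P - _ = 0
      ring
    · have e1 : lineFn (comp line j) V hj' (pb Φ _ u) = _ := hu2 j hj' hj
      have e2 : lineFn (comp line j) V hj' (pb Φ _ v) = _ := hv2 j hj' hj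
      rw [e1, e2, hQ j hj' hj, eval₂_mul_left _ hβ, eval₂_zero_right, hP0, P1.rat_eq,
        P1.rat_one_X]
      ring
  have hS : ∀ r, scalar π V r ∈ (pb Φ (P1Pow.chart (cut c l))).range := by
    intro r
    refine ⟨scalar (P1Pow.toSpec k n) _ r, ?_⟩
    refine (appLE_scalar _ Φ _ _ _ r).trans ?_
    exact scalar_congr hΦ _ _
  have hg := congrArg (descend π lam hV) key
  rw [descend_pb π lam hV hlam, map_sub, map_add, descend_pb_mul_scalar, one_mul] at hg
  change g ∈ (pb Φ (P1Pow.chart (cut c l))).range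
  rw [hg]
  exact Subring.sub_mem _ (Subring.add_mem _ (descend_eval₂_mem lam hV _ hS ⟨u, rfl⟩ _)
    (descend_eval₂_mem lam hV _ hS ⟨v, rfl⟩ _)) (hS _)

omit H hΦ ht in
theorem coord_zero {i : Fin (n + 1)} {l : Fin (m + 1)} {b : Fin 2} {W : C.Opens}
    (h : W ≤ (Φ ≫ P1Pow.proj k n i) ⁻¹ᵁ P1.chart k b)
    (h' : genericPoint (P1 K) ∈ comp line l ⁻¹ᵁ W) (b' : Fin 2)
    (hl : if b' = 1 then l < c i else c i < l) :
    lineFn (comp line l) W h' (coordRatio (Φ ≫ P1Pow.proj k n i) b' b W h) = 0 := by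
  by_cases hb : b = b'
  · subst hb
    obtain ⟨b', r, hbr⟩ := P1.exists_pt_mem h'
    have : point (P1.pt b' r ≫ comp line l) ∈ W := by rw [point_comp]; exact hbr
    have := (L.mem i b l b' r).1 (h this)
    fin_cases b <;> simp [coordLocus] at this hl <;> omega
  · fin_cases b' <;> fin_cases b
    · exact absurd rfl hb
    · exact L.infty _ _ _ _ _ (by simpa using hl)
    · exact L.zero _ _ _ _ _ (by simpa using hl)
    · exact absurd rfl hb

omit H hΦ ht [IsAlgClosed K] in
theorem coord_eq {i : Fin (n + 1)} {b : Fin 2} {W : C.Opens} (ha : a i ≠ 0)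
    (h : W ≤ (Φ ≫ P1Pow.proj k n i) ⁻¹ᵁ P1.chart k b)
    (h' : genericPoint (P1 K) ∈ comp line (c i) ⁻¹ᵁ W) :
    P1.const (a i) * lineFn (comp line (c i)) W h' (coordRatio (Φ ≫ P1Pow.proj k n i) 1 b W h) =
      P1.x K * lineFn (comp line (c i)) W h' (coordRatio (Φ ≫ P1Pow.proj k n i) 0 b W h) := by
  have ha' : P1.const (a i) ≠ 0 := by simpa using ha
  fin_cases b
  · have e1 := L.coord i W h h'
    have e2 := congrArg (lineFn (comp line (c i)) W h')
      (coordRatio_self (Φ ≫ P1Pow.proj k n i) 0 W h)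
    rw [map_one] at e2
    refine (congrArg₂ _ rfl e1).trans (Eq.trans ?_ (congrArg₂ _ rfl e2).symm)
    field_simp
  · have e1 := L.coord_inv i W h h'
    have e2 := congrArg (lineFn (comp line (c i)) W h')
      (coordRatio_self (Φ ≫ P1Pow.proj k n i) 1 W h)
    rw [map_one] at e2
    refine (congrArg₂ _ rfl e2).trans (Eq.trans ?_ (congrArg₂ _ rfl e1).symm)
    have := P1.x_ne_zero (k := K)
    field_simp

omit hΦ in
/-- The equations of the curve hold on the chain. -/
theorem dehomogenise_eq_zero {p : MvPolynomial (Fin (n + 1) × Fin 2) k} (hp : p ∈ curveEquations t)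
    (ε : Fin (n + 1) → Fin 2) (W : C.Opens) (hW : IsAffineOpen W)
    (h : ∀ i, W ≤ (Φ ≫ P1Pow.proj k n i) ⁻¹ᵁ P1.chart k (ε i)) :
    dehomogenise π (fun i => Φ ≫ P1Pow.proj k n i) ε W h p = 0 := by
  obtain ⟨i, j, hij, rfl⟩ := hp
  refine H.eq_zero_of_lineFn hW fun l hl => ?_
  simp only [dehomogenise, MvPolynomial.eval₂_sub, MvPolynomial.eval₂_mul,
    MvPolynomial.eval₂_C, MvPolynomial.eval₂_X, coordRatios, map_sub, map_mul]
  have hs : ∀ r, lineFn (comp line l) W hl (scalar π W r) = P1.const (algebraMap k K r) :=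
    H.lineFn_comp_scalar l W hl
  set R : Fin (n + 1) → Fin 2 → (P1 K).functionField := fun i b =>
    lineFn (comp line l) W hl (coordRatio (Φ ≫ P1Pow.proj k n i) b (ε i) W (h i)) with hR
  have h0 : ∀ i, l < c i → R i 1 = 0 := fun i hi => coord_zero L (h i) hl 1 (by simpa using hi)
  have h1 : ∀ i, c i < l → R i 0 = 0 := fun i hi => coord_zero L (h i) hl 0 (by simpa using hi)
  have h2 : ∀ i, c i = l → P1.const (a i) * R i 1 = P1.x K * R i 0 := by
    rintro i rfl
    exact coord_eq L (H.ne_zero i) (h i) hl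
  change lineFn (comp line l) W hl (scalar π W (t i j)) * R j 1 * R i 0 -
    lineFn (comp line l) W hl (scalar π W (t j i)) * R j 0 * R i 1 = 0
  rw [hs, hs]
  clear_value R
  have key : ∀ i j, i ≠ j → c i ≤ c j → P1.const (algebraMap k K (t i j)) * R j 1 * R i 0 -
      P1.const (algebraMap k K (t j i)) * R j 0 * R i 1 = 0 := by
    intro i j hij hc
    rcases hc.lt_or_eq with hc | hc
    · rw [(ht i j hij).2.1 hc, map_zero, map_zero, zero_mul, zero_mul, sub_zero]
      rcases lt_or_ge l (c j) with hlj | hlj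
      · rw [h0 j hlj]; ring
      · rw [h1 i (hc.trans_le hlj)]; ring
    · rcases lt_trichotomy l (c i) with hl | hl | hl
      · rw [h0 i hl, h0 j (hc ▸ hl)]; ring
      · have e1 := h2 i hl.symm
        have e2 := h2 j (hc.symm.trans hl.symm)
        have e3 := congrArg P1.const ((ht i j hij).2.2 hc)
        rw [map_mul, map_mul] at e3
        have hai : P1.const (a i) ≠ 0 := by simpa using H.ne_zero i
        have haj : P1.const (a j) ≠ 0 := by simpa using H.ne_zero j
        refine mul_left_cancel₀ (mul_ne_zero hai haj) ?_
        linear_combination (P1.const (algebraMap k K (t i j)) * P1.const (a i) * R i 0) * e2 -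
          (P1.const (algebraMap k K (t j i)) * P1.const (a j) * R j 0) * e1 +
          (P1.x K * R j 0 * R i 0) * e3
      · rw [h1 i hl, h1 j (hc ▸ hl)]; ring
  rcases le_total (c i) (c j) with hc | hc
  · exact key i j hij hc
  · linear_combination - key j i hij.symm hc

theorem pb_chartEquation {l : ℕ} (hV : IsAffineOpen (Φ ⁻¹ᵁ P1Pow.chart (cut c l)))
    {p : MvPolynomial (Fin (n + 1) × Fin 2) k} (hp : p ∈ curveEquations t) :
    pb Φ (P1Pow.chart (cut c l)) (chartEquation (cut c l) p) = 0 := by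
  subst hΦ
  refine (appLE_dehomogenise Φ _ _ _ _ _ _ _ _).trans ?_
  exact H.dehomogenise_eq_zero L ht hp _ _ hV _

theorem mem_span_of_pb_eq_zero {l : ℕ} (hl : l ≤ m + 1)
    (hV : IsAffineOpen (Φ ⁻¹ᵁ P1Pow.chart (cut c l))) {g : Γ(P1Pow k n, P1Pow.chart (cut c l))}
    (hg : pb Φ _ g = 0) : g ∈ Ideal.span (chartEquation (cut c l) '' curveEquations t) := by
  obtain ⟨u, v, α, β, hα, hβ, hu1, hu2, hv1, hv2, hu3, hv3, hq⟩ := H.exists_generators L ht hl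
  set Sp := Ideal.span (chartEquation (cut c l) '' curveEquations t) with hSp
  obtain ⟨h1, h2⟩ := hq _ (Ideal.Quotient.mk Sp) fun p hp =>
    Ideal.Quotient.eq_zero_iff_mem.2 (Ideal.subset_span ⟨p, hp, rfl⟩)
  obtain ⟨P, Q, hPQ⟩ := exists_polynomials (Ideal.Quotient.mk Sp) h1 h2 g
  set sc := scalar (P1Pow.toSpec k n) (P1Pow.chart (cut c l)) with hsc
  rw [← Polynomial.hom_eval₂, ← Polynomial.hom_eval₂, ← map_add, Ideal.Quotient.eq] at hPQ
  have hle : Sp ≤ RingHom.ker (pb Φ (P1Pow.chart (cut c l))) := by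
    refine Ideal.span_le.2 ?_
    rintro _ ⟨p, hp, rfl⟩
    exact H.pb_chartEquation hΦ L ht hV hp
  have hg' : pb Φ _ (P.eval₂ sc u + Q.eval₂ sc v) = 0 := by
    have := hle hPQ
    rw [RingHom.mem_ker, map_sub, hg, zero_sub, neg_eq_zero] at this
    exact this
  have hline : ∀ j h, (P.eval₂ (P1.const.comp (algebraMap k K))
      (lineFn (comp line j) (Φ ⁻¹ᵁ P1Pow.chart (cut c l)) h (pb Φ _ u))) +
      (Q.eval₂ (P1.const.comp (algebraMap k K))
      (lineFn (comp line j) (Φ ⁻¹ᵁ P1Pow.chart (cut c l)) h (pb Φ _ v))) = 0 := by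
    intro j h
    have e := congrArg (lineFn (comp line j) _ h) hg'
    rw [map_zero, map_add, map_add, Polynomial.hom_eval₂, Polynomial.hom_eval₂,
      Polynomial.hom_eval₂, Polynomial.hom_eval₂] at e
    have hs : ((lineFn (comp line j) (Φ ⁻¹ᵁ P1Pow.chart (cut c l)) h).comp
        ((pb Φ (P1Pow.chart (cut c l))).comp sc)) = P1.const.comp (algebraMap k K) := by
      ext r
      have e1 : pb Φ (P1Pow.chart (cut c l)) (sc r) = scalar π _ r :=
        (appLE_scalar _ Φ _ _ _ r).trans (scalar_congr hΦ _ _)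
      exact (congrArg (lineFn (comp line j) _ h) e1).trans (H.lineFn_comp_scalar j _ h r)
    rwa [hs] at e
  have hgen0 : ∀ j : Fin (m + 1), j.1 = l → genericPoint (P1 K) ∈ comp line j ⁻¹ᵁ
      Φ ⁻¹ᵁ P1Pow.chart (cut c l) := fun j hj => generic_mem_preimage (s := P1.pt 0 0)
    ((H.mem_cut L hl j 0 0).2 (Or.inl ⟨hj, (pt_plus_ne 0).symm⟩))
  have hgen1 : ∀ j : Fin (m + 1), j.1 + 1 = l → genericPoint (P1 K) ∈ comp line j ⁻¹ᵁ
      Φ ⁻¹ᵁ P1Pow.chart (cut c l) := fun j hj => generic_mem_preimage (s := P1.pt 1 0)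
    ((H.mem_cut L hl j 1 0).2 (Or.inr ⟨hj, pt_plus_ne 0⟩))
  have hl0 : ∀ j : Fin (m + 1), j.1 = l → P.eval₂ (P1.const.comp (algebraMap k K))
      (P1.const α * P1.x K) + P1.const (algebraMap k K (Q.eval 0)) = 0 := by
    intro j hj
    have := hline j (hgen0 j hj)
    rwa [hu1 j _ hj, hv1 j _ hj, eval₂_zero_right] at this
  have hl1 : ∀ j : Fin (m + 1), j.1 + 1 = l → P1.const (algebraMap k K (P.eval 0)) +
      Q.eval₂ (P1.const.comp (algebraMap k K)) (P1.const β * (P1.x K)⁻¹) = 0 := by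
    intro j hj
    have := hline j (hgen1 j hj)
    rwa [hu2 j _ hj, hv2 j _ hj, eval₂_zero_right] at this
  have hPc : l < m + 1 → P = Polynomial.C (P.eval 0) := fun hl' =>
    P1.eq_C_of_eval₂ 0 hα (d := - algebraMap k K (Q.eval 0)) (by
      rw [map_neg]
      exact eq_neg_of_add_eq_zero_left (hl0 ⟨l, hl'⟩ rfl))
  have hQc : 0 < l → Q = Polynomial.C (Q.eval 0) := fun hl' =>
    P1.eq_C_of_eval₂ 1 hβ (d := - algebraMap k K (P.eval 0)) (by
      rw [map_neg, P1.rat_one_X]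
      exact eq_neg_of_add_eq_zero_right (hl1 ⟨l - 1, by omega⟩ (by simp only; omega)))
  have hPu : P.eval₂ sc u = sc (P.eval 0) := by
    rcases hl.eq_or_lt with h | h
    · rw [hu3 h, eval₂_zero_right]
    · conv_lhs => rw [hPc h, Polynomial.eval₂_C]
  have hQv : Q.eval₂ sc v = sc (Q.eval 0) := by
    rcases Nat.eq_zero_or_pos l with h | h
    · rw [hv3 h, eval₂_zero_right]
    · conv_lhs => rw [hQc h, Polynomial.eval₂_C]
  have hsum : P.eval 0 + Q.eval 0 = 0 := by
    have : P1.const (algebraMap k K (P.eval 0 + Q.eval 0)) = 0 := by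
      rw [map_add, map_add]
      rcases hl.lt_or_eq with h | h
      · have := hl0 ⟨l, h⟩ rfl
        rw [hPc h, Polynomial.eval₂_C] at this
        exact this
      · have := hl1 (Fin.last m) h.symm
        rw [hQc (by omega), Polynomial.eval₂_C] at this
        exact this
    exact (map_eq_zero (P1.const.comp (algebraMap k K))).1 this
  rwa [hPu, hQv, ← map_add, hsum, map_zero, sub_zero] at hPQ

end IsLineChain

theorem isClosedImmersion_of_cover {X Y : Scheme.{u}} (f : X ⟶ Y) [IsAffineHom f]
    (hf : IsClosed (Set.range f)) {ι : Type*} (U : ι → Y.Opens) (hU : ∀ i, IsAffineOpen (U i))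
    (hc : ∀ x, ∃ i, f x ∈ U i) (hs : ∀ i, Function.Surjective (pb f (U i))) :
    IsClosedImmersion f := by
  let V : Option ι → Y.Opens := fun o => o.elim ⟨_, hf.isOpen_compl⟩ U
  refine IsZariskiLocalAtTarget.of_iSup_eq_top V ?_ fun o => ?_
  · rw [eq_top_iff]
    intro y _
    rw [TopologicalSpace.Opens.mem_iSup]
    by_cases hy : y ∈ Set.range f
    · obtain ⟨x, rfl⟩ := hy
      obtain ⟨i, hi⟩ := hc x
      exact ⟨some i, hi⟩
    · exact ⟨none, hy⟩
  · cases o with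
    | none =>
      have : IsEmpty (f ⁻¹ᵁ V none) := ⟨fun x => x.2 ⟨x.1, rfl⟩⟩
      have : IsEmpty (f ⁻¹ᵁ V none : X.Opens).toScheme := this
      infer_instance
    | some i =>
      have h1 : IsAffine (V (some i)).toScheme := hU i
      have h2 : IsAffine (f ⁻¹ᵁ V (some i) : X.Opens).toScheme := (hU i).preimage f
      refine IsClosedImmersion.of_surjective_of_isAffine _ ?_
      have key : ∀ W, W = U i → Function.Surjective (f.app W).hom := by
        rintro _ rfl
        rw [Scheme.Hom.app_eq_appLE]
        exact hs i
      intro y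
      obtain ⟨y', hy'⟩ := (ConcreteCategory.bijective_of_isIso (X.presheaf.map
        (eqToHom (image_morphismRestrict_preimage f (V (some i)) ⊤)).op)).2 y
      obtain ⟨z, hz⟩ := key _ (V (some i)).ι_image_top y'
      refine ⟨z, (congrArg (fun g => g.hom z) (morphismRestrict_appTop f (V (some i)))).trans ?_⟩
      exact (congrArg _ hz).trans hy'

namespace IsLineChain

variable {k : Type u} [Field k] {K : Type u} [Field K] [Algebra k K] [IsAlgClosed K]
  [Algebra.IsAlgebraic k K] {C : Scheme.{u}}
  {π : C ⟶ Spec (CommRingCat.of k)} {sMinus sPlus : Spec (CommRingCat.of k) ⟶ C} {n : ℕ}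
  {s : Fin (n + 1) → (Spec (CommRingCat.of k) ⟶ C)} {m : ℕ}
  {line : Fin (m + 1) → (P1 K ⟶ bc K π)} {c : Fin (n + 1) → Fin (m + 1)}
  {a : Fin (n + 1) → K} (H : IsLineChain π sMinus sPlus s line c a)
  {Φ : C ⟶ P1Pow k n} (hΦ : Φ ≫ P1Pow.toSpec k n = π)
  (L : HasLineCoords line c a fun i => Φ ≫ P1Pow.proj k n i)
  {t : Fin (n + 1) → Fin (n + 1) → k} (ht : IsAdapted c a t)
include H hΦ L ht

theorem isClosedImmersion : IsClosedImmersion Φ := by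
  have := H.isFinite hΦ L
  refine isClosedImmersion_of_cover Φ Φ.isClosedMap.isClosed_range
    (fun l : Fin (m + 2) => P1Pow.chart (cut c l)) (fun l => P1Pow.isAffineOpen_chart _)
    (H.exists_cut L) fun l => ?_
  exact H.pb_chart_surjective hΦ L ht (by omega) ((P1Pow.isAffineOpen_chart _).preimage Φ)

theorem ker_eq : Scheme.Hom.ker Φ = equationIdeal (curveEquations t) := by
  have := H.isFinite hΦ L
  refine ker_eq_equationIdeal Φ _ (fun p hp ε W h => ?_) fun x => ?_
  · rw [Scheme.Hom.ker_apply, RingHom.mem_ker, Scheme.Hom.app_eq_appLE]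
    refine (appLE_dehomogenise Φ _ _ _ _ _ _ _ _).trans ?_
    subst hΦ
    exact H.dehomogenise_eq_zero L ht hp _ _ (W.2.preimage Φ) _
  · by_cases hx : ∃ ε, x ∈ P1Pow.chart ε ∧ ∃ p ∈ curveEquations t,
        x ∈ (P1Pow k n).basicOpen (chartEquation ε p)
    · obtain ⟨ε, h1, h2⟩ := hx
      exact ⟨ε, h1, Or.inl h2⟩
    push Not at hx
    obtain ⟨ε, hε⟩ := P1Pow.exists_mem_chart x
    have hiff := fun i j hij => mem_chart_iff_of_notMem hε (hx ε hε _ ⟨i, j, hij, rfl⟩)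
    have h01 : ∀ i, P1Pow.proj k n i x ∈ P1.chart k 0 ∨ P1Pow.proj k n i x ∈ P1.chart k 1 := by
      intro i
      have := P1Pow.mem_chart.1 hε i
      generalize ε i = b at this
      fin_cases b
      · exact Or.inl this
      · exact Or.inr this
    have hl : ∃ l ≤ m + 1, x ∈ P1Pow.chart (cut c l) := by
      by_cases hex : ∃ l, ∃ i, (c i).1 = l ∧ P1Pow.proj k n i x ∈ P1.chart k 0
      · classical
        obtain ⟨i₀, hi₀, h0⟩ := Nat.find_spec hex
        refine ⟨Nat.find hex, by rw [← hi₀]; omega, P1Pow.mem_chart.2 fun i => ?_⟩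
        unfold cut
        split_ifs with hi
        · exact (h01 i).resolve_left fun h => Nat.find_min hex hi ⟨i, rfl, h⟩
        · by_cases hii : i₀ = i
          · rwa [← hii]
          by_contra hi0
          have h1 := (h01 i).resolve_left hi0
          have := (hiff i₀ i hii).1 ⟨ht.ne_zero H.ne_zero hii (Fin.le_def.2 (by omega)), h1, h0⟩
          exact hi0 this.2.1
      · refine ⟨m + 1, le_rfl, P1Pow.mem_chart.2 fun i => ?_⟩
        unfold cut
        rw [if_pos (c i).2]
        exact (h01 i).resolve_left fun h => hex ⟨_, i, rfl, h⟩
    obtain ⟨l, hl, hxl⟩ := hl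
    refine ⟨_, hxl, Or.inr fun g hg => ?_⟩
    refine H.mem_span_of_pb_eq_zero hΦ L ht hl ((P1Pow.isAffineOpen_chart _).preimage Φ) ?_
    rw [Scheme.Hom.ker_apply, RingHom.mem_ker, Scheme.Hom.app_eq_appLE] at hg
    exact hg

end IsLineChain

section Points

variable {k : Type u} [Field k] {n : ℕ}

theorem ker_point_eq {p : Spec (CommRingCat.of k) ⟶ P1Pow k n} (hp : p ≫ P1Pow.toSpec k n = 𝟙 _)
    {E : Set (MvPolynomial (Fin (n + 1) × Fin 2) k)} {ε₀ : Fin (n + 1) → Fin 2}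
    (hmem : point p ∈ P1Pow.chart ε₀)
    (h1 : ∀ e ∈ E, ∀ ε (h : point p ∈ P1Pow.chart ε), evalAt p _ h (chartEquation ε e) = 0)
    (h2 : ∀ x : P1Pow k n, (∀ ε, x ∈ P1Pow.chart ε → ∀ e ∈ E,
      x ∉ (P1Pow k n).basicOpen (chartEquation ε e)) → x ∈ P1Pow.chart ε₀)
    (h3 : ∀ i, ∃ ρ, chartCoord ε₀ i (other (ε₀ i)) - scalar (P1Pow.toSpec k n) _ ρ ∈
      Ideal.span (chartEquation ε₀ '' E)) : Scheme.Hom.ker p = equationIdeal E := by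
  refine ker_eq_equationIdeal p E (fun e he ε W h => (mem_ker_iff p W _).2 fun hW => ?_)
    fun x => ?_
  · have hle : W.1 ≤ P1Pow.chart ε := fun x hx => P1Pow.mem_chart.2 fun i => h i hx
    have := h1 e he ε (hle hW)
    rw [← evalAt_res p hle hW] at this
    rw [← this]
    congr 1
    exact (res_dehomogenise _ _ ε hle (P1Pow.chart_le ε) e).symm
  · by_cases hx : ∃ ε, x ∈ P1Pow.chart ε ∧ ∃ e ∈ E,
        x ∈ (P1Pow k n).basicOpen (chartEquation ε e)
    · obtain ⟨ε, h1, h2⟩ := hx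
      exact ⟨ε, h1, Or.inl h2⟩
    push Not at hx
    refine ⟨ε₀, h2 x hx, Or.inr fun g hg => ?_⟩
    set Sp := Ideal.span (chartEquation ε₀ '' E)
    obtain ⟨P, Q, hPQ⟩ := exists_polynomials (Ideal.Quotient.mk Sp) (mul_zero 1) (fun i => by
      obtain ⟨ρ, hρ⟩ := h3 i
      exact ⟨ρ, Or.inl (by rw [mul_one]; exact Ideal.Quotient.eq.2 hρ)⟩) g
    rw [eval₂_zero_right, Polynomial.eval₂_at_one, RingHom.comp_apply, RingHom.comp_apply, ← map_add, ← map_add,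
      Ideal.Quotient.eq] at hPQ
    have hle : Sp ≤ RingHom.ker (evalAt p _ hmem) := by
      refine Ideal.span_le.2 ?_
      rintro _ ⟨e, he, rfl⟩
      exact h1 e he ε₀ hmem
    have h4 := hle hPQ
    have h5 := (mem_ker_iff p _ _).1 hg hmem
    rw [RingHom.mem_ker, map_sub, h5, evalAt_scalar_self hp, zero_sub, neg_eq_zero] at h4
    rwa [h4, map_zero, sub_zero] at hPQ

end Points

namespace IsLineChain

variable {k : Type u} [Field k] {K : Type u} [Field K] [Algebra k K] [IsAlgClosed K]
  [Algebra.IsAlgebraic k K] {C : Scheme.{u}}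
  {π : C ⟶ Spec (CommRingCat.of k)} {sMinus sPlus : Spec (CommRingCat.of k) ⟶ C} {n : ℕ}
  {s : Fin (n + 1) → (Spec (CommRingCat.of k) ⟶ C)} {m : ℕ}
  {line : Fin (m + 1) → (P1 K ⟶ bc K π)} {c : Fin (n + 1) → Fin (m + 1)}
  {a : Fin (n + 1) → K} (H : IsLineChain π sMinus sPlus s line c a)
  {Φ : C ⟶ P1Pow k n} (hΦ : Φ ≫ P1Pow.toSpec k n = π)
  (L : HasLineCoords line c a fun i => Φ ≫ P1Pow.proj k n i)
  {t : Fin (n + 1) → Fin (n + 1) → k} (ht : IsAdapted c a t)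
include H hΦ L ht

theorem evalAt_chartEquation_curve {p : Spec (CommRingCat.of k) ⟶ C}
    {e : MvPolynomial (Fin (n + 1) × Fin 2) k} (he : e ∈ curveEquations t)
    (ε : Fin (n + 1) → Fin 2) (h : point (p ≫ Φ) ∈ P1Pow.chart ε) :
    evalAt (p ≫ Φ) _ h (chartEquation ε e) = 0 := by
  have := H.isFinite hΦ L
  have h' : point p ∈ Φ ⁻¹ᵁ P1Pow.chart ε := by rw [point_comp] at h; exact h
  have h0 : pb Φ (P1Pow.chart ε) (chartEquation ε e) = 0 := by
    subst hΦ
    refine (appLE_dehomogenise Φ _ _ _ _ _ _ _ _).trans ?_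
    exact H.dehomogenise_eq_zero L ht he _ _ ((P1Pow.isAffineOpen_chart _).preimage Φ) _
  rw [← evalAt_pb Φ p h' h, h0, map_zero]

/-- A rational point at which all coordinates `X_{i, b}` vanish is defined by these equations. -/
theorem ker_pole_eq {p : Spec (CommRingCat.of k) ⟶ C} (hp : p ≫ π = 𝟙 _) (b : Fin 2)
    (hb : ∀ i, point p ∉ (Φ ≫ P1Pow.proj k n i) ⁻¹ᵁ P1.chart k (other b)) :
    Scheme.Hom.ker (p ≫ Φ) =
      equationIdeal (curveEquations t ∪ {e | ∃ i, e = MvPolynomial.X (i, other b)}) := by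
  have hmemε : ∀ (x : P1Pow k n) ε, x ∈ P1Pow.chart ε → ∀ i,
      P1Pow.proj k n i x ∉ P1.chart k (other b) → P1Pow.proj k n i x ∈ P1.chart k b := by
    intro x ε hx i hi
    obtain ⟨b', hb'⟩ := exists_mem_chart (P1Pow.proj k n i) x
    by_cases h : b' = b
    · exact h ▸ hb'
    · have : b' = other b := by revert h; fin_cases b <;> fin_cases b' <;> decide
      exact absurd (this ▸ hb') hi
  have hpt : ∀ i, P1Pow.proj k n i (point (p ≫ Φ)) ∉ P1.chart k (other b) := by
    intro i
    rw [point_comp]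
    exact fun h => hb i h
  refine ker_point_eq (ε₀ := fun _ => b) (by rw [Category.assoc, hΦ, hp]) ?_ ?_ ?_ ?_
  · obtain ⟨ε, hε⟩ := P1Pow.exists_mem_chart (point (p ≫ Φ))
    exact P1Pow.mem_chart.2 fun i => hmemε _ ε hε i (hpt i)
  · rintro e (he | ⟨i, rfl⟩) ε h
    · exact H.evalAt_chartEquation_curve hΦ L ht he ε h
    · rw [chartEquation_X]
      by_contra hne
      exact hpt i ((mem_basicOpen_chartCoord h i _).1 ((mem_basicOpen_iff _ _ h _).2 hne))
  · intro x hx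
    obtain ⟨ε, hε⟩ := P1Pow.exists_mem_chart x
    refine P1Pow.mem_chart.2 fun i => hmemε x ε hε i fun hi => ?_
    refine hx ε hε _ (Or.inr ⟨i, rfl⟩) ?_
    rw [chartEquation_X]
    exact (mem_basicOpen_chartCoord hε i _).2 hi
  · intro i
    refine ⟨0, ?_⟩
    rw [map_zero, sub_zero]
    exact Ideal.subset_span ⟨_, Or.inr ⟨i, rfl⟩, chartEquation_X _ _⟩

theorem ker_minus_eq : Scheme.Hom.ker (sMinus ≫ Φ) =
    equationIdeal (curveEquations t ∪ {e | ∃ i, e = MvPolynomial.X (i, 1)}) := by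
  refine H.ker_pole_eq hΦ L ht H.sMinus_over 0 fun i => ?_
  rw [point_eq H.minus]
  refine fun h => ?_
  have := (L.mem i 1 0 0 0).1 h
  simp [coordLocus] at this

theorem ker_plus_eq : Scheme.Hom.ker (sPlus ≫ Φ) =
    equationIdeal (curveEquations t ∪ {e | ∃ i, e = MvPolynomial.X (i, 0)}) := by
  refine H.ker_pole_eq hΦ L ht H.sPlus_over 1 fun i => ?_
  rw [point_eq H.plus]
  refine fun h => ?_
  have := (L.mem i 0 (Fin.last m) 1 0).1 h
  simp [coordLocus] at this; exact absurd (Fin.le_last _) (not_le.2 this)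

theorem ker_marked_eq (i : Fin (n + 1)) : Scheme.Hom.ker (s i ≫ Φ) = equationIdeal
    (curveEquations t ∪ {MvPolynomial.X (i, 1) - MvPolynomial.X (i, 0)}) := by
  have hpt : point (s i ≫ Φ) ∈ P1Pow.chart (k := k) (cut c (c i)) := by
    rw [point_comp, point_eq (H.marked i)]
    exact (H.mem_cut L (c i).2.le (c i) 0 (a i)).2 (Or.inl ⟨rfl, (pt_plus_ne _).symm⟩)
  refine ker_point_eq (ε₀ := cut c (c i)) (by rw [Category.assoc, hΦ, H.s_over]) hpt ?_ ?_ ?_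
  · rintro e (he | rfl) ε h
    · exact H.evalAt_chartEquation_curve hΦ L ht he ε h
    · rw [chartEquation_sub, chartEquation_X, chartEquation_X, map_sub, sub_eq_zero]
      have h' : point (s i) ∈ Φ ⁻¹ᵁ P1Pow.chart ε := by rw [point_comp] at h; exact h
      have h'' : point (P1.pt 0 (a i) ≫ comp line (c i)) ∈ Φ ⁻¹ᵁ P1Pow.chart ε :=
        (mem_comp (H.marked i)).2 h'
      have hg := generic_mem_preimage h''
      rw [← evalAt_pb Φ _ h' h, ← evalAt_pb Φ _ h' h, pb_chartCoord, pb_chartCoord]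
      have e1 := coord_eq L (H.ne_zero i) (Scheme.Hom.preimage_mono Φ (P1Pow.chart_le ε i)) hg
      have e2 := fun b => hasVal_rational (H.s_over i) (H.marked i) h' hg
        (coordRatio (Φ ≫ P1Pow.proj k n i) b (ε i) _
          (Scheme.Hom.preimage_mono Φ (P1Pow.chart_le ε i)))
      have e3 := (P1.hasVal_const 0 (a i) (a i)).mul (e2 1)
      rw [e1] at e3
      have e4 := e3.unique ((P1.hasVal_x (a i)).mul (e2 0))
      exact (algebraMap k K).injective (mul_left_cancel₀ (H.ne_zero i) e4)
  · intro x hx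
    obtain ⟨ε, hε⟩ := P1Pow.exists_mem_chart x
    have hiff := fun i j hij =>
      mem_chart_iff_of_notMem hε (hx ε hε _ (Or.inl ⟨i, j, hij, rfl⟩))
    have hi := fun b => mem_chart_of_notMem hε (hx ε hε _ (Or.inr rfl)) b
    have h01 : ∀ j, P1Pow.proj k n j x ∈ P1.chart k 0 ∨ P1Pow.proj k n j x ∈ P1.chart k 1 := by
      intro i
      have := P1Pow.mem_chart.1 hε i
      generalize ε i = b at this
      fin_cases b
      · exact Or.inl this
      · exact Or.inr this
    refine P1Pow.mem_chart.2 fun j => ?_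
    by_cases hij : i = j
    · exact hij ▸ hi _
    unfold cut
    split_ifs with h
    · by_contra h1
      have h0 := (h01 j).resolve_right h1
      exact h1 ((hiff j i (Ne.symm hij)).1 ⟨ht.ne_zero H.ne_zero (Ne.symm hij)
        (Fin.le_def.2 h.le), hi 1, h0⟩).2.2
    · by_contra h0
      have h1 := (h01 j).resolve_left h0
      exact h0 ((hiff i j hij).1 ⟨ht.ne_zero H.ne_zero hij (Fin.le_def.2 (not_lt.1 h)), h1,
        hi 0⟩).2.1
  · set ε := cut c (c i) with hε
    set Sp := Ideal.span (chartEquation ε '' (curveEquations t ∪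
      {MvPolynomial.X (i, 1) - MvPolynomial.X (i, 0)})) with hSp
    let q := Ideal.Quotient.mk Sp
    suffices h : ∀ j, ∃ ρ, q (chartCoord ε j (other (ε j))) =
        q (scalar (P1Pow.toSpec k n) _ ρ) by
      intro j
      obtain ⟨ρ, hρ⟩ := h j
      exact ⟨ρ, Ideal.Quotient.eq.1 hρ⟩
    have hself : ∀ i b, ε i = b → q (chartCoord (k := k) ε i b) = 1 := by
      rintro i _ rfl
      rw [chartCoord_self, map_one]
    have hq : ∀ e ∈ curveEquations t ∪ {MvPolynomial.X (i, 1) - MvPolynomial.X (i, 0)},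
        q (chartEquation ε e) = 0 := fun e he =>
      Ideal.Quotient.eq_zero_iff_mem.2 (Ideal.subset_span ⟨e, he, rfl⟩)
    have heq : ∀ i j, i ≠ j → q (scalar (P1Pow.toSpec k n) _ (t i j)) * q (chartCoord ε j 1) *
        q (chartCoord ε i 0) =
        q (scalar (P1Pow.toSpec k n) _ (t j i)) * q (chartCoord ε j 0) * q (chartCoord ε i 1) := by
      intro i j hij
      have := hq _ (Or.inl ⟨i, j, hij, rfl⟩)
      rw [chartEquation_curve, map_sub, sub_eq_zero] at this
      simpa only [map_mul] using this
    have hi0 : ε i = 0 := if_neg (lt_irrefl _)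
    have hi : ∀ b, q (chartCoord ε i b) = 1 := by
      have := hq _ (Or.inr rfl)
      rw [chartEquation_sub, chartEquation_X, chartEquation_X, map_sub, sub_eq_zero] at this
      intro b
      fin_cases b
      · exact hself i 0 hi0
      · exact this.trans (hself i 0 hi0)
    have hdiv : ∀ (x y : k) f, x ≠ 0 → q (scalar (P1Pow.toSpec k n) _ x) * f =
        q (scalar (P1Pow.toSpec k n) _ y) → f = q (scalar (P1Pow.toSpec k n) _ (y / x)) := by
      intro x y f hx h
      have h1 : q (scalar (P1Pow.toSpec k n) _ x⁻¹) * q (scalar (P1Pow.toSpec k n) _ x) = 1 := by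
        rw [← map_mul, ← map_mul, inv_mul_cancel₀ hx, map_one, map_one]
      rw [div_eq_mul_inv, map_mul, map_mul]
      linear_combination (q (scalar (P1Pow.toSpec k n) _ x⁻¹)) * h - f * h1
    intro j
    by_cases hij : i = j
    · exact ⟨1, by rw [← hij, hi, map_one, map_one]⟩
    rcases lt_or_ge (c j) (c i) with h | h
    · have hj : ε j = 1 := if_pos (Fin.lt_def.1 h)
      have := heq j i (Ne.symm hij)
      rw [hi, hi, mul_one, mul_one, hself j 1 hj, mul_one] at this
      exact ⟨_, by
        rw [hj]
        exact hdiv _ _ _ (ht.ne_zero H.ne_zero (Ne.symm hij) h.le) this⟩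
    · have hj : ε j = 0 := if_neg (by rw [← Fin.lt_def]; exact h.not_gt)
      have := heq i j hij
      rw [hi, hi, mul_one, mul_one, hself j 0 hj, mul_one] at this
      exact ⟨_, by
        rw [hj]
        exact hdiv _ _ _ (ht.ne_zero H.ne_zero hij h) this⟩

end IsLineChain

namespace IsLineChain

variable {k : Type u} [Field k] {K : Type u} [Field K] [Algebra k K] {C : Scheme.{u}}
    {π : C ⟶ Spec (CommRingCat.of k)} {sMinus sPlus : Spec (CommRingCat.of k) ⟶ C} {n : ℕ}
    {s : Fin (n + 1) → (Spec (CommRingCat.of k) ⟶ C)} {m : ℕ} {line : Fin (m + 1) → (P1 K ⟶ bc K π)}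
    {c : Fin (n + 1) → Fin (m + 1)} {a : Fin (n + 1) → K}
    (H : IsLineChain π sMinus sPlus s line c a)
include H

theorem baseChangeSection_eq {σ : Spec (CommRingCat.of k) ⟶ C} (hσ : σ ≫ π = 𝟙 _)
    {p : Spec (CommRingCat.of K) ⟶ P1 K} (hp : p ≫ P1.toSpec K = 𝟙 _) {j : Fin (m + 1)}
    (h : p ≫ line j ≫ bcFst K π = Spec.map (CommRingCat.ofHom (algebraMap k K)) ≫ σ) :
    baseChangeSection K σ hσ = p ≫ line j := by
  apply pullback.hom_ext
  · rw [baseChangeSection, pullback.lift_fst, Category.assoc, h]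
  · rw [baseChangeSection, pullback.lift_snd, Category.assoc, H.line_over, hp]

theorem eq_poles_of_lt {i j : Fin (m + 1)} (hij : i < j) {x y : P1 K} (h : line i x = line j y) :
    i.1 + 1 = j.1 ∧ x = point (P1.pt 1 (0 : K)) ∧ y = point (P1.pt 0 (0 : K)) := by
  obtain ⟨h1, rfl⟩ := H.inter i j hij x y h
  refine ⟨h1, ?_, rfl⟩
  have := H.line_closed i
  have hi : i.1 < m := by have := j.2; lia
  have hn := H.node ⟨i.1, hi⟩
  have e1 : Fin.castSucc ⟨i.1, hi⟩ = i := rfl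
  have e2 : Fin.succ ⟨i.1, hi⟩ = j := Fin.ext h1
  rw [e1, e2] at hn
  have hn' := congrArg point hn
  rw [point_comp, point_comp] at hn'
  exact (line i).isClosedEmbedding.injective (h.trans hn'.symm)

theorem isStablePointedChain : IsStablePointedChain (bcSnd K π)
    (baseChangeSection K sMinus H.sMinus_over) (baseChangeSection K sPlus H.sPlus_over)
    (fun i => baseChangeSection K (s i) (H.s_over i)) m line
    (fun _ => point (P1.pt 0 0)) (fun _ => point (P1.pt 1 0)) := by
  have hm := H.baseChangeSection_eq H.sMinus_over (P1.pt_toSpec 0 0) H.minus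
  have hp := H.baseChangeSection_eq H.sPlus_over (P1.pt_toSpec 1 0) H.plus
  have hs := fun i => H.baseChangeSection_eq (H.s_over i) (P1.pt_toSpec 0 (a i)) (H.marked i)
  have hinj : ∀ {j} {x y : P1 K}, line j x = line j y → x = y := fun {j} x y h =>
    have := H.line_closed j
    (line j).isClosedEmbedding.injective h
  have hpt : ∀ {p q : Spec (CommRingCat.of K) ⟶ P1 K}, p ≫ P1.toSpec K = 𝟙 _ →
      q ≫ P1.toSpec K = 𝟙 _ → point p = point q → p = q := fun h h' e =>
    eq_of_point_eq_self h' h e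
  have := H.isProper
  refine ⟨inferInstance, H.isReduced, H.line_over, H.line_closed, ?_, ?_, ?_, ?_, ?_, ?_, ?_,
    H.transversal, ?_, ?_, ?_, ?_, ?_, ?_, ?_⟩
  · intro x
    obtain ⟨j, y, h⟩ := H.cover x
    exact ⟨j, y, h⟩
  · exact fun _ => isClosed_point (P1.pt_toSpec 0 (0 : K))
  · exact fun _ => isClosed_point (P1.pt_toSpec 1 (0 : K))
  · exact fun _ h => pt_plus_ne 0 (hpt (P1.pt_toSpec _ _) (P1.pt_toSpec _ _) h.symm)
  · intro i j hij
    rw [Set.disjoint_left]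
    rintro _ ⟨x, rfl⟩ ⟨y, h⟩
    have := (H.eq_poles_of_lt (Fin.lt_def.2 (by lia)) h.symm).1
    lia
  · intro j
    have := congrArg point (H.node j)
    rwa [point_comp, point_comp] at this
  · intro j
    have hj := congrArg point (H.node j)
    rw [point_comp, point_comp] at hj
    ext z
    constructor
    · rintro ⟨⟨x, rfl⟩, y, h⟩
      rw [(H.eq_poles_of_lt Fin.castSucc_lt_succ h.symm).2.1]
      rfl
    · rintro rfl
      exact ⟨⟨_, rfl⟩, _, hj.symm⟩
  · exact pullback.lift_snd _ _ _
  · exact pullback.lift_snd _ _ _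
  · exact fun i => pullback.lift_snd _ _ _
  · rw [hm, point_comp]
  · rw [hp, point_comp]
  · intro i j
    rw [hs, point_comp]
    have h0 : point (P1.pt 0 (a i)) ≠ point (P1.pt 0 0) := fun h =>
      H.pt_minus_ne (hpt (P1.pt_toSpec _ _) (P1.pt_toSpec _ _) h).symm
    have h1 : point (P1.pt 0 (a i)) ≠ point (P1.pt 1 0) := fun h =>
      pt_plus_ne (a i) (hpt (P1.pt_toSpec _ _) (P1.pt_toSpec _ _) h).symm
    rcases lt_trichotomy (c i) j with hij | rfl | hij
    · exact ⟨fun h => h1 (H.eq_poles_of_lt hij h).2.1, fun h => h1 (H.eq_poles_of_lt hij h).2.1⟩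
    · exact ⟨fun h => h0 (hinj h), fun h => h1 (hinj h)⟩
    · exact ⟨fun h => h0 (H.eq_poles_of_lt hij h.symm).2.2,
        fun h => h0 (H.eq_poles_of_lt hij h.symm).2.2⟩
  · intro j
    obtain ⟨i, rfl⟩ := H.stable j
    exact ⟨i, _, ((congrArg point (hs i)).trans (point_comp _ _)).symm⟩

theorem transport {C' : Scheme.{u}} {π' : C' ⟶ Spec (CommRingCat.of k)} (e : C ≅ C')
    (he : e.hom ≫ π' = π) : ∃ line' : Fin (m + 1) → (P1 K ⟶ bc K π'),
      IsLineChain π' (sMinus ≫ e.hom) (sPlus ≫ e.hom) (fun i => s i ≫ e.hom) line' c a := by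
  let E : bc K π ⟶ bc K π' := pullback.map _ _ _ _ e.hom (𝟙 _) (𝟙 _)
    (by rw [he, Category.comp_id]) (by rw [Category.comp_id, Category.id_comp])
  have hE1 : E ≫ bcFst K π' = bcFst K π ≫ e.hom := pullback.lift_fst _ _ _
  have hE2 : E ≫ bcSnd K π' = bcSnd K π := (pullback.lift_snd _ _ _).trans (Category.comp_id _)
  have : IsIso E := inferInstanceAs (IsIso (pullback.map _ _ _ _ _ _ _ _ _))
  have hinj : Function.Injective E := E.homeomorph.injective
  have := H.isProper
  have := H.isReduced
  have hc := H.line_closed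
  have hπ' : π' = e.inv ≫ π := by rw [← he, Iso.inv_hom_id_assoc]
  refine ⟨fun j => line j ≫ E, ?_, ?_, ?_, fun j => ?_, ?_, ?_, ?_, ?_, ?_, ?_, ?_, ?_, ?_, ?_,
    H.ne_zero, H.stable⟩
  · rw [hπ']
    infer_instance
  · exact isReduced_of_isOpenImmersion (inv E)
  · intro j
    rw [Category.assoc, hE2, H.line_over]
  · infer_instance
  · intro x
    obtain ⟨j, y, h⟩ := H.cover (inv E x)
    refine ⟨j, y, ?_⟩
    rw [Scheme.Hom.comp_apply, h, ← Scheme.Hom.comp_apply, IsIso.inv_hom_id]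
    rfl
  · intro j
    rw [← Category.assoc, H.node, Category.assoc]
  · intro i j hij x y h
    exact H.inter i j hij x y (hinj h)
  · intro j
    have := H.transversal j
    exact isReduced_of_isOpenImmersion (inv (pullback.map (line j.castSucc) (line j.succ)
      (line j.castSucc ≫ E) (line j.succ ≫ E) (𝟙 _) (𝟙 _) E
      (by rw [Category.id_comp]) (by rw [Category.id_comp])))
  · rw [Category.assoc, he, H.sMinus_over]
  · rw [Category.assoc, he, H.sPlus_over]
  · intro i
    rw [Category.assoc, he, H.s_over]
  · rw [Category.assoc, hE1, ← Category.assoc, ← Category.assoc, Category.assoc _ (line 0), H.minus,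
      Category.assoc]
  · rw [Category.assoc, hE1, ← Category.assoc, ← Category.assoc, Category.assoc _ (line _), H.plus,
      Category.assoc]
  · intro i
    rw [Category.assoc, hE1, ← Category.assoc, ← Category.assoc, Category.assoc _ (line _),
      H.marked, Category.assoc]

end IsLineChain

section Transport

variable {k : Type u} [Field k] {C : Scheme.{u}} {π : C ⟶ Spec (CommRingCat.of k)}
    {sMinus sPlus : Spec (CommRingCat.of k) ⟶ C} {n : ℕ}
    {s : Fin (n + 1) → (Spec (CommRingCat.of k) ⟶ C)}

theorem isAnCurve_of_isLineChain (H : ∀ (K : Type u) [Field K] [IsAlgClosed K] [Algebra k K],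
    ∃ (m : ℕ) (line : Fin (m + 1) → (P1 K ⟶ bc K π)) (c : Fin (n + 1) → Fin (m + 1))
      (a : Fin (n + 1) → K), IsLineChain π sMinus sPlus s line c a) :
    IsAnCurve π sMinus sPlus s := by
  obtain ⟨_, _, _, _, H₀⟩ := H (AlgebraicClosure k)
  refine ⟨H₀.isProper, inferInstance, H₀.sMinus_over, H₀.sPlus_over, H₀.s_over, ?_⟩
  intro K _ _ _
  obtain ⟨m, line, c, a, H'⟩ := H K
  exact ⟨m, line, _, _, H'.isStablePointedChain⟩

theorem IsAnCurve.transport (H : IsAnCurve π sMinus sPlus s) {C' : Scheme.{u}}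
    {π' : C' ⟶ Spec (CommRingCat.of k)} (e : C ≅ C') (he : e.hom ≫ π' = π) :
    IsAnCurve π' (sMinus ≫ e.hom) (sPlus ≫ e.hom) (fun i => s i ≫ e.hom) := by
  apply isAnCurve_of_isLineChain
  intro K _ _ _
  obtain ⟨m, line, c, a, H'⟩ := IsAnCurve.exists_lineChain K H
  obtain ⟨line', h⟩ := H'.transport e he
  exact ⟨m, line', c, a, h⟩

theorem exists_iso_embeddedCurve {t : Fin (n + 1) → Fin (n + 1) → k} {Φ : C ⟶ P1Pow k n}
    [IsClosedImmersion Φ] (h : Scheme.Hom.ker Φ = equationIdeal (curveEquations t)) :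
    ∃ e : C ≅ embeddedCurve t, e.hom ≫ embeddedCurve.ι t = Φ := by
  have : IsClosedImmersion (embeddedCurve.ι t) :=
    inferInstanceAs (IsClosedImmersion (Scheme.IdealSheafData.subschemeι _))
  have hk : (embeddedCurve.ι t).ker = Φ.ker :=
    (Scheme.IdealSheafData.ker_subschemeι _).trans h.symm
  have := IsClosedImmersion.isIso_lift (embeddedCurve.ι t) Φ hk
  exact ⟨asIso (IsClosedImmersion.lift (embeddedCurve.ι t) Φ hk.le),
    IsClosedImmersion.lift_fac _ _ _⟩

end Transport

/-! ## The combinatorial type of `A_n`-data -/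

theorem exists_surjective_level {n : ℕ} (f : Fin (n + 1) → ℕ) :
    ∃ (m : ℕ) (c : Fin (n + 1) → Fin (m + 1)), (∀ j, ∃ i, c i = j) ∧
      ∀ i j, c i < c j ↔ f i < f j := by
  let S := Finset.univ.image f
  have hS : ∀ i, f i ∈ S := fun i => Finset.mem_image_of_mem _ (Finset.mem_univ _)
  obtain ⟨m, hm⟩ : ∃ m, S.card = m + 1 :=
    Nat.exists_eq_succ_of_ne_zero (Finset.card_ne_zero_of_mem (hS 0))
  refine ⟨m, fun i => (S.orderIsoOfFin hm).symm ⟨f i, hS i⟩, fun j => ?_, fun i j => ?_⟩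
  · obtain ⟨i, -, hi⟩ := Finset.mem_image.1 (S.orderIsoOfFin hm j).2
    exact ⟨i, by rw [OrderIso.symm_apply_eq]; exact Subtype.ext hi⟩
  · rw [OrderIso.lt_iff_lt, Subtype.mk_lt_mk]

theorem IsAnData.exists_isLineChain_data {k : Type u} [Field k] {n : ℕ}
    {t : Fin (n + 1) → Fin (n + 1) → k} (ht : IsAnData t) :
    ∃ (m : ℕ) (c : Fin (n + 1) → Fin (m + 1)) (a : Fin (n + 1) → k), (∀ i, a i ≠ 0) ∧
      (∀ j, ∃ i, c i = j) ∧ ∀ i j, i ≠ j → (c i < c j → t j i = 0) ∧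
        (c i = c j → t i j * a i = t j i * a j) := by
  classical
  have htrans : ∀ i j l, i ≠ j → i ≠ l → j ≠ l → t i j = 0 → t j l = 0 → t i l = 0 := by
    intro i j l hij hil hjl h1 h2
    have h3 := ht.rel i j l hij hjl hil
    rw [h1, zero_mul, zero_mul, eq_comm, mul_eq_zero, mul_eq_zero] at h3
    rcases h3 with (h | h) | h
    · exact absurd ⟨h1, h⟩ (ht.ne_zero i j hij)
    · exact absurd ⟨h2, h⟩ (ht.ne_zero j l hjl)
    · exact h
  let B : Fin (n + 1) → Finset (Fin (n + 1)) := fun i => {l | l ≠ i ∧ t i l = 0}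
  have hB : ∀ i l, l ∈ B i ↔ l ≠ i ∧ t i l = 0 := fun i l => by simp [B]
  have hlt : ∀ i j, i ≠ j → t j i = 0 → (B i).card < (B j).card := by
    intro i j hij h
    refine Finset.card_lt_card ((Finset.ssubset_iff_of_subset ?_).2 ⟨i, (hB j i).2 ⟨hij, h⟩, ?_⟩)
    · intro l hl
      obtain ⟨h1, h2⟩ := (hB i l).1 hl
      have hlj : l ≠ j := by
        rintro rfl
        exact ht.ne_zero i l hij ⟨h2, h⟩
      exact (hB j l).2 ⟨hlj, htrans j i l hij.symm hlj.symm h1.symm h h2⟩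
    · exact fun h => ((hB i i).1 h).1 rfl
  have heq : ∀ i j, i ≠ j → t i j ≠ 0 → t j i ≠ 0 → (B i).card ≤ (B j).card := by
    intro i j hij h h'
    refine Finset.card_le_card fun l hl => ?_
    obtain ⟨h1, h2⟩ := (hB i l).1 hl
    have hlj : l ≠ j := by
      rintro rfl
      exact h h2
    refine (hB j l).2 ⟨hlj, ?_⟩
    have h3 := ht.rel i j l hij hlj.symm h1.symm
    rw [h2, mul_zero, mul_eq_zero, mul_eq_zero] at h3
    rcases h3 with (h3 | h3) | h3
    · exact absurd h3 h
    · exact h3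
    · exact absurd ⟨h2, h3⟩ (ht.ne_zero i l h1.symm)
  obtain ⟨m, c, hc, hcf⟩ := exists_surjective_level fun i => (B i).card
  have hne : ∀ i j, i ≠ j → c i = c j → t i j ≠ 0 := by
    intro i j hij h h0
    exact absurd ((hcf _ _).2 (hlt j i hij.symm h0)) (by rw [h]; exact lt_irrefl _)
  choose r hr using hc
  refine ⟨m, c, fun i => if r (c i) = i then 1 else t (r (c i)) i / t i (r (c i)), ?_,
    fun j => ⟨r j, hr j⟩, ?_⟩
  · intro i
    dsimp only
    split_ifs with h
    · exact one_ne_zero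
    · exact div_ne_zero (hne _ _ h (hr _)) (hne _ _ (Ne.symm h) (hr _).symm)
  · intro i j hij
    refine ⟨fun h => ?_, fun h => ?_⟩
    · by_contra h0
      have h1 := (hcf i j).1 h
      by_cases h2 : t i j = 0
      · exact absurd (hlt j i hij.symm h2) (by lia)
      · exact absurd (heq j i hij.symm h0 h2) (by lia)
    · dsimp only
      rw [h]
      have hrj := hr (c j)
      generalize r (c j) = q at hrj
      split_ifs with h1 h2 h2
      · exact absurd (h1.symm.trans h2) hij
      · subst h1
        have := hne j q hij.symm h.symm
        field_simp
      · subst h2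
        have := hne i q hij h
        field_simp
      · have e1 := hne i q (Ne.symm h1) (h.trans hrj.symm)
        have e2 := hne j q (Ne.symm h2) hrj.symm
        have := ht.rel i j q hij (Ne.symm h2) (Ne.symm h1)
        field_simp
        linear_combination this

/-! ## Base change of the projective line -/

section BaseMap

variable (k : Type u) [Field k] (K : Type u) [Field K] [Algebra k K]

theorem P1.exists_baseMap : ∃ g : P1 K ⟶ P1 k,
    g ≫ P1.toSpec k = P1.toSpec K ≫ Spec.map (CommRingCat.ofHom (algebraMap k K)) ∧
    ∀ b, HasCoords g (P1.chart K b) (fun a => P1.ratio K a b) := by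
  have hid := fun b => hasCoords_id (k := K) b
  obtain ⟨g, h1, h2⟩ := P1.exists_hom_of_coords
    (P1.toSpec K ≫ Spec.map (CommRingCat.ofHom (algebraMap k K))) (ι := ULift.{u} (Fin 2))
    (fun b => P1.chart K b.down)
    (by
      rw [eq_top_iff]
      intro x _
      obtain ⟨b, hb⟩ := exists_mem_chart (𝟙 (P1 K)) x
      exact TopologicalSpace.Opens.mem_iSup.2 ⟨⟨b⟩, hb⟩)
    (fun b a => P1.ratio K a b.down)
    (by
      intro b x hx
      obtain ⟨b', hb'⟩ := exists_mem_basicOpen (hid b.down) hx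
      fin_cases b'
      · exact Or.inl hb'
      · exact Or.inr hb')
    (fun i j => ((hid i.down).restrict inf_le_left).cross ((hid j.down).restrict inf_le_right) 0 1)
  exact ⟨g, h1, fun b => h2 ⟨b⟩⟩

/-- The projection `ℙ¹_K ⟶ ℙ¹_k`. -/
def P1.baseMap : P1 K ⟶ P1 k := (P1.exists_baseMap k K).choose

theorem P1.baseMap_toSpec : P1.baseMap k K ≫ P1.toSpec k =
    P1.toSpec K ≫ Spec.map (CommRingCat.ofHom (algebraMap k K)) :=
  (P1.exists_baseMap k K).choose_spec.1

theorem P1.hasCoords_baseMap (b : Fin 2) :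
    HasCoords (P1.baseMap k K) (P1.chart K b) (fun a => P1.ratio K a b) :=
  (P1.exists_baseMap k K).choose_spec.2 b

theorem P1.baseMap_preimage (b : Fin 2) : P1.baseMap k K ⁻¹ᵁ P1.chart k b = P1.chart K b := by
  ext x
  obtain ⟨b', hb'⟩ := exists_mem_chart (𝟙 (P1 K)) x
  have h := ((P1.hasCoords_baseMap k K b').preimage b).trans
    ((hasCoords_id (k := K) b').preimage b).symm
  have hx : x ∈ P1.chart K b' ⊓ P1.baseMap k K ⁻¹ᵁ P1.chart k b ↔
    x ∈ P1.chart K b' ⊓ 𝟙 (P1 K) ⁻¹ᵁ P1.chart K b := by rw [h]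
  exact ⟨fun h => (hx.1 ⟨hb', h⟩).2, fun h => (hx.2 ⟨hb', h⟩).2⟩

variable {k K}

theorem P1.preimage_comp_baseMap {T : Scheme.{u}} (ψ : T ⟶ P1 K) (b : Fin 2) :
    (ψ ≫ P1.baseMap k K) ⁻¹ᵁ P1.chart k b = ψ ⁻¹ᵁ P1.chart K b := by
  rw [Scheme.Hom.comp_preimage, P1.baseMap_preimage]

theorem coordRatio_comp_baseMap {T : Scheme.{u}} (ψ : T ⟶ P1 K) (a b : Fin 2) (W : T.Opens)
    (h : W ≤ (ψ ≫ P1.baseMap k K) ⁻¹ᵁ P1.chart k b) (h' : W ≤ ψ ⁻¹ᵁ P1.chart K b) :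
    coordRatio (ψ ≫ P1.baseMap k K) a b W h = coordRatio ψ a b W h' := by
  have hb := (P1.baseMap_preimage k K b).ge
  have h1 := (P1.hasCoords_baseMap k K b).ratio a b _ le_rfl hb
  rw [P1.ratio_self, map_one, mul_one, res_self] at h1
  have h2 : (ψ ≫ P1.baseMap k K).appLE (P1.chart k b) W h =
      (P1.baseMap k K).appLE (P1.chart k b) (P1.chart K b) hb ≫ ψ.appLE (P1.chart K b) W h' :=
    (Scheme.Hom.appLE_comp_appLE ψ (P1.baseMap k K) (P1.chart k b) (P1.chart K b) W hb h').symm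
  exact (congrArg (fun f => f.hom (P1.ratio k a b)) h2).trans
    (congrArg (ψ.appLE (P1.chart K b) W h').hom h1)

theorem HasCoords.comp_baseMap {T : Scheme.{u}} {ψ : T ⟶ P1 K} {W : T.Opens}
    {v : Fin 2 → Γ(T, W)} (hv : HasCoords ψ W v) : HasCoords (ψ ≫ P1.baseMap k K) W v := by
  refine ⟨fun b => ?_, fun a b V hV h => ?_⟩
  · rw [P1.preimage_comp_baseMap, hv.preimage]
  · have h' : V ≤ ψ ⁻¹ᵁ P1.chart K b := by rwa [← P1.preimage_comp_baseMap (k := k)]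
    rw [coordRatio_comp_baseMap ψ a b V h h', hv.ratio]

theorem P1.hom_ext_baseMap {T : Scheme.{u}} {ψ ψ' : T ⟶ P1 K}
    (h : ψ ≫ P1.toSpec K = ψ' ≫ P1.toSpec K) (hg : ψ ≫ P1.baseMap k K = ψ' ≫ P1.baseMap k K) :
    ψ = ψ' := by
  refine P1.hom_ext_of_hasCoords h fun x => ?_
  obtain ⟨b, hb⟩ := exists_mem_chart ψ x
  have hW : ψ ⁻¹ᵁ P1.chart K b ≤ ψ' ⁻¹ᵁ P1.chart K b := by
    rw [← P1.preimage_comp_baseMap (k := k) ψ, ← P1.preimage_comp_baseMap (k := k) ψ', hg]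
  refine ⟨_, hb, _, _, hasCoords_coordRatio ψ b _ le_rfl, hasCoords_coordRatio ψ' b _ hW, ?_⟩
  have e : ∀ a, coordRatio ψ' a b _ hW = coordRatio ψ a b _ le_rfl := by
    intro a
    rw [← coordRatio_comp_baseMap (k := k) ψ a b _ (P1.preimage_comp_baseMap ψ b).ge,
      ← coordRatio_comp_baseMap (k := k) ψ' a b _ (hW.trans (P1.preimage_comp_baseMap ψ' b).ge)]
    congr 1
    exact hg.symm
  rw [e, e, mul_comm]

variable (k K) in
theorem P1.isPullback_baseMap : IsPullback (P1.baseMap k K) (P1.toSpec K) (P1.toSpec k)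
    (Spec.map (CommRingCat.ofHom (algebraMap k K))) := by
  have key : ∀ {T : Scheme.{u}} (φ : T ⟶ P1 k) (f : T ⟶ Spec (CommRingCat.of K)),
      φ ≫ P1.toSpec k = f ≫ Spec.map (CommRingCat.ofHom (algebraMap k K)) →
      ∃ ψ : T ⟶ P1 K, ψ ≫ P1.baseMap k K = φ ∧ ψ ≫ P1.toSpec K = f := by
    intro T φ f h
    have hc := fun b => hasCoords_coordRatio φ b _ le_rfl
    obtain ⟨ψ, h1, h2⟩ := P1.exists_hom_of_coords f (ι := ULift.{u} (Fin 2))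
      (fun b => φ ⁻¹ᵁ P1.chart k b.down)
      (by
        rw [eq_top_iff]
        intro x _
        obtain ⟨b, hb⟩ := exists_mem_chart φ x
        exact TopologicalSpace.Opens.mem_iSup.2 ⟨⟨b⟩, hb⟩)
      (fun b a => coordRatio φ a b.down _ le_rfl)
      (by
        intro b x hx
        obtain ⟨b', hb'⟩ := exists_mem_basicOpen (hc b.down) hx
        fin_cases b'
        · exact Or.inl hb'
        · exact Or.inr hb')
      (fun i j => ((hc i.down).restrict inf_le_left).cross ((hc j.down).restrict inf_le_right) 0 1)
    refine ⟨ψ, P1.hom_ext_of_hasCoords ?_ fun x => ?_, h1⟩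
    · rw [Category.assoc, P1.baseMap_toSpec, ← Category.assoc, h1, h]
    · obtain ⟨b, hb⟩ := exists_mem_chart φ x
      exact ⟨_, hb, _, _, (h2 ⟨b⟩).comp_baseMap, hc b, mul_comm _ _⟩
  exact ⟨⟨P1.baseMap_toSpec k K⟩, ⟨PullbackCone.IsLimit.mk _
    (fun S => (key S.fst S.snd S.condition).choose)
    (fun S => (key S.fst S.snd S.condition).choose_spec.1)
    (fun S => (key S.fst S.snd S.condition).choose_spec.2)
    (fun S l h1 h2 => P1.hom_ext_baseMap
      (h2.trans (key S.fst S.snd S.condition).choose_spec.2.symm)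
      (h1.trans (key S.fst S.snd S.condition).choose_spec.1.symm))⟩⟩

theorem P1.pt_baseMap (b : Fin 2) (r : k) : P1.pt b (algebraMap k K r) ≫ P1.baseMap k K =
    Spec.map (CommRingCat.ofHom (algebraMap k K)) ≫ P1.pt b r := by
  refine P1.hom_ext_of_hasCoords ?_ fun x => ?_
  · rw [Category.assoc, P1.baseMap_toSpec, ← Category.assoc, P1.pt_toSpec, Category.id_comp,
      Category.assoc, P1.pt_toSpec, Category.comp_id]
  · refine ⟨⊤, trivial, _, _, (P1.hasCoords_pt b _).comp_baseMap,
      (P1.hasCoords_pt b r).comp _ le_top, ?_⟩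
    have e : ∀ y : k, ((Spec.map (CommRingCat.ofHom (algebraMap k K))).appLE ⊤ ⊤ le_top).hom
        ((Scheme.ΓSpecIso (CommRingCat.of k)).inv.hom y) =
        (Scheme.ΓSpecIso (CommRingCat.of K)).inv.hom (algebraMap k K y) := by
      intro y
      apply ΓSpecIso_hom_injective
      have := congrArg (fun f => f.hom ((Scheme.ΓSpecIso (CommRingCat.of k)).inv.hom y))
        (appLE_specMap_ΓSpecIso (CommRingCat.ofHom (algebraMap k K)) le_top)
      refine Eq.trans this ?_
      rw [ΓSpecIso_hom_inv]
      exact congrArg (algebraMap k K) (ΓSpecIso_hom_inv y)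
    have e' : ∀ a : Fin 2, (if a = b then (1 : K) else algebraMap k K r) =
        algebraMap k K (if a = b then 1 else r) := by
      intro a
      split_ifs <;> simp
    dsimp only
    rw [e, e, e', e', mul_comm]

end BaseMap

/-! ## The chain of projective lines of a given combinatorial type -/

theorem isSchemeTheoreticallyDominant_toImage {X Y : Scheme.{u}} (f : X ⟶ Y) [QuasiCompact f] :
    IsSchemeTheoreticallyDominant f.toImage := by
  refine ⟨Scheme.IdealSheafData.ext_of_iSup_eq_top (ι := Y.affineOpens)
    (fun U => ⟨f.imageι ⁻¹ᵁ U.1, U.2.preimage f.imageι⟩) ?_ fun U => ?_⟩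
  · rw [← Scheme.Hom.preimage_iSup, iSup_affineOpens_eq_top]
    rfl
  · rw [Scheme.Hom.ker_apply, Scheme.IdealSheafData.ideal_bot, Pi.bot_apply]
    exact (RingHom.injective_iff_ker_eq_bot _).1 (f.toImage_app_injective U)

section ChainCurve

variable (k : Type u) [Field k]

/-- The restriction to the `j`-th line of a chain of the coordinate that varies on the line with
index `c`: it is constant `∞` on the later lines and `0` on the earlier ones. -/
def chainCoord {m : ℕ} (c j : Fin (m + 1)) : P1 k ⟶ P1 k :=
  if c < j then P1.toSpec k ≫ P1.pt 1 0 else if j < c then P1.toSpec k ≫ P1.pt 0 0 else 𝟙 _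

variable {k} {m n : ℕ}

theorem chainCoord_of_lt {c j : Fin (m + 1)} (h : c < j) :
    chainCoord k c j = P1.toSpec k ≫ P1.pt 1 0 := if_pos h

theorem chainCoord_of_gt {c j : Fin (m + 1)} (h : j < c) :
    chainCoord k c j = P1.toSpec k ≫ P1.pt 0 0 := by
  rw [chainCoord, if_neg h.not_gt, if_pos h]

theorem chainCoord_self (j : Fin (m + 1)) : chainCoord k j j = 𝟙 _ := by
  rw [chainCoord, if_neg (lt_irrefl _), if_neg (lt_irrefl _)]

theorem chainCoord_toSpec (c j : Fin (m + 1)) : chainCoord k c j ≫ P1.toSpec k = P1.toSpec k := by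
  rw [chainCoord]
  split_ifs
  · rw [Category.assoc, P1.pt_toSpec, Category.comp_id]
  · rw [Category.assoc, P1.pt_toSpec, Category.comp_id]
  · rw [Category.id_comp]

theorem chainCoord_baseMap {K : Type u} [Field K] [Algebra k K] (c j : Fin (m + 1)) :
    chainCoord K c j ≫ P1.baseMap k K = P1.baseMap k K ≫ chainCoord k c j := by
  have h : ∀ b, (P1.toSpec K ≫ P1.pt b 0) ≫ P1.baseMap k K =
      P1.baseMap k K ≫ P1.toSpec k ≫ P1.pt b 0 := by
    intro b
    have := P1.pt_baseMap (K := K) b (0 : k)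
    rw [map_zero] at this
    rw [Category.assoc, this, ← Category.assoc, ← Category.assoc, P1.baseMap_toSpec]
  rw [chainCoord, chainCoord]
  split_ifs
  · exact h 1
  · exact h 0
  · rw [Category.id_comp, Category.comp_id]

theorem exists_chainLine (c : Fin (n + 1) → Fin (m + 1)) (j : Fin (m + 1)) :
    ∃ Φ : P1 k ⟶ P1Pow k n, Φ ≫ P1Pow.toSpec k n = P1.toSpec k ∧
      ∀ i, Φ ≫ P1Pow.proj k n i = chainCoord k (c i) j :=
  P1Pow.exists_lift _ _ fun _ => chainCoord_toSpec _ _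

/-- The `j`-th line of the chain where the `i`-th coordinate varies on the line `c i`. -/
def chainLine (c : Fin (n + 1) → Fin (m + 1)) (j : Fin (m + 1)) : P1 k ⟶ P1Pow k n :=
  (exists_chainLine c j).choose

variable (k m) in
/-- The disjoint union of the lines of a chain. -/
abbrev chainLines : Scheme.{u} := ∐ fun _ : Fin (m + 1) => P1 k

variable (k) in
/-- The union of the lines of a chain. -/
def chainMap (c : Fin (n + 1) → Fin (m + 1)) : chainLines k m ⟶ P1Pow k n :=
  Sigma.desc (chainLine c)

instance compactSpace_sigma : CompactSpace (chainLines k m) := by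
  have : CompactSpace (P1 k) := QuasiCompact.compactSpace_of_compactSpace (P1.toSpec k)
  refine ⟨?_⟩
  have h : (Set.univ : Set (chainLines k m)) =
      ⋃ j, Set.range (Sigma.ι (fun _ : Fin (m + 1) => P1 k) j) := by
    refine (Set.eq_univ_of_forall fun y => ?_).symm
    obtain ⟨j, z, rfl⟩ := (sigmaOpenCover (fun _ : Fin (m + 1) => P1 k)).exists_eq y
    exact Set.mem_iUnion.2 ⟨j, z, rfl⟩
  rw [h]
  exact isCompact_iUnion fun j => isCompact_range (Scheme.Hom.continuous _)

instance isReduced_sigma : IsReduced (chainLines k m) := by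
  have : ∀ i, IsReduced ((sigmaOpenCover (fun _ : Fin (m + 1) => P1 k)).X i) := fun i =>
    inferInstanceAs (IsReduced (P1 k))
  exact IsReduced.of_openCover (𝒰 := sigmaOpenCover _)

instance (c : Fin (n + 1) → Fin (m + 1)) : QuasiCompact (chainMap k c) := by
  have : QuasiSeparatedSpace (P1Pow k n) :=
    quasiSeparatedSpace_of_quasiSeparated (P1Pow.toSpec k n)
  infer_instance

variable (k) in
/-- The chain of projective lines in `(ℙ¹)^(n+1)` where the `i`-th coordinate varies on the line
`c i`. -/
abbrev chainCurve (c : Fin (n + 1) → Fin (m + 1)) : Scheme.{u} := (chainMap k c).image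

/-- The structure morphism of `chainCurve`. -/
def chainCurve.toSpec (c : Fin (n + 1) → Fin (m + 1)) :
    chainCurve k c ⟶ Spec (CommRingCat.of k) :=
  (chainMap k c).imageι ≫ P1Pow.toSpec k n

/-- The coordinates on `chainCurve`. -/
def chainCurve.coord (c : Fin (n + 1) → Fin (m + 1)) (i : Fin (n + 1)) : chainCurve k c ⟶ P1 k :=
  (chainMap k c).imageι ≫ P1Pow.proj k n i

/-- The lines of `chainCurve`. -/
def chainCurve.line (c : Fin (n + 1) → Fin (m + 1)) (j : Fin (m + 1)) : P1 k ⟶ chainCurve k c :=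
  Sigma.ι (fun _ : Fin (m + 1) => P1 k) j ≫ (chainMap k c).toImage

namespace chainCurve

variable (c : Fin (n + 1) → Fin (m + 1))

theorem line_ι (j : Fin (m + 1)) : line (k := k) c j ≫ (chainMap k c).imageι = chainLine c j := by
  rw [line, Category.assoc, Scheme.Hom.toImage_imageι, chainMap, Sigma.ι_desc]

theorem line_coord (j : Fin (m + 1)) (i : Fin (n + 1)) :
    line (k := k) c j ≫ coord c i = chainCoord k (c i) j := by
  rw [coord, ← Category.assoc, line_ι]
  exact (exists_chainLine c j).choose_spec.2 i

theorem line_toSpec (j : Fin (m + 1)) : line (k := k) c j ≫ toSpec c = P1.toSpec k := by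
  rw [toSpec, ← Category.assoc, line_ι]
  exact (exists_chainLine c j).choose_spec.1

theorem coord_toSpec (i : Fin (n + 1)) : coord c i ≫ P1.toSpec k = toSpec c := by
  rw [coord, Category.assoc, P1Pow.proj_toSpec, toSpec]

theorem hom_ext {T : Scheme.{u}} {f g : T ⟶ chainCurve k c}
    (h : ∀ i, f ≫ coord c i = g ≫ coord c i) : f = g := by
  rw [← cancel_mono (chainMap k c).imageι]
  refine P1Pow.hom_ext fun i => ?_
  rw [Category.assoc, Category.assoc]
  exact h i

instance isProper : IsProper (toSpec (k := k) c) := by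
  rw [toSpec]
  infer_instance

theorem exists_line_eq (x : chainCurve k c) : ∃ j y, line c j y = x := by
  have hcl : IsClosed (Set.range (chainMap k c).toImage) := by
    have : Set.range (chainMap k c).toImage = ⋃ j, Set.range (line (k := k) c j) := by
      ext x
      rw [Set.mem_iUnion]
      constructor
      · rintro ⟨y, rfl⟩
        obtain ⟨j, z, rfl⟩ := (sigmaOpenCover (fun _ : Fin (m + 1) => P1 k)).exists_eq y
        exact ⟨j, z, rfl⟩
      · rintro ⟨j, z, rfl⟩
        exact ⟨_, rfl⟩
    rw [this]
    refine isClosed_iUnion_of_finite fun j => ?_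
    have : IsProper (line (k := k) c j ≫ toSpec c) := by
      rw [line_toSpec]
      infer_instance
    have : IsProper (line (k := k) c j) := IsProper.of_comp _ (toSpec c)
    exact (line (k := k) c j).isClosedMap.isClosed_range
  have hx : x ∈ Set.range (chainMap k c).toImage := by
    rw [← hcl.closure_eq, (chainMap k c).toImage.denseRange.closure_eq]
    trivial
  obtain ⟨y, rfl⟩ := hx
  obtain ⟨j, z, rfl⟩ := (sigmaOpenCover (fun _ : Fin (m + 1) => P1 k)).exists_eq y
  exact ⟨j, z, rfl⟩

end chainCurve

end ChainCurve

namespace chainCurve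

variable {k : Type u} [Field k] (K : Type u) [Field K] [Algebra k K] {m n : ℕ}
    (c : Fin (n + 1) → Fin (m + 1))

/-- The coordinates on the base change of `chainCurve`. -/
def bcCoord (i : Fin (n + 1)) : bc K (toSpec (k := k) c) ⟶ P1 K :=
  (P1.isPullback_baseMap k K).lift (bcFst K (toSpec c) ≫ coord c i) (bcSnd K (toSpec c))
    (by rw [Category.assoc, coord_toSpec]; exact pullback.condition)

/-- The lines of the base change of `chainCurve`. -/
def bcLine (j : Fin (m + 1)) : P1 K ⟶ bc K (toSpec (k := k) c) :=
  pullback.lift (P1.baseMap k K ≫ line c j) (P1.toSpec K)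
    (by rw [Category.assoc, line_toSpec]; exact P1.baseMap_toSpec k K)

variable {K}

theorem bcCoord_baseMap (i : Fin (n + 1)) : bcCoord K c i ≫ P1.baseMap k K =
    bcFst K (toSpec c) ≫ coord c i :=
  (P1.isPullback_baseMap k K).lift_fst _ _ _

theorem bcCoord_toSpec (i : Fin (n + 1)) :
    bcCoord (k := k) K c i ≫ P1.toSpec K = bcSnd K (toSpec c) :=
  (P1.isPullback_baseMap k K).lift_snd _ _ _

theorem bcLine_fst (j : Fin (m + 1)) :
    bcLine K c j ≫ bcFst K (toSpec c) = P1.baseMap k K ≫ line c j := pullback.lift_fst _ _ _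

theorem bcLine_snd (j : Fin (m + 1)) :
    bcLine K c j ≫ bcSnd K (toSpec (k := k) c) = P1.toSpec K := pullback.lift_snd _ _ _

theorem bcLine_coord (j : Fin (m + 1)) (i : Fin (n + 1)) :
    bcLine (k := k) K c j ≫ bcCoord K c i = chainCoord K (c i) j := by
  apply P1.hom_ext_baseMap (k := k)
  · rw [Category.assoc, bcCoord_toSpec, bcLine_snd, chainCoord_toSpec]
  · rw [Category.assoc, bcCoord_baseMap, ← Category.assoc, bcLine_fst, Category.assoc, line_coord,
      chainCoord_baseMap]

variable {c} in
theorem bc_hom_ext {T : Scheme.{u}} {f g : T ⟶ bc K (toSpec (k := k) c)}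
    (h : ∀ i, f ≫ bcCoord K c i = g ≫ bcCoord K c i) : f = g := by
  apply pullback.hom_ext
  · refine hom_ext c fun i => ?_
    rw [Category.assoc, Category.assoc, ← bcCoord_baseMap, ← Category.assoc, h, Category.assoc]
  · have := congrArg (· ≫ P1.toSpec K) (h 0)
    simp only [Category.assoc, bcCoord_toSpec] at this
    exact this

theorem isPullback_bcLine (j : Fin (m + 1)) :
    IsPullback (bcLine (k := k) K c j) (P1.baseMap k K) (bcFst K (toSpec c)) (line c j) := by
  refine IsPullback.of_right ?_ (bcLine_fst c j) (IsPullback.of_hasPullback (toSpec (k := k) c)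
      (Spec.map (CommRingCat.ofHom (algebraMap k K)))).flip
  rw [bcLine_snd, line_toSpec]
  exact (P1.isPullback_baseMap k K).flip

theorem exists_bcLine_eq (x : bc K (toSpec (k := k) c)) : ∃ j y, bcLine K c j y = x := by
  obtain ⟨j, y, hy⟩ := exists_line_eq c (bcFst K (toSpec c) x)
  obtain ⟨z, hz, -⟩ := Scheme.Pullback.exists_preimage_pullback x y hy.symm
  refine ⟨j, (isPullback_bcLine c j).isoPullback.inv z, ?_⟩
  rw [← Scheme.Hom.comp_apply, IsPullback.isoPullback_inv_fst, hz]

theorem isReduced_bc : IsReduced (bc K (toSpec (k := k) c)) := by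
  have := isSchemeTheoreticallyDominant_toImage (chainMap k c)
  have H := IsUniversalColimit.isPullback_of_isColimit_left
    (X := fun _ : Fin (m + 1) => P1 k)
    (FinitaryPreExtensive.isUniversal_finiteCoproducts
      (coproductIsCoproduct (fun _ : Fin (m + 1) => P1 k)))
    (fun j => line (k := k) c j) (chainMap k c).toImage (bcFst K (toSpec c))
    (bcLine K c) (fun _ => P1.baseMap k K) (fun j => isPullback_bcLine c j)
    (coproductIsCoproduct (fun _ : Fin (m + 1) => P1 K)) (fun _ => rfl)
  have := IsSchemeTheoreticallyDominant.of_isPullback H.flip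
  have : IsReduced (Cofan.mk (∐ fun _ : Fin (m + 1) => P1 K) (Sigma.ι fun _ => P1 K)).pt :=
    isReduced_sigma (k := K) (m := m)
  have : QuasiCompact (Cofan.IsColimit.desc
    (coproductIsCoproduct (fun _ : Fin (m + 1) => P1 K)) (bcLine (k := k) K c)) :=
    MorphismProperty.of_isPullback (P := @QuasiCompact.{u}) H.flip inferInstance
  exact IsSchemeTheoreticallyDominant.isReduced (Cofan.IsColimit.desc
    (coproductIsCoproduct (fun _ : Fin (m + 1) => P1 K)) (bcLine (k := k) K c))

theorem bcLine_isClosedImmersion (hc : ∀ j, ∃ i, c i = j) (j : Fin (m + 1)) :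
    IsClosedImmersion (bcLine (k := k) K c j) := by
  obtain ⟨i, rfl⟩ := hc j
  have h : bcLine (k := k) K c (c i) ≫ bcCoord K c i = 𝟙 _ := by
    rw [bcLine_coord, chainCoord_self]
  have : IsClosedImmersion (bcLine (k := k) K c (c i) ≫ bcCoord K c i) := by
    rw [h]
    infer_instance
  have : IsSeparated (bcCoord (k := k) K c i ≫ P1.toSpec K) := by
    rw [bcCoord_toSpec]
    infer_instance
  have : IsSeparated (bcCoord (k := k) K c i) := IsSeparated.of_comp _ (P1.toSpec K)
  exact IsClosedImmersion.of_comp _ (bcCoord K c i)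

theorem pt_chainCoord_of_lt {c j : Fin (m + 1)} (h : c < j) {p : Spec (CommRingCat.of K) ⟶ P1 K}
    (hp : p ≫ P1.toSpec K = 𝟙 _) : p ≫ chainCoord K c j = P1.pt 1 0 := by
  rw [chainCoord_of_lt h, ← Category.assoc, hp, Category.id_comp]

theorem pt_chainCoord_of_gt {c j : Fin (m + 1)} (h : j < c) {p : Spec (CommRingCat.of K) ⟶ P1 K}
    (hp : p ≫ P1.toSpec K = 𝟙 _) : p ≫ chainCoord K c j = P1.pt 0 0 := by
  rw [chainCoord_of_gt h, ← Category.assoc, hp, Category.id_comp]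

theorem bcLine_node (j : Fin m) : P1.pt 1 0 ≫ bcLine (k := k) K c j.castSucc =
    P1.pt 0 0 ≫ bcLine K c j.succ := by
  refine bc_hom_ext fun i => ?_
  rw [Category.assoc, Category.assoc, bcLine_coord, bcLine_coord]
  have h0 := P1.pt_toSpec 0 (0 : K)
  have h1 := P1.pt_toSpec 1 (0 : K)
  have hlt : j.castSucc < j.succ := Fin.castSucc_lt_succ
  rcases lt_trichotomy (c i) j.castSucc with h | h | h
  · rw [pt_chainCoord_of_lt h h1, pt_chainCoord_of_lt (h.trans hlt) h0]
  · rw [h, chainCoord_self, pt_chainCoord_of_lt hlt h0, Category.comp_id]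
  · rw [pt_chainCoord_of_gt h h1]
    rcases (Fin.castSucc_lt_iff_succ_le.1 h).eq_or_lt with h' | h'
    · rw [← h', chainCoord_self, Category.comp_id]
    · rw [pt_chainCoord_of_gt h' h0]

theorem chainCoord_apply_of_lt {c j : Fin (m + 1)} (h : c < j) (x : P1 K) :
    chainCoord K c j x = point (P1.pt 1 (0 : K)) := by
  rw [chainCoord_of_lt h, Scheme.Hom.comp_apply, eq_closedPoint (P1.toSpec K x)]
  rfl

theorem chainCoord_apply_of_gt {c j : Fin (m + 1)} (h : j < c) (x : P1 K) :
    chainCoord K c j x = point (P1.pt 0 (0 : K)) := by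
  rw [chainCoord_of_gt h, Scheme.Hom.comp_apply, eq_closedPoint (P1.toSpec K x)]
  rfl

theorem point_pt_ne : point (P1.pt 0 (0 : K)) ≠ point (P1.pt 1 (0 : K)) := fun h =>
  P1.point_pt_one_notMem (h ▸ P1.pt_mem_chart 0 0)

theorem bcLine_inter (hc : ∀ j, ∃ i, c i = j) {i j : Fin (m + 1)} (hij : i < j) {x y : P1 K}
    (h : bcLine (k := k) K c i x = bcLine K c j y) :
    i.1 + 1 = j.1 ∧ y = point (P1.pt 0 (0 : K)) := by
  have hx : ∀ l, chainCoord K (c l) i x = chainCoord K (c l) j y := by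
    intro l
    rw [← bcLine_coord (k := k), ← bcLine_coord (k := k), Scheme.Hom.comp_apply, h,
      Scheme.Hom.comp_apply]
  refine ⟨?_, ?_⟩
  · by_contra hne
    have hi : i.1 + 1 < j.1 := by rw [Fin.lt_def] at hij; lia
    obtain ⟨l, hl⟩ := hc ⟨i.1 + 1, hi.trans j.2⟩
    have := hx l
    rw [chainCoord_apply_of_gt (by rw [hl, Fin.lt_def]; exact Nat.lt_succ_self _),
      chainCoord_apply_of_lt (by rw [hl]; exact hi)] at this
    exact point_pt_ne this
  · obtain ⟨l, rfl⟩ := hc j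
    have := hx l
    rw [chainCoord_apply_of_gt hij, chainCoord_self] at this
    exact this.symm

theorem bcLine_transversal (hc : ∀ j, ∃ i, c i = j) (j : Fin m) :
    IsReduced (pullback (bcLine (k := k) K c j.castSucc) (bcLine K c j.succ)) := by
  have hlt : j.castSucc < j.succ := Fin.castSucc_lt_succ
  let Z := pullback (bcLine (k := k) K c j.castSucc) (bcLine K c j.succ)
  let p : Z ⟶ P1 K := pullback.fst _ _
  let q : Z ⟶ P1 K := pullback.snd _ _
  have hpq : p ≫ bcLine (k := k) K c j.castSucc = q ≫ bcLine K c j.succ := pullback.condition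
  have hs : p ≫ P1.toSpec K = q ≫ P1.toSpec K := by
    rw [← bcLine_snd (k := k) c j.castSucc, ← Category.assoc, hpq, Category.assoc, bcLine_snd,
      bcLine_snd]
  have hco : ∀ i, p ≫ chainCoord K (c i) j.castSucc = q ≫ chainCoord K (c i) j.succ := by
    intro i
    rw [← bcLine_coord (k := k), ← bcLine_coord (k := k), ← Category.assoc, hpq, Category.assoc]
  have hp : p = (p ≫ P1.toSpec K) ≫ P1.pt 1 0 := by
    obtain ⟨i, hi⟩ := hc j.castSucc
    have := hco i
    rw [hi, chainCoord_self, chainCoord_of_lt hlt, Category.comp_id] at this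
    rw [hs, Category.assoc]
    exact this
  have hq : q = (p ≫ P1.toSpec K) ≫ P1.pt 0 0 := by
    obtain ⟨i, hi⟩ := hc j.succ
    have := hco i
    rw [hi, chainCoord_self, chainCoord_of_gt hlt, Category.comp_id] at this
    rw [Category.assoc]
    exact this.symm
  let σ : Spec (CommRingCat.of K) ⟶ Z := pullback.lift (P1.pt 1 0) (P1.pt 0 0) (bcLine_node c j)
  have hσp : σ ≫ p = P1.pt 1 0 := pullback.lift_fst _ _ _
  have hσq : σ ≫ q = P1.pt 0 0 := pullback.lift_snd _ _ _
  have : IsIso σ := by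
    refine ⟨p ≫ P1.toSpec K, ?_, ?_⟩
    · rw [← Category.assoc, hσp, P1.pt_toSpec]
    · apply pullback.hom_ext
      · rw [Category.assoc, Category.id_comp]
        exact (congrArg _ hσp).trans hp.symm
      · rw [Category.assoc, Category.id_comp]
        exact (congrArg _ hσq).trans hq.symm
  exact isReduced_of_isOpenImmersion (inv σ)

variable (K) in
theorem isLineChain (hc : ∀ j, ∃ i, c i = j) {a : Fin (n + 1) → k} (ha : ∀ i, a i ≠ 0) :
    IsLineChain (toSpec c) (P1.pt 0 0 ≫ line c 0) (P1.pt 1 0 ≫ line c (Fin.last m))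
      (fun i => P1.pt 0 (a i) ≫ line c (c i)) (bcLine K c) c (fun i => algebraMap k K (a i)) := by
  have hpt : ∀ (b : Fin 2) (r : k) (r' : K) (j : Fin (m + 1)), r' = algebraMap k K r →
      P1.pt b r' ≫ bcLine K c j ≫ bcFst K (toSpec c) =
        Spec.map (CommRingCat.ofHom (algebraMap k K)) ≫ P1.pt b r ≫ line c j := by
    rintro b r _ j rfl
    rw [bcLine_fst, ← Category.assoc, P1.pt_baseMap, Category.assoc]
  have hover : ∀ (b : Fin 2) (r : k) (j : Fin (m + 1)),
      (P1.pt b r ≫ line c j) ≫ toSpec c = 𝟙 _ := by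
    intro b r j
    rw [Category.assoc, line_toSpec, P1.pt_toSpec]
  exact ⟨inferInstance, isReduced_bc c, bcLine_snd c, bcLine_isClosedImmersion c hc,
    exists_bcLine_eq c, bcLine_node c, fun i j hij x y h => bcLine_inter c hc hij h,
    bcLine_transversal c hc, hover _ _ _, hover _ _ _, fun i => hover _ _ _,
    hpt _ _ _ _ (map_zero _).symm, hpt _ _ _ _ (map_zero _).symm, fun i => hpt _ _ _ _ rfl,
    fun i => (map_ne_zero _).2 (ha i), hc⟩

end chainCurve

variable {k : Type u} [Field k] {n : ℕ}

theorem IsAnCurve.exists_iso_embeddedCurve {C : Scheme.{u}} {π : C ⟶ Spec (CommRingCat.of k)}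
    {sMinus sPlus : Spec (CommRingCat.of k) ⟶ C} {s : Fin (n + 1) → (Spec (CommRingCat.of k) ⟶ C)}
    (hC : IsAnCurve π sMinus sPlus s)
    {z : ∀ i, Module.Basis (Fin 2) k (H0 π (Scheme.Hom.ker (s i)))}
    (hz : ∀ i, IsNormalised sMinus sPlus (s i) (z i)) {t : Fin (n + 1) → Fin (n + 1) → k}
    (ht : IsExtracted z t) {φ : C ⟶ P1Pow k n} (hφ : φ ≫ P1Pow.toSpec k n = π)
    (hφz : ∀ i, H0.IsMorphismOf (φ ≫ P1Pow.proj k n i) (z i)) :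
    ∃ (e : C ≅ embeddedCurve t) (sMinus' sPlus' : Spec (CommRingCat.of k) ⟶ embeddedCurve t)
      (s' : Fin (n + 1) → (Spec (CommRingCat.of k) ⟶ embeddedCurve t)),
      e.hom ≫ embeddedCurve.ι t = φ ∧
      IsPointDefinedBy sMinus' {p | ∃ i, p = MvPolynomial.X (i, 1)} ∧
      IsPointDefinedBy sPlus' {p | ∃ i, p = MvPolynomial.X (i, 0)} ∧
      (∀ i, IsPointDefinedBy (s' i) {MvPolynomial.X (i, 1) - MvPolynomial.X (i, 0)}) ∧
      IsAnCurve (embeddedCurve.ι t ≫ P1Pow.toSpec k n) sMinus' sPlus' s' ∧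
      sMinus ≫ e.hom = sMinus' ∧ sPlus ≫ e.hom = sPlus' ∧ ∀ i, s i ≫ e.hom = s' i := by
  obtain ⟨m, line, c, a, H⟩ := IsAnCurve.exists_lineChain (AlgebraicClosure k) hC
  have L := H.hasLineCoords hz hφz
  have hta : IsAdapted c a t := (H.isExtracted_iff hz t).1 ht
  have := H.isClosedImmersion hφ L hta
  obtain ⟨e, he⟩ := LosevManin.exists_iso_embeddedCurve (H.ker_eq hφ L hta)
  have hpt : ∀ {σ : Spec (CommRingCat.of k) ⟶ C} {E : Set (MvPolynomial (Fin (n + 1) × Fin 2) k)},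
      Scheme.Hom.ker (σ ≫ φ) = equationIdeal (curveEquations t ∪ E) →
      IsPointDefinedBy (σ ≫ e.hom) E := by
    intro σ E h
    rw [IsPointDefinedBy, Category.assoc, he, h]
  exact ⟨e, _, _, fun i => s i ≫ e.hom, he, hpt (H.ker_minus_eq hφ L hta),
    hpt (H.ker_plus_eq hφ L hta), fun i => hpt (H.ker_marked_eq hφ L hta i),
    hC.transport e (by rw [← Category.assoc, he, hφ]), rfl, rfl, fun _ => rfl⟩

theorem IsAnData.exists_isAnCurve {t : Fin (n + 1) → Fin (n + 1) → k} (ht : IsAnData t) :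
    ∃ (C : Scheme.{u}) (π : C ⟶ Spec (CommRingCat.of k))
      (sMinus sPlus : Spec (CommRingCat.of k) ⟶ C)
      (s : Fin (n + 1) → (Spec (CommRingCat.of k) ⟶ C))
      (z : ∀ i, Module.Basis (Fin 2) k (H0 π (Scheme.Hom.ker (s i)))),
      IsAnCurve π sMinus sPlus s ∧ (∀ i, IsNormalised sMinus sPlus (s i) (z i)) ∧
      IsExtracted z t := by
  obtain ⟨m, c, a, ha, hc, h⟩ := ht.exists_isLineChain_data
  have H := chainCurve.isLineChain (AlgebraicClosure k) c hc ha
  choose z hz using H.exists_basis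
  refine ⟨_, _, _, _, _, z, isAnCurve_of_isLineChain fun K _ _ _ =>
    ⟨_, _, _, _, chainCurve.isLineChain K c hc ha⟩, hz, (H.isExtracted_iff hz t).2 ?_⟩
  refine fun i j hij => ⟨ht.ne_zero i j hij, (h i j hij).1, fun e => ?_⟩
  rw [← map_mul, ← map_mul, (h i j hij).2 e]

end

end LosevManin

theorem mainTheorem6 (k : Type u) [Field k] (n : ℕ) :
    (∀ (C : Scheme.{u}) (π : C ⟶ Spec (CommRingCat.of k))
        (sMinus sPlus : Spec (CommRingCat.of k) ⟶ C)
        (s : Fin (n + 1) → (Spec (CommRingCat.of k) ⟶ C)), IsAnCurve π sMinus sPlus s →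
      (∃ z : ∀ i, Module.Basis (Fin 2) k (H0 π (Scheme.Hom.ker (s i))),
        ∀ i, IsNormalised sMinus sPlus (s i) (z i)) ∧
      ∀ z : ∀ i, Module.Basis (Fin 2) k (H0 π (Scheme.Hom.ker (s i))),
        (∀ i, IsNormalised sMinus sPlus (s i) (z i)) →
        (∃ t : Fin (n + 1) → Fin (n + 1) → k, IsExtracted z t) ∧
        (∃! φ : C ⟶ P1Pow k n, φ ≫ P1Pow.toSpec k n = π ∧
          ∀ i, H0.IsMorphismOf (φ ≫ P1Pow.proj k n i) (z i)) ∧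
        ∀ t : Fin (n + 1) → Fin (n + 1) → k, IsExtracted z t →
          IsAnData t ∧
          ∀ φ : C ⟶ P1Pow k n, φ ≫ P1Pow.toSpec k n = π →
            (∀ i, H0.IsMorphismOf (φ ≫ P1Pow.proj k n i) (z i)) →
            ∃ (e : C ≅ embeddedCurve t) (sMinus' sPlus' : Spec (CommRingCat.of k) ⟶ embeddedCurve t)
              (s' : Fin (n + 1) → (Spec (CommRingCat.of k) ⟶ embeddedCurve t)),
              e.hom ≫ embeddedCurve.ι t = φ ∧
              IsPointDefinedBy sMinus' {p | ∃ i, p = MvPolynomial.X (i, 1)} ∧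
              IsPointDefinedBy sPlus' {p | ∃ i, p = MvPolynomial.X (i, 0)} ∧
              (∀ i, IsPointDefinedBy (s' i) {MvPolynomial.X (i, 1) - MvPolynomial.X (i, 0)}) ∧
              IsAnCurve (embeddedCurve.ι t ≫ P1Pow.toSpec k n) sMinus' sPlus' s' ∧
              sMinus ≫ e.hom = sMinus' ∧ sPlus ≫ e.hom = sPlus' ∧ ∀ i, s i ≫ e.hom = s' i) ∧
    (∀ t : Fin (n + 1) → Fin (n + 1) → k, IsAnData t →
      ∃ (C : Scheme.{u}) (π : C ⟶ Spec (CommRingCat.of k))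
        (sMinus sPlus : Spec (CommRingCat.of k) ⟶ C)
        (s : Fin (n + 1) → (Spec (CommRingCat.of k) ⟶ C))
        (z : ∀ i, Module.Basis (Fin 2) k (H0 π (Scheme.Hom.ker (s i)))),
        IsAnCurve π sMinus sPlus s ∧ (∀ i, IsNormalised sMinus sPlus (s i) (z i)) ∧
        IsExtracted z t) := by
  refine ⟨fun C π sMinus sPlus s hC => ?_, fun t ht => ht.exists_isAnCurve⟩
  obtain ⟨m, line, c, a, H⟩ := IsAnCurve.exists_lineChain (AlgebraicClosure k) hC
  have hb := H.exists_basis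
  choose z hz using hb
  refine ⟨⟨z, hz⟩, fun z hz => ⟨H.exists_isExtracted hz, H.existsUnique_morphism hz,
    fun t ht => ⟨H.isAnData hz ht, fun φ hφ hφz => hC.exists_iso_embeddedCurve hz ht hφ hφz⟩⟩⟩
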